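/- **Setting.** All algorithms are families indexed by a security parameter $\lambda$; "efficient" means given by circuits of size polynomial in $\lambda$ (reversible Boolean circuits for classical algorithms, with uniform coins if randomized; circuits over $\{\mathrm{NOT},\mathrm{CNOT},\mathrm{Toffoli},H,T\}$ for quantum ones), and adversaries, provers and distinguishers are non-uniform quantum polynomial time (QPT), with quantum advice. $\approx_c$ is indistinguishability by such algorithms with negligible advantage. *rTCF.* A Mahadev randomized trapdoor claw-free function family consists of efficient classical algorithms $\mathsf{TCF.Gen}(1^\lambda,\mathsf{mode})\to(\mathsf{pk},\mathsf{sk})$ ($\mathsf{mode}=0$: injective, $\mathsf{mode}=1$: 2-to-1), randomized $\mathsf{Eval}(\mathsf{pk},b,x)$ for $b\in\{0,1\}$, $x\in D_{\mathsf{pk}}\subseteq\{0,1\}^{\ell}$, and deterministic $\mathsf{Invert},\mathsf{Check},\mathsf{Good}$ and domain membership test, such that for all keys in the support of $\mathsf{TCF.Gen}$: (a) in injective mode, $\mathsf{Invert}(0,\mathsf{sk},y)=(b,x)$ for all $y\in\mathrm{Supp}\,\mathsf{Eval}(\mathsf{pk},b,x)$; (b) in 2-to-1 mode, for such $y$, $\mathsf{Invert}(1,\mathsf{sk},y)=((0,x_0),(1,x_1))$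 with $x_b=x$, $x_0,x_1\in D_{\mathsf{pk}}$, $y\in\mathrm{Supp}\,\mathsf{Eval}(\mathsf{pk},\beta,x_\beta)$ for $\beta=0,1$; (c) $\mathsf{Check}(\mathsf{pk},b,x,y)=1$ iff $x\in D_{\mathsf{pk}}$ and $y\in\mathrm{Supp}\,\mathsf{Eval}(\mathsf{pk},b,x)$; (d) for 2-to-1 keys and all $x_0,x_1\in D_{\mathsf{pk}}$ the set $\mathsf{Good}_{x_0,x_1}\subseteq\{0,1\}^{\ell+1}$, which does not depend on the first bit, has density $1-\mathsf{negl}(\lambda)$. Its security properties are: *key indistinguishability* (public keys of the two modes are $\approx_c$) and the *adaptive hardcore bit*: for every adversary that is given a 2-to-1 key $\mathsf{pk}$ and outputs $(y,d,b,x)$, the probabilities of the events $E_0$ and $E_1$ differ negligibly, where $E_c$ is the event that $\mathsf{Check}(\mathsf{pk},b,x,y)=1$, $d\in\mathsf{Good}_{x_0,x_1}$ and $d\cdot(1,x_0\oplus x_1)=c$, for $((0,x_0),(1,x_1))=\mathsf{Invert}(1,\mathsf{sk},y)$. *Batch key generation.* Let $N=N(\lambda)\ge1$ be polynomially bounded.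 A batch key generation scheme consists of efficient classical algorithms $\mathsf{Gen}(1^\lambda,C)\to(\mathsf{PK},\mathsf{SK})$, $\mathsf{ExtPk}(\mathsf{PK},i)=\mathsf{pk}_i$, $\mathsf{ExtSk}(\mathsf{SK},i)=\mathsf{sk}_i$, where $C$ describes a function $[N]\to\{0,1\}$, in a representation in which the constant function $\mathbf 1$ has a description. It is *correct* if $(\mathsf{pk}_i,\mathsf{sk}_i)$ is always in the range of $\mathsf{TCF.Gen}(1^\lambda,C(i))$. It has *key indistinguishability* if $(\mathsf{PK},(\mathsf{sk}_i)_{i\in T})$ for $C_0$ and for $C_1$ are $\approx_c$ whenever $C_0,C_1$ agree on $T\subseteq[N]$; it is *collapsing at a single index* if for all $C$ and $j$ no QPT adversary given $(\mathsf{PK},(\mathsf{sk}_i)_{i\ne j})$ that prepares $y$ and a register $\mathcal B\otimes\mathcal X$, on which $\mathsf{Check}(\mathsf{pk}_j,\cdot,\cdot,y)=1$ is then verified in superposition, can detect with non-negligible advantage whether $\mathcal B$ is measured afterwards; it has the *adaptive hardcore bit property at a single index* if for all $C$ and $j$ with $C(j)=1$ the adaptive hardcore bit property holds for $(\mathsf{pk}_j,\mathsf{sk}_j)$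 against adversaries given $(\mathsf{PK},(\mathsf{sk}_i)_{i\neq j})$. *Protocol.* For a basis vector $h\in\{0,1\}^N$ described by $C$, the verifier samples $(\mathsf{PK},\mathsf{SK})\gets\mathsf{Gen}(1^\lambda,C)$ and sends $\mathsf{PK}$; the prover replies with $y=(y_1,\dots,y_N)$; the verifier sends a challenge bit. In the test round the prover answers with $(b_i,x_i)_i$ and the verifier accepts iff $\mathsf{Check}(\mathsf{pk}_i,b_i,x_i,y_i)=1$ for all $i$. In the measurement round the prover answers with $(d_i)_i$, and the verifier outputs $m\in\{0,1\}^N$: if $h_i=0$, $m_i$ is the first bit of $\mathsf{Invert}(0,\mathsf{sk}_i,y_i)$ ($0$ if this is $\bot$); if $h_i=1$ and $\mathsf{Invert}(1,\mathsf{sk}_i,y_i)=((0,x_{0,i}),(1,x_{1,i}))$ with $d_i\in\mathsf{Good}_{x_{0,i},x_{1,i}}$, $m_i=d_i\cdot(1,x_{0,i}\oplus x_{1,i})$; otherwise $m_i$ is a uniformly random bit. A cheating prover consists of an initial state, an efficient commitment unitary controlled on $\mathsf{PK}$, after which $y$ is measured, leaving a state $\rho$ on $\mathcal Z\otimes\mathcal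 I$, where $\mathcal Z=\mathcal Z_1\otimes\dots\otimes\mathcal Z_N$ and $\mathcal Z_i$ has $\ell+1$ qubits, and an efficient attack unitary $U$ on $\mathcal Z\otimes\mathcal I$ (controlled on $\mathsf{PK},y$). Its answer is the standard-basis measurement of $\mathcal Z$ on $\rho$ in the test round, and the Hadamard-basis measurement of $\mathcal Z$ on $U\rho U^\dagger$ in the measurement round. *The extracted state.* Given $(U,\rho,\mathsf{SK},y)$ add ancilla qubits $\mathcal U_1,\dots,\mathcal U_N$ in state $|0\rangle$. Let $Z_i$ be Pauli $\sigma_z$ on the first qubit of $\mathcal Z_i$ and let $X_i=U^\dagger H_iX_i'H_iU$, where $H_i$ is the tensor of Hadamard gates on $\mathcal Z_i$ and $\mathcal U_i$, and $X'_i$ is diagonal, with entry $(-1)^{d_i\cdot(1,x_{0,i}\oplus x_{1,i})}$ if $\mathsf{Invert}(1,\mathsf{sk}_i,y_i)=((0,x_{0,i}),(1,x_{1,i}))$ and $d_i\in\mathsf{Good}_{x_{0,i},x_{1,i}}$, and $(-1)^{u_i}$ otherwise, where $d_i,u_i$ are the contents of $\mathcal Z_i,\mathcal U_i$. With $X(r)=\prod_iX_i^{r_i}$,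 $Z(s)=\prod_iZ_i^{s_i}$ (and $\sigma_x(r),\sigma_z(s)$ likewise for the Pauli operators on $N$ qubits), apply $2^{-N}\sum_{r,s\in\{0,1\}^N}X(r)Z(s)\otimes\sigma_x(r)\sigma_z(s)\otimes\mathsf{Id}$ to $\rho\otimes|0\rangle\langle 0|_{\mathcal U}$ and $N$ EPR pairs in registers $\mathcal A_1\otimes\mathcal A_2$, and trace out everything but $\mathcal A_2$. The result is the $N$-qubit state $\tau(U,\rho,\mathsf{SK},y)$. **Theorem.** There is an algorithm $\mathsf{Ext}^{U,\rho}(\mathsf{PK},\mathsf{SK},y)$, a circuit of size polynomial in $\lambda$ and independent of the prover, which touches $\mathcal I$ only through (possibly controlled) calls to $U$ and $U^\dagger$, whose output is exactly $\tau(U,\rho,\mathsf{SK},y)$ for every unitary $U$, such that, with $\mathsf{SimGen}(1^\lambda):=\mathsf{Gen}(1^\lambda,\mathbf 1)$ (also efficient), the following holds. $\mathsf{Ext}$ and $\mathsf{SimGen}$ at $\lambda$ are determined by the circuits of the scheme at $\lambda$. 1. Suppose the rTCF algorithms are efficient and satisfy (a)–(d), and the batch key generation scheme is correct and has key indistinguishability,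 collapsing at a single index and the adaptive hardcore bit property at a single index. Then the protocol is sound: for every non-uniform QPT prover that passes the test round with probability $1-\mathsf{negl}(\lambda)$ for all $h$, and for every $h$ (with description $C$), the verifier's output $m$ in the measurement round is computationally indistinguishable from the outcome of the following experiment: sample $(\mathsf{PK},\mathsf{SK})\gets\mathsf{SimGen}(1^\lambda)$, run the prover on $\mathsf{PK}$ to get $y$ and $\rho$, run $\mathsf{Ext}^{U,\rho}(\mathsf{PK},\mathsf{SK},y)$, and measure qubit $i$ of the resulting $N$-qubit state in the standard basis if $h_i=0$ and in the Hadamard basis if $h_i=1$. 2. In particular this conclusion holds, with the same $\mathsf{Ext}$ and $\mathsf{SimGen}$, for Mahadev's protocol, in which the $N$ key pairs are sampled independently, $(\mathsf{pk}_i,\mathsf{sk}_i)\gets\mathsf{TCF.Gen}(1^\lambda,h_i)$, for every Mahadev rTCF, i.e. assuming only (a)–(d), key indistinguishability and the adaptive hardcore bit property of the rTCF (and no second hardcore bit property). -/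

import Mathlib

open scoped Matrix Kronecker BigOperators ComplexOrder

noncomputable section

namespace CommitMeasure

/-! ### Asymptotics -/

/-- `f` is bounded by a polynomial in the security parameter. -/
def PolyBounded (f : ℕ → ℕ) : Prop := ∃ p : Polynomial ℕ, ∀ n, f n ≤ p.eval n

/-- `f` is negligible in the security parameter. -/
def Negl (f : ℕ → ℝ) : Prop :=
  Asymptotics.SuperpolynomialDecay Filter.atTop (fun n : ℕ => (n : ℝ)) f

/-- The expectation of `f` over a uniformly random bit string. -/
def avg {α : Type} [Fintype α] [DecidableEq α] (f : (α → Bool) → ℝ) : ℝ :=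
  (∑ c, f c) / 2 ^ Fintype.card α

/-- The distribution of `f c` for a uniformly random bit string `c`. -/
def law {α β : Type} [Fintype α] [DecidableEq α] [Fintype β] [DecidableEq β]
    (f : (α → Bool) → (β → Bool)) (x : β → Bool) : ℝ :=
  avg fun c => if f c = x then 1 else 0

/-! ### Classical circuits

Bit strings are functions `α → Bool`, where `α` is a finite type of wires; concatenation of
strings corresponds to the sum of wire types. -/

/-- Reversible Boolean gates on the wires `α`; the last argument is the target. -/
inductive CGate (α : Type)
  | not (a : α)
  | cnot (a b : α) (h : a ≠ b)
  | toffoli (a b c : α) (hab : a ≠ b) (hac : a ≠ c) (hbc : b ≠ c)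

def CGate.apply {α : Type} [DecidableEq α] : CGate α → (α → Bool) → (α → Bool)
  | .not a, s => Function.update s a (!s a)
  | .cnot a b _, s => Function.update s b (s b ^^ s a)
  | .toffoli a b c _ _ _, s => Function.update s c (s c ^^ (s a && s b))

def CGate.map {α β : Type} (f : α ↪ β) : CGate α → CGate β
  | .not a => .not (f a)
  | .cnot a b h => .cnot (f a) (f b) (f.injective.ne h)
  | .toffoli a b c hab hac hbc =>
      .toffoli (f a) (f b) (f c) (f.injective.ne hab) (f.injective.ne hac) (f.injective.ne hbc)

/-- Run a list of gates; the head of the list is applied first. -/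
def runGates {α : Type} [DecidableEq α] (c : List (CGate α)) (s : α → Bool) : α → Bool :=
  c.foldl (fun t g => g.apply t) s

/-- A deterministic classical algorithm with input wires `α` and output wires `β`: a reversible
circuit that XORs the value of the function `fn` onto the output wires and returns its ancillas
to `0`. A randomized algorithm is one that has its random coins among the inputs. -/
structure ClassicalAlg (α β : Type) [DecidableEq α] [DecidableEq β] where
  anc : ℕ
  gates : List (CGate (α ⊕ (β ⊕ Fin anc)))
  fn : (α → Bool) → (β → Bool)
  spec : ∀ x y, runGates gates (Sum.elim x (Sum.elim y fun _ => false)) =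
    Sum.elim x (Sum.elim (fun b => y b ^^ fn x b) fun _ => false)

def ClassicalAlg.size {α β : Type} [DecidableEq α] [DecidableEq β] (A : ClassicalAlg α β) : ℕ :=
  A.anc + A.gates.length

/-- Decoding of an optional string: the wire `none` is a flag, and `⊥` has flag `0`. -/
def decodeOpt {β : Type} (v : Option β → Bool) : Option (β → Bool) :=
  if v none then some fun b => v (some b) else none

/-! ### Quantum states and circuits -/

/-- Operators on the Hilbert space of one qubit for every wire in `α`. -/
abbrev Op (α : Type) := Matrix (α → Bool) (α → Bool) ℂ

section Quantum

variable {α β : Type} [Fintype α] [DecidableEq α] [Fintype β] [DecidableEq β]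

/-- Density matrices. -/
def IsState (ρ : Op α) : Prop := ρ.PosSemidef ∧ ρ.trace = 1

/-- A universal set of quantum gates: `NOT`, `CNOT`, Toffoli, Hadamard and `T`. -/
inductive QGate (α : Type)
  | classical (g : CGate α)
  | had (a : α)
  | phaseT (a : α)

def QGate.map {α β : Type} (f : α ↪ β) : QGate α → QGate β
  | .classical g => .classical (g.map f)
  | .had a => .had (f a)
  | .phaseT a => .phaseT (f a)

/-- The tensor product of Hadamard matrices on the wires `a` with `h a = true` and identities on
the other wires. -/
def hadOn (h : α → Bool) : Op α := Matrix.of fun s t =>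
  ∏ a, if h a then (if s a && t a then -1 else 1) / (Real.sqrt 2 : ℂ)
    else if s a = t a then 1 else 0

def QGate.mat : QGate α → Op α
  | .classical g => Matrix.of fun s t => if s = g.apply t then 1 else 0
  | .had a => hadOn fun b => decide (b = a)
  | .phaseT a => Matrix.diagonal fun s =>
      if s a then Complex.exp (Complex.I * (Real.pi / 4 : ℝ)) else 1

/-- The unitary of a circuit; the head of the list is applied first. -/
def circMat : List (QGate α) → Op α
  | [] => 1
  | g :: c => circMat c * g.mat

def evolve (U ρ : Op α) : Op α := U * ρ * Uᴴ

/-- The state `|x⟩⟨x| ⊗ σ`. -/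
def withInput (x : α → Bool) (σ : Op β) : Op (α ⊕ β) := Matrix.of fun s t =>
  if s ∘ Sum.inl = x ∧ t ∘ Sum.inl = x then σ (s ∘ Sum.inr) (t ∘ Sum.inr) else 0

/-- The state `σ ⊗ |x⟩⟨x|`. -/
def withAncilla (σ : Op α) (x : β → Bool) : Op (α ⊕ β) := Matrix.of fun s t =>
  if s ∘ Sum.inr = x ∧ t ∘ Sum.inr = x then σ (s ∘ Sum.inl) (t ∘ Sum.inl) else 0

/-- The probability that a measurement of `ρ` in the standard basis gives a string in `p`. -/
def prob (ρ : Op α) (p : (α → Bool) → Bool) : ℝ := ∑ s, if p s then (ρ s s).re else 0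

/-- The effect of measuring the function `f` of the standard basis and forgetting the outcome. -/
def dephase {γ : Type} [DecidableEq γ] (f : (α → Bool) → γ) (ρ : Op α) : Op α :=
  Matrix.of fun s t => if f s = f t then ρ s t else 0

/-- The (unnormalized) state after a projection onto the span of the basis states in `p`. -/
def restrict (p : (α → Bool) → Bool) (ρ : Op α) : Op α :=
  Matrix.of fun s t => if p s ∧ p t then ρ s t else 0

/-- The distribution `M(h, ρ)`: wire `a` is measured in the Hadamard basis if `h a = true` and in
the standard basis otherwise. -/
def measure (h : α → Bool) (ρ : Op α) (m : α → Bool) : ℝ := (evolve (hadOn h) ρ m m).re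

end Quantum

/-! ### Computational indistinguishability -/

/-- A quantum algorithm with classical input on the wires `α`, with quantum advice, that outputs
one bit. -/
structure Distinguisher (α : Type) [Fintype α] [DecidableEq α] where
  work : ℕ
  advice : Op (Fin work)
  isState : IsState advice
  circ : List (QGate (α ⊕ Fin work))
  out : α ⊕ Fin work

def Distinguisher.size {α : Type} [Fintype α] [DecidableEq α] (A : Distinguisher α) : ℕ :=
  A.work + A.circ.length

def Distinguisher.accept {α : Type} [Fintype α] [DecidableEq α] (A : Distinguisher α)
    (x : α → Bool) : ℝ :=
  prob (evolve (circMat A.circ) (withInput x A.advice)) fun s => s A.out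

/-- Indistinguishability by non-uniform quantum polynomial-time algorithms of two ensembles of
distributions, given by their probability mass functions. -/
def CompIndist {α : ℕ → Type} [∀ n, Fintype (α n)] [∀ n, DecidableEq (α n)]
    (D₀ D₁ : ∀ n, (α n → Bool) → ℝ) : Prop :=
  ∀ A : ∀ n, Distinguisher (α n), PolyBounded (fun n => (A n).size) →
    Negl fun n => |∑ x, D₀ n x * (A n).accept x - ∑ x, D₁ n x * (A n).accept x|

/-! ### Randomized trapdoor claw-free functions -/

/-- The algorithms of a randomized trapdoor claw-free function at one security parameter. A pair
`(b, x)` in `{0,1} × {0,1}^ℓ` is a string `z` of length `ℓ + 1` with `b = z 0` and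
`x = Fin.tail z`. The mode `false` is injective, the mode `true` is two-to-one. -/
structure TCF where
  ℓ : ℕ
  pkLen : ℕ
  skLen : ℕ
  yLen : ℕ
  coinLen : ℕ
  evalCoinLen : ℕ
  genAlg : Bool → ClassicalAlg (Fin coinLen) (Fin pkLen ⊕ Fin skLen)
  domAlg : ClassicalAlg (Fin pkLen ⊕ Fin ℓ) Unit
  evalAlg : ClassicalAlg (Fin pkLen ⊕ (Fin (ℓ + 1) ⊕ Fin evalCoinLen)) (Fin yLen)
  invertInjAlg : ClassicalAlg (Fin skLen ⊕ Fin yLen) (Option (Fin (ℓ + 1)))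
  invertTwoAlg : ClassicalAlg (Fin skLen ⊕ Fin yLen) (Option (Fin ℓ ⊕ Fin ℓ))
  checkAlg : ClassicalAlg (Fin pkLen ⊕ (Fin (ℓ + 1) ⊕ Fin yLen)) Unit
  /-- The set `Good` ignores the first bit of `d`, so it is decided from the last `ℓ` bits. -/
  goodAlg : ClassicalAlg ((Fin ℓ ⊕ Fin ℓ) ⊕ Fin ℓ) Unit

namespace TCF

variable (F : TCF)

def size : ℕ :=
  F.ℓ + F.pkLen + F.skLen + F.yLen + F.coinLen + F.evalCoinLen +
    (F.genAlg false).size + (F.genAlg true).size + F.domAlg.size + F.evalAlg.size +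
    F.invertInjAlg.size + F.invertTwoAlg.size + F.checkAlg.size + F.goodAlg.size

def genPk (mode : Bool) (r : Fin F.coinLen → Bool) : Fin F.pkLen → Bool :=
  (F.genAlg mode).fn r ∘ Sum.inl

def genSk (mode : Bool) (r : Fin F.coinLen → Bool) : Fin F.skLen → Bool :=
  (F.genAlg mode).fn r ∘ Sum.inr

/-- Membership in the domain `D_pk`. -/
def dom (pk : Fin F.pkLen → Bool) (x : Fin F.ℓ → Bool) : Bool := F.domAlg.fn (Sum.elim pk x) ()

/-- `y` is in the support of `Eval(pk, b, x)`, where `z = (b, x)`. -/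
def InSupp (pk : Fin F.pkLen → Bool) (z : Fin (F.ℓ + 1) → Bool) (y : Fin F.yLen → Bool) : Prop :=
  ∃ e, F.evalAlg.fn (Sum.elim pk (Sum.elim z e)) = y

def invertInj (sk : Fin F.skLen → Bool) (y : Fin F.yLen → Bool) :
    Option (Fin (F.ℓ + 1) → Bool) := decodeOpt (F.invertInjAlg.fn (Sum.elim sk y))

def invertTwo (sk : Fin F.skLen → Bool) (y : Fin F.yLen → Bool) :
    Option ((Fin F.ℓ → Bool) × (Fin F.ℓ → Bool)) :=
  (decodeOpt (F.invertTwoAlg.fn (Sum.elim sk y))).map fun v => (v ∘ Sum.inl, v ∘ Sum.inr)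

def check (pk : Fin F.pkLen → Bool) (z : Fin (F.ℓ + 1) → Bool) (y : Fin F.yLen → Bool) : Bool :=
  F.checkAlg.fn (Sum.elim pk (Sum.elim z y)) ()

def good (x₀ x₁ : Fin F.ℓ → Bool) (d : Fin (F.ℓ + 1) → Bool) : Bool :=
  F.goodAlg.fn (Sum.elim (Sum.elim x₀ x₁) (Fin.tail d)) ()

end TCF

/-- The inner product `d · (1, x₀ ⊕ x₁)` modulo `2`. -/
def dotClaw {ℓ : ℕ} (x₀ x₁ : Fin ℓ → Bool) (d : Fin (ℓ + 1) → Bool) : Bool :=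
  decide (((d 0).toNat + ∑ k : Fin ℓ, (d k.succ && (x₀ k ^^ x₁ k)).toNat) % 2 = 1)

namespace TCF

/-- Correctness of the algorithms at one security parameter. `Check` rejects outside the
domain. -/
structure Correct (F : TCF) : Prop where
  injective : ∀ r z e, F.dom (F.genPk false r) (Fin.tail z) →
    F.invertInj (F.genSk false r)
      (F.evalAlg.fn (Sum.elim (F.genPk false r) (Sum.elim z e))) = some z
  twoToOne : ∀ r z e, F.dom (F.genPk true r) (Fin.tail z) →
    ∃ x₀ x₁, F.invertTwo (F.genSk true r)
        (F.evalAlg.fn (Sum.elim (F.genPk true r) (Sum.elim z e))) = some (x₀, x₁) ∧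
      (if z 0 then x₁ else x₀) = Fin.tail z ∧
      F.dom (F.genPk true r) x₀ ∧ F.dom (F.genPk true r) x₁ ∧
      ∀ b : Bool, F.InSupp (F.genPk true r) (Fin.cons b (if b then x₁ else x₀))
        (F.evalAlg.fn (Sum.elim (F.genPk true r) (Sum.elim z e)))
  check_iff : ∀ mode r z y, F.check (F.genPk mode r) z y ↔
    F.dom (F.genPk mode r) (Fin.tail z) ∧ F.InSupp (F.genPk mode r) z y

/-- The sets `Good` have density `1 - negl`. -/
def GoodDense (F : ℕ → TCF) : Prop :=
  ∃ μ : ℕ → ℝ, Negl μ ∧ ∀ n r x₀ x₁, (F n).dom ((F n).genPk true r) x₀ →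
    (F n).dom ((F n).genPk true r) x₁ →
    1 - μ n ≤ avg fun d => if (F n).good x₀ x₁ d then 1 else 0

/-- Public keys of the two modes are indistinguishable. -/
def KeyIndist (F : ℕ → TCF) : Prop :=
  CompIndist (fun n => law ((F n).genPk true)) fun n => law ((F n).genPk false)

end TCF

/-- An adversary in the adaptive hardcore bit game, with classical input on the wires `α`. It
outputs `y`, `d` and `(b, x)`. -/
structure HardcoreAdv (α : Type) [Fintype α] [DecidableEq α] (F : TCF) where
  work : ℕ
  advice : Op ((Fin F.yLen ⊕ (Fin (F.ℓ + 1) ⊕ Fin (F.ℓ + 1))) ⊕ Fin work)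
  isState : IsState advice
  circ : List (QGate (α ⊕ ((Fin F.yLen ⊕ (Fin (F.ℓ + 1) ⊕ Fin (F.ℓ + 1))) ⊕ Fin work)))

namespace HardcoreAdv

variable {α : Type} [Fintype α] [DecidableEq α] {F : TCF} (A : HardcoreAdv α F)

def size : ℕ := A.work + A.circ.length

/-- The probability, on input `x` and with the challenge key pair `(pk, sk)`, that the adversary
outputs `y`, a valid preimage `(b, x)` of `y` and some `d` in `Good` with
`d · (1, x₀ ⊕ x₁) = c`. -/
def winProb (pk : Fin F.pkLen → Bool) (sk : Fin F.skLen → Bool) (x : α → Bool) (c : Bool) : ℝ :=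
  prob (evolve (circMat A.circ) (withInput x A.advice)) fun s =>
    let y : Fin F.yLen → Bool := fun k => s (.inr (.inl (.inl k)))
    let d : Fin (F.ℓ + 1) → Bool := fun k => s (.inr (.inl (.inr (.inl k))))
    let z : Fin (F.ℓ + 1) → Bool := fun k => s (.inr (.inl (.inr (.inr k))))
    F.check pk z y &&
      (F.invertTwo sk y).elim false fun p => F.good p.1 p.2 d && (dotClaw p.1 p.2 d == c)

end HardcoreAdv

/-- The adaptive hardcore bit property of a single two-to-one key. -/
def TCF.AdaptiveHardcoreBit (F : ℕ → TCF) : Prop :=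
  ∀ A : ∀ n, HardcoreAdv (Fin (F n).pkLen) (F n), PolyBounded (fun n => (A n).size) →
    Negl fun n => |avg fun r =>
      (A n).winProb ((F n).genPk true r) ((F n).genSk true r) ((F n).genPk true r) false -
      (A n).winProb ((F n).genPk true r) ((F n).genSk true r) ((F n).genPk true r) true|

/-- Mahadev randomized trapdoor claw-free functions. -/
structure TCF.IsMahadevRTCF (F : ℕ → TCF) : Prop where
  efficient : PolyBounded fun n => (F n).size
  correct : ∀ n, (F n).Correct
  goodDense : TCF.GoodDense F
  keyIndist : TCF.KeyIndist F
  hardcore : TCF.AdaptiveHardcoreBit F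

/-- An adversary in the collapsing game, with classical input on the wires `α`. The circuit `prep`
prepares `y` and the register of `(b, x)`, the circuit `guess` acts after the challenger. -/
structure CollapseAdv (α : Type) [Fintype α] [DecidableEq α] (F : TCF) where
  work : ℕ
  advice : Op (Fin F.yLen ⊕ (Fin (F.ℓ + 1) ⊕ Fin work))
  isState : IsState advice
  prep : List (QGate (α ⊕ (Fin F.yLen ⊕ (Fin (F.ℓ + 1) ⊕ Fin work))))
  guess : List (QGate (α ⊕ (Fin F.yLen ⊕ (Fin (F.ℓ + 1) ⊕ Fin work))))
  out : α ⊕ (Fin F.yLen ⊕ (Fin (F.ℓ + 1) ⊕ Fin work))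

namespace CollapseAdv

variable {α : Type} [Fintype α] [DecidableEq α] {F : TCF} (A : CollapseAdv α F)

def size : ℕ := A.work + A.prep.length + A.guess.length

/-- The probability that the superposed check of `(b, x)` against `y` passes and that the adversary
then outputs `1`, if the challenge bit is `c`; for `c = 1` the challenger measures the register of
`b`. Since the adversary wins with probability `1/2` when the check fails, the winning probability
in the collapsing game is `1/2` plus half the difference of the values at `c = 1` and `c = 0`. -/
def outProb (pk : Fin F.pkLen → Bool) (x : α → Bool) (c : Bool) : ℝ :=
  let yOf : (α ⊕ (Fin F.yLen ⊕ (Fin (F.ℓ + 1) ⊕ Fin A.work)) → Bool) → (Fin F.yLen → Bool) :=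
    fun s k => s (.inr (.inl k))
  let zOf : (α ⊕ (Fin F.yLen ⊕ (Fin (F.ℓ + 1) ⊕ Fin A.work)) → Bool) →
      (Fin (F.ℓ + 1) → Bool) := fun s k => s (.inr (.inr (.inl k)))
  let ρ := restrict (fun s => F.check pk (zOf s) (yOf s))
    (dephase yOf (evolve (circMat A.prep) (withInput x A.advice)))
  let ρ' := if c then dephase (fun s => zOf s 0) ρ else ρ
  prob (evolve (circMat A.guess) ρ') fun s => s A.out

end CollapseAdv

/-! ### Batch key generation -/

/-- A batch key generation scheme for `N` keys at one security parameter. The function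
`C : [N] → {0,1}` is given to the key generation by a description of `descLen` bits, in any
representation in which the constant function `1` has a description. -/
structure BatchKeyGen (F : TCF) where
  N : ℕ
  N_pos : 0 < N
  descLen : ℕ
  PKLen : ℕ
  SKLen : ℕ
  coinLen : ℕ
  basis : (Fin descLen → Bool) → (Fin N → Bool)
  one : Fin descLen → Bool
  basis_one : basis one = fun _ => true
  genAlg : ClassicalAlg (Fin descLen ⊕ Fin coinLen) (Fin PKLen ⊕ Fin SKLen)
  extPkAlg : Fin N → ClassicalAlg (Fin PKLen) (Fin F.pkLen)
  extSkAlg : Fin N → ClassicalAlg (Fin SKLen) (Fin F.skLen)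

namespace BatchKeyGen

section

variable {F : TCF} (B : BatchKeyGen F)

def size : ℕ := B.N + B.descLen + B.PKLen + B.SKLen + B.coinLen + B.genAlg.size +
  ∑ i, ((B.extPkAlg i).size + (B.extSkAlg i).size)

def genPK (C : Fin B.descLen → Bool) (r : Fin B.coinLen → Bool) : Fin B.PKLen → Bool :=
  B.genAlg.fn (Sum.elim C r) ∘ Sum.inl

def genSK (C : Fin B.descLen → Bool) (r : Fin B.coinLen → Bool) : Fin B.SKLen → Bool :=
  B.genAlg.fn (Sum.elim C r) ∘ Sum.inr

def extPk (PK : Fin B.PKLen → Bool) (i : Fin B.N) : Fin F.pkLen → Bool := (B.extPkAlg i).fn PK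

def extSk (SK : Fin B.SKLen → Bool) (i : Fin B.N) : Fin F.skLen → Bool := (B.extSkAlg i).fn SK

/-- Every `(pk_i, sk_i)` is in the range of the key generation in mode `C(i)`. -/
def Correct : Prop := ∀ C r i, ∃ r', F.genPk (B.basis C i) r' = B.extPk (B.genPK C r) i ∧
  F.genSk (B.basis C i) r' = B.extSk (B.genSK C r) i

/-- The string `(PK, (sk_i)_{i ∈ T})`, where the other secret keys are replaced by zeros. -/
def view (T : Fin B.N → Bool) (C : Fin B.descLen → Bool) (r : Fin B.coinLen → Bool) :
    Fin B.PKLen ⊕ (Fin B.N × Fin F.skLen) → Bool :=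
  Sum.elim (B.genPK C r) fun p => T p.1 && B.extSk (B.genSK C r) p.1 p.2

/-- The wires of the `i`th key pair are separate blocks of `PK` and `SK`, and the `i`th key pair
is sampled by the key generation in mode `C(i)` with its own coins. -/
structure IsIndependent : Prop where
  pk_block : ∃ e : Fin B.N × Fin F.pkLen ≃ Fin B.PKLen, ∀ PK i k, B.extPk PK i k = PK (e (i, k))
  sk_block : ∃ e : Fin B.N × Fin F.skLen ≃ Fin B.SKLen, ∀ SK i k, B.extSk SK i k = SK (e (i, k))
  coins_block : ∃ e : Fin B.N × Fin F.coinLen ≃ Fin B.coinLen, ∀ C r i,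
    B.extPk (B.genPK C r) i = F.genPk (B.basis C i) (fun k => r (e (i, k))) ∧
    B.extSk (B.genSK C r) i = F.genSk (B.basis C i) (fun k => r (e (i, k)))

end

variable {F : ℕ → TCF} (B : ∀ n, BatchKeyGen (F n))

def KeyIndist : Prop :=
  ∀ (C₀ C₁ : ∀ n, Fin (B n).descLen → Bool) (T : ∀ n, Fin (B n).N → Bool),
    (∀ n i, T n i → (B n).basis (C₀ n) i = (B n).basis (C₁ n) i) →
    CompIndist (fun n => law ((B n).view (T n) (C₀ n))) fun n => law ((B n).view (T n) (C₁ n))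

/-- The function of the `j`th key is collapsing, given all other secret keys. -/
def CollapsingAtIndex : Prop :=
  ∀ (C : ∀ n, Fin (B n).descLen → Bool) (j : ∀ n, Fin (B n).N)
    (A : ∀ n, CollapseAdv (Fin (B n).PKLen ⊕ (Fin (B n).N × Fin (F n).skLen)) (F n)),
    PolyBounded (fun n => (A n).size) →
    Negl fun n => |avg fun r =>
      let pk := (B n).extPk ((B n).genPK (C n) r) (j n)
      let x := (B n).view (fun i => decide (i ≠ j n)) (C n) r
      (A n).outProb pk x true - (A n).outProb pk x false|

/-- The function of the `j`th key has the adaptive hardcore bit property if it is two-to-one,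
given all other secret keys. -/
def HardcoreAtIndex : Prop :=
  ∀ (C : ∀ n, Fin (B n).descLen → Bool) (j : ∀ n, Fin (B n).N)
    (A : ∀ n, HardcoreAdv (Fin (B n).PKLen ⊕ (Fin (B n).N × Fin (F n).skLen)) (F n)),
    (∀ n, (B n).basis (C n) (j n) = true) → PolyBounded (fun n => (A n).size) →
    Negl fun n => |avg fun r =>
      let pk := (B n).extPk ((B n).genPK (C n) r) (j n)
      let sk := (B n).extSk ((B n).genSK (C n) r) (j n)
      let x := (B n).view (fun i => decide (i ≠ j n)) (C n) r
      (A n).winProb pk sk x false - (A n).winProb pk sk x true|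

end BatchKeyGen

/-! ### The measurement protocol -/

section Protocol

variable {F : TCF} (B : BatchKeyGen F)

/-- The wires of the commitment register. -/
abbrev YWire := Fin B.N × Fin F.yLen

/-- The wires of the opening register; its `i`th block holds `(b_i, x_i)` or `d_i`. -/
abbrev ZWire := Fin B.N × Fin (F.ℓ + 1)

/-- The test of the verifier. -/
def testAccepts (PK : Fin B.PKLen → Bool) (y : YWire B → Bool) (z : ZWire B → Bool) : Bool :=
  decide (∀ i, F.check (B.extPk PK i) (fun k => z (i, k)) fun k => y (i, k))

/-- The two preimages of `y_i`, if `Invert` finds them and `d` is in the set `Good` that they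
define. -/
def goodClaw (SK : Fin B.SKLen → Bool) (y : YWire B → Bool) (i : Fin B.N)
    (d : Fin (F.ℓ + 1) → Bool) : Option ((Fin F.ℓ → Bool) × (Fin F.ℓ → Bool)) :=
  (F.invertTwo (B.extSk SK i) fun k => y (i, k)).filter fun p => F.good p.1 p.2 d

/-- The probability that the verifier outputs `m` in the measurement round. Where a preimage does
not exist, the output is `0` in the standard basis and a random bit in the Hadamard basis. -/
def outDist (h : Fin B.N → Bool) (SK : Fin B.SKLen → Bool) (y : YWire B → Bool)
    (z : ZWire B → Bool) (m : Fin B.N → Bool) : ℝ :=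
  ∏ i, if h i then
      (goodClaw B SK y i fun k => z (i, k)).elim (1 / 2) fun p =>
        if m i = dotClaw p.1 p.2 fun k => z (i, k) then 1 else 0
    else
      if m i = (F.invertInj (B.extSk SK i) fun k => y (i, k)).elim false (fun v => v 0)
        then 1 else 0

/-- A non-uniform cheating prover at one security parameter. Its registers hold the public key, the
commitment, the opening, and `aux` internal qubits. The commitment unitary is classically controlled
on the public key, the attack unitary on the public key and the commitment. In the test round
the prover measures the opening register in the standard basis. -/
structure Prover where
  aux : ℕ
  init : Op (YWire B ⊕ (ZWire B ⊕ Fin aux))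
  isState : IsState init
  commit : List (QGate (Fin B.PKLen ⊕ (YWire B ⊕ (ZWire B ⊕ Fin aux))))
  commit_controlled : ∀ s t, s ∘ Sum.inl ≠ t ∘ Sum.inl → circMat commit s t = 0
  attack : List (QGate (Fin B.PKLen ⊕ (YWire B ⊕ (ZWire B ⊕ Fin aux))))
  attack_controlled : ∀ s t, (s ∘ Sum.inl ≠ t ∘ Sum.inl ∨
    s ∘ Sum.inr ∘ Sum.inl ≠ t ∘ Sum.inr ∘ Sum.inl) → circMat attack s t = 0

namespace Prover

variable {B} (P : Prover B)

def size : ℕ := P.aux + P.commit.length + P.attack.length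

/-- The block of an operator for fixed contents of the public key and commitment registers. -/
def block (M : Op (Fin B.PKLen ⊕ (YWire B ⊕ (ZWire B ⊕ Fin P.aux))))
    (PK : Fin B.PKLen → Bool) (y : YWire B → Bool) : Op (ZWire B ⊕ Fin P.aux) :=
  M.submatrix (fun w => Sum.elim PK (Sum.elim y w)) fun w => Sum.elim PK (Sum.elim y w)

/-- The residual state after the commitment `y` on public key `PK`, not normalized: its trace is
the probability of `y`. -/
def state (PK : Fin B.PKLen → Bool) (y : YWire B → Bool) : Op (ZWire B ⊕ Fin P.aux) :=
  P.block (evolve (circMat P.commit) (withInput PK P.init)) PK y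

/-- The attack unitary on the opening and internal registers. -/
def U (PK : Fin B.PKLen → Bool) (y : YWire B → Bool) : Op (ZWire B ⊕ Fin P.aux) :=
  P.block (circMat P.attack) PK y

/-- The probability to pass the test round. -/
def passProb (C : Fin B.descLen → Bool) : ℝ :=
  avg fun r => ∑ y, prob (P.state (B.genPK C r) y)
    fun w => testAccepts B (B.genPK C r) y (w ∘ Sum.inl)

/-- The distribution of the output of the verifier in the measurement round. The opening register
is measured in the Hadamard basis. -/
def realDist (C : Fin B.descLen → Bool) (m : Fin B.N → Bool) : ℝ :=
  avg fun r => ∑ y, ∑ w : ZWire B ⊕ Fin P.aux → Bool,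
    measure (Sum.elim (fun _ => true) fun _ => false)
      (evolve (P.U (B.genPK C r) y) (P.state (B.genPK C r) y)) w *
    outDist B (B.basis C) (B.genSK C r) y (w ∘ Sum.inl) m

end Prover

end Protocol

/-! ### Black-box extraction -/

/-- Operations of an algorithm with black-box access to a unitary `U` on the registers
`ζ` and `ι`: gates on `ζ` and on the wires `ω` of the algorithm itself, and the operators `U` and
`U†`, possibly controlled on a wire in `ω`. The register `ι` cannot be accessed otherwise. -/
inductive BBGate (ζ ω : Type)
  | gate (g : QGate (ζ ⊕ ω))
  | fwd (ctrl : Option ω)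
  | bwd (ctrl : Option ω)

section BlackBox

variable {ζ ι ω : Type} [Fintype ζ] [DecidableEq ζ] [Fintype ι] [DecidableEq ι] [Fintype ω]
  [DecidableEq ω]

def accessible : ζ ⊕ ω ↪ (ζ ⊕ ι) ⊕ ω :=
  ⟨Sum.map Sum.inl id, Sum.inl_injective.sumMap Function.injective_id⟩

/-- `M` on the registers `ζ` and `ι`, possibly controlled on a wire in `ω`. -/
def controlled (M : Op (ζ ⊕ ι)) (ctrl : Option ω) : Op ((ζ ⊕ ι) ⊕ ω) := Matrix.of fun s t =>
  if s ∘ Sum.inr = t ∘ Sum.inr then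
    (if ctrl.elim true (fun a => t (.inr a)) then M else 1) (s ∘ Sum.inl) (t ∘ Sum.inl)
  else 0

def BBGate.mat (U : Op (ζ ⊕ ι)) : BBGate ζ ω → Op ((ζ ⊕ ι) ⊕ ω)
  | .gate g => (g.map accessible).mat
  | .fwd ctrl => controlled U ctrl
  | .bwd ctrl => controlled Uᴴ ctrl

def bbMat (U : Op (ζ ⊕ ι)) : List (BBGate ζ ω) → Op ((ζ ⊕ ι) ⊕ ω)
  | [] => 1
  | g :: c => bbMat U c * g.mat U

end BlackBox

/-- An algorithm with black-box access to an attacker with answer register `ζ`. It has a classical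
input on the wires `α`, and outputs the qubits on the wires `β`. -/
structure BBAlg (α β ζ : Type) where
  anc : ℕ
  gates : List (BBGate ζ (α ⊕ (β ⊕ Fin anc)))

namespace BBAlg

variable {α β ζ ι : Type} [Fintype α] [DecidableEq α] [Fintype β] [DecidableEq β] [Fintype ζ]
  [DecidableEq ζ] [Fintype ι] [DecidableEq ι]

def size (E : BBAlg α β ζ) : ℕ := E.anc + E.gates.length

/-- The output state on black-box access to `(U, ρ)` and input `x`; all other registers are traced
out. -/
def run (E : BBAlg α β ζ) (U ρ : Op (ζ ⊕ ι)) (x : α → Bool) : Op β := Matrix.of fun a b =>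
  ∑ w : ζ ⊕ ι → Bool, ∑ x' : α → Bool, ∑ c : Fin E.anc → Bool,
    evolve (bbMat U E.gates)
      (withAncilla ρ (Sum.elim x (Sum.elim (fun _ => false) fun _ => false)))
      (Sum.elim w (Sum.elim x' (Sum.elim a c))) (Sum.elim w (Sum.elim x' (Sum.elim b c)))

end BBAlg

/-- Extractors: the input is `(PK, SK, y)` and the output is an `N`-qubit state. -/
abbrev Extractor {F : TCF} (B : BatchKeyGen F) :=
  BBAlg (Fin B.PKLen ⊕ (Fin B.SKLen ⊕ YWire B)) (Fin B.N) (ZWire B)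

/-- The distribution of the `h`-basis measurement of the extracted state, where `C` describes `h`
and the keys are sampled by `sim`. -/
def simDist {F : TCF} {B : BatchKeyGen F} (P : Prover B) {k : ℕ}
    (sim : ClassicalAlg (Fin k) (Fin B.PKLen ⊕ Fin B.SKLen)) (ext : Extractor B)
    (C : Fin B.descLen → Bool) (m : Fin B.N → Bool) : ℝ :=
  avg fun r =>
    let PK := sim.fn r ∘ Sum.inl
    let SK := sim.fn r ∘ Sum.inr
    ∑ y, measure (B.basis C)
      (ext.run (P.U PK y) (P.state PK y) (Sum.elim PK (Sum.elim SK y))) m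

/-- Soundness of the commit-and-measure protocol, with the key generation `sim` and the extractor
`ext`: both are efficient, and for every non-uniform quantum polynomial-time prover that passes the
test round with probability `1 - negl` for all bases, and for all bases, the output of the verifier
is indistinguishable from the measurement of the extracted state. -/
structure SoundWith {F : ℕ → TCF} (B : ∀ n, BatchKeyGen (F n)) {k : ℕ → ℕ}
    (sim : ∀ n, ClassicalAlg (Fin (k n)) (Fin (B n).PKLen ⊕ Fin (B n).SKLen))
    (ext : ∀ n, Extractor (B n)) : Prop where
  coins_poly : PolyBounded k
  sim_efficient : PolyBounded fun n => (sim n).size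
  ext_efficient : PolyBounded fun n => (ext n).size
  sound : ∀ P : ∀ n, Prover (B n), PolyBounded (fun n => (P n).size) →
    (∀ C : ∀ n, Fin (B n).descLen → Bool, Negl fun n => 1 - (P n).passProb (C n)) →
    ∀ C : ∀ n, Fin (B n).descLen → Bool,
      CompIndist (fun n => (P n).realDist (C n)) fun n => simDist (P n) (sim n) (ext n) (C n)

/-! ### The teleported state -/

section Teleport

/-- The product of the operators `O i` over the indices with `r i = true`, in increasing order. -/
def parity {N : ℕ} {α : Type} [Fintype α] [DecidableEq α] (O : Fin N → Op α)
    (r : Fin N → Bool) : Op α :=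
  (List.ofFn fun i => if r i then O i else 1).prod

/-- The Pauli `Z` operator on wire `a`. -/
def pauliZ {α : Type} [Fintype α] [DecidableEq α] (a : α) : Op α :=
  Matrix.diagonal fun s => if s a then -1 else 1

/-- The Pauli `X` operator on wire `a`. -/
def pauliX {α : Type} [Fintype α] [DecidableEq α] (a : α) : Op α :=
  Matrix.of fun s t => if s = Function.update t a (!t a) then 1 else 0

variable {N : ℕ} {α : Type} [Fintype α] [DecidableEq α]

/-- The operator `2⁻ᴺ ∑ X(r) Z(s) ⊗ σ_x(r) σ_z(s) ⊗ 1` on the given system and two registers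
of `N` qubits. -/
def teleportOp (X Z : Fin N → Op α) :
    Matrix ((α → Bool) × ((Fin N → Bool) × (Fin N → Bool)))
      ((α → Bool) × ((Fin N → Bool) × (Fin N → Bool))) ℂ :=
  ((2 : ℂ) ^ N)⁻¹ • ∑ r : Fin N → Bool, ∑ s : Fin N → Bool,
    (parity X r * parity Z s) ⊗ₖ ((parity pauliX r * parity pauliZ s) ⊗ₖ (1 : Op (Fin N)))

/-- The density matrix of `N` EPR pairs. -/
def epr (N : ℕ) :
    Matrix ((Fin N → Bool) × (Fin N → Bool)) ((Fin N → Bool) × (Fin N → Bool)) ℂ :=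
  Matrix.of fun a b => if a.1 = a.2 ∧ b.1 = b.2 then ((2 : ℂ) ^ N)⁻¹ else 0

/-- The state on the last `N` qubits after `teleportOp` is applied to `ρ` and `N` EPR pairs. -/
def teleported (X Z : Fin N → Op α) (ρ : Op α) : Op (Fin N) := Matrix.of fun a b =>
  ∑ w : α → Bool, ∑ c : Fin N → Bool,
    (teleportOp X Z * (ρ ⊗ₖ epr N) * (teleportOp X Z)ᴴ) (w, (c, a)) (w, (c, b))

variable {F : TCF} (B : BatchKeyGen F) {ι : Type} [Fintype ι] [DecidableEq ι]

/-- The observable `Z_i`: Pauli `Z` on the first bit of the `i`th block of the opening register. The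
last `N` wires are the ancillas that supply random bits. -/
def obsZ (i : Fin B.N) : Op ((ZWire B ⊕ ι) ⊕ Fin B.N) := pauliZ (.inl (.inl (i, 0)))

/-- The observable `X_i`: apply `U`, measure the `i`th block of the opening register and the
`i`th ancilla in the Hadamard basis, and compute the `i`th output bit of the verifier, with the
ancilla as its random bit. -/
def obsX (U : Op (ZWire B ⊕ ι)) (SK : Fin B.SKLen → Bool) (y : YWire B → Bool) (i : Fin B.N) :
    Op ((ZWire B ⊕ ι) ⊕ Fin B.N) :=
  let V : Op ((ZWire B ⊕ ι) ⊕ Fin B.N) := controlled U none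
  let H : Op ((ZWire B ⊕ ι) ⊕ Fin B.N) := hadOn
    (Sum.elim (Sum.elim (fun p => decide (p.1 = i)) fun _ => false) fun a => decide (a = i))
  let D : Op ((ZWire B ⊕ ι) ⊕ Fin B.N) := Matrix.diagonal fun s =>
    let d : Fin (F.ℓ + 1) → Bool := fun k => s (.inl (.inl (i, k)))
    if (goodClaw B SK y i d).elim (s (.inr i)) (fun p => dotClaw p.1 p.2 d) then -1 else 1
  Vᴴ * H * D * H * V

/-- The state that the teleportation procedure extracts from `(U, ρ)` given `(SK, y)`. -/
def extractedState (U ρ : Op (ZWire B ⊕ ι)) (SK : Fin B.SKLen → Bool) (y : YWire B → Bool) :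
    Op (Fin B.N) :=
  teleported (obsX B U SK y) (obsZ B) (withAncilla ρ fun _ => false)

end Teleport

end CommitMeasure

end

open CommitMeasure

set_option linter.unusedSectionVars false
set_option linter.unusedSimpArgs false
set_option synthInstance.maxSize 1000

open scoped Matrix Kronecker BigOperators ComplexOrder

noncomputable section

namespace CommitMeasure

/-! ### Operators on qubit registers: tensor products, renaming of wires, conjugation, gates,
states. -/

section OperatorCalculus

variable {α β γ δ : Type} [Fintype α] [DecidableEq α] [Fintype β] [DecidableEq β]
  [Fintype γ] [DecidableEq γ] [Fintype δ] [DecidableEq δ]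

/-! The extracted state has a closed form. The observables `Z_i` are diagonal in the standard basis,
and one unitary `G` (the attack followed by Hadamard gates on the openings and on the random-bit
ancillas) diagonalizes all `X_i` at once, because the Hadamard gates on the other blocks commute
with the diagonal part of `X_i` and cancel. Orthogonality of the characters `phase` then shows that
entry `(a, b)` of the teleported state is the sum over `w` of `(-1)^((a ⊕ b) · v(w))` times the
diagonal entry at `w` of `G P_a ρ P_b G†`, where `P_a` projects onto openings with first bits `a`
and `v(w)` are the decoded bits (`teleported_apply`, `extractedState_apply`). A circuit with the
same closed form copies the first bits coherently into the output register, applies the attack and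
the Hadamard gates, and multiplies by the phase through phase kickback (`run_extractorAlg`).

Measuring this state in basis `h` is the following experiment (`measure_extractedState`): choose a
uniform mask supported on the positions with `h_i = 1`; measure the first bits at the positions with
`h_i = 0`; apply Pauli `Z` according to the mask; run the attack; output the measured first bits
and, where `h_i = 1`, the decoded bits XORed with the mask. The quantities computed in such
experiments are called `score`. This form needs secret keys only where `h_i = 1`, so key
indistinguishability replaces the keys for `1` by the keys for `h`.

It remains to compare this experiment with the real one under the keys for `h`. With all masks off
(`hybrid` at `0`), the only difference is that measured first bits stand in for inverted ones. They
agree on openings that pass the test, and since the test passes almost surely, gentle measurement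
bounds the error by a multiple of the square root of the failure probability
(`abs_real_sub_hybrid_zero_le`).

The masks are switched on one position at a time. A random `Z` at `k`, with the output bit flipped
accordingly, changes the score by two terms (`score_step`). In the first the decoded bit at `k` has
cancelled and only the effect of measuring the first bit of block `k` remains, which is the
collapsing property. In the second that bit has been measured and the test function carries the sign
of the decoded bit. After the check, in 2-to-1 mode, measuring the first bit is the same as
measuring the whole preimage (`dephase_openAt_restrict`), so an adversary may output the preimage
together with `d`, adding the guess of the distinguisher to the first bit of `d`: this is the
adaptive hardcore bit. Where the decoded bit is not defined it is a fresh random bit, and its sign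
averages to zero. Both reductions work without the secret key at `k`. They have the worst position,
mask and random bits hardwired, and finiteness of these choices turns the resulting bounds into
uniform negligible ones (`exists_negl_bound`).

For independent keys the three batch properties follow from the two properties of the function
family. Key indistinguishability is a hybrid over positions. The hardcore bit survives hardwiring
all other keys. Collapsing holds because the check needs only the public key, so the whole game can
be run by a distinguisher: the challenge key may be replaced by an injective one, for which the
checked opening is determined by `y` and the measurement does nothing. -/

theorem sum_bits_sum {M : Type*} [AddCommMonoid M] (f : (α ⊕ β → Bool) → M) :
    ∑ s, f s = ∑ a, ∑ b, f (Sum.elim a b) := by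
  rw [← Fintype.sum_prod_type']
  exact (Fintype.sum_equiv (Equiv.sumArrowEquivProdArrow α β Bool).symm _ _ fun _ => rfl).symm

theorem sum_bits_equiv {M : Type*} [AddCommMonoid M] (e : α ≃ β) (f : (α → Bool) → M) :
    ∑ s, f s = ∑ t : β → Bool, f (t ∘ e) :=
  Fintype.sum_equiv (e.arrowCongr (Equiv.refl Bool)) _ _ fun s => by
    congr 1; ext a; simp [Equiv.arrowCongr]

/-- The tensor product of operators on disjoint sets of wires. -/
def tensOp (A : Op α) (B : Op β) : Op (α ⊕ β) := Matrix.of fun s t =>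
  A (s ∘ Sum.inl) (t ∘ Sum.inl) * B (s ∘ Sum.inr) (t ∘ Sum.inr)

/-- The operator `A` on renamed wires. -/
def relabel (e : α ≃ β) (A : Op α) : Op β := A.submatrix (· ∘ e) (· ∘ e)

/-- The projection onto a standard basis state. -/
def pureOp (x : α → Bool) : Op α := Matrix.of fun s t => if s = x ∧ t = x then 1 else 0

/-- The operator that maps the basis state `t` to the basis state `π t`. -/
def permOp (π : (α → Bool) → (α → Bool)) : Op α := Matrix.of fun s t => if s = π t then 1 else 0

theorem tensOp_apply (A : Op α) (B : Op β) (s t) : tensOp A B s t =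
    A (s ∘ Sum.inl) (t ∘ Sum.inl) * B (s ∘ Sum.inr) (t ∘ Sum.inr) := rfl

theorem relabel_apply (e : α ≃ β) (A : Op α) (s t) : relabel e A s t = A (s ∘ e) (t ∘ e) := rfl

theorem permOp_apply (π : (α → Bool) → (α → Bool)) (s t) :
    permOp π s t = if s = π t then 1 else 0 := rfl

theorem pureOp_apply (x s t : α → Bool) : pureOp x s t = if s = x ∧ t = x then 1 else 0 := rfl

theorem bits_sum_ext {s t : α ⊕ β → Bool} :
    s = t ↔ s ∘ Sum.inl = t ∘ Sum.inl ∧ s ∘ Sum.inr = t ∘ Sum.inr := by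
  constructor
  · rintro rfl; exact ⟨rfl, rfl⟩
  · rintro ⟨h₁, h₂⟩
    funext x
    rcases x with a | b
    exacts [congrFun h₁ a, congrFun h₂ b]

theorem tensOp_mul (A A' : Op α) (B B' : Op β) :
    tensOp A B * tensOp A' B' = tensOp (A * A') (B * B') := by
  ext s t
  simp only [Matrix.mul_apply, tensOp_apply, sum_bits_sum, Sum.elim_comp_inl, Sum.elim_comp_inr,
    Finset.sum_mul_sum]
  exact Finset.sum_congr rfl fun _ _ => Finset.sum_congr rfl fun _ _ => by ring

theorem tensOp_one : tensOp (1 : Op α) (1 : Op β) = 1 := by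
  ext s t
  simp only [tensOp_apply, Matrix.one_apply, bits_sum_ext (s := s), ite_and]
  split_ifs <;> simp

theorem tensOp_conjTranspose (A : Op α) (B : Op β) : (tensOp A B)ᴴ = tensOp Aᴴ Bᴴ := by
  ext s t
  simp [tensOp_apply, Matrix.conjTranspose_apply]

theorem evolve_mul (A B ρ : Op α) : evolve (A * B) ρ = evolve A (evolve B ρ) := by
  simp only [evolve, Matrix.conjTranspose_mul, Matrix.mul_assoc]

theorem evolve_one (ρ : Op α) : evolve 1 ρ = ρ := by simp [evolve]

theorem evolve_tensOp (A ρ : Op α) (B σ : Op β) :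
    evolve (tensOp A B) (tensOp ρ σ) = tensOp (evolve A ρ) (evolve B σ) := by
  simp only [evolve, tensOp_conjTranspose, tensOp_mul]

theorem evolve_apply (A ρ : Op α) (s t) :
    evolve A ρ s t = ∑ u, ∑ v, A s u * ρ u v * star (A t v) := by
  simp only [evolve, Matrix.mul_apply, Matrix.conjTranspose_apply, Finset.sum_mul]
  rw [Finset.sum_comm]

/-- An operator on the first register acts separately on each block with fixed contents of the
second. This is how spectator registers are frozen at classical values below. -/
theorem evolve_tensOp_one_apply (A : Op α) (σ : Op (α ⊕ β)) (s t : α → Bool) (g g' : β → Bool) :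
    evolve (tensOp A 1) σ (Sum.elim s g) (Sum.elim t g') =
      evolve A (Matrix.of fun u v => σ (Sum.elim u g) (Sum.elim v g')) s t := by
  have h₁ (f : (β → Bool) → ℂ) : ∑ b, (1 : Op β) g b * f b = f g :=
    congrFun (Matrix.one_mulVec f) g
  have h₂ (f : (β → Bool) → ℂ) : ∑ b, star ((1 : Op β) g' b) * f b = f g' := by
    have : ∀ b, star ((1 : Op β) g' b) = (1 : Op β) g' b := fun b => by
      rw [Matrix.one_apply]; split_ifs <;> simp
    simp only [this]
    exact congrFun (Matrix.one_mulVec f) g'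
  generalize (1 : Op β) = I at h₁ h₂
  simp only [evolve_apply, sum_bits_sum, tensOp_apply, Sum.elim_comp_inl, Sum.elim_comp_inr,
    Matrix.of_apply]
  refine Finset.sum_congr rfl fun u _ => ?_
  rw [Finset.sum_comm]
  refine Finset.sum_congr rfl fun v _ => ?_
  calc _ = ∑ b, I g b * ∑ c, star (I g' c) *
        (A s u * σ (Sum.elim u b) (Sum.elim v c) * star (A t v)) := by
        refine Finset.sum_congr rfl fun b _ => ?_
        rw [Finset.mul_sum]
        exact Finset.sum_congr rfl fun c _ => by rw [star_mul']; ring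
    _ = _ := by rw [h₁, h₂]

theorem evolve_permOp_apply {π : (α → Bool) → (α → Bool)} (hπ : Function.Bijective π) (σ : Op α)
    (s t) : evolve (permOp π) σ (π s) (π t) = σ s t := by
  simp only [evolve_apply, permOp_apply, hπ.1.eq_iff]
  simp [apply_ite star]

theorem evolve_permOp_of_involutive {π : (α → Bool) → (α → Bool)} (hπ : Function.Involutive π)
    (σ : Op α) (s t) : evolve (permOp π) σ s t = σ (π s) (π t) := by
  have := evolve_permOp_apply hπ.bijective σ (π s) (π t)
  rwa [hπ s, hπ t] at this

theorem evolve_diagonal_apply (d : (α → Bool) → ℂ) (σ : Op α) (s t) :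
    evolve (Matrix.diagonal d) σ s t = d s * σ s t * star (d t) := by
  simp only [evolve, Matrix.diagonal_conjTranspose, Matrix.mul_diagonal, Matrix.diagonal_mul]
  rfl

theorem relabel_mul (e : α ≃ β) (A B : Op α) : relabel e (A * B) = relabel e A * relabel e B := by
  ext s t
  simp only [relabel_apply, Matrix.mul_apply]
  rw [sum_bits_equiv e]

theorem relabel_one (e : α ≃ β) : relabel e (1 : Op α) = 1 := by
  ext s t
  simp only [relabel_apply, Matrix.one_apply, e.surjective.injective_comp_right.eq_iff]

theorem relabel_conjTranspose (e : α ≃ β) (A : Op α) : (relabel e A)ᴴ = relabel e Aᴴ := rfl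

theorem evolve_relabel (e : α ≃ β) (A ρ : Op α) :
    evolve (relabel e A) (relabel e ρ) = relabel e (evolve A ρ) := by
  simp only [evolve, relabel_conjTranspose, relabel_mul]

theorem prob_relabel (e : α ≃ β) (ρ : Op α) (p : (β → Bool) → Bool) :
    prob (relabel e ρ) p = prob ρ fun s => p (s ∘ e.symm) := by
  simp only [prob]
  rw [sum_bits_equiv e]
  simp [relabel_apply, Function.comp_assoc]

theorem withInput_eq (x : α → Bool) (σ : Op β) : withInput x σ = tensOp (pureOp x) σ := by
  ext s t
  simp only [withInput, tensOp_apply, pureOp_apply, Matrix.of_apply, ite_mul, one_mul, zero_mul]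

theorem withAncilla_eq (σ : Op α) (x : β → Bool) : withAncilla σ x = tensOp σ (pureOp x) := by
  ext s t
  simp only [withAncilla, tensOp_apply, pureOp_apply, Matrix.of_apply, mul_ite, mul_one, mul_zero]

theorem pureOp_sumElim (x : α → Bool) (y : β → Bool) :
    pureOp (Sum.elim x y) = tensOp (pureOp x) (pureOp y) := by
  ext s t
  simp only [tensOp_apply, pureOp_apply, bits_sum_ext (t := Sum.elim x y), Sum.elim_comp_inl,
    Sum.elim_comp_inr, ite_and]
  split_ifs <;> simp

/-! ### Hadamard gates -/

/-- The entries of a Hadamard or identity matrix on one wire. -/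
def hadEntry (h s t : Bool) : ℂ :=
  if h then (if s && t then -1 else 1) / (Real.sqrt 2 : ℂ) else if s = t then 1 else 0

theorem hadOn_apply (h s t : α → Bool) : hadOn h s t = ∏ a, hadEntry (h a) (s a) (t a) := rfl

/-- The Hadamard matrix is an involution, so its exponents add modulo 2. -/
theorem sum_hadEntry_mul (h h' s t : Bool) :
    ∑ x, hadEntry h s x * hadEntry h' x t = hadEntry (h ^^ h') s t := by
  have h2 : (Real.sqrt 2 : ℂ) * Real.sqrt 2 = 2 := by
    rw [← Complex.ofReal_mul, Real.mul_self_sqrt (by norm_num)]; norm_num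
  have h0 : (Real.sqrt 2 : ℂ) ≠ 0 := by
    intro h; rw [h] at h2; norm_num at h2
  have h3 : (Real.sqrt 2 : ℂ) ^ 2 = 2 := by rw [sq, h2]
  rw [Fintype.sum_bool]
  cases h <;> cases h' <;> cases s <;> cases t <;> simp [hadEntry] <;> field_simp <;>
    rw [h3] <;> norm_num

theorem hadOn_mul (h h' : α → Bool) : hadOn h * hadOn h' = hadOn fun a => h a ^^ h' a := by
  ext s t
  simp only [Matrix.mul_apply, hadOn_apply, ← Finset.prod_mul_distrib, ← sum_hadEntry_mul]
  rw [Finset.prod_univ_sum, Fintype.piFinset_univ]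

theorem hadOn_false : hadOn (fun _ : α => false) = 1 := by
  ext s t
  simp only [hadOn, Matrix.of_apply, Matrix.one_apply, Bool.false_eq_true, if_false,
    funext_iff (f := s), Fintype.prod_ite_zero, Finset.prod_const_one]

theorem hadOn_apply_comm (h : α → Bool) (s t) : hadOn h s t = hadOn h t s := by
  simp only [hadOn, Matrix.of_apply]
  refine Finset.prod_congr rfl fun a _ => ?_
  simp only [Bool.and_comm, eq_comm]

theorem hadOn_star (h : α → Bool) (s t) : star (hadOn h s t) = hadOn h s t := by
  simp only [hadOn, Matrix.of_apply, star_prod]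
  refine Finset.prod_congr rfl fun a _ => ?_
  split_ifs <;> simp

theorem hadOn_conjTranspose (h : α → Bool) : (hadOn h)ᴴ = hadOn h := by
  ext s t
  rw [Matrix.conjTranspose_apply, hadOn_star, hadOn_apply_comm]

theorem hadOn_mul_self (h : α → Bool) : hadOn h * hadOn h = 1 := by
  rw [hadOn_mul, ← hadOn_false]; simp

theorem hadOn_mem_unitaryGroup (h : α → Bool) :
    hadOn h ∈ Matrix.unitaryGroup (α → Bool) ℂ := by
  rw [Matrix.mem_unitaryGroup_iff, Matrix.star_eq_conjTranspose, hadOn_conjTranspose,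
    hadOn_mul_self]

theorem hadOn_sumElim (h : α → Bool) (h' : β → Bool) :
    hadOn (Sum.elim h h') = tensOp (hadOn h) (hadOn h') := by
  ext s t
  simp only [hadOn_apply, tensOp_apply, Fintype.prod_sum_type]
  rfl

theorem hadOn_relabel (e : α ≃ β) (h : α → Bool) : relabel e (hadOn h) = hadOn (h ∘ e.symm) := by
  ext s t
  simp only [hadOn, relabel_apply, Matrix.of_apply]
  exact Fintype.prod_equiv e _ _ fun a => by simp

theorem hadOn_apply_eq_zero {h : α → Bool} {s t : α → Bool} {a : α} (ha : h a = false)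
    (hst : s a ≠ t a) : hadOn h s t = 0 :=
  Finset.prod_eq_zero (Finset.mem_univ a) (by simp [ha, hst])

/-! ### Gates -/

theorem CGate.apply_apply (g : CGate α) (s) : g.apply (g.apply s) = s := by
  cases g with
  | not a => simp [CGate.apply]
  | cnot a b h => simp [CGate.apply, h]
  | toffoli a b c hab hac hbc => simp [CGate.apply, hac, hbc]

theorem runGates_append (c c' : List (CGate α)) (s) :
    runGates (c ++ c') s = runGates c' (runGates c s) := by simp [runGates]

theorem runGates_cons (g : CGate α) (c : List (CGate α)) (s) :
    runGates (g :: c) s = runGates c (g.apply s) := rfl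

theorem runGates_reverse (c : List (CGate α)) (s) : runGates c.reverse (runGates c s) = s := by
  induction c generalizing s with
  | nil => rfl
  | cons g c ih =>
    rw [List.reverse_cons, runGates_append, runGates_cons g c, ih]
    exact g.apply_apply s

theorem runGates_bijective (c : List (CGate α)) : Function.Bijective (runGates c) :=
  ⟨Function.LeftInverse.injective (g := runGates c.reverse) (runGates_reverse c),
    fun s => ⟨runGates c.reverse s, by simpa using runGates_reverse c.reverse s⟩⟩

theorem circMat_append (c c' : List (QGate α)) : circMat (c ++ c') = circMat c' * circMat c := by
  induction c with
  | nil => simp [circMat]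
  | cons g c ih => simp [circMat, ih, Matrix.mul_assoc]

theorem permOp_mul (π π' : (α → Bool) → (α → Bool)) :
    permOp π * permOp π' = permOp (π ∘ π') := by
  ext s t
  simp [Matrix.mul_apply, permOp_apply]

theorem circMat_classical (c : List (CGate α)) :
    circMat (c.map QGate.classical) = permOp (runGates c) := by
  induction c with
  | nil => ext s t; simp only [List.map_nil, circMat, permOp_apply, Matrix.one_apply]; rfl
  | cons g c ih =>
    rw [List.map_cons, circMat, ih]
    exact permOp_mul _ _

theorem permOp_mem_unitaryGroup {π : (α → Bool) → (α → Bool)} (hπ : Function.Bijective π) :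
    permOp π ∈ Matrix.unitaryGroup (α → Bool) ℂ := by
  rw [Matrix.mem_unitaryGroup_iff']
  ext s t
  simp [Matrix.mul_apply, permOp_apply, Matrix.star_eq_conjTranspose, Matrix.conjTranspose_apply,
    Matrix.one_apply, hπ.1.eq_iff, eq_comm]

theorem QGate.mat_mem_unitaryGroup (g : QGate α) :
    g.mat ∈ Matrix.unitaryGroup (α → Bool) ℂ := by
  cases g with
  | classical g =>
    exact permOp_mem_unitaryGroup (π := g.apply)
      (Function.Involutive.bijective fun s => g.apply_apply s)
  | had a => exact hadOn_mem_unitaryGroup _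
  | phaseT a =>
    rw [Matrix.mem_unitaryGroup_iff, Matrix.star_eq_conjTranspose, QGate.mat,
      Matrix.diagonal_conjTranspose, Matrix.diagonal_mul_diagonal, ← Matrix.diagonal_one]
    congr 1
    ext s
    simp only [Pi.star_apply]
    split_ifs
    · rw [Complex.star_def, ← Complex.exp_conj, ← Complex.exp_add, map_mul, Complex.conj_I,
        Complex.conj_ofReal, neg_mul, add_neg_cancel, Complex.exp_zero]
    · simp

theorem circMat_mem_unitaryGroup (c : List (QGate α)) :
    circMat c ∈ Matrix.unitaryGroup (α → Bool) ℂ := by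
  induction c with
  | nil => exact one_mem _
  | cons g c ih => exact mul_mem ih g.mat_mem_unitaryGroup

theorem CGate.map_apply_comp (f : α ↪ β) (g : CGate α) (t : β → Bool) :
    (g.map f).apply t ∘ f = g.apply (t ∘ f) := by
  cases g <;> ext a <;>
    simp [CGate.map, CGate.apply, Function.update_apply, f.injective.eq_iff]

theorem CGate.map_apply_of_notMem (f : α ↪ β) (g : CGate α) (t : β → Bool) {b : β}
    (hb : b ∉ Set.range f) : (g.map f).apply t b = t b := by
  have h : ∀ a, b ≠ f a := fun a h => hb ⟨a, h.symm⟩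
  cases g <;> simp [CGate.map, CGate.apply, h]

theorem QGate.mat_map_inl (g : QGate α) :
    (g.map (Function.Embedding.inl : α ↪ α ⊕ β)).mat = tensOp g.mat 1 := by
  cases g with
  | classical g =>
    ext s t
    have h₁ : (g.map (Function.Embedding.inl : α ↪ α ⊕ β)).apply t ∘ Sum.inl =
      g.apply (t ∘ Sum.inl) := CGate.map_apply_comp Function.Embedding.inl g t
    have h₂ : (g.map (Function.Embedding.inl : α ↪ α ⊕ β)).apply t ∘ Sum.inr = t ∘ Sum.inr := by
      ext b
      exact CGate.map_apply_of_notMem _ g t (by simp [Function.Embedding.inl])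
    simp only [QGate.map, QGate.mat, tensOp_apply, Matrix.of_apply, Matrix.one_apply,
      bits_sum_ext (s := s), h₁, h₂, ite_and]
    split_ifs <;> simp
  | had a =>
    rw [QGate.map, QGate.mat, QGate.mat, ← hadOn_false, ← hadOn_sumElim]
    congr 1
    ext b
    rcases b with b | b <;> simp [Function.Embedding.inl_apply]
  | phaseT a =>
    ext s t
    simp only [QGate.map, QGate.mat, tensOp_apply, Matrix.diagonal_apply, Matrix.one_apply,
      bits_sum_ext (s := s), ite_and]
    split_ifs <;> simp_all [Function.Embedding.inl_apply]

theorem circMat_map_inl (c : List (QGate α)) :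
    circMat (c.map (QGate.map (Function.Embedding.inl : α ↪ α ⊕ β))) = tensOp (circMat c) 1 := by
  induction c with
  | nil => exact tensOp_one.symm
  | cons g c ih => rw [List.map_cons, circMat, ih, circMat, QGate.mat_map_inl, tensOp_mul, mul_one]

theorem QGate.mat_map_equiv (e : α ≃ β) (g : QGate α) :
    (g.map e.toEmbedding).mat = relabel e g.mat := by
  cases g with
  | classical g =>
    ext s t
    have h : (g.map e.toEmbedding).apply t ∘ e = g.apply (t ∘ e) :=
      CGate.map_apply_comp e.toEmbedding g t
    simp only [QGate.map, QGate.mat, relabel_apply, Matrix.of_apply, ← h,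
      e.surjective.injective_comp_right.eq_iff]
  | had a =>
    rw [QGate.map, QGate.mat, QGate.mat, hadOn_relabel]
    congr 1
    ext b
    simp [Equiv.symm_apply_eq]
  | phaseT a =>
    ext s t
    simp only [QGate.map, QGate.mat, relabel_apply, Matrix.diagonal_apply,
      e.surjective.injective_comp_right.eq_iff]
    rfl

theorem circMat_map_equiv (e : α ≃ β) (c : List (QGate α)) :
    circMat (c.map (QGate.map e.toEmbedding)) = relabel e (circMat c) := by
  induction c with
  | nil => exact (relabel_one e).symm
  | cons g c ih => rw [List.map_cons, circMat, ih, circMat, QGate.mat_map_equiv, relabel_mul]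

theorem QGate.map_map (f : α ↪ β) (f' : β ↪ γ) (g : QGate α) :
    (g.map f).map f' = g.map (f.trans f') := by
  rcases g with (_ | _ | _) | _ | _ <;> rfl

/-- An embedding of wires is an inclusion as a summand followed by a bijection, and both cases are
known; the remaining wires are identified with `β`. -/
theorem circMat_map_of_equiv (e : α ⊕ β ≃ γ) (f : α ↪ γ) (hf : ∀ a, e (.inl a) = f a)
    (c : List (QGate α)) :
    circMat (c.map (QGate.map f)) = relabel e (tensOp (circMat c) 1) := by
  have : f = (Function.Embedding.inl : α ↪ α ⊕ β).trans e.toEmbedding := by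
    ext a; exact (hf a).symm
  rw [← circMat_map_inl, ← circMat_map_equiv, List.map_map]
  congr 2
  ext g
  rw [Function.comp_apply, QGate.map_map, this]

/-! ### States and measurements -/

theorem tensOp_eq_submatrix (A : Op α) (B : Op β) : tensOp A B =
    (A ⊗ₖ B).submatrix (Equiv.sumArrowEquivProdArrow α β Bool)
      (Equiv.sumArrowEquivProdArrow α β Bool) := rfl

theorem IsState.tensOp {A : Op α} {B : Op β} (hA : IsState A) (hB : IsState B) :
    IsState (tensOp A B) := by
  refine ⟨?_, ?_⟩
  · rw [tensOp_eq_submatrix]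
    exact (hA.1.kronecker hB.1).submatrix _
  · have : (CommitMeasure.tensOp A B).trace = A.trace * B.trace := by
      simp only [Matrix.trace, Matrix.diag_apply, sum_bits_sum, tensOp_apply, Finset.sum_mul_sum,
        Sum.elim_comp_inl, Sum.elim_comp_inr]
    rw [this, hA.2, hB.2, mul_one]

theorem IsState.relabel {A : Op α} (hA : IsState A) (e : α ≃ β) : IsState (relabel e A) := by
  refine ⟨hA.1.submatrix _, ?_⟩
  rw [← hA.2]
  simp only [Matrix.trace, Matrix.diag_apply, relabel_apply]
  exact (sum_bits_equiv e fun s => A s s).symm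

theorem isState_pureOp (x : α → Bool) : IsState (pureOp x) := by
  refine ⟨?_, by simp [Matrix.trace, pureOp_apply]⟩
  have : pureOp x = Matrix.vecMulVec (Pi.single x (1 : ℂ)) (star (Pi.single x (1 : ℂ))) := by
    ext s t
    simp only [pureOp_apply, Matrix.vecMulVec_apply, Pi.star_apply, Pi.single_apply, ite_and]
    split_ifs <;> simp
  rw [this]
  exact Matrix.posSemidef_vecMulVec_self_star _

theorem Matrix.PosSemidef.evolve {ρ : Op α} (hρ : ρ.PosSemidef) (U : Op α) :
    (evolve U ρ).PosSemidef := hρ.mul_mul_conjTranspose_same U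

theorem trace_evolve {U : Op α} (hU : U ∈ Matrix.unitaryGroup (α → Bool) ℂ) (ρ : Op α) :
    (evolve U ρ).trace = ρ.trace := by
  rw [CommitMeasure.evolve, Matrix.trace_mul_comm, ← Matrix.mul_assoc, ← Matrix.star_eq_conjTranspose,
    Matrix.mem_unitaryGroup_iff'.mp hU, one_mul]

theorem IsState.evolve {ρ : Op α} (hρ : IsState ρ) {U : Op α}
    (hU : U ∈ Matrix.unitaryGroup (α → Bool) ℂ) : IsState (evolve U ρ) :=
  ⟨Matrix.PosSemidef.evolve hρ.1 U, by rw [trace_evolve hU, hρ.2]⟩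

theorem diag_re_nonneg {ρ : Op α} (hρ : ρ.PosSemidef) (s) : 0 ≤ (ρ s s).re :=
  (Complex.le_def.mp (hρ.diag_nonneg (i := s))).1

theorem prob_nonneg {ρ : Op α} (hρ : ρ.PosSemidef) (p) : 0 ≤ prob ρ p :=
  Finset.sum_nonneg fun s _ => by split_ifs; exacts [diag_re_nonneg hρ s, le_rfl]

theorem prob_le_one {ρ : Op α} (hρ : IsState ρ) (p) : prob ρ p ≤ 1 := by
  have : ∑ s, (ρ s s).re = 1 := by
    have := congrArg Complex.re hρ.2
    simpa [Matrix.trace] using this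
  rw [← this]
  exact Finset.sum_le_sum fun s _ => by split_ifs; exacts [le_rfl, diag_re_nonneg hρ.1 s]

theorem prob_evolve_permOp {π : (α → Bool) → (α → Bool)} (hπ : Function.Bijective π) (σ : Op α)
    (p) : prob (evolve (permOp π) σ) p = prob σ fun s => p (π s) := by
  simp only [prob]
  rw [← hπ.sum_comp]
  simp only [evolve_permOp_apply hπ]

theorem Distinguisher.accept_nonneg (A : Distinguisher α) (x) : 0 ≤ A.accept x :=
  prob_nonneg (Matrix.PosSemidef.evolve (by
    rw [withInput_eq]; exact ((isState_pureOp x).tensOp A.isState).1) _) _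

theorem Distinguisher.accept_le_one (A : Distinguisher α) (x) : A.accept x ≤ 1 :=
  prob_le_one (IsState.evolve (by
    rw [withInput_eq]; exact (isState_pureOp x).tensOp A.isState) (circMat_mem_unitaryGroup _)) _

end OperatorCalculus

/-! ### Construction of classical algorithms -/

section ClassicalAlgorithms

/-- `f` is computed by a classical algorithm of size at most `k`. -/
def ComputedWithin {α β : Type} [DecidableEq α] [DecidableEq β]
    (f : (α → Bool) → (β → Bool)) (k : ℕ) : Prop :=
  ∃ A : ClassicalAlg α β, A.fn = f ∧ A.size ≤ k

variable {α β γ W : Type} [DecidableEq α] [DecidableEq β] [DecidableEq γ] [Fintype W]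
  [DecidableEq W]

theorem ClassicalAlg.computedWithin (A : ClassicalAlg α β) : ComputedWithin A.fn A.size :=
  ⟨A, rfl, le_rfl⟩

theorem ComputedWithin.mono {f : (α → Bool) → (β → Bool)} {k l : ℕ} (h : ComputedWithin f k)
    (hkl : k ≤ l) : ComputedWithin f l := by
  obtain ⟨A, hA, hk⟩ := h
  exact ⟨A, hA, hk.trans hkl⟩

/-- A renamed circuit acts on the range of `f` as the original does and fixes every other wire, so
its effect can be checked on the two parts separately. -/
theorem runGates_map_eq {α β : Type} [DecidableEq α] [DecidableEq β] (f : α ↪ β)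
    (c : List (CGate α)) {t t' : β → Bool}
    (h₁ : runGates c (t ∘ f) = t' ∘ f) (h₂ : ∀ b, b ∉ Set.range f → t b = t' b) :
    runGates (c.map (CGate.map f)) t = t' := by
  have : ∀ (c : List (CGate α)) (t : β → Bool),
      runGates (c.map (CGate.map f)) t ∘ f = runGates c (t ∘ f) ∧
      ∀ b, b ∉ Set.range f → runGates (c.map (CGate.map f)) t b = t b := by
    intro c
    induction c with
    | nil => exact fun t => ⟨rfl, fun _ _ => rfl⟩
    | cons g c ih =>
      intro t
      have h₁ : (g.map f).apply t ∘ f = g.apply (t ∘ f) := by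
        cases g <;> ext a <;>
          simp [CGate.map, CGate.apply, Function.update_apply, f.injective.eq_iff]
      have h₂ : ∀ b, b ∉ Set.range f → (g.map f).apply t b = t b := by
        intro b hb
        have h : ∀ a, b ≠ f a := fun a h => hb ⟨a, h.symm⟩
        cases g <;> simp [CGate.map, CGate.apply, h]
      refine ⟨?_, fun b hb => ?_⟩
      · rw [List.map_cons]
        exact ((ih _).1).trans (congrArg (runGates c) h₁)
      · rw [List.map_cons]
        exact ((ih _).2 b hb).trans (h₂ b hb)
  funext b
  by_cases hb : b ∈ Set.range f
  · obtain ⟨a, rfl⟩ := hb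
    exact congrFun ((this c t).1.trans h₁) a
  · rw [(this c t).2 b hb, h₂ b hb]

/-- Permits ancillas of any finite type, so that a composite circuit can give every intermediate
register its own summand. -/
theorem computedWithin_of_gates (gates : List (CGate (α ⊕ (β ⊕ W))))
    (f : (α → Bool) → (β → Bool))
    (spec : ∀ x y, runGates gates (Sum.elim x (Sum.elim y fun _ => false)) =
      Sum.elim x (Sum.elim (fun b => y b ^^ f x b) fun _ => false)) :
    ComputedWithin f (Fintype.card W + gates.length) := by
  let e : α ⊕ (β ⊕ W) ↪ α ⊕ (β ⊕ Fin (Fintype.card W)) :=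
    ((Equiv.refl α).sumCongr ((Equiv.refl β).sumCongr (Fintype.equivFin W))).toEmbedding
  have he : ∀ x (y : β → Bool), (Sum.elim x (Sum.elim y fun _ => false) :
      α ⊕ (β ⊕ Fin (Fintype.card W)) → Bool) ∘ e = Sum.elim x (Sum.elim y fun _ => false) := by
    intro x y; funext b; rcases b with b | b | b <;> rfl
  refine ⟨⟨Fintype.card W, gates.map (CGate.map e), f, fun x y => ?_⟩, rfl, ?_⟩
  · refine runGates_map_eq e gates (by rw [he, he, spec]) fun b hb => absurd ?_ hb
    exact (Equiv.surjective _ b)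
  · simp [ClassicalAlg.size]

theorem ComputedWithin.map {α' β' : Type} [DecidableEq α'] [DecidableEq β']
    {f : (α → Bool) → (β → Bool)} {k : ℕ} (h : ComputedWithin f k) (i : α ↪ α') (o : β ↪ β')
    {f' : (α' → Bool) → (β' → Bool)} (h₁ : ∀ x b, f' x (o b) = f (x ∘ i) b)
    (h₂ : ∀ x b, b ∉ Set.range o → f' x b = false) : ComputedWithin f' k := by
  obtain ⟨A, rfl, hk⟩ := h
  let e : α ⊕ (β ⊕ Fin A.anc) ↪ α' ⊕ (β' ⊕ Fin A.anc) :=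
    i.sumMap (o.sumMap (Function.Embedding.refl _))
  have he : ∀ x (y : β' → Bool), (Sum.elim x (Sum.elim y fun _ => false) :
      α' ⊕ (β' ⊕ Fin A.anc) → Bool) ∘ e =
        Sum.elim (x ∘ i) (Sum.elim (y ∘ o) fun _ => false) := by
    intro x y; funext b; rcases b with b | b | b <;> rfl
  refine ⟨⟨A.anc, A.gates.map (CGate.map e), f', fun x y => ?_⟩, rfl, ?_⟩
  · refine runGates_map_eq e _ ?_ fun b hb => ?_
    · rw [he, he, A.spec]
      congr 2
      funext b
      simp [h₁]
    · rcases b with b | b | b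
      · rfl
      · have : b ∉ Set.range o := by
          rintro ⟨a, rfl⟩; exact hb ⟨.inr (.inl a), rfl⟩
        simp [h₂ x b this]
      · rfl
  · simpa [ClassicalAlg.size] using hk

theorem ComputedWithin.comp_injective {α' : Type} [DecidableEq α']
    {f : (α → Bool) → (β → Bool)} {k : ℕ} (h : ComputedWithin f k) {i : α → α'}
    (hi : Function.Injective i) : ComputedWithin (fun x => f (x ∘ i)) k :=
  h.map ⟨i, hi⟩ (Function.Embedding.refl _) (fun _ _ => rfl) fun _ b hb => absurd ⟨b, rfl⟩ hb

theorem update_output_wire (x : α → Bool) (y : Unit → Bool) (v : Bool) :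
    Function.update (Sum.elim x (Sum.elim y fun _ : Fin 0 => false)) (.inr (.inl ())) v =
      Sum.elim x (Sum.elim (fun _ => v) fun _ => false) := by
  funext b
  rcases b with b | b | b
  · rw [Function.update_of_ne (by exact Sum.inl_ne_inr)]; rfl
  · exact Function.update_self ..
  · exact b.elim0

theorem computedWithin_wire (a : α) : ComputedWithin (fun x (_ : Unit) => x a) 1 := by
  refine (computedWithin_of_gates (W := Fin 0)
    [.cnot (.inl a) (.inr (.inl ())) (by simp)] _ fun x y => ?_).mono le_rfl
  exact update_output_wire x y _

theorem computedWithin_and {a b : α} (h : a ≠ b) :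
    ComputedWithin (fun x (_ : Unit) => x a && x b) 1 := by
  refine (computedWithin_of_gates (W := Fin 0)
    [.toffoli (.inl a) (.inl b) (.inr (.inl ())) (by simpa) (by simp) (by simp)] _
    fun x y => ?_).mono le_rfl
  exact update_output_wire x y _

theorem computedWithin_const_bit (c : Bool) :
    ComputedWithin (fun (_ : α → Bool) (_ : Unit) => c) 1 := by
  refine (computedWithin_of_gates (W := Fin 0) (if c then [.not (.inr (.inl ()))] else []) _
    fun x y => ?_).mono (by cases c; exacts [Nat.zero_le _, le_rfl])
  cases c
  · funext b; rcases b with b | b | b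
    exacts [rfl, (Bool.xor_false _).symm, rfl]
  · refine (update_output_wire x y _).trans ?_
    funext b; rcases b with b | b | b
    exacts [rfl, (Bool.xor_true _).symm, rfl]

/-- Since circuits XOR their value onto the output, running both in succession on the same output
wires, with separate ancillas, adds the values. -/
theorem ComputedWithin.xor {f g : (α → Bool) → (β → Bool)} {k l : ℕ} (hf : ComputedWithin f k)
    (hg : ComputedWithin g l) : ComputedWithin (fun x b => f x b ^^ g x b) (k + l) := by
  obtain ⟨A, rfl, hk⟩ := hf
  obtain ⟨B, rfl, hl⟩ := hg
  let eA : α ⊕ (β ⊕ Fin A.anc) ↪ α ⊕ (β ⊕ (Fin A.anc ⊕ Fin B.anc)) :=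
    (Function.Embedding.refl _).sumMap ((Function.Embedding.refl _).sumMap .inl)
  let eB : α ⊕ (β ⊕ Fin B.anc) ↪ α ⊕ (β ⊕ (Fin A.anc ⊕ Fin B.anc)) :=
    (Function.Embedding.refl _).sumMap ((Function.Embedding.refl _).sumMap .inr)
  have hA : ∀ x (y : β → Bool), (Sum.elim x (Sum.elim y fun _ => false) :
      α ⊕ (β ⊕ (Fin A.anc ⊕ Fin B.anc)) → Bool) ∘ eA =
        Sum.elim x (Sum.elim y fun _ => false) := by
    intro x y; funext b; rcases b with b | b | b <;> rfl
  have hB : ∀ x (y : β → Bool), (Sum.elim x (Sum.elim y fun _ => false) :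
      α ⊕ (β ⊕ (Fin A.anc ⊕ Fin B.anc)) → Bool) ∘ eB =
        Sum.elim x (Sum.elim y fun _ => false) := by
    intro x y; funext b; rcases b with b | b | b <;> rfl
  refine (computedWithin_of_gates (W := Fin A.anc ⊕ Fin B.anc)
    (A.gates.map (CGate.map eA) ++ B.gates.map (CGate.map eB)) _ fun x y => ?_).mono ?_
  · have h₁ : runGates (A.gates.map (CGate.map eA)) (Sum.elim x (Sum.elim y fun _ => false)) =
        Sum.elim x (Sum.elim (fun b => y b ^^ A.fn x b) fun _ => false) :=
      runGates_map_eq eA _ (by rw [hA, hA, A.spec]) fun b hb => by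
        rcases b with b | b | b
        exacts [rfl, absurd ⟨.inr (.inl b), rfl⟩ hb, rfl]
    rw [runGates, List.foldl_append]
    change runGates _ (runGates _ _) = _
    rw [h₁]
    refine runGates_map_eq eB _ (by rw [hB, hB, B.spec]; simp [Bool.xor_assoc]) fun b hb => by
      rcases b with b | b | b
      exacts [rfl, absurd ⟨.inr (.inl b), rfl⟩ hb, rfl]
  · simp only [ClassicalAlg.size] at hk hl
    simp only [Fintype.card_sum, Fintype.card_fin, List.length_append, List.length_map]
    omega

/-- Compute, use, uncompute: the value of `f` is XORed onto scratch wires, `g` reads it, and a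
second run of the circuit of `f` erases it. This is the source of the factor 2. -/
theorem ComputedWithin.bind [Fintype β] {f : (α → Bool) → (β → Bool)}
    {g : (α ⊕ β → Bool) → (γ → Bool)} {k l : ℕ} (hf : ComputedWithin f k)
    (hg : ComputedWithin g l) :
    ComputedWithin (fun x => g (Sum.elim x (f x))) (2 * k + l + Fintype.card β) := by
  obtain ⟨A, rfl, hk⟩ := hf
  obtain ⟨B, rfl, hl⟩ := hg
  let V := α ⊕ (γ ⊕ (β ⊕ (Fin A.anc ⊕ Fin B.anc)))
  let eA : α ⊕ (β ⊕ Fin A.anc) ↪ V :=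
    (Function.Embedding.refl _).sumMap (((Function.Embedding.refl _).sumMap .inl).trans .inr)
  let eB : (α ⊕ β) ⊕ (γ ⊕ Fin B.anc) ↪ V :=
    ⟨Sum.elim (Sum.elim .inl fun b => .inr (.inr (.inl b)))
      (Sum.elim (fun c => .inr (.inl c)) fun b => .inr (.inr (.inr (.inr b)))), by
        rintro ((a | a) | (a | a)) ((b | b) | (b | b)) <;> simp [V]⟩
  let S (x : α → Bool) (y : γ → Bool) (z : β → Bool) : V → Bool :=
    Sum.elim x (Sum.elim y (Sum.elim z fun _ => false))
  have hA : ∀ x y z, S x y z ∘ eA = Sum.elim x (Sum.elim z fun _ => false) := by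
    intro x y z; funext b; rcases b with b | b | b <;> rfl
  have hB : ∀ x y z, S x y z ∘ eB = Sum.elim (Sum.elim x z) (Sum.elim y fun _ => false) := by
    intro x y z; funext b; rcases b with (b | b) | b | b <;> rfl
  have rA : ∀ x y z, runGates (A.gates.map (CGate.map eA)) (S x y z) =
      S x y fun b => z b ^^ A.fn x b := fun x y z =>
    runGates_map_eq eA _ (by rw [hA, hA, A.spec]) fun b hb => by
      rcases b with b | b | b | b | b
      exacts [rfl, rfl, absurd ⟨.inr (.inl b), rfl⟩ hb, rfl, rfl]
  have rB : ∀ x y z, runGates (B.gates.map (CGate.map eB)) (S x y z) =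
      S x (fun c => y c ^^ B.fn (Sum.elim x z) c) z := fun x y z =>
    runGates_map_eq eB _ (by rw [hB, hB, B.spec]) fun b hb => by
      rcases b with b | b | b | b | b
      exacts [rfl, absurd ⟨.inr (.inl b), rfl⟩ hb, rfl, rfl, rfl]
  refine (computedWithin_of_gates (W := β ⊕ (Fin A.anc ⊕ Fin B.anc))
    (A.gates.map (CGate.map eA) ++ (B.gates.map (CGate.map eB) ++
      A.gates.map (CGate.map eA))) _ fun x y => ?_).mono ?_
  · have hS : ∀ y, (Sum.elim x (Sum.elim y fun _ => false) : V → Bool) =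
        S x y fun _ => false := by
      intro y; funext b; rcases b with b | b | b | b <;> rfl
    rw [runGates, List.foldl_append, List.foldl_append]
    change runGates _ (runGates _ (runGates _ _)) = _
    rw [hS, hS, rA, rB, rA]
    simp
  · simp only [ClassicalAlg.size] at hk hl
    simp only [Fintype.card_sum, Fintype.card_fin, List.length_append, List.length_map]
    omega

/-- A string is the XOR of strings that are supported on one output wire each. -/
theorem computedWithin_pi {ι : Type} [Fintype ι] [DecidableEq ι] {f : ι → (α → Bool) → Bool}
    {k : ι → ℕ} (hf : ∀ i, ComputedWithin (fun x (_ : Unit) => f i x) (k i)) :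
    ComputedWithin (fun x i => f i x) (∑ i, k i) := by
  have : ∀ s : Finset ι,
      ComputedWithin (fun x i => decide (i ∈ s) && f i x) (∑ i ∈ s, k i) := by
    intro s
    induction s using Finset.induction_on with
    | empty =>
      refine (computedWithin_of_gates (W := Fin 0) [] _ fun x y => ?_).mono (by simp)
      simp [runGates]
    | insert j s hj ih =>
      have h := (hf j).map (Function.Embedding.refl _) (⟨fun _ => j, fun _ _ _ => rfl⟩ : Unit ↪ ι)
        (f' := fun x i => decide (i = j) && f i x) (fun x b => by
          change (decide (j = j) && f j x) = _
          rw [decide_eq_true rfl]; rfl)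
        (fun x b hb => by
          have : b ≠ j := by rintro rfl; exact hb ⟨(), rfl⟩
          simp [this])
      convert h.xor ih using 1
      · funext x i
        by_cases hi : i = j
        · subst hi; simp [hj]
        · simp [hi]
      · exact Finset.sum_insert hj
  simpa using this Finset.univ

/-- All summands are XORed onto the same output wire. -/
theorem computedWithin_parity {ι : Type} [Fintype ι] [DecidableEq ι]
    {f : ι → (α → Bool) → Bool} {k : ι → ℕ}
    (hf : ∀ i, ComputedWithin (fun x (_ : Unit) => f i x) (k i)) :
    ComputedWithin (fun x (_ : Unit) => decide ((∑ i, (f i x).toNat) % 2 = 1)) (∑ i, k i) := by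
  have : ∀ s : Finset ι, ComputedWithin
      (fun x (_ : Unit) => decide ((∑ i ∈ s, (f i x).toNat) % 2 = 1)) (∑ i ∈ s, k i) := by
    intro s
    induction s using Finset.induction_on with
    | empty =>
      refine (computedWithin_of_gates (W := Fin 0) [] _ fun x y => ?_).mono (by simp)
      simp [runGates]
    | insert j s hj ih =>
      convert (hf j).xor ih using 1
      · funext x i
        rw [Finset.sum_insert hj]
        rcases Nat.mod_two_eq_zero_or_one (∑ i ∈ s, (f i x).toNat) with h | h <;>
          cases hj' : f j x <;> simp [Nat.add_mod, h]
      · exact Finset.sum_insert hj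
  exact this Finset.univ

theorem ComputedWithin.congr {f g : (α → Bool) → (β → Bool)} {k l : ℕ}
    (h : ComputedWithin f k) (hfg : ∀ x b, f x b = g x b) (hkl : k ≤ l) : ComputedWithin g l := by
  have : f = g := funext fun x => funext (hfg x)
  exact this ▸ h.mono hkl

theorem ComputedWithin.and {f g : (α → Bool) → (Unit → Bool)} {k l : ℕ} (hf : ComputedWithin f k)
    (hg : ComputedWithin g l) :
    ComputedWithin (fun x u => f x u && g x u) (2 * (k + l) + 3) := by
  have h : ComputedWithin (fun x (b : Bool) => if b then f x () else g x ()) (k + l) := by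
    have := computedWithin_pi (ι := Bool) (k := fun b => if b then k else l)
      (f := fun b x => if b then f x () else g x ()) (by rintro (_ | _) <;> assumption)
    exact this.mono (by simp)
  exact (h.bind (computedWithin_and (a := .inr true) (b := .inr false) (by simp))).congr
    (fun x _ => rfl) (by simp)

/-- The constant string is a function computed by `NOT` gates, followed by `ComputedWithin.bind`: at
most one gate per bit, run twice, and one scratch wire per bit. -/
theorem ComputedWithin.hardwire {α' : Type} [Fintype α'] [DecidableEq α']
    {f : (α' ⊕ α → Bool) → (β → Bool)} {k : ℕ} (h : ComputedWithin f k) (c : α' → Bool) :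
    ComputedWithin (fun x => f (Sum.elim c x)) (k + 3 * Fintype.card α') := by
  have h₁ : ComputedWithin (fun (_ : α → Bool) => c) (∑ _ : α', 1) :=
    computedWithin_pi (f := fun i _ => c i) fun i => computedWithin_const_bit (c i)
  have h₂ := h.comp_injective (Equiv.sumComm α' α).injective
  refine ComputedWithin.mono (k := 2 * (∑ _ : α', 1) + k + Fintype.card α') ?_ (by simp; omega)
  convert h₁.bind h₂ using 2 with x
  congr 1
  funext b
  rcases b with b | b <;> rfl

end ClassicalAlgorithms

/-! ### Decoding of the outputs of the verifier -/

/-- The output bit of the verifier for a Hadamard basis position, where `u` is its random bit. -/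
def TCF.decodeBit (F : TCF) (sk : Fin F.skLen → Bool) (y : Fin F.yLen → Bool)
    (d : Fin (F.ℓ + 1) → Bool) (u : Bool) : Bool :=
  ((F.invertTwo sk y).filter fun p => F.good p.1 p.2 d).elim u fun p => dotClaw p.1 p.2 d

/-- Conjunction distributes over XOR, so the inner product is a parity of terms each of which is a
wire or a conjunction of two wires. -/
theorem dotClaw_eq {ℓ : ℕ} (x₀ x₁ : Fin ℓ → Bool) (d : Fin (ℓ + 1) → Bool) :
    dotClaw x₀ x₁ d = decide (((d 0).toNat + (∑ k : Fin ℓ, (d k.succ && x₀ k).toNat +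
      ∑ k : Fin ℓ, (d k.succ && x₁ k).toNat)) % 2 = 1) := by
  rw [dotClaw, ← Finset.sum_add_distrib]
  have : ∀ k : Fin ℓ, (d k.succ && (x₀ k ^^ x₁ k)).toNat ≡
      (d k.succ && x₀ k).toNat + (d k.succ && x₁ k).toNat [MOD 2] := by
    intro k; cases d k.succ <;> cases x₀ k <;> cases x₁ k <;> rfl
  have h : ∑ k : Fin ℓ, (d k.succ && (x₀ k ^^ x₁ k)).toNat ≡
      ∑ k : Fin ℓ, ((d k.succ && x₀ k).toNat + (d k.succ && x₁ k).toNat) [MOD 2] := by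
    rw [Nat.ModEq, Finset.sum_nat_mod, Finset.sum_nat_mod Finset.univ 2 fun k : Fin ℓ =>
      (d k.succ && x₀ k).toNat + (d k.succ && x₁ k).toNat]
    simp only [Nat.ModEq] at this
    simp only [this]
  have h' := h.add_left (d 0).toNat
  rw [Nat.ModEq] at h'
  rw [h']

theorem TCF.decodeBit_computedWithin (F : TCF) :
    ComputedWithin (α := Fin F.skLen ⊕ (Fin F.yLen ⊕ (Fin (F.ℓ + 1) ⊕ Unit)))
      (fun s (_ : Unit) => F.decodeBit (fun k => s (.inl k)) (fun k => s (.inr (.inl k)))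
        (fun k => s (.inr (.inr (.inl k)))) (s (.inr (.inr (.inr ())))))
      (2 * F.invertTwoAlg.size + 4 * F.goodAlg.size + 10 * F.ℓ + 21) := by
  have h₁ : ComputedWithin (fun s : Fin F.skLen ⊕ (Fin F.yLen ⊕ (Fin (F.ℓ + 1) ⊕ Unit)) → Bool =>
      F.invertTwoAlg.fn (s ∘ Sum.map id Sum.inl)) F.invertTwoAlg.size :=
    F.invertTwoAlg.computedWithin.comp_injective
      (Function.injective_id.sumMap Sum.inl_injective)
  have h₂ : ComputedWithin (fun (s : (Fin F.skLen ⊕ (Fin F.yLen ⊕ (Fin (F.ℓ + 1) ⊕ Unit))) ⊕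
      Option (Fin F.ℓ ⊕ Fin F.ℓ) → Bool) => F.goodAlg.fn (s ∘ Sum.elim (fun p => .inr (some p))
        fun k => .inl (.inr (.inr (.inl k.succ))))) F.goodAlg.size :=
    F.goodAlg.computedWithin.comp_injective (by
      rintro (a | a) (b | b) h
      · simpa using h
      · simp at h
      · simp at h
      · simpa using h)
  have h₃ : ComputedWithin (fun (s : (Fin F.skLen ⊕ (Fin F.yLen ⊕ (Fin (F.ℓ + 1) ⊕ Unit))) ⊕
      Option (Fin F.ℓ ⊕ Fin F.ℓ) → Bool) (_ : Unit) => s (.inl (.inr (.inr (.inr ())))) ^^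
        dotClaw (fun k => s (.inr (some (.inl k)))) (fun k => s (.inr (some (.inr k))))
          fun k => s (.inl (.inr (.inr (.inl k)))))
      (1 + ∑ _ : Unit ⊕ (Fin F.ℓ ⊕ Fin F.ℓ), 1) := by
    refine (computedWithin_wire _).xor ?_
    have := computedWithin_parity (ι := Unit ⊕ (Fin F.ℓ ⊕ Fin F.ℓ)) (k := fun _ => 1)
      (f := Sum.elim (fun _ (s : (Fin F.skLen ⊕ (Fin F.yLen ⊕ (Fin (F.ℓ + 1) ⊕ Unit))) ⊕
        Option (Fin F.ℓ ⊕ Fin F.ℓ) → Bool) => s (.inl (.inr (.inr (.inl 0)))))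
        (Sum.elim (fun k s => s (.inl (.inr (.inr (.inl k.succ)))) && s (.inr (some (.inl k))))
          fun k s => s (.inl (.inr (.inr (.inl k.succ)))) && s (.inr (some (.inr k))))) (by
        rintro (_ | k | k)
        exacts [computedWithin_wire _, computedWithin_and (by simp),
          computedWithin_and (by simp)])
    convert this using 3 with s _
    rw [dotClaw_eq, Fintype.sum_sum_type, Fintype.sum_sum_type]
    simp
  -- The decoded bit is `u ⊕ (flag ∧ (good ∧ (u ⊕ d · (1, x₀ ⊕ x₁))))`: if the flag and the goodness
  -- bit are both set then `u` cancels, and otherwise `u` is left.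
  refine (h₁.bind ((computedWithin_wire (.inl (.inr (.inr (.inr ()))))).xor
    ((computedWithin_wire (.inr none)).and (h₂.and h₃)))).congr (fun s _ => ?_) (by simp; omega)
  have e₁ : s ∘ Sum.map id Sum.inl =
      Sum.elim (fun k => s (.inl k)) fun k => s (.inr (.inl k)) := by
    funext b; rcases b with b | b <;> rfl
  rw [e₁, TCF.decodeBit, TCF.invertTwo, decodeOpt]
  generalize F.invertTwoAlg.fn _ = v
  have e₂ : (Sum.elim s v ∘ Sum.elim (fun p => .inr (some p))
        fun k => .inl (.inr (.inr (.inl k.succ)))) =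
      Sum.elim (Sum.elim (fun k => v (some (.inl k))) fun k => v (some (.inr k)))
        (Fin.tail fun k => s (.inr (.inr (.inl k)))) := by
    funext b; rcases b with (b | b) | b <;> rfl
  rw [e₂]
  simp only [Sum.elim_inl, Sum.elim_inr]
  cases hn : v none
  · simp
  · cases hg : F.goodAlg.fn (Sum.elim (Sum.elim (fun k => v (some (.inl k)))
        fun k => v (some (.inr k))) (Fin.tail fun k => s (.inr (.inr (.inl k))))) () <;>
      simp [Option.filter, TCF.good, Function.comp_def, hg]

/-- The key generation with the description of the constant function `1`. -/
theorem exists_simAlg {F : TCF} (B : BatchKeyGen F) :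
    ComputedWithin (fun r => B.genAlg.fn (Sum.elim B.one r))
      (B.genAlg.size + 3 * B.descLen) := by
  simpa using B.genAlg.computedWithin.hardwire B.one

/-! ### The teleported state -/

/-- The sign `(-1) ^ (r · v)`. -/
def phase {N : ℕ} (r v : Fin N → Bool) : ℂ := ∏ i, if r i && v i then -1 else 1

section Phase

variable {N : ℕ}

theorem phase_comm (r v : Fin N → Bool) : phase r v = phase v r := by
  simp only [phase, Bool.and_comm]

theorem phase_mul (r s v : Fin N → Bool) :
    phase r v * phase s v = phase (fun i => r i ^^ s i) v := by
  rw [phase, phase, ← Finset.prod_mul_distrib]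
  have h : ∀ a b c : Bool, ((if a && c then -1 else 1) * if b && c then -1 else 1 : ℂ) =
      if (a ^^ b) && c then -1 else 1 := by
    intro a b c; cases a <;> cases b <;> cases c <;> simp
  exact Finset.prod_congr rfl fun i _ => h (r i) (s i) (v i)

theorem phase_mul_right (r v v' : Fin N → Bool) :
    phase r v * phase r v' = phase r fun i => v i ^^ v' i := by
  rw [phase_comm, phase_comm r, phase_mul, phase_comm]

theorem star_phase (r v : Fin N → Bool) : star (phase r v) = phase r v := by
  rw [phase, star_prod]
  exact Finset.prod_congr rfl fun i _ => by split_ifs <;> simp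

/-- Orthogonality of characters: the sum is a product over positions, and a position with `v i = 1`
contributes `1 - 1`. -/
theorem sum_phase (v : Fin N → Bool) :
    ∑ r, phase r v = if v = fun _ => false then (2 : ℂ) ^ N else 0 := by
  have h : ∑ r, phase r v = ∏ i, ∑ b : Bool, (if b && v i then (-1 : ℂ) else 1) := by
    rw [Finset.prod_univ_sum, Fintype.piFinset_univ]; rfl
  rw [h]
  split_ifs with hv
  · subst hv; simp
  · obtain ⟨i, hi⟩ := Function.ne_iff.mp hv
    refine Finset.prod_eq_zero (Finset.mem_univ i) ?_
    simp at hi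
    simp [hi]

theorem sum_phase_mul (u v : Fin N → Bool) :
    ∑ r, phase r u * phase r v = if u = v then (2 : ℂ) ^ N else 0 := by
  simp only [phase_mul_right, sum_phase]
  refine if_congr ?_ rfl rfl
  simp [funext_iff]

end Phase

/-! ### The teleportation operator for commuting families of observables -/

section Teleported

variable {N : ℕ} {α : Type} [Fintype α] [DecidableEq α]

theorem prod_conj_diagonal {G : Op α} (hG : G ∈ Matrix.unitaryGroup (α → Bool) ℂ)
    (l : List ((α → Bool) → ℂ)) :
    (l.map fun d => Gᴴ * Matrix.diagonal d * G).prod = Gᴴ * Matrix.diagonal l.prod * G := by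
  have h₁ : Gᴴ * G = 1 := Matrix.mem_unitaryGroup_iff'.mp hG
  have h₂ : G * Gᴴ = 1 := Matrix.mem_unitaryGroup_iff.mp hG
  induction l with
  | nil =>
    have : Matrix.diagonal (1 : (α → Bool) → ℂ) = (1 : Op α) := Matrix.diagonal_one
    simp only [List.map_nil, List.prod_nil, this, mul_one, h₁]
  | cons d l ih =>
    rw [List.map_cons, List.prod_cons, ih, List.prod_cons]
    calc _ = Gᴴ * Matrix.diagonal d * (G * Gᴴ) * Matrix.diagonal l.prod * G := by
          simp only [Matrix.mul_assoc]
      _ = Gᴴ * (Matrix.diagonal d * Matrix.diagonal l.prod) * G := by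
          rw [h₂, mul_one]; simp only [Matrix.mul_assoc]
      _ = _ := by rw [Matrix.diagonal_mul_diagonal']; rfl

/-- All operators of the family are diagonal in the same basis, so a product of them is the
conjugate of a product of signs, which is a character evaluated at `v`. -/
theorem parity_conj_diagonal {G : Op α} (hG : G ∈ Matrix.unitaryGroup (α → Bool) ℂ)
    (v : (α → Bool) → Fin N → Bool) (r : Fin N → Bool) :
    parity (fun i => Gᴴ * Matrix.diagonal (fun s => if v s i then (-1 : ℂ) else 1) * G) r =
      Gᴴ * Matrix.diagonal (fun s => phase r (v s)) * G := by
  have h₁ : Gᴴ * G = 1 := Matrix.mem_unitaryGroup_iff'.mp hG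
  have : (fun i => if r i then
      Gᴴ * Matrix.diagonal (fun s => if v s i then (-1 : ℂ) else 1) * G else 1) =
      (fun d => Gᴴ * Matrix.diagonal d * G) ∘
        fun i (s : α → Bool) => if r i && v s i then (-1 : ℂ) else 1 := by
    funext i
    dsimp only [Function.comp_apply]
    cases r i
    · have : Matrix.diagonal (fun _ : α → Bool => (1 : ℂ)) = 1 := Matrix.diagonal_one
      simp [this, h₁]
    · simp
  rw [parity, this, ← List.map_ofFn, prod_conj_diagonal hG, List.prod_ofFn]
  congr 3
  funext s
  rw [Finset.prod_apply]
  rfl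

theorem parity_diagonal (v : (α → Bool) → Fin N → Bool) (r : Fin N → Bool) :
    parity (fun i => Matrix.diagonal (fun s => if v s i then (-1 : ℂ) else 1)) r =
      Matrix.diagonal (fun s => phase r (v s)) := by
  simpa using parity_conj_diagonal (one_mem (Matrix.unitaryGroup (α → Bool) ℂ)) v r

theorem parity_pauliX (r : Fin N → Bool) :
    parity pauliX r = permOp fun t i => t i ^^ r i := by
  have : ∀ l : List (Fin N), l.Nodup → (l.map fun i => if r i then pauliX i else 1).prod =
      permOp fun t i => t i ^^ (decide (i ∈ l) && r i) := by
    intro l hl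
    induction l with
    | nil => ext s t; simp [permOp_apply, Matrix.one_apply]
    | cons j l ih =>
      rw [List.map_cons, List.prod_cons, ih (List.nodup_cons.mp hl).2]
      have hj : (if r j then pauliX j else 1 : Op (Fin N)) =
          permOp fun t => Function.update t j (t j ^^ r j) := by
        cases hr : r j
        · ext s t; simp [permOp_apply, Matrix.one_apply]
        · ext s t; simp [permOp_apply, pauliX]
      rw [hj, permOp_mul]
      congr 1
      funext t i
      have := (List.nodup_cons.mp hl).1
      by_cases hi : i = j
      · subst hi; simp [this]
      · simp [hi]
  rw [parity, List.ofFn_eq_map, this _ (List.nodup_finRange N)]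
  simp

/-- The operator `P_a ρ P_b`, where `P_a` projects onto the basis states `s` with `c s = a`. -/
def select (c : (α → Bool) → Fin N → Bool) (a b : Fin N → Bool) (ρ : Op α) : Op α :=
  Matrix.of fun s t => if c s = a ∧ c t = b then ρ s t else 0

/-- The Pauli `X` factor forces `r = d ⊕ d'`, and then the sum over `s` is an orthogonality relation
that forces `c w' = d'`. -/
theorem teleportOp_apply {X Z : Fin N → Op α} (c : (α → Bool) → Fin N → Bool)
    (hZ : ∀ r, parity Z r = Matrix.diagonal fun s => phase r (c s)) (w w' : α → Bool)
    (d d' a a' : Fin N → Bool) :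
    teleportOp X Z (w, (d, a)) (w', (d', a')) =
      if a = a' ∧ c w' = d' then parity X (fun i => d i ^^ d' i) w w' else 0 := by
  have h : ∀ r s : Fin N → Bool, ((parity X r * parity Z s) ⊗ₖ
      ((parity pauliX r * parity pauliZ s) ⊗ₖ (1 : Op (Fin N)))) (w, (d, a)) (w', (d', a')) =
      if a = a' then if r = (fun i => d i ^^ d' i) then
        parity X (fun i => d i ^^ d' i) w w' * (phase s (c w') * phase s d') else 0 else 0 := by
    intro r s
    have hz : parity pauliZ s = Matrix.diagonal fun t : Fin N → Bool => phase s t :=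
      parity_diagonal (fun t => t) s
    have hr : (d = fun i => d' i ^^ r i) ↔ r = fun i => d i ^^ d' i := by
      constructor
      · rintro rfl; funext i; dsimp only; cases d' i <;> simp
      · rintro rfl; funext i; dsimp only; cases d' i <;> simp
    simp only [Matrix.kroneckerMap_apply, hZ, hz, Matrix.mul_diagonal, parity_pauliX,
      permOp_apply, Matrix.one_apply, hr]
    split_ifs with h₁ h₂
    · subst h₁; ring
    · ring
    · ring
    · ring
  simp only [teleportOp, Matrix.smul_apply, Matrix.sum_apply, h, smul_eq_mul]
  by_cases ha : a = a'
  · simp only [ha, if_true, true_and]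
    rw [Finset.sum_comm]
    simp only [Finset.sum_ite_eq', Finset.mem_univ, if_true, ← Finset.mul_sum, sum_phase_mul]
    split_ifs with hc
    · field_simp
    · simp
  · simp [ha]

theorem trace_mul_diagonal_conj {G : Op α} (hG : G ∈ Matrix.unitaryGroup (α → Bool) ℂ)
    (d d' : (α → Bool) → ℂ) (R : Op α) :
    ((Gᴴ * Matrix.diagonal d * G) * R * (Gᴴ * Matrix.diagonal d' * G)ᴴ).trace =
      ∑ w, d w * star (d' w) * evolve G R w w := by
  have h₂ : G * Gᴴ = 1 := Matrix.mem_unitaryGroup_iff.mp hG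
  have : (Gᴴ * Matrix.diagonal d * G) * R * (Gᴴ * Matrix.diagonal d' * G)ᴴ =
      Gᴴ * (Matrix.diagonal d * evolve G R * (Matrix.diagonal d')ᴴ * G) := by
    simp only [Matrix.conjTranspose_mul, Matrix.conjTranspose_conjTranspose, evolve,
      Matrix.mul_assoc]
  rw [this, Matrix.trace_mul_comm]
  have : Matrix.diagonal d * evolve G R * (Matrix.diagonal d')ᴴ * G * Gᴴ =
      Matrix.diagonal d * evolve G R * (Matrix.diagonal d')ᴴ := by
    rw [Matrix.mul_assoc, h₂, mul_one]
  rw [this, Matrix.trace]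
  refine Finset.sum_congr rfl fun w _ => ?_
  rw [Matrix.diag_apply, Matrix.diagonal_conjTranspose, Matrix.mul_diagonal, Matrix.diagonal_mul,
    Pi.star_apply]
  ring

/-- On EPR pairs, the condition `c w' = d'` ties the system to the register that is kept, so entry
`(a, b)` comes from the block `P_a ρ P_b` only. If the first auxiliary register is found in `d`,
this block is multiplied by `X(d ⊕ a)` on the left and by the adjoint of `X(d ⊕ b)` on the right. -/
theorem teleported_apply {G : Op α} (hG : G ∈ Matrix.unitaryGroup (α → Bool) ℂ)
    {X Z : Fin N → Op α} (c v : (α → Bool) → Fin N → Bool)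
    (hX : ∀ i, X i = Gᴴ * Matrix.diagonal (fun s => if v s i then (-1 : ℂ) else 1) * G)
    (hZ : ∀ i, Z i = Matrix.diagonal (fun s => if c s i then (-1 : ℂ) else 1))
    (ρ : Op α) (a b : Fin N → Bool) :
    teleported X Z ρ a b =
      ∑ w, phase (fun i => a i ^^ b i) (v w) * evolve G (select c a b ρ) w w := by
  have hX' : ∀ r, parity X r = Gᴴ * Matrix.diagonal (fun s => phase r (v s)) * G := by
    intro r; rw [← parity_conj_diagonal hG, ← funext hX]
  have hZ' : ∀ r, parity Z r = Matrix.diagonal fun s => phase r (c s) := by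
    intro r; rw [← parity_diagonal, ← funext hZ]
  have h₁ : ∀ (w : α → Bool) (d : Fin N → Bool),
      (teleportOp X Z * (ρ ⊗ₖ epr N) * (teleportOp X Z)ᴴ) (w, (d, a)) (w, (d, b)) =
      ((2 : ℂ) ^ N)⁻¹ * (parity X (fun i => d i ^^ a i) * select c a b ρ *
        (parity X (fun i => d i ^^ b i))ᴴ) w w := by
    intro w d
    simp only [Matrix.mul_apply, Matrix.conjTranspose_apply, Fintype.sum_prod_type,
      teleportOp_apply c hZ', ite_and, ite_mul, zero_mul, apply_ite star, star_zero, mul_ite,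
      mul_zero, Finset.sum_ite_irrel, Finset.sum_const_zero, Finset.sum_ite_eq, Finset.mem_univ,
      if_true, Matrix.kroneckerMap_apply, epr, select, Matrix.of_apply, Finset.mul_sum,
      Finset.sum_mul]
    refine Finset.sum_congr rfl fun t _ => ?_
    by_cases ht : c t = b
    · simp only [ht, if_true, and_true]
      refine Finset.sum_congr rfl fun s _ => ?_
      by_cases hs : c s = a
      · simp only [hs, if_true]; ring
      · simp [hs]
    · simp [ht]
  -- The characters of `d ⊕ a` and `d ⊕ b` multiply to that of `a ⊕ b`, so every `d` contributes the
  -- same amount and the `2 ^ N` values of `d` cancel the normalization of the EPR pairs.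
  have h₂ : ∀ d : Fin N → Bool, ∑ w, (parity X (fun i => d i ^^ a i) * select c a b ρ *
        (parity X (fun i => d i ^^ b i))ᴴ) w w =
      ∑ w, phase (fun i => a i ^^ b i) (v w) * evolve G (select c a b ρ) w w := by
    intro d
    rw [hX', hX']
    refine (trace_mul_diagonal_conj hG _ _ _).trans (Finset.sum_congr rfl fun w _ => ?_)
    rw [star_phase, phase_mul]
    congr 2
    funext i
    cases d i <;> simp
  simp only [teleported, Matrix.of_apply, h₁, ← Finset.mul_sum]
  rw [Finset.sum_comm]
  simp only [h₂, Finset.sum_const, Finset.card_univ, Fintype.card_fun, Fintype.card_bool,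
    Fintype.card_fin, nsmul_eq_mul]
  push_cast
  field_simp

end Teleported

/-! ### Closed form of the extracted state -/

section ExtractedState

variable {F : TCF} (B : BatchKeyGen F) {ι : Type} [Fintype ι] [DecidableEq ι]

/-- The output bits of the verifier if all positions are in the Hadamard basis, where `u` are its
random bits. -/
def decodeBits (sk : Fin B.N → Fin F.skLen → Bool) (y : YWire B → Bool) (z : ZWire B → Bool)
    (u : Fin B.N → Bool) (i : Fin B.N) : Bool :=
  F.decodeBit (sk i) (fun k => y (i, k)) (fun k => z (i, k)) (u i)

/-- The first bits of the blocks of the opening register. -/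
def firstBits (s : ZWire B ⊕ ι → Bool) (i : Fin B.N) : Bool := s (.inl (i, 0))

/-- Hadamard gates on the opening register. -/
def hadOpen (B : BatchKeyGen F) (ι : Type) [Fintype ι] [DecidableEq ι] : Op (ZWire B ⊕ ι) :=
  hadOn (Sum.elim (fun _ => true) fun _ => false)

/-- The Hadamard gates change only wires on which the diagonal does not depend. -/
theorem hadOn_mul_diagonal_comm {α : Type} [Fintype α] [DecidableEq α] {h : α → Bool}
    {d : (α → Bool) → ℂ}
    (hd : ∀ s t : α → Bool, (∀ a, h a = false → s a = t a) → d s = d t) :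
    hadOn h * Matrix.diagonal d = Matrix.diagonal d * hadOn h := by
  ext s t
  rw [Matrix.mul_diagonal, Matrix.diagonal_mul, mul_comm]
  by_cases hst : ∀ a, h a = false → s a = t a
  · rw [hd s t hst]
  · push Not at hst
    obtain ⟨a, ha, hne⟩ := hst
    rw [hadOn_apply_eq_zero ha hne]; simp

theorem controlled_none {ζ ι ω : Type} [Fintype ζ] [DecidableEq ζ] [Fintype ι] [DecidableEq ι]
    [Fintype ω] [DecidableEq ω] (M : Op (ζ ⊕ ι)) :
    controlled M (none : Option ω) = tensOp M 1 := by
  ext s t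
  simp only [controlled, tensOp_apply, Matrix.of_apply, Option.elim_none, if_true,
    Matrix.one_apply]
  split_ifs <;> simp

theorem hadOn_true_pureOp {N : ℕ} (u : Fin N → Bool) :
    evolve (hadOn fun _ => true) (pureOp fun _ => false) u u = ((2 : ℂ) ^ N)⁻¹ := by
  have h2 : (Real.sqrt 2 : ℂ) * Real.sqrt 2 = 2 := by
    rw [← Complex.ofReal_mul, Real.mul_self_sqrt (by norm_num)]; norm_num
  have h : hadOn (fun _ : Fin N => true) u (fun _ => false) = ((Real.sqrt 2 : ℂ)⁻¹) ^ N := by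
    simp [hadOn_apply, hadEntry]
  rw [evolve_apply]
  rw [Finset.sum_eq_single (fun _ => false), Finset.sum_eq_single (fun _ => false)]
  · rw [hadOn_star, h, pureOp_apply, if_pos ⟨rfl, rfl⟩, mul_one, ← mul_pow, ← mul_inv, h2, inv_pow]
  · intro b _ hb; simp [pureOp_apply, hb]
  · simp
  · intro b _ hb; simp [pureOp_apply, hb]
  · simp

/-- The observables `X_i` use Hadamard gates on different blocks. Completing them to Hadamard gates
on all blocks and all ancillas does not change `X_i`, so a single unitary `G` diagonalizes the
family and `teleported_apply` is applicable. The ancillas then contribute uniformly random bits `u`.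
-/
theorem extractedState_apply {U : Op (ZWire B ⊕ ι)}
    (hU : U ∈ Matrix.unitaryGroup (ZWire B ⊕ ι → Bool) ℂ) (ρ : Op (ZWire B ⊕ ι))
    (SK : Fin B.SKLen → Bool) (y : YWire B → Bool) (a b : Fin B.N → Bool) :
    extractedState B U ρ SK y a b = ∑ w, ∑ u, ((2 : ℂ) ^ B.N)⁻¹ *
      phase (fun i => a i ^^ b i) (decodeBits B (B.extSk SK) y (w ∘ Sum.inl) u) *
      evolve (hadOpen B ι * U) (select (firstBits B) a b ρ) w w := by
  let G : Op ((ZWire B ⊕ ι) ⊕ Fin B.N) :=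
    tensOp (hadOpen B ι * U) (hadOn fun _ => true)
  have hG' : G = hadOn (Sum.elim (Sum.elim (fun _ => true) fun _ => false) fun _ => true) *
      tensOp U 1 := by
    rw [hadOn_sumElim, tensOp_mul, mul_one]; rfl
  have hV : tensOp U (1 : Op (Fin B.N)) ∈ Matrix.unitaryGroup _ ℂ := by
    rw [Matrix.mem_unitaryGroup_iff, Matrix.star_eq_conjTranspose, tensOp_conjTranspose,
      tensOp_mul, ← Matrix.star_eq_conjTranspose U, Matrix.mem_unitaryGroup_iff.mp hU]
    simp [tensOp_one]
  have hG : G ∈ Matrix.unitaryGroup _ ℂ := by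
    rw [hG']; exact mul_mem (hadOn_mem_unitaryGroup _) hV
  let v : ((ZWire B ⊕ ι) ⊕ Fin B.N → Bool) → Fin B.N → Bool := fun s =>
    decodeBits B (B.extSk SK) y (s ∘ Sum.inl ∘ Sum.inl) (s ∘ Sum.inr)
  have hX : ∀ i, obsX B U SK y i =
      Gᴴ * Matrix.diagonal (fun s => if v s i then (-1 : ℂ) else 1) * G := by
    intro i
    let hi : (ZWire B ⊕ ι) ⊕ Fin B.N → Bool := Sum.elim (Sum.elim (fun p => decide (p.1 = i))
      fun _ => false) fun a => decide (a = i)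
    let hr : (ZWire B ⊕ ι) ⊕ Fin B.N → Bool := Sum.elim (Sum.elim (fun p => !decide (p.1 = i))
      fun _ => false) fun a => !decide (a = i)
    let D : Op ((ZWire B ⊕ ι) ⊕ Fin B.N) :=
      Matrix.diagonal (fun s => if v s i then (-1 : ℂ) else 1)
    have hx : obsX B U SK y i = (tensOp U 1)ᴴ * hadOn hi * D * hadOn hi * tensOp U 1 := by
      rw [obsX, controlled_none]; rfl
    -- The diagonal of `X_i` reads only block `i` and ancilla `i`, while `hr` marks the other
    -- openings and ancillas. Hence the gates on `hr` may be inserted on both sides of `D`, where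
    -- they cancel.
    have hc : hadOn hr * D = D * hadOn hr := by
      refine hadOn_mul_diagonal_comm fun s t hst => ?_
      have : v s i = v t i := by
        have h₁ : (fun k => s (.inl (.inl (i, k)))) = fun k => t (.inl (.inl (i, k))) :=
          funext fun k => hst _ (by simp [hr])
        have h₂ : s (.inr i) = t (.inr i) := hst _ (by simp [hr])
        simp only [v, decodeBits, Function.comp_apply, h₁, h₂]
      simp only [this]
    have hall : hadOn (Sum.elim (Sum.elim (fun _ => true) fun _ => false) fun _ => true :
        (ZWire B ⊕ ι) ⊕ Fin B.N → Bool) = hadOn hi * hadOn hr := by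
      rw [hadOn_mul]; congr 1; funext x; rcases x with (x | x) | x <;> simp [hi, hr]
    have hall' : hadOn (Sum.elim (Sum.elim (fun _ => true) fun _ => false) fun _ => true :
        (ZWire B ⊕ ι) ⊕ Fin B.N → Bool) = hadOn hr * hadOn hi := by
      rw [hadOn_mul]; congr 1; funext x; rcases x with (x | x) | x <;> simp [hi, hr]
    rw [hx, hG', Matrix.conjTranspose_mul, hadOn_conjTranspose]
    conv_rhs => rw [← Matrix.mul_assoc (_ * D)]
    calc _ = (tensOp U 1)ᴴ * hadOn hi * (hadOn hr * hadOn hr * D) * hadOn hi * tensOp U 1 := by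
          rw [hadOn_mul_self, one_mul]
      _ = (tensOp U 1)ᴴ * hadOn hi * (hadOn hr * (D * hadOn hr)) * hadOn hi * tensOp U 1 := by
          rw [Matrix.mul_assoc (hadOn hr), hc]
      _ = (tensOp U 1)ᴴ * (hadOn hi * hadOn hr) * D * (hadOn hr * hadOn hi) * tensOp U 1 := by
          simp only [Matrix.mul_assoc]
      _ = _ := by rw [← hall, ← hall']
  have hZ : ∀ i, obsZ B (ι := ι) i = Matrix.diagonal
      (fun s => if firstBits B (s ∘ Sum.inl) i then (-1 : ℂ) else 1) := fun i => rfl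
  rw [extractedState, teleported_apply hG (fun s => firstBits B (s ∘ Sum.inl)) v hX hZ,
    sum_bits_sum]
  refine Finset.sum_congr rfl fun w _ => Finset.sum_congr rfl fun u _ => ?_
  have hs : select (fun s : (ZWire B ⊕ ι) ⊕ Fin B.N → Bool => firstBits B (s ∘ Sum.inl)) a b
      (withAncilla ρ fun _ => false) = tensOp (select (firstBits B) a b ρ)
        (pureOp fun _ => false) := by
    ext s t
    simp only [select, withAncilla_eq, tensOp_apply, Matrix.of_apply, ite_mul, zero_mul]
  rw [hs, evolve_tensOp, tensOp_apply]
  simp only [Sum.elim_comp_inl, Sum.elim_comp_inr, hadOn_true_pureOp, v]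
  rw [← Function.comp_assoc, Sum.elim_comp_inl]
  ring

end ExtractedState

/-! ### Building blocks of circuits -/

section Blocks

variable {α β γ : Type} [Fintype α] [DecidableEq α] [Fintype β] [DecidableEq β]
  [Fintype γ] [DecidableEq γ]

/-- XOR the value of `f` on the first wires onto the last wires. -/
def xorMap (f : (α → Bool) → (β → Bool)) (s : α ⊕ β → Bool) : α ⊕ β → Bool :=
  Sum.elim (s ∘ Sum.inl) fun b => s (.inr b) ^^ f (s ∘ Sum.inl) b

theorem xorMap_elim (f : (α → Bool) → (β → Bool)) (x y) :
    xorMap f (Sum.elim x y) = Sum.elim x fun b => y b ^^ f x b := rfl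

theorem xorMap_involutive (f : (α → Bool) → (β → Bool)) : Function.Involutive (xorMap f) := by
  intro s
  funext b
  rcases b with a | b
  · rfl
  · change ((s (.inr b) ^^ f (s ∘ Sum.inl) b) ^^ f (s ∘ Sum.inl) b) = _
    rw [Bool.xor_assoc, Bool.xor_self, Bool.xor_false]

theorem circMat_had (l : List α) (hl : l.Nodup) :
    circMat (l.map QGate.had) = hadOn fun a => decide (a ∈ l) := by
  induction l with
  | nil => simpa [circMat] using hadOn_false.symm
  | cons a l ih =>
    rw [List.map_cons, circMat, ih (List.nodup_cons.mp hl).2, QGate.mat, hadOn_mul]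
    congr 1
    funext b
    have := (List.nodup_cons.mp hl).1
    by_cases hb : b = a
    · subst hb; simp [this]
    · simp [hb]

theorem circMat_map_had (f : β ↪ α) (m : α → Bool) (hm : ∀ a, m a = true ↔ ∃ b, f b = a) :
    circMat (((Finset.univ : Finset β).toList.map f).map QGate.had) = hadOn m := by
  rw [circMat_had _ ((Finset.nodup_toList _).map f.injective)]
  congr 1
  funext a
  rw [Bool.eq_iff_iff, hm, decide_eq_true_iff]
  simp

/-- CNOT gates that copy the wire `p b`, if there is one, onto the wire `b` in `l`. -/
def copyGates (p : β → Option α) (l : List β) : List (CGate (α ⊕ β)) :=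
  l.filterMap fun b => (p b).map fun a => .cnot (.inl a) (.inr b) Sum.inl_ne_inr

/-- The values of the wires `p b`, and `0` where there is none. -/
def copied (p : β → Option α) (x : α → Bool) (b : β) : Bool := (p b).elim false x

theorem length_copyGates_le (p : β → Option α) (l : List β) :
    (copyGates p l).length ≤ l.length := List.length_filterMap_le _ _

theorem runGates_copyGates (p : β → Option α) (l : List β) (hl : l.Nodup) :
    runGates (copyGates p l) = xorMap fun x b => decide (b ∈ l) && copied p x b := by
  funext s
  induction l generalizing s with
  | nil =>
    funext b
    rcases b with b | b
    · rfl
    · simp [copyGates, runGates, xorMap]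
  | cons b l ih =>
    have hb := (List.nodup_cons.mp hl).1
    have ih := ih (List.nodup_cons.mp hl).2
    rw [copyGates] at ih ⊢
    rcases hp : p b with _ | a
    · rw [List.filterMap_cons_none (by simp [hp]), ih]
      funext c
      rcases c with c | c
      · rfl
      · by_cases hc : c = b
        · subst hc; simp [xorMap, hb, copied, hp]
        · simp [xorMap, hc]
    · rw [List.filterMap_cons_some (b := .cnot (.inl a) (.inr b) Sum.inl_ne_inr) (by simp [hp]),
        runGates_cons, ih]
      have hs : (CGate.cnot (.inl a) (.inr b) Sum.inl_ne_inr : CGate (α ⊕ β)).apply s ∘ Sum.inl =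
          s ∘ Sum.inl := by
        funext c; simp [CGate.apply]
      funext c
      rcases c with c | c
      · exact congrFun hs c
      · rw [xorMap, hs]
        by_cases hc : c = b
        · subst hc; simp [xorMap, hb, copied, hp, CGate.apply]
        · simp [xorMap, hc, CGate.apply]

theorem runGates_copyGates_univ (p : β → Option α) :
    runGates (copyGates p Finset.univ.toList) = xorMap (copied p) := by
  rw [runGates_copyGates p _ (Finset.nodup_toList _)]
  simp

theorem copyGates_map {α' : Type} (i : α ↪ α') (p : β → Option α) (l : List β) :
    (copyGates p l).map (CGate.map (i.sumMap (Function.Embedding.refl β))) =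
      copyGates (fun b => (p b).map i) l := by
  rw [copyGates, copyGates, List.map_filterMap]
  congr 1
  funext b
  cases p b <;> rfl

theorem copied_map {α' : Type} (i : α ↪ α') (p : β → Option α) (x : α' → Bool) :
    copied (fun b => (p b).map i) x = copied p (x ∘ i) := by
  funext b
  simp only [copied]
  cases p b <;> rfl

/-- The algorithm `A` on more input wires. -/
def ClassicalAlg.mapInput {α β α' : Type} [DecidableEq α] [DecidableEq β] [DecidableEq α']
    (A : ClassicalAlg α β) (i : α ↪ α') : ClassicalAlg α' β where
  anc := A.anc
  gates := A.gates.map (CGate.map (i.sumMap (Function.Embedding.refl _)))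
  fn x := A.fn (x ∘ i)
  spec x y := by
    have he : ∀ z : β → Bool, (Sum.elim x (Sum.elim z fun _ => false) :
        α' ⊕ (β ⊕ Fin A.anc) → Bool) ∘ (i.sumMap (Function.Embedding.refl _)) =
        Sum.elim (x ∘ i) (Sum.elim z fun _ => false) := by
      intro z; funext b; rcases b with b | b | b <;> rfl
    refine runGates_map_eq _ _ (by rw [he, he, A.spec]) fun b hb => ?_
    rcases b with b | b
    · rfl
    · exact absurd ⟨.inr b, rfl⟩ hb

/-- On clean ancillas the circuit is the XOR oracle of its function and leaves the ancillas clean,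
also on superpositions. The specification covers clean inputs only; bijectivity of the circuit
excludes that other inputs are mapped to clean outputs. -/
theorem evolve_classicalAlg (A : ClassicalAlg α β) (τ : Op (α ⊕ β)) :
    evolve (relabel (Equiv.sumAssoc α β (Fin A.anc)).symm (permOp (runGates A.gates)))
        (tensOp τ (pureOp fun _ => false)) =
      tensOp (evolve (permOp (xorMap A.fn)) τ) (pureOp fun _ => false) := by
  have hrun : ∀ s : α ⊕ β → Bool, runGates A.gates (Sum.elim (s ∘ Sum.inl)
      (Sum.elim (s ∘ Sum.inr) fun _ => false)) =
      Sum.elim (xorMap A.fn s ∘ Sum.inl) (Sum.elim (xorMap A.fn s ∘ Sum.inr) fun _ => false) :=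
    fun s => A.spec _ _
  have hinv := xorMap_involutive A.fn
  let e := Equiv.sumAssoc α β (Fin A.anc)
  let π : ((α ⊕ β) ⊕ Fin A.anc → Bool) → (α ⊕ β) ⊕ Fin A.anc → Bool := fun s =>
    runGates A.gates (s ∘ e.symm) ∘ e
  have hπ : Function.Bijective π :=
    (e.arrowCongr (Equiv.refl Bool)).symm.bijective.comp
      ((runGates_bijective A.gates).comp (e.arrowCongr (Equiv.refl Bool)).bijective)
  have hperm : relabel e.symm (permOp (runGates A.gates)) = permOp π := by
    ext s t
    rw [relabel_apply, permOp_apply, permOp_apply]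
    congr 1
    apply propext
    constructor
    · intro h; funext b; simp only [π, ← h]; simp
    · intro h; rw [h]; funext b; simp [π]
  have hπ0 : ∀ s, π (Sum.elim s fun _ => false) = Sum.elim (xorMap A.fn s) fun _ => false := by
    intro s
    have : (Sum.elim s fun _ => false : (α ⊕ β) ⊕ Fin A.anc → Bool) ∘ e.symm =
        Sum.elim (s ∘ Sum.inl) (Sum.elim (s ∘ Sum.inr) fun _ => false) := by
      funext b; rcases b with b | b | b <;> rfl
    simp only [π, this, hrun]
    funext b; rcases b with (b | b) | b <;> rfl
  -- Every state with clean ancillas is already the image of such a state, because the XOR map is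
  -- onto; injectivity then identifies the preimage.
  have hπ1 : ∀ s, π s ∘ Sum.inr = (fun _ => false) → s ∘ Sum.inr = fun _ => false := by
    intro s hs
    have h₁ : π s = π (Sum.elim (xorMap A.fn (π s ∘ Sum.inl)) fun _ => false) := by
      rw [hπ0, hinv]
      exact bits_sum_ext.mpr ⟨rfl, hs⟩
    have := hπ.1 h₁
    rw [this]; rfl
  rw [hperm]
  ext s t
  obtain ⟨s, rfl⟩ := hπ.2 s
  obtain ⟨t, rfl⟩ := hπ.2 t
  rw [evolve_permOp_apply hπ, tensOp_apply, tensOp_apply, pureOp_apply, pureOp_apply]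
  by_cases h : s ∘ Sum.inr = (fun _ => false) ∧ t ∘ Sum.inr = fun _ => false
  · obtain ⟨hs, ht⟩ := h
    have es : s = Sum.elim (s ∘ Sum.inl) fun _ => false := bits_sum_ext.mpr ⟨rfl, hs⟩
    have et : t = Sum.elim (t ∘ Sum.inl) fun _ => false := bits_sum_ext.mpr ⟨rfl, ht⟩
    rw [es, et, hπ0, hπ0]
    simp only [Sum.elim_comp_inl, Sum.elim_comp_inr]
    rw [evolve_permOp_apply hinv.bijective]
  · rw [if_neg h, if_neg fun h' => h ⟨hπ1 s h'.1, hπ1 t h'.2⟩, mul_zero, mul_zero]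

theorem evolve_one_tensOp_apply (A : Op β) (σ : Op (α ⊕ β)) (s t : β → Bool) (g g' : α → Bool) :
    evolve (tensOp 1 A) σ (Sum.elim g s) (Sum.elim g' t) =
      evolve A (Matrix.of fun u v => σ (Sum.elim g u) (Sum.elim g' v)) s t := by
  let e := Equiv.sumComm β α
  have h₁ : tensOp 1 A = relabel e (tensOp A 1) := by
    ext s t; exact mul_comm _ _
  have h₂ : σ = relabel e (relabel e.symm σ) := by
    ext s t; simp [relabel_apply, Function.comp_assoc]
  have h₃ : ∀ (g : α → Bool) (s : β → Bool), Sum.elim g s ∘ e = Sum.elim s g := by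
    intro g s; funext b; rcases b with b | b <;> rfl
  have h₄ : ∀ (g : α → Bool) (s : β → Bool), Sum.elim s g ∘ e.symm = Sum.elim g s := by
    intro g s; funext b; rcases b with b | b <;> rfl
  rw [h₁, h₂, evolve_relabel, relabel_apply, h₃, h₃, evolve_tensOp_one_apply]
  congr 1
  ext u v
  simp only [Matrix.of_apply, relabel_apply, h₃, h₄]

/-- Conjugation by Hadamard gates turns the Pauli operator `X(v)` into `Z(v)`. -/
theorem hadOn_true_mul_permOp {N : ℕ} (v : Fin N → Bool) :
    hadOn (fun _ => true) * (permOp (fun t i => t i ^^ v i) * hadOn fun _ => true) =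
      Matrix.diagonal fun a => phase a v := by
  have : permOp (fun t i => t i ^^ v i) * hadOn (fun _ => true) =
      hadOn (fun _ => true) * Matrix.diagonal fun a => phase a v := by
    ext s t
    have h₁ : ∀ r : Fin N → Bool, (s = fun i => r i ^^ v i) ↔ r = fun i => s i ^^ v i := by
      intro r
      constructor
      · rintro rfl; funext i; simp [Bool.xor_assoc]
      · rintro rfl; funext i; simp [Bool.xor_assoc]
    have h₂ : ∀ a b c : Bool, hadEntry true (a ^^ b) c =
        hadEntry true a c * if c && b then -1 else 1 := by
      intro a b c; cases a <;> cases b <;> cases c <;> simp [hadEntry] <;> ring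
    rw [Matrix.mul_apply, Matrix.mul_diagonal, hadOn_apply, phase, ← Finset.prod_mul_distrib]
    simp only [permOp_apply, h₁, ite_mul, one_mul, zero_mul, Finset.sum_ite_eq',
      Finset.mem_univ, if_true, hadOn_apply, h₂]
  rw [this, ← Matrix.mul_assoc, hadOn_mul_self, one_mul]

end Blocks

/-! ### The extractor -/

section Extractor

variable {α β ζ ι ω n c : Type}

theorem bbMat_append [Fintype ζ] [DecidableEq ζ] [Fintype ι] [DecidableEq ι] [Fintype ω]
    [DecidableEq ω] (U : Op (ζ ⊕ ι)) (l l' : List (BBGate ζ ω)) :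
    bbMat U (l ++ l') = bbMat U l' * bbMat U l := by
  induction l with
  | nil => simp [bbMat]
  | cons g l ih => simp [bbMat, ih, Matrix.mul_assoc]

theorem bbMat_map_gate [Fintype ζ] [DecidableEq ζ] [Fintype ι] [DecidableEq ι] [Fintype ω]
    [DecidableEq ω] (U : Op (ζ ⊕ ι)) (l : List (QGate (ζ ⊕ ω))) :
    bbMat U (l.map BBGate.gate) = circMat (l.map (QGate.map (accessible (ι := ι)))) := by
  induction l with
  | nil => rfl
  | cons g l ih => simp [bbMat, circMat, ih, BBGate.mat]

/-- The accessible wires of the extractor, with the ancillas of its algorithm last. -/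
def extractorWires (α β ζ n c : Type) : ((ζ ⊕ (α ⊕ n)) ⊕ β) ⊕ c ≃ ζ ⊕ (α ⊕ (β ⊕ (n ⊕ c))) where
  toFun
    | .inl (.inl (.inl z)) => .inl z
    | .inl (.inl (.inr (.inl a))) => .inr (.inl a)
    | .inl (.inl (.inr (.inr u))) => .inr (.inr (.inr (.inl u)))
    | .inl (.inr b) => .inr (.inr (.inl b))
    | .inr k => .inr (.inr (.inr (.inr k)))
  invFun
    | .inl z => .inl (.inl (.inl z))
    | .inr (.inl a) => .inl (.inl (.inr (.inl a)))
    | .inr (.inr (.inr (.inl u))) => .inl (.inl (.inr (.inr u)))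
    | .inr (.inr (.inl b)) => .inl (.inr b)
    | .inr (.inr (.inr (.inr k))) => .inr k
  left_inv := by rintro (((z | a | u) | b) | k) <;> rfl
  right_inv := by rintro (z | a | b | u | k) <;> rfl

/-- All wires of the extractor, with the ancillas of its algorithm last. -/
def extractorAllWires (α β ζ ι n c : Type) :
    (((ζ ⊕ ι) ⊕ (α ⊕ n)) ⊕ β) ⊕ c ≃ (ζ ⊕ ι) ⊕ (α ⊕ (β ⊕ (n ⊕ c))) where
  toFun
    | .inl (.inl (.inl z)) => .inl z
    | .inl (.inl (.inr (.inl a))) => .inr (.inl a)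
    | .inl (.inl (.inr (.inr u))) => .inr (.inr (.inr (.inl u)))
    | .inl (.inr b) => .inr (.inr (.inl b))
    | .inr k => .inr (.inr (.inr (.inr k)))
  invFun
    | .inl z => .inl (.inl (.inl z))
    | .inr (.inl a) => .inl (.inl (.inr (.inl a)))
    | .inr (.inr (.inr (.inl u))) => .inl (.inl (.inr (.inr u)))
    | .inr (.inr (.inl b)) => .inl (.inr b)
    | .inr (.inr (.inr (.inr k))) => .inr k
  left_inv := by rintro (((z | a | u) | b) | k) <;> rfl
  right_inv := by rintro (z | a | b | u | k) <;> rfl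

variable {N : ℕ} [Fintype α] [DecidableEq α] [Fintype ζ] [DecidableEq ζ] [Fintype ι]
  [DecidableEq ι]

def extractorEmb (α ζ : Type) (N m : ℕ) :
    ((ζ ⊕ (α ⊕ Fin N)) ⊕ Fin N) ⊕ Fin m ≃ ζ ⊕ (α ⊕ (Fin N ⊕ Fin (N + m))) :=
  (extractorWires α (Fin N) ζ (Fin N) (Fin m)).trans ((Equiv.refl _).sumCongr
    ((Equiv.refl _).sumCongr ((Equiv.refl _).sumCongr finSumFinEquiv)))

def extractorAllEmb (α ζ ι : Type) (N m : ℕ) : (((ζ ⊕ ι) ⊕ (α ⊕ Fin N)) ⊕ Fin N) ⊕ Fin m ≃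
    (ζ ⊕ ι) ⊕ (α ⊕ (Fin N ⊕ Fin (N + m))) :=
  (extractorAllWires α (Fin N) ζ ι (Fin N) (Fin m)).trans ((Equiv.refl _).sumCongr
    ((Equiv.refl _).sumCongr ((Equiv.refl _).sumCongr finSumFinEquiv)))

def extractorAcc (α ζ ι : Type) (N : ℕ) :
    (ζ ⊕ (α ⊕ Fin N)) ↪ ((ζ ⊕ ι) ⊕ (α ⊕ Fin N)) :=
  Function.Embedding.inl.sumMap (Function.Embedding.refl _)

theorem bbMat_extractor {m : ℕ} (U : Op (ζ ⊕ ι))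
    (l : List (QGate (((ζ ⊕ (α ⊕ Fin N)) ⊕ Fin N) ⊕ Fin m))) :
    bbMat U (l.map fun g => BBGate.gate (g.map (extractorEmb α ζ N m).toEmbedding)) =
      relabel (extractorAllEmb α ζ ι N m) (circMat (l.map (QGate.map
        (((extractorAcc α ζ ι N).sumMap (Function.Embedding.refl _)).sumMap
          (Function.Embedding.refl _))))) := by
  have : (l.map fun g => BBGate.gate (g.map (extractorEmb α ζ N m).toEmbedding)) =
      (l.map (QGate.map (extractorEmb α ζ N m).toEmbedding)).map BBGate.gate := by simp
  rw [this, bbMat_map_gate, ← circMat_map_equiv, List.map_map, List.map_map]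
  congr 2
  funext _
  rw [Function.comp_apply, Function.comp_apply, QGate.map_map, QGate.map_map]
  congr 1
  ext x
  rcases x with ((z | a | u) | b) | k <;> rfl

/-- Copy the wires `src i` of the answer register, apply the attack, measure the answer register in
the Hadamard basis, and multiply the phases given by the values of `A`, where `N` ancillas supply
random bits. -/
def extractorAlg (src : Fin N → ζ) (A : ClassicalAlg (ζ ⊕ (α ⊕ Fin N)) (Fin N)) :
    BBAlg α (Fin N) ζ where
  anc := N + A.anc
  gates :=
    let e : QGate (((ζ ⊕ (α ⊕ Fin N)) ⊕ Fin N) ⊕ Fin A.anc) → BBGate _ _ := fun g =>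
      BBGate.gate (g.map (extractorEmb α ζ N A.anc).toEmbedding)
    ((((copyGates (fun i => some (.inl (src i))) Finset.univ.toList).map QGate.classical).map
      (QGate.map .inl)).map e ++ [.fwd none]) ++
    (((((Finset.univ : Finset ((ζ ⊕ Fin N) ⊕ Fin N)).toList.map
      (Sum.map (Sum.map id Sum.inr) id)).map QGate.had).map (QGate.map .inl)).map e ++
    ((A.gates.map QGate.classical).map (QGate.map (Equiv.sumAssoc _ _ _).symm.toEmbedding)).map e ++
    ((((Finset.univ : Finset (Fin N)).toList.map Sum.inr).map QGate.had).map
      (QGate.map .inl)).map e)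

theorem size_extractorAlg_le (src : Fin N → ζ) (A : ClassicalAlg (ζ ⊕ (α ⊕ Fin N)) (Fin N)) :
    (extractorAlg src A).size ≤ 5 * N + 1 + Fintype.card ζ + A.size := by
  have := length_copyGates_le (α := ζ ⊕ (α ⊕ Fin N)) (fun i => some (.inl (src i)))
    (Finset.univ : Finset (Fin N)).toList
  simp only [extractorAlg, BBAlg.size, ClassicalAlg.size, List.length_append, List.length_map,
    Finset.length_toList, Finset.card_univ, Fintype.card_sum, Fintype.card_fin,
    List.length_singleton] at this ⊢
  omega

/-- For fixed contents `r`, XORing `f r` onto the output wires is the Pauli operator `X(f r)`.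
Between two layers of Hadamard gates it becomes diagonal and multiplies entry `(a, b)` by the
characters of `a` and of `b`. -/
theorem evolve_phase_kickback {R : Type} [Fintype R] [DecidableEq R]
    (f : (R → Bool) → Fin N → Bool) (σ : Op (R ⊕ Fin N)) (r : R → Bool) (a b : Fin N → Bool) :
    evolve (tensOp 1 (hadOn fun _ => true)) (evolve (permOp (xorMap f))
      (evolve (tensOp 1 (hadOn fun _ => true)) σ)) (Sum.elim r a) (Sum.elim r b) =
    phase (fun i => a i ^^ b i) (f r) * σ (Sum.elim r a) (Sum.elim r b) := by
  have hinv : Function.Involutive fun (t : Fin N → Bool) i => t i ^^ f r i := by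
    intro t; funext i; simp [Bool.xor_assoc]
  have h : (Matrix.of fun u v => evolve (permOp (xorMap f))
      (evolve (tensOp 1 (hadOn fun _ => true)) σ) (Sum.elim r u) (Sum.elim r v)) =
      evolve (permOp fun t i => t i ^^ f r i) (evolve (hadOn fun _ => true)
        (Matrix.of fun u v => σ (Sum.elim r u) (Sum.elim r v))) := by
    ext u v
    rw [Matrix.of_apply, evolve_permOp_of_involutive (xorMap_involutive f),
      evolve_permOp_of_involutive hinv, xorMap_elim, xorMap_elim, evolve_one_tensOp_apply]
  rw [evolve_one_tensOp_apply, h, ← evolve_mul, ← evolve_mul, Matrix.mul_assoc,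
    hadOn_true_mul_permOp, evolve_diagonal_apply, star_phase, Matrix.of_apply, ← phase_mul]
  ring

theorem relabel_combine {R n c X : Type} [Fintype R] [DecidableEq R] [Fintype n] [DecidableEq n]
    [Fintype c] [DecidableEq c] [Fintype X] [DecidableEq X] (e : (R ⊕ n) ⊕ c ≃ X) (H : Op n)
    (G : Op ((R ⊕ n) ⊕ c)) (A U : Op R) (P : Op (R ⊕ n)) :
    relabel e (tensOp (tensOp 1 H) 1) * (relabel e G * relabel e (tensOp (tensOp A H) 1)) *
      (relabel e (tensOp (tensOp U 1) 1) * relabel e (tensOp P 1)) =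
    relabel e (tensOp (tensOp 1 H) 1 * (G * (tensOp (tensOp (A * U) H) 1 * tensOp P 1))) := by
  have : tensOp (tensOp (A * U) H) (1 : Op c) =
      tensOp (tensOp A H) 1 * tensOp (tensOp U 1) 1 := by
    simp only [tensOp_mul, mul_one]
  rw [this]
  simp only [← relabel_mul, Matrix.mul_assoc]

/-- Copying the wires `src` places `P_a ρ P_b` at entry `(a, b)` of the output register. The attack
and the Hadamard gates act on the opening and internal registers only, the `N` ancillas become
uniform bits `u`, and the computation of `A` between Hadamard gates kicks back the phase. Tracing
out the rest leaves diagonal entries. -/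
theorem run_extractorAlg (src : Fin N → ζ) (A : ClassicalAlg (ζ ⊕ (α ⊕ Fin N)) (Fin N))
    (U ρ : Op (ζ ⊕ ι)) (x : α → Bool) (a b : Fin N → Bool) :
    (extractorAlg src A).run U ρ x a b = ∑ w, ∑ u, ((2 : ℂ) ^ N)⁻¹ *
      phase (fun i => a i ^^ b i) (A.fn (Sum.elim (w ∘ Sum.inl) (Sum.elim x u))) *
      evolve (hadOn (Sum.elim (fun _ => true) fun _ => false) * U)
        (select (fun s i => s (.inl (src i))) a b ρ) w w := by
  let A' : ClassicalAlg ((ζ ⊕ ι) ⊕ (α ⊕ Fin N)) (Fin N) := A.mapInput (extractorAcc α ζ ι N)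
  let gs : List (CGate (((ζ ⊕ ι) ⊕ (α ⊕ Fin N)) ⊕ (Fin N ⊕ Fin A.anc))) :=
    A.gates.map (CGate.map ((extractorAcc α ζ ι N).sumMap (Function.Embedding.refl _)))
  let cp : (((ζ ⊕ ι) ⊕ (α ⊕ Fin N)) → Bool) → Fin N → Bool := fun s i => s (.inl (.inl (src i)))
  let K : Op ((ζ ⊕ ι) ⊕ (α ⊕ Fin N)) := tensOp (hadOn (Sum.elim (fun _ => true) fun _ => false) * U)
    (tensOp 1 (hadOn fun _ => true))
  let H : Op (Fin N) := hadOn fun _ => true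
  have hgates : bbMat U (extractorAlg src A).gates = relabel (extractorAllEmb α ζ ι N A.anc) (tensOp (tensOp 1 H) 1 *
      (relabel (Equiv.sumAssoc ((ζ ⊕ ι) ⊕ (α ⊕ Fin N)) (Fin N) (Fin A.anc)).symm (permOp (runGates gs)) *
        (tensOp (tensOp K H) 1 * tensOp (permOp (xorMap cp)) 1))) := by
    have h₁ : ∀ l : List (QGate ((ζ ⊕ (α ⊕ Fin N)) ⊕ Fin N)),
        circMat ((l.map (QGate.map (.inl : _ ↪ _ ⊕ Fin A.anc))).map (QGate.map
          (((extractorAcc α ζ ι N).sumMap (Function.Embedding.refl _)).sumMap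
            (Function.Embedding.refl _)))) =
        tensOp (circMat (l.map (QGate.map ((extractorAcc α ζ ι N).sumMap
          (Function.Embedding.refl _))))) 1 := by
      intro l
      rw [← circMat_map_inl, List.map_map, List.map_map]
      congr 2
      funext g
      rw [Function.comp_apply, Function.comp_apply, QGate.map_map, QGate.map_map]
      congr 1
    have hcopy : circMat (((copyGates (fun i => some (.inl (src i)))
        (Finset.univ : Finset (Fin N)).toList).map QGate.classical).map
        (QGate.map ((extractorAcc α ζ ι N).sumMap (Function.Embedding.refl (Fin N))))) =
        permOp (xorMap cp) := by
      have : ((copyGates (fun i => some (.inl (src i)))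
        (Finset.univ : Finset (Fin N)).toList).map QGate.classical).map
        (QGate.map ((extractorAcc α ζ ι N).sumMap (Function.Embedding.refl (Fin N)))) =
        ((copyGates (fun i => some (.inl (src i))) (Finset.univ : Finset (Fin N)).toList).map
          (CGate.map ((extractorAcc α ζ ι N).sumMap (Function.Embedding.refl (Fin N))))).map
          QGate.classical := by
        simp only [List.map_map]; rfl
      rw [this, circMat_classical, copyGates_map, runGates_copyGates_univ]
      rfl
    have hhad : ∀ {δ : Type} [DecidableEq δ] [Fintype δ] (f : δ ↪ (ζ ⊕ (α ⊕ Fin N)) ⊕ Fin N)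
        (m : ((ζ ⊕ ι) ⊕ (α ⊕ Fin N)) ⊕ Fin N → Bool), (∀ a, m a = true ↔ ∃ d, (f.trans ((extractorAcc α ζ ι N).sumMap
          (Function.Embedding.refl (Fin N)))) d = a) →
        circMat ((((Finset.univ : Finset δ).toList.map f).map
        QGate.had).map (QGate.map ((extractorAcc α ζ ι N).sumMap
          (Function.Embedding.refl (Fin N))))) = hadOn m := by
      intro δ _ _ f m hm
      have : (((Finset.univ : Finset δ).toList.map f).map
        QGate.had).map (QGate.map ((extractorAcc α ζ ι N).sumMap
          (Function.Embedding.refl (Fin N)))) =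
          ((Finset.univ : Finset δ).toList.map (f.trans ((extractorAcc α ζ ι N).sumMap
          (Function.Embedding.refl (Fin N))))).map QGate.had := by
        simp only [List.map_map]; rfl
      rw [this]
      exact circMat_map_had _ _ hm
    have hhad₁ := hhad ⟨Sum.map (Sum.map id Sum.inr) id,
      (Function.injective_id.sumMap Sum.inr_injective).sumMap Function.injective_id⟩
      (Sum.elim (Sum.elim (Sum.elim (fun _ => true) fun _ => false)
        (Sum.elim (fun _ => false) fun _ => true)) fun _ => true) (by
      rintro (((z | i) | a | u) | b)
      · exact iff_of_true rfl ⟨.inl (.inl z), rfl⟩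
      · refine iff_of_false Bool.false_ne_true ?_
        rintro ⟨(z | u) | b, h⟩ <;> exact nomatch h
      · refine iff_of_false Bool.false_ne_true ?_
        rintro ⟨(z | u) | b, h⟩ <;> exact nomatch h
      · exact iff_of_true rfl ⟨.inl (.inr u), rfl⟩
      · exact iff_of_true rfl ⟨.inr b, rfl⟩)
    have hhad₂ := hhad (.inr : Fin N ↪ _) (Sum.elim (fun _ => false) fun _ => true) (by
      rintro (a | b)
      · refine iff_of_false Bool.false_ne_true ?_
        rintro ⟨d, h⟩; exact nomatch h
      · exact iff_of_true rfl ⟨b, rfl⟩)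
    have halg : circMat (((A.gates.map QGate.classical).map
        (QGate.map (Equiv.sumAssoc _ _ _).symm.toEmbedding)).map (QGate.map
          (((extractorAcc α ζ ι N).sumMap (Function.Embedding.refl (Fin N))).sumMap
            (Function.Embedding.refl (Fin A.anc))))) =
        relabel (Equiv.sumAssoc ((ζ ⊕ ι) ⊕ (α ⊕ Fin N)) (Fin N) (Fin A.anc)).symm (permOp (runGates gs)) := by
      rw [← circMat_classical, ← circMat_map_equiv]
      simp only [gs, List.map_map]
      congr 2
      funext g
      simp only [Function.comp_apply]
      change QGate.map _ (QGate.map _ (QGate.classical g)) = QGate.map _ (QGate.map _ (.classical g))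
      rw [QGate.map_map, QGate.map_map]
      congr 1
      ext x
      rcases x with x | x | x <;> rfl
    have hfwd : bbMat U [(BBGate.fwd none : BBGate ζ (α ⊕ (Fin N ⊕ Fin (N + A.anc))))] =
        relabel (extractorAllEmb α ζ ι N A.anc) (tensOp (tensOp (tensOp U 1) 1) 1) := by
      rw [bbMat, bbMat, one_mul, BBGate.mat, controlled_none]
      have e₁ : tensOp U (1 : Op (α ⊕ (Fin N ⊕ Fin (N + A.anc)))) = relabel (extractorAllEmb α ζ ι N A.anc) (relabel
          ((Equiv.sumAssoc (ζ ⊕ ι) (α ⊕ Fin N) (Fin N)).symm.sumCongr (Equiv.refl _)) (relabel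
          (Equiv.sumAssoc (ζ ⊕ ι) ((α ⊕ Fin N) ⊕ Fin N) (Fin A.anc)).symm (tensOp U 1))) := by
        ext s t
        simp only [relabel_apply, tensOp_apply]
        congr 1
        rw [Matrix.one_apply, Matrix.one_apply]
        congr 1
        apply propext
        constructor
        · intro h
          funext b
          rcases b with ((b | b) | b) | b
          exacts [congrFun h (.inl b), congrFun h (.inr (.inr (Fin.castAdd _ b))),
            congrFun h (.inr (.inl b)), congrFun h (.inr (.inr (Fin.natAdd _ b)))]
        · intro h
          funext b
          rcases b with b | b | b
          · exact congrFun h (.inl (.inl (.inl b)))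
          · exact congrFun h (.inl (.inr b))
          · induction b using Fin.addCases with
            | left b => exact congrFun h (.inl (.inl (.inr b)))
            | right b => exact congrFun h (.inr b)
      rw [e₁]
      congr 1
      ext s t
      simp only [relabel_apply, tensOp_apply, mul_assoc]
      congr 1
      rw [← tensOp_one, ← tensOp_one (α := α ⊕ Fin N) (β := Fin N)]
      simp only [tensOp_apply, mul_assoc]
      rfl
    have hH₁ : hadOn (Sum.elim (Sum.elim (Sum.elim (fun _ : ζ => true) fun _ : ι => false)
        (Sum.elim (fun _ : α => false) fun _ : Fin N => true)) fun _ : Fin N => true) =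
        tensOp (tensOp (hadOn (Sum.elim (fun _ => true) fun _ => false)) (tensOp 1 H)) H := by
      rw [hadOn_sumElim, hadOn_sumElim, hadOn_sumElim (fun _ : α => false), hadOn_false]
    have hH₂ : hadOn (Sum.elim (fun _ : (ζ ⊕ ι) ⊕ (α ⊕ Fin N) => false) fun _ : Fin N => true) =
        tensOp 1 H := by
      rw [hadOn_sumElim, hadOn_false]
    have hK : K = tensOp (hadOn (Sum.elim (fun _ => true) fun _ => false)) (tensOp 1 H) *
        tensOp U 1 := by
      rw [tensOp_mul, mul_one]
    change bbMat (ω := α ⊕ (Fin N ⊕ Fin (N + A.anc))) U ((List.map _ _ ++ [.fwd none]) ++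
      (List.map _ _ ++ List.map _ _ ++ List.map _ _)) = _
    simp only [bbMat_append, bbMat_extractor, hfwd, h₁, halg, hcopy]
    rw [show (Sum.map (Sum.map id Sum.inr) id : (ζ ⊕ Fin N) ⊕ Fin N → (ζ ⊕ (α ⊕ Fin N)) ⊕ Fin N) =
      (⟨Sum.map (Sum.map id Sum.inr) id,
        (Function.injective_id.sumMap Sum.inr_injective).sumMap Function.injective_id⟩ :
        (ζ ⊕ Fin N) ⊕ Fin N ↪ _) from rfl, hhad₁,
      show (Sum.inr : Fin N → (ζ ⊕ (α ⊕ Fin N)) ⊕ Fin N) = (.inr : Fin N ↪ _) from rfl, hhad₂]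
    rw [hK, hH₁, hH₂]
    exact relabel_combine _ _ _ _ _ _
  have hinit : withAncilla ρ (Sum.elim x (Sum.elim (fun _ => false) fun _ => false)) =
      relabel (extractorAllEmb α ζ ι N A.anc) (tensOp (tensOp (tensOp ρ (pureOp (Sum.elim x fun _ => false)))
        (pureOp fun _ => false)) (pureOp fun _ => false)) := by
    have h₂ : tensOp (tensOp (tensOp ρ (pureOp (Sum.elim x fun _ : Fin N => false)))
        (pureOp fun _ : Fin N => false)) (pureOp fun _ : Fin A.anc => false) =
        relabel ((Equiv.sumAssoc (ζ ⊕ ι) (α ⊕ Fin N) (Fin N)).symm.sumCongr (Equiv.refl _))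
          (relabel (Equiv.sumAssoc (ζ ⊕ ι) ((α ⊕ Fin N) ⊕ Fin N) (Fin A.anc)).symm
          (tensOp ρ (pureOp (Sum.elim (Sum.elim (Sum.elim x fun _ : Fin N => false)
            fun _ : Fin N => false) fun _ : Fin A.anc => false)))) := by
      rw [pureOp_sumElim _ (fun _ : Fin A.anc => false),
        pureOp_sumElim (Sum.elim x fun _ : Fin N => false) (fun _ : Fin N => false)]
      ext s t
      simp only [relabel_apply, tensOp_apply, mul_assoc]
      rfl
    rw [h₂, withAncilla_eq]
    ext s t
    have h₃ : ∀ s : (ζ ⊕ ι) ⊕ (α ⊕ (Fin N ⊕ Fin (N + A.anc))) → Bool,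
        s ∘ Sum.inr = Sum.elim x (Sum.elim (fun _ => false) fun _ => false) ↔
        ((((s ∘ (extractorAllEmb α ζ ι N A.anc)) ∘ ((Equiv.sumAssoc (ζ ⊕ ι) (α ⊕ Fin N) (Fin N)).symm.sumCongr
          (Equiv.refl _))) ∘ (Equiv.sumAssoc (ζ ⊕ ι) ((α ⊕ Fin N) ⊕ Fin N) (Fin A.anc)).symm) ∘
          Sum.inr) = Sum.elim (Sum.elim (Sum.elim x fun _ => false) fun _ => false)
            fun _ => false := by
      intro s
      constructor
      · intro h
        funext b
        rcases b with ((b | b) | b) | b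
        exacts [congrFun h (.inl b), congrFun h (.inr (.inr (Fin.castAdd _ b))),
          congrFun h (.inr (.inl b)), congrFun h (.inr (.inr (Fin.natAdd _ b)))]
      · intro h
        funext b
        rcases b with b | b | b
        · exact congrFun h (.inl (.inl (.inl b)))
        · exact congrFun h (.inl (.inr b))
        · induction b using Fin.addCases with
          | left b => exact congrFun h (.inl (.inl (.inr b)))
          | right b => exact congrFun h (.inr b)
    simp only [relabel_apply, tensOp_apply]
    congr 1
    rw [pureOp_apply, pureOp_apply]
    simp only [h₃ s, h₃ t]
  let ρR : Op ((ζ ⊕ ι) ⊕ (α ⊕ Fin N)) := tensOp ρ (pureOp (Sum.elim x fun _ => false))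
  let τ : Op (((ζ ⊕ ι) ⊕ (α ⊕ Fin N)) ⊕ Fin N) := evolve (tensOp 1 H) (evolve (permOp (xorMap A'.fn))
    (evolve (tensOp K H) (evolve (permOp (xorMap cp)) (tensOp ρR (pureOp fun _ => false)))))
  have hfinal : evolve (bbMat U (extractorAlg src A).gates)
      (withAncilla ρ (Sum.elim x (Sum.elim (fun _ => false) fun _ => false))) =
      relabel (extractorAllEmb α ζ ι N A.anc) (tensOp τ (pureOp fun _ => false)) := by
    refine (congrArg₂ evolve hgates hinit).trans ((evolve_relabel _ _ _).trans ?_)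
    simp only [evolve_mul, evolve_tensOp, evolve_one]
    refine congrArg (relabel (extractorAllEmb α ζ ι N A.anc)) ?_
    refine (congrArg _ (evolve_classicalAlg A' _)).trans ?_
    exact (evolve_tensOp _ _ _ _).trans (congrArg _ (evolve_one _))
  have hτ : ∀ w x' u, τ (Sum.elim (Sum.elim w (Sum.elim x' u)) a)
      (Sum.elim (Sum.elim w (Sum.elim x' u)) b) = if x' = x then ((2 : ℂ) ^ N)⁻¹ *
        phase (fun i => a i ^^ b i) (A.fn (Sum.elim (w ∘ Sum.inl) (Sum.elim x u))) *
        evolve (hadOn (Sum.elim (fun _ => true) fun _ => false) * U)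
          (select (fun s i => s (.inl (src i))) a b ρ) w w else 0 := by
    intro w x' u
    have hKH : tensOp K H = tensOp 1 H * tensOp K 1 := by rw [tensOp_mul, mul_one, one_mul]
    -- The output wires start at `0`, so after the copy they hold exactly the source bits: entry
    -- `(a, b)` survives only if these are `a` on the left and `b` on the right.
    have hsel : (Matrix.of fun s t => evolve (permOp (xorMap cp))
        (tensOp ρR (pureOp fun _ => false)) (Sum.elim s a) (Sum.elim t b)) =
        tensOp (select (fun s i => s (.inl (src i))) a b ρ)
          (tensOp (pureOp x) (pureOp fun _ => false)) := by
      have hz : ∀ (s : ((ζ ⊕ ι) ⊕ (α ⊕ Fin N)) → Bool) (a : Fin N → Bool),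
          ((fun i => a i ^^ cp s i) = fun _ => false) ↔
            (fun i => (s ∘ Sum.inl) (.inl (src i))) = a := by
        intro s a
        constructor
        · intro h; funext i; have := congrFun h i; simp at this; exact this.symm
        · rintro rfl; funext i; simp [cp]
      ext s t
      rw [Matrix.of_apply, evolve_permOp_of_involutive (xorMap_involutive cp), xorMap_elim,
        xorMap_elim, ← pureOp_sumElim]
      simp only [tensOp_apply, Sum.elim_comp_inl, Sum.elim_comp_inr, ρR]
      rw [pureOp_apply (fun _ => false), select, Matrix.of_apply]
      simp only [hz]
      split_ifs <;> ring
    simp only [τ, hKH, evolve_mul, H]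
    rw [evolve_phase_kickback, evolve_tensOp_one_apply, hsel]
    simp only [K, evolve_tensOp, evolve_one, tensOp_apply, Sum.elim_comp_inl, Sum.elim_comp_inr,
      hadOn_true_pureOp, pureOp_apply, and_self]
    split_ifs with hx
    · subst hx
      have : A'.fn (Sum.elim w (Sum.elim x' u)) =
          A.fn (Sum.elim (w ∘ Sum.inl) (Sum.elim x' u)) := by
        change A.fn _ = _
        congr 1
        funext b; rcases b with b | b | b <;> rfl
      rw [this, ← evolve_mul]
      ring
    · ring
  have hE : ∀ (w : ζ ⊕ ι → Bool) (x' : α → Bool) (a : Fin N → Bool) (u : Fin N → Bool)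
      (k : Fin A.anc → Bool), Sum.elim w (Sum.elim x' (Sum.elim a
        (Sum.elim u k ∘ finSumFinEquiv.symm))) ∘ (extractorAllEmb α ζ ι N A.anc) =
        Sum.elim (Sum.elim (Sum.elim w (Sum.elim x' u)) a) k := by
    intro w x' a u k
    funext b
    rcases b with ((b | b | b) | b) | b
    · rfl
    · rfl
    · change (Sum.elim u k ∘ finSumFinEquiv.symm) (finSumFinEquiv (.inl b)) = u b
      simp
    · rfl
    · change (Sum.elim u k ∘ finSumFinEquiv.symm) (finSumFinEquiv (.inr b)) = k b
      simp
  rw [BBAlg.run, Matrix.of_apply, hfinal]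
  refine Finset.sum_congr rfl fun w _ => ?_
  have hc : ∀ x' : α → Bool, (∑ c : Fin (N + A.anc) → Bool,
      relabel (extractorAllEmb α ζ ι N A.anc) (tensOp τ (pureOp fun _ => false)) (Sum.elim w (Sum.elim x' (Sum.elim a c)))
        (Sum.elim w (Sum.elim x' (Sum.elim b c)))) =
      ∑ u, τ (Sum.elim (Sum.elim w (Sum.elim x' u)) a)
        (Sum.elim (Sum.elim w (Sum.elim x' u)) b) := by
    intro x'
    rw [sum_bits_equiv finSumFinEquiv.symm, sum_bits_sum]
    refine Finset.sum_congr rfl fun u _ => ?_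
    simp only [relabel_apply, hE, tensOp_apply, Sum.elim_comp_inl, Sum.elim_comp_inr,
      pureOp_apply, and_self, mul_ite, mul_one, mul_zero, Finset.sum_ite_eq', Finset.mem_univ,
      if_true]
  refine (Finset.sum_congr rfl fun x' _ => hc x').trans ?_
  rw [Finset.sum_comm]
  refine Finset.sum_congr rfl fun u _ => ?_
  simp only [hτ, Finset.sum_ite_eq', Finset.mem_univ, if_true]

end Extractor

/-! ### The extractor and the simulated key generation -/

theorem exists_extractorDecode {F : TCF} (B : BatchKeyGen F) :
    ComputedWithin (α := ZWire B ⊕ ((Fin B.PKLen ⊕ (Fin B.SKLen ⊕ YWire B)) ⊕ Fin B.N))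
      (fun s => decodeBits B (B.extSk fun k => s (.inr (.inl (.inr (.inl k)))))
        (fun p => s (.inr (.inl (.inr (.inr p))))) (s ∘ Sum.inl) fun i => s (.inr (.inr i)))
      (2 * (∑ i, (B.extSkAlg i).size) + B.N * (F.skLen +
        (2 * F.invertTwoAlg.size + 4 * F.goodAlg.size + 10 * F.ℓ + 21))) := by
  have h : ∀ i : Fin B.N, ComputedWithin
      (fun (s : ZWire B ⊕ ((Fin B.PKLen ⊕ (Fin B.SKLen ⊕ YWire B)) ⊕ Fin B.N) → Bool) (_ : Unit) =>
        decodeBits B (B.extSk fun k => s (.inr (.inl (.inr (.inl k)))))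
          (fun p => s (.inr (.inl (.inr (.inr p))))) (s ∘ Sum.inl) (fun i => s (.inr (.inr i))) i)
      (2 * (B.extSkAlg i).size + (F.skLen +
        (2 * F.invertTwoAlg.size + 4 * F.goodAlg.size + 10 * F.ℓ + 21))) := by
    intro i
    have h₁ := (B.extSkAlg i).computedWithin.comp_injective
      (i := fun k => (.inr (.inl (.inr (.inl k))) :
        ZWire B ⊕ ((Fin B.PKLen ⊕ (Fin B.SKLen ⊕ YWire B)) ⊕ Fin B.N))) (by
      intro a b h; simpa using h)
    have h₂ := F.decodeBit_computedWithin.comp_injective (α' :=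
      (ZWire B ⊕ ((Fin B.PKLen ⊕ (Fin B.SKLen ⊕ YWire B)) ⊕ Fin B.N)) ⊕ Fin F.skLen)
      (i := Sum.elim .inr (Sum.elim (fun k => .inl (.inr (.inl (.inr (.inr (i, k))))))
        (Sum.elim (fun k => .inl (.inl (i, k))) fun _ => .inl (.inr (.inr i))))) (by
      rintro (a | a | a | a) (b | b | b | b) h <;> simp at h ⊢ <;> exact h)
    exact (h₁.bind h₂).congr (fun s _ => rfl) (by simp; omega)
  refine (computedWithin_pi h).mono ?_
  simp [Finset.sum_add_distrib, Finset.mul_sum]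

/-- The teleportation-based extractor. -/
def extractor {F : TCF} (B : BatchKeyGen F) : Extractor B :=
  extractorAlg (fun i => (i, 0)) (Classical.choose (exists_extractorDecode B))

/-- The circuit and the teleportation operator have the same closed form. Unitarity of `U` enters
through the diagonalization of the observables `X_i`. -/
theorem run_extractor {F : TCF} (B : BatchKeyGen F) {ι : Type} [Fintype ι] [DecidableEq ι]
    {U : Op (ZWire B ⊕ ι)} (hU : U ∈ Matrix.unitaryGroup (ZWire B ⊕ ι → Bool) ℂ)
    (ρ : Op (ZWire B ⊕ ι)) (PK : Fin B.PKLen → Bool) (SK : Fin B.SKLen → Bool)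
    (y : YWire B → Bool) :
    (extractor B).run U ρ (Sum.elim PK (Sum.elim SK y)) = extractedState B U ρ SK y := by
  ext a b
  rw [extractor, run_extractorAlg, extractedState_apply B hU,
    (Classical.choose_spec (exists_extractorDecode B)).1]
  rfl

theorem size_extractor_le {F : TCF} (B : BatchKeyGen F) :
    (extractor B).size ≤ 5 * B.N + 1 + B.N * (F.ℓ + 1) + (2 * (∑ i, (B.extSkAlg i).size) +
      B.N * (F.skLen + (2 * F.invertTwoAlg.size + 4 * F.goodAlg.size + 10 * F.ℓ + 21))) := by
  refine (size_extractorAlg_le _ _).trans ?_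
  rw [Fintype.card_prod, Fintype.card_fin, Fintype.card_fin]
  exact Nat.add_le_add_left (Classical.choose_spec (exists_extractorDecode B)).2 _

/-- The key generation for the constant function `1`. -/
def simGen {F : TCF} (B : BatchKeyGen F) :
    ClassicalAlg (Fin B.coinLen) (Fin B.PKLen ⊕ Fin B.SKLen) :=
  Classical.choose (exists_simAlg B)

theorem simGen_fn {F : TCF} (B : BatchKeyGen F) (r : Fin B.coinLen → Bool) :
    (simGen B).fn r = B.genAlg.fn (Sum.elim B.one r) :=
  congrFun (Classical.choose_spec (exists_simAlg B)).1 r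

theorem size_simGen_le {F : TCF} (B : BatchKeyGen F) :
    (simGen B).size ≤ B.genAlg.size + 3 * B.descLen :=
  (Classical.choose_spec (exists_simAlg B)).2

/-! ### Quantum algorithms with quantum input and one output bit -/

section Tests

variable {α β γ M R : Type} [Fintype α] [DecidableEq α] [Fintype β] [DecidableEq β]
  [Fintype γ] [DecidableEq γ] [Fintype M] [DecidableEq M] [Fintype R] [DecidableEq R]

/-- A quantum algorithm with advice that acts on the register `α` and outputs one bit. -/
structure Test (α : Type) where
  wires : Type
  [fintype : Fintype wires]
  [decEq : DecidableEq wires]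
  state : Op wires
  isState : IsState state
  circ : List (QGate (α ⊕ wires))
  out : α ⊕ wires

attribute [instance] Test.fintype Test.decEq

/-- The diagonal block of an operator for fixed contents `r` of the first register. -/
def diagBlock (Γ : Op (R ⊕ M)) (r : R → Bool) : Op M :=
  Matrix.of fun s t => Γ (Sum.elim r s) (Sum.elim r t)

namespace Test

def size (T : Test α) : ℕ := Fintype.card T.wires + T.circ.length

/-- The expectation of `g` on the contents of `α` and of the wire `out` after a circuit. -/
def runExpect {V : Type} [Fintype V] [DecidableEq V] (σ : Op V) (c : List (QGate (α ⊕ V)))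
    (out : α ⊕ V) (Γ : Op α) (g : (α → Bool) → Bool → ℝ) : ℝ :=
  ∑ s, (evolve (circMat c) (tensOp Γ σ) s s).re * g (s ∘ Sum.inl) (s out)

/-- The expectation of `g` on the contents of `α` and the output bit, for a final measurement in
the standard basis. -/
def expect (T : Test α) (Γ : Op α) (g : (α → Bool) → Bool → ℝ) : ℝ :=
  runExpect T.state T.circ T.out Γ g

/-- The probability to output `1`. -/
def accept (T : Test α) (Γ : Op α) : ℝ := T.expect Γ fun _ o => if o then 1 else 0

/-- Run a circuit before the test. -/
def precomp (T : Test α) (c : List (QGate α)) : Test α where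
  wires := T.wires
  state := T.state
  isState := T.isState
  circ := c.map (QGate.map .inl) ++ T.circ
  out := T.out

theorem expect_precomp (T : Test α) (c : List (QGate α)) (Γ g) :
    (T.precomp c).expect Γ g = T.expect (evolve (circMat c) Γ) g := by
  change runExpect (V := T.wires) T.state (c.map (QGate.map .inl) ++ T.circ) T.out Γ g =
    runExpect T.state T.circ T.out _ g
  simp only [runExpect, circMat_append, circMat_map_inl, evolve_mul, evolve_tensOp, evolve_one]

theorem size_precomp (T : Test α) (c : List (QGate α)) :
    (T.precomp c).size = T.size + c.length := by
  refine (congrArg₂ (· + ·) rfl (List.length_append.trans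
    (congrArg (· + _) (List.length_map _)))).trans ?_
  change Fintype.card T.wires + (c.length + T.circ.length) =
    Fintype.card T.wires + T.circ.length + c.length
  omega

/-- Rename the wires. -/
def relabel (T : Test α) (e : α ≃ β) : Test β where
  wires := T.wires
  state := T.state
  isState := T.isState
  circ := T.circ.map (QGate.map (e.sumCongr (Equiv.refl _)).toEmbedding)
  out := e.sumCongr (Equiv.refl _) T.out

theorem expect_relabel (T : Test α) (e : α ≃ β) (Γ g) :
    (T.relabel e).expect Γ g =
      T.expect (CommitMeasure.relabel e.symm Γ) fun s o => g (s ∘ e.symm) o := by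
  have h : tensOp Γ T.state = CommitMeasure.relabel (e.sumCongr (Equiv.refl _))
      (tensOp (CommitMeasure.relabel e.symm Γ) T.state) := by
    ext s t
    simp only [tensOp_apply, relabel_apply]
    congr 2 <;> funext b <;> simp
  change runExpect (V := T.wires) T.state
    (T.circ.map (QGate.map (e.sumCongr (Equiv.refl _)).toEmbedding))
    (e.sumCongr (Equiv.refl _) T.out) Γ g = runExpect T.state T.circ T.out _ _
  simp only [runExpect, circMat_map_equiv, h, evolve_relabel]
  rw [sum_bits_equiv (e.sumCongr (Equiv.refl T.wires)).symm]
  refine Finset.sum_congr rfl fun s _ => ?_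
  rw [relabel_apply, Function.comp_assoc, Equiv.symm_comp_self, Function.comp_id]
  refine congrArg₂ (· * ·) rfl (congrArg₂ g rfl ?_)
  exact congrArg s (Equiv.symm_apply_apply _ _)

theorem size_relabel (T : Test α) (e : α ≃ β) : (T.relabel e).size = T.size := by
  exact congrArg₂ (· + ·) rfl (List.length_map _)

/-- Supply a part of the register as advice. -/
def addState (T : Test (α ⊕ γ)) (σ : Op γ) (hσ : IsState σ) : Test α where
  wires := γ ⊕ T.wires
  state := tensOp σ T.state
  isState := hσ.tensOp T.isState
  circ := T.circ.map (QGate.map (Equiv.sumAssoc _ _ _).toEmbedding)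
  out := Equiv.sumAssoc _ _ _ T.out

theorem expect_addState (T : Test (α ⊕ γ)) (σ : Op γ) (hσ : IsState σ) (Γ g) :
    (T.addState σ hσ).expect Γ g = T.expect (tensOp Γ σ) fun s o => g (s ∘ Sum.inl) o := by
  have h : tensOp Γ (tensOp σ T.state) = CommitMeasure.relabel (Equiv.sumAssoc _ _ _)
      (tensOp (tensOp Γ σ) T.state) := by
    ext s t
    simp only [tensOp_apply, relabel_apply, mul_assoc]
    rfl
  change runExpect (V := γ ⊕ T.wires) (tensOp σ T.state)
    (T.circ.map (QGate.map (Equiv.sumAssoc _ _ _).toEmbedding)) (Equiv.sumAssoc _ _ _ T.out) Γ g =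
    runExpect T.state T.circ T.out _ _
  simp only [runExpect, circMat_map_equiv, h, evolve_relabel]
  rw [sum_bits_equiv (Equiv.sumAssoc α γ T.wires).symm]
  refine Finset.sum_congr rfl fun s _ => ?_
  rw [relabel_apply, Function.comp_assoc, Equiv.symm_comp_self, Function.comp_id]
  refine congrArg₂ (· * ·) rfl (congrArg₂ g rfl ?_)
  exact congrArg s (Equiv.symm_apply_apply _ _)

theorem size_addState (T : Test (α ⊕ γ)) (σ : Op γ) (hσ : IsState σ) :
    (T.addState σ hσ).size = T.size + Fintype.card γ := by
  refine (congrArg₂ (· + ·) Fintype.card_sum (List.length_map _)).trans ?_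
  simp only [size]
  omega

/-- The wires of a test with a register of spectators, in a different order. -/
def spectWires (R M W : Type) : (M ⊕ W) ⊕ R ≃ (R ⊕ M) ⊕ W where
  toFun
    | .inl (.inl m) => .inl (.inr m)
    | .inl (.inr w) => .inr w
    | .inr r => .inl (.inl r)
  invFun
    | .inl (.inr m) => .inl (.inl m)
    | .inr w => .inl (.inr w)
    | .inl (.inl r) => .inr r
  left_inv := by rintro ((m | w) | r) <;> rfl
  right_inv := by rintro ((r | m) | w) <;> rfl

/-- Add a register that the test does not touch. -/
def spect (T : Test M) (R : Type) : Test (R ⊕ M) where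
  wires := T.wires
  state := T.state
  isState := T.isState
  circ := T.circ.map (QGate.map (Function.Embedding.inl.trans (spectWires R M T.wires).toEmbedding))
  out := spectWires R M T.wires (.inl T.out)

/-- A register that is only measured at the end may be measured first, so coherences between its
basis states are irrelevant. -/
theorem expect_spect (T : Test M) (Γ : Op (R ⊕ M)) (g : (R → Bool) → Bool → ℝ) :
    (T.spect R).expect Γ (fun s o => g (s ∘ Sum.inl) o) =
      ∑ r, T.expect (diagBlock Γ r) fun _ o => g r o := by
  let X : Op ((M ⊕ T.wires) ⊕ R) :=
    CommitMeasure.relabel (spectWires R M T.wires).symm (tensOp Γ T.state)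
  have h : tensOp Γ T.state = CommitMeasure.relabel (spectWires R M T.wires) X := by
    ext s t
    simp only [X, relabel_apply, Function.comp_assoc, Equiv.self_comp_symm, Function.comp_id]
  have hX : ∀ r, (Matrix.of fun u v => X (Sum.elim u r) (Sum.elim v r)) =
      tensOp (diagBlock Γ r) T.state := by
    intro r
    ext s t
    simp only [Matrix.of_apply, X, relabel_apply, tensOp_apply, diagBlock]
    congr 2 <;> funext b <;> rcases b with b | b <;> rfl
  change runExpect (V := T.wires) T.state (T.circ.map
    (QGate.map (Function.Embedding.inl.trans (spectWires R M T.wires).toEmbedding)))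
    (spectWires R M T.wires (.inl T.out)) Γ _ = _
  simp only [runExpect, circMat_map_of_equiv (spectWires R M T.wires)
    (Function.Embedding.inl.trans (spectWires R M T.wires).toEmbedding) (fun _ => rfl), h,
    evolve_relabel]
  rw [sum_bits_equiv (spectWires R M T.wires).symm, sum_bits_sum, Finset.sum_comm]
  refine Finset.sum_congr rfl fun r _ => ?_
  rw [expect, runExpect]
  refine Finset.sum_congr rfl fun s _ => ?_
  rw [relabel_apply, Function.comp_assoc, Equiv.symm_comp_self, Function.comp_id,
    evolve_tensOp_one_apply, hX]
  congr 2
  rw [Function.comp_apply, Equiv.symm_apply_apply, Sum.elim_inl]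

theorem size_spect (T : Test M) (R : Type) : (T.spect R).size = T.size := by
  exact congrArg₂ (· + ·) rfl (List.length_map _)

theorem expect_zero (T : Test α) (g) : T.expect 0 g = 0 := by
  have : tensOp (0 : Op α) T.state = 0 := by ext s t; simp [tensOp_apply]
  simp [expect, runExpect, this, evolve]

theorem expect_smul_pureOp (T : Test α) (c : ℂ) (x : α → Bool) (g) :
    T.expect (c • pureOp x) g = c.re * T.expect (pureOp x) g := by
  have h : tensOp (c • pureOp x) T.state = c • tensOp (pureOp x) T.state := by
    ext s t; simp [tensOp_apply, mul_assoc]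
  have hpos := (((isState_pureOp x).tensOp T.isState).evolve
    (circMat_mem_unitaryGroup T.circ)).1
  rw [expect, expect, runExpect, runExpect, h, Finset.mul_sum]
  refine Finset.sum_congr rfl fun s _ => ?_
  have him : (evolve (circMat T.circ) (tensOp (pureOp x) T.state) s s).im = 0 :=
    (Complex.nonneg_iff.mp hpos.diag_nonneg).2.symm
  have : evolve (circMat T.circ) (c • tensOp (pureOp x) T.state) s s =
      c * evolve (circMat T.circ) (tensOp (pureOp x) T.state) s s := by
    simp [evolve]
  rw [this, Complex.mul_re, him]
  ring

/-- The joint law of the output bit on a classical input is determined by the acceptance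
probability. -/
theorem expect_pureOp (T : Test α) (x : α → Bool) (g : Bool → ℝ) :
    T.expect (pureOp x) (fun _ o => g o) =
      T.accept (pureOp x) * g true + (1 - T.accept (pureOp x)) * g false := by
  have hs := ((isState_pureOp x).tensOp T.isState).evolve (circMat_mem_unitaryGroup T.circ)
  have h1 : ∑ s, (evolve (circMat T.circ) (tensOp (pureOp x) T.state) s s).re = 1 := by
    rw [← Complex.re_sum]
    exact congrArg Complex.re hs.2
  have h0 : 1 - T.accept (pureOp x) = T.expect (pureOp x) fun _ o => if o then 0 else 1 := by
    rw [sub_eq_iff_eq_add]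
    refine h1.symm.trans ?_
    rw [accept, expect, expect, runExpect, runExpect, ← Finset.sum_add_distrib]
    refine Finset.sum_congr rfl fun s _ => ?_
    cases s T.out <;> simp
  rw [h0, accept, expect, expect, expect, runExpect, runExpect, runExpect, Finset.sum_mul,
    Finset.sum_mul, ← Finset.sum_add_distrib]
  refine Finset.sum_congr rfl fun s _ => ?_
  cases s T.out <;> simp

/-- Compute a function of a register and test its value. -/
def comp (T : Test M) (A : ClassicalAlg R M) : Test R :=
  ((((T.spect (R ⊕ Fin A.anc)).relabel (((Equiv.sumAssoc _ _ _).trans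
    ((Equiv.refl _).sumCongr (Equiv.sumComm _ _))).trans (Equiv.sumAssoc _ _ _).symm)).precomp
    ((A.gates.map QGate.classical).map (QGate.map (Equiv.sumAssoc _ _ _).symm.toEmbedding))).addState
    (pureOp fun _ => false) (isState_pureOp _)).addState (pureOp fun _ => false) (isState_pureOp _)

/-- The argument `r` is kept and measured, hence only the diagonal of `Γ` matters, and the test runs
on the classical value of the function. -/
theorem expect_comp (T : Test M) (A : ClassicalAlg R M) (Γ g) :
    (T.comp A).expect Γ g =
      ∑ r, (Γ r r).re * T.expect (pureOp (A.fn r)) fun _ o => g r o := by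
  rw [comp, expect_addState, expect_addState, expect_precomp, circMat_map_equiv, circMat_classical,
    evolve_classicalAlg, expect_relabel]
  refine (expect_spect T _ fun r o => g (r ∘ Sum.inl) o).trans ?_
  rw [sum_bits_sum]
  refine Finset.sum_congr rfl fun r _ => ?_
  have hinv := xorMap_involutive A.fn
  have hb : ∀ k : Fin A.anc → Bool, diagBlock (CommitMeasure.relabel (((Equiv.sumAssoc _ _ _).trans
    ((Equiv.refl _).sumCongr (Equiv.sumComm _ _))).trans (Equiv.sumAssoc _ _ _).symm).symm
      (tensOp (evolve (permOp (xorMap A.fn)) (tensOp Γ (pureOp fun _ => false)))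
        (pureOp fun _ => false))) (Sum.elim r k) =
      if k = fun _ => false then Γ r r • pureOp (A.fn r) else 0 := by
    intro k
    have hx : ∀ (s : M → Bool), (fun b => s b ^^ A.fn r b) = (fun _ => false) ↔ s = A.fn r := by
      intro s
      constructor
      · intro h; funext b; have := congrFun h b; simpa using this
      · rintro rfl; simp
    have hs : ∀ s : M → Bool, Sum.elim (Sum.elim r k) s ∘ (((Equiv.sumAssoc R (Fin A.anc) M).trans
        ((Equiv.refl _).sumCongr (Equiv.sumComm _ _))).trans (Equiv.sumAssoc _ _ _).symm).symm =
        Sum.elim (Sum.elim r s) k := by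
      intro s; funext b; rcases b with (b | b) | b <;> rfl
    ext s t
    simp only [diagBlock, Matrix.of_apply, relabel_apply, hs, tensOp_apply, Sum.elim_comp_inl,
      Sum.elim_comp_inr]
    rw [evolve_permOp_of_involutive hinv, xorMap_elim, xorMap_elim, tensOp_apply, pureOp_apply,
      pureOp_apply]
    simp only [Sum.elim_comp_inl, Sum.elim_comp_inr, hx, and_self]
    split_ifs with h₁ h₂ <;> simp_all [pureOp_apply]
  simp only [hb, Sum.elim_comp_inl]
  rw [Finset.sum_eq_single fun _ => false]
  · rw [if_pos rfl, expect_smul_pureOp]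
  · intro k _ hk
    rw [if_neg hk, expect_zero]
  · simp

theorem size_comp (T : Test M) (A : ClassicalAlg R M) :
    (T.comp A).size = T.size + A.size + Fintype.card M := by
  simp [comp, size_addState, size_precomp, size_relabel, size_spect, ClassicalAlg.size]
  omega

end Test

/-- A distinguisher as a test. -/
def Distinguisher.toTest (D : Distinguisher α) : Test α where
  wires := Fin D.work
  state := D.advice
  isState := D.isState
  circ := D.circ
  out := D.out

theorem Distinguisher.accept_toTest (D : Distinguisher α) (x) :
    D.toTest.accept (pureOp x) = D.accept x := by
  rw [Test.accept]
  change Test.runExpect (V := Fin D.work) D.advice D.circ D.out _ _ = _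
  rw [Test.runExpect, Distinguisher.accept, prob, withInput_eq]
  exact Finset.sum_congr rfl fun s _ => by simp [toTest]

theorem Distinguisher.size_toTest (D : Distinguisher α) : D.toTest.size = D.size := by
  change Fintype.card (Fin D.work) + D.circ.length = _
  simp [Distinguisher.size]

theorem Test.exists_distinguisher (T : Test α) :
    ∃ D : Distinguisher α, D.size = T.size ∧ ∀ x, D.accept x = T.accept (pureOp x) := by
  let e := Fintype.equivFin T.wires
  refine ⟨⟨Fintype.card T.wires, CommitMeasure.relabel e T.state, T.isState.relabel e,
    T.circ.map (QGate.map ((Equiv.refl α).sumCongr e).toEmbedding),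
    (Equiv.refl α).sumCongr e T.out⟩, by simp [Distinguisher.size, Test.size], fun x => ?_⟩
  have h : tensOp (pureOp x) (CommitMeasure.relabel e T.state) =
      CommitMeasure.relabel ((Equiv.refl α).sumCongr e) (tensOp (pureOp x) T.state) := rfl
  rw [Distinguisher.accept, withInput_eq, circMat_map_equiv, h, evolve_relabel, prob_relabel]
  rw [Test.accept, Test.expect, Test.runExpect, prob]
  exact Finset.sum_congr rfl fun s _ => by simp

end Tests

section Reductions

variable {α β M A Q S V : Type} [Fintype α] [DecidableEq α] [Fintype β] [DecidableEq β]
  [Fintype M] [DecidableEq M] [Fintype A] [DecidableEq A] [Fintype Q] [DecidableEq Q]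
  [Fintype S] [DecidableEq S] [Fintype V] [DecidableEq V]

/-- The diagonal block of an operator for fixed contents `s` of the last register. -/
def sideBlock (Γ : Op (Q ⊕ S)) (s : S → Bool) : Op Q :=
  Matrix.of fun u v => Γ (Sum.elim u s) (Sum.elim v s)

/-! ### Tests that attack a register -/

/-- Copy the wires `p a` of `Q`, apply the circuit `k` to `Q`, and test the value of a function of
all contents. -/
def Test.attack (T : Test M) (p : A → Option Q) (k : List (QGate Q))
    (G : ClassicalAlg ((Q ⊕ S) ⊕ A) M) : Test (Q ⊕ S) :=
  ((T.comp G).precomp ((copyGates (fun a => (p a).map .inl) Finset.univ.toList).map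
    QGate.classical ++ (k.map (QGate.map .inl)).map (QGate.map .inl))).addState
    (pureOp fun _ => false) (isState_pureOp _)

/-- A coherent copy that is not disturbed afterwards acts as a measurement of the copied wires with
outcome `a`. The register `S` is never acted on and may be treated as classical. -/
theorem Test.expect_attack (T : Test M) (p : A → Option Q) (k : List (QGate Q))
    (G : ClassicalAlg ((Q ⊕ S) ⊕ A) M) (Γ : Op (Q ⊕ S)) (g) :
    (T.attack p k G).expect Γ g = ∑ s, ∑ a, ∑ q,
      (evolve (circMat k) (restrict (fun u => decide (copied p u = a)) (sideBlock Γ s)) q q).re *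
        T.expect (pureOp (G.fn (Sum.elim (Sum.elim q s) a))) fun _ o => g (Sum.elim q s) o := by
  rw [Test.attack, Test.expect_addState, Test.expect_precomp, Test.expect_comp, sum_bits_sum,
    sum_bits_sum, Finset.sum_comm]
  refine Finset.sum_congr rfl fun s _ => ?_
  rw [Finset.sum_comm]
  refine Finset.sum_congr rfl fun a _ => Finset.sum_congr rfl fun q _ => ?_
  rw [circMat_append, circMat_map_inl, circMat_map_inl, circMat_classical, runGates_copyGates_univ,
    evolve_mul, evolve_tensOp_one_apply, evolve_tensOp_one_apply]
  congr 3
  congr 1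
  ext u v
  have hinv := xorMap_involutive (copied (α := Q ⊕ S) fun a => (p a).map .inl)
  have hz : ∀ u : Q → Bool, (fun b => a b ^^ copied (fun a => (p a).map Sum.inl) (Sum.elim u s) b) =
      (fun _ => false) ↔ copied p u = a := by
    intro u
    have : copied (fun a => (p a).map Sum.inl) (Sum.elim u s) = copied p u :=
      copied_map (Function.Embedding.inl : Q ↪ Q ⊕ S) p (Sum.elim u s)
    rw [this]
    constructor
    · intro h; funext b; have := congrFun h b; simp at this; exact this.symm
    · rintro rfl; simp
  simp only [Matrix.of_apply]
  rw [evolve_permOp_of_involutive hinv, xorMap_elim, xorMap_elim, tensOp_apply, pureOp_apply]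
  simp only [Sum.elim_comp_inl, Sum.elim_comp_inr, hz, restrict, Matrix.of_apply, sideBlock,
    decide_eq_true_eq]
  split_ifs <;> simp

theorem Test.size_attack_le (T : Test M) (p : A → Option Q) (k : List (QGate Q))
    (G : ClassicalAlg ((Q ⊕ S) ⊕ A) M) : (T.attack p k G).size ≤
      T.size + G.size + Fintype.card M + 2 * Fintype.card A + k.length := by
  rw [Test.attack, Test.size_addState, Test.size_precomp, Test.size_comp]
  have := length_copyGates_le (α := Q ⊕ S) (fun a => (p a).map .inl)
    (Finset.univ : Finset A).toList
  simp only [List.length_append, List.length_map, Finset.length_toList, Finset.card_univ] at this ⊢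
  omega

/-! ### Adversaries in the security games from tests -/

theorem exists_equiv_extending (f : α ↪ β) :
    ∃ n, n ≤ Fintype.card β ∧ ∃ e : α ⊕ Fin n ≃ β, ∀ a, e (.inl a) = f a := by
  classical
  let g := Fintype.equivFin {b // ¬ b ∈ Set.range f}
  refine ⟨Fintype.card {b // ¬ b ∈ Set.range f}, Fintype.card_subtype_le _,
    ((Equiv.ofInjective f f.injective).sumCongr g.symm).trans (Equiv.sumCompl _), fun a => ?_⟩
  rfl

theorem restrict_relabel (e : α ≃ β) (p : (β → Bool) → Bool) (ρ : Op α) :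
    restrict p (relabel e ρ) = relabel e (restrict (fun s => p (s ∘ e.symm)) ρ) := by
  ext s t
  simp [restrict, relabel_apply, Function.comp_assoc]

theorem dephase_relabel {γ : Type} [DecidableEq γ] (e : α ≃ β) (f : (β → Bool) → γ) (ρ : Op α) :
    dephase f (relabel e ρ) = relabel e (dephase (fun s => f (s ∘ e.symm)) ρ) := by
  ext s t
  simp [dephase, relabel_apply, Function.comp_assoc]

theorem restrict_tensOp (p : (α → Bool) → Bool) (ρ : Op α) (σ : Op β) :
    restrict (fun s => p (s ∘ Sum.inl)) (tensOp ρ σ) = tensOp (restrict p ρ) σ := by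
  ext s t
  simp [restrict, tensOp_apply]

theorem dephase_tensOp {γ : Type} [DecidableEq γ] (f : (α → Bool) → γ) (ρ : Op α) (σ : Op β) :
    dephase (fun s => f (s ∘ Sum.inl)) (tensOp ρ σ) = tensOp (dephase f ρ) σ := by
  ext s t
  simp [dephase, tensOp_apply]

/-- The registers of the public key, of the prover and of the secret keys, in a different order. -/
def inputWires (α S V : Type) : (α ⊕ V) ⊕ S ≃ (α ⊕ S) ⊕ V where
  toFun
    | .inl (.inl a) => .inl (.inl a)
    | .inl (.inr v) => .inr v
    | .inr s => .inl (.inr s)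
  invFun
    | .inl (.inl a) => .inl (.inl a)
    | .inr v => .inl (.inr v)
    | .inl (.inr s) => .inr s
  left_inv := by rintro ((a | v) | s) <;> rfl
  right_inv := by rintro ((a | s) | v) <;> rfl

theorem tensOp_inputWires (x : α → Bool) (s : S → Bool) (σ : Op V) :
    tensOp (pureOp (Sum.elim x s)) σ =
      relabel (inputWires α S V) (tensOp (tensOp (pureOp x) σ) (pureOp s)) := by
  rw [pureOp_sumElim]
  ext u v
  simp only [tensOp_apply, relabel_apply]
  rw [mul_right_comm]
  rfl

theorem exists_distinguisher_of_test (T : Test ((α ⊕ V) ⊕ S)) (c : List (QGate (α ⊕ V)))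
    {σ : Op V} (hσ : IsState σ) :
    ∃ D : Distinguisher (α ⊕ S), D.size = T.size + c.length + Fintype.card V ∧ ∀ x s,
      D.accept (Sum.elim x s) =
        T.accept (tensOp (evolve (circMat c) (tensOp (pureOp x) σ)) (pureOp s)) := by
  obtain ⟨D, hD, h⟩ := (((T.precomp (c.map (QGate.map .inl))).relabel
    (inputWires α S V)).addState σ hσ).exists_distinguisher
  refine ⟨D, ?_, fun x s => ?_⟩
  · rw [hD, Test.size_addState, Test.size_relabel, Test.size_precomp, List.length_map]
  · rw [h, Test.accept, Test.expect_addState, Test.expect_relabel, Test.expect_precomp,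
      tensOp_inputWires, circMat_map_inl]
    have : relabel (inputWires α S V).symm (relabel (inputWires α S V)
        (tensOp (tensOp (pureOp x) σ) (pureOp s))) =
        tensOp (tensOp (pureOp x) σ) (pureOp s) := by
      ext u v; simp [relabel_apply, Function.comp_assoc]
    rw [this, evolve_tensOp, evolve_one]
    rfl

/-- The circuit `c` is the preparation and the circuit of the test is the guess. The operations of
the challenger touch only the prover's wires selected by `f`, so they pass through the tensor
factors of the secret keys and of the advice of the test. -/
theorem exists_collapseAdv (F : TCF) (T : Test ((α ⊕ V) ⊕ S)) (c : List (QGate (α ⊕ V)))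
    {σ : Op V} (hσ : IsState σ) (f : Fin F.yLen ⊕ Fin (F.ℓ + 1) ↪ V) :
    ∃ D : CollapseAdv (α ⊕ S) F, D.size ≤ T.size + c.length + Fintype.card V ∧ ∀ pk x s b,
      D.outProb pk (Sum.elim x s) b =
        let ρ := restrict (fun u => F.check pk (fun k => u (.inr (f (.inr k))))
          fun k => u (.inr (f (.inl k)))) (dephase (fun u (k : Fin F.yLen) => u (.inr (f (.inl k))))
            (evolve (circMat c) (tensOp (pureOp x) σ)))
        T.accept (tensOp (if b then dephase (fun u => u (.inr (f (.inr 0)))) ρ else ρ)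
          (pureOp s)) := by
  obtain ⟨n, hn, e, he⟩ := exists_equiv_extending (f.trans (.inl : V ↪ V ⊕ T.wires))
  let e₀ : Fin F.yLen ⊕ (Fin (F.ℓ + 1) ⊕ Fin n) ≃ V ⊕ T.wires := (Equiv.sumAssoc _ _ _).symm.trans e
  let Φ : ((α ⊕ V) ⊕ S) ⊕ T.wires ≃ (α ⊕ S) ⊕ (Fin F.yLen ⊕ (Fin (F.ℓ + 1) ⊕ Fin n)) :=
    (((inputWires α S V).sumCongr (Equiv.refl _)).trans (Equiv.sumAssoc _ _ _)).trans
      ((Equiv.refl _).sumCongr e₀.symm)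
  have hy : ∀ k, Φ.symm (.inr (.inl k)) = .inl (.inl (.inr (f (.inl k)))) := by
    intro k
    have : e₀ (.inl k) = .inl (f (.inl k)) := he (.inl k)
    simp [Φ, this, inputWires]
  have hz : ∀ k, Φ.symm (.inr (.inr (.inl k))) = .inl (.inl (.inr (f (.inr k)))) := by
    intro k
    have : e₀ (.inr (.inl k)) = .inl (f (.inr k)) := he (.inr k)
    simp [Φ, this, inputWires]
  refine ⟨⟨n, relabel e₀.symm (tensOp σ T.state), (hσ.tensOp T.isState).relabel _,
    ((c.map (QGate.map .inl)).map (QGate.map .inl)).map (QGate.map Φ.toEmbedding),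
    T.circ.map (QGate.map Φ.toEmbedding), Φ T.out⟩, ?_, fun pk x s b => ?_⟩
  · simp only [CollapseAdv.size, List.length_map, Test.size, Fintype.card_sum] at hn ⊢
    omega
  · have hinit : tensOp (pureOp (Sum.elim x s)) (relabel e₀.symm (tensOp σ T.state)) =
        relabel Φ (tensOp (tensOp (tensOp (pureOp x) σ) (pureOp s)) T.state) := by
      have h₁ : tensOp (pureOp (Sum.elim x s)) (tensOp σ T.state) =
          relabel (Equiv.sumAssoc _ _ _) (tensOp (tensOp (pureOp (Sum.elim x s)) σ) T.state) := by
        ext u v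
        simp only [tensOp_apply, relabel_apply, mul_assoc]
        rfl
      have h₂ : tensOp (pureOp (Sum.elim x s)) (relabel e₀.symm (tensOp σ T.state)) =
          relabel ((Equiv.refl _).sumCongr e₀.symm)
            (tensOp (pureOp (Sum.elim x s)) (tensOp σ T.state)) := rfl
      rw [h₂, h₁, tensOp_inputWires]
      rfl
    simp only [CollapseAdv.outProb, withInput_eq, hinit, circMat_map_equiv, circMat_map_inl,
      evolve_relabel, evolve_tensOp, evolve_one, dephase_relabel, restrict_relabel,
      Function.comp_apply, hy, hz]
    have h₃ := fun ρ : Op (α ⊕ V) => dephase_tensOp (β := T.wires)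
      (fun (u : (α ⊕ V) ⊕ S → Bool) (k : Fin F.yLen) => u (.inl (.inr (f (.inl k)))))
      (tensOp ρ (pureOp s)) T.state
    have h₄ := fun ρ : Op (α ⊕ V) => dephase_tensOp
      (fun (u : α ⊕ V → Bool) (k : Fin F.yLen) => u (.inr (f (.inl k)))) ρ (pureOp s)
    have h₅ := fun ρ : Op (α ⊕ V) => restrict_tensOp (β := T.wires)
      (fun (u : (α ⊕ V) ⊕ S → Bool) => F.check pk (fun k => u (.inl (.inr (f (.inr k)))))
          fun k => u (.inl (.inr (f (.inl k))))) (tensOp ρ (pureOp s)) T.state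
    have h₆ := fun ρ : Op (α ⊕ V) => restrict_tensOp
      (fun (u : α ⊕ V → Bool) => F.check pk (fun k => u (.inr (f (.inr k))))
          fun k => u (.inr (f (.inl k)))) ρ (pureOp s)
    have h₇ := fun ρ : Op (α ⊕ V) => dephase_tensOp (β := T.wires)
      (fun (u : (α ⊕ V) ⊕ S → Bool) => u (.inl (.inr (f (.inr 0)))))
      (tensOp ρ (pureOp s)) T.state
    have h₈ := fun ρ : Op (α ⊕ V) => dephase_tensOp
      (fun (u : α ⊕ V → Bool) => u (.inr (f (.inr 0)))) ρ (pureOp s)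
    simp only [Function.comp_apply] at h₃ h₄ h₅ h₆ h₇ h₈
    have hfin : ∀ ρ : Op (α ⊕ V), prob (relabel Φ (evolve (circMat T.circ)
        (tensOp (tensOp ρ (pureOp s)) T.state))) (fun u => u (Φ T.out)) =
        T.accept (tensOp ρ (pureOp s)) := by
      intro ρ
      rw [prob_relabel, prob, Test.accept, Test.expect, Test.runExpect]
      exact Finset.sum_congr rfl fun u _ => by simp
    cases b
    · simp only [Bool.false_eq_true, if_false, h₃, h₄, h₅, h₆, evolve_relabel]
      exact hfin _
    · simp only [if_true, h₃, h₄, h₅, h₆, h₇, h₈, dephase_relabel, evolve_relabel,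
        Function.comp_apply, hz]
      exact hfin _

/-- The event that the adversary wins in the adaptive hardcore bit game for the value `c`. -/
def hardcoreWin (F : TCF) (pk : Fin F.pkLen → Bool) (sk : Fin F.skLen → Bool)
    (y : Fin F.yLen → Bool) (d z : Fin (F.ℓ + 1) → Bool) (c : Bool) : Bool :=
  F.check pk z y &&
    (F.invertTwo sk y).elim false fun p => F.good p.1 p.2 d && (dotClaw p.1 p.2 d == c)

/-- The output registers are filled by copies of `y`, `d` and `z`, and the answer of the test is
then added to the first bit of `d`. All of this is a permutation of basis states followed by a
measurement, so it can be moved into the event. -/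
theorem exists_hardcoreAdv (F : TCF) (T : Test (α ⊕ V)) {σ : Op V} (hσ : IsState σ)
    (fy : Fin F.yLen → V) (fd fz : Fin (F.ℓ + 1) → V) :
    ∃ D : HardcoreAdv α F, D.size ≤ T.size + Fintype.card V + 2 * (F.yLen + 2 * (F.ℓ + 1)) ∧
      ∀ pk sk x c, D.winProb pk sk x c = T.expect (tensOp (pureOp x) σ) fun u o =>
        if hardcoreWin F pk sk (fun k => u (.inr (fy k)))
          (fun k => u (.inr (fd k)) ^^ (decide (k = 0) && o)) (fun k => u (.inr (fz k))) c
        then 1 else 0 := by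
  let e := Fintype.equivFin (V ⊕ T.wires)
  let Γ := Fin F.yLen ⊕ (Fin (F.ℓ + 1) ⊕ Fin (F.ℓ + 1))
  let p₁ : Fin F.yLen ⊕ (Fin (F.ℓ + 1) ⊕ Fin (F.ℓ + 1)) → Option ((α ⊕ V) ⊕ T.wires) := fun b =>
    some (.inl (.inr (Sum.elim fy (Sum.elim fd fz) b)))
  -- The second round of copies writes the answer of the test onto the first bit of `d`, the bit
  -- whose coefficient in the inner product is always `1`.
  let p₂ : Fin F.yLen ⊕ (Fin (F.ℓ + 1) ⊕ Fin (F.ℓ + 1)) → Option ((α ⊕ V) ⊕ T.wires) := fun b =>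
    if b = .inr (.inl 0) then some T.out else none
  let Ψ : ((α ⊕ V) ⊕ T.wires) ⊕ (Fin F.yLen ⊕ (Fin (F.ℓ + 1) ⊕ Fin (F.ℓ + 1))) ≃
      α ⊕ ((Fin F.yLen ⊕ (Fin (F.ℓ + 1) ⊕ Fin (F.ℓ + 1))) ⊕ Fin (Fintype.card (V ⊕ T.wires))) :=
    (((Equiv.sumAssoc _ _ _).sumCongr (Equiv.refl _)).trans (Equiv.sumAssoc _ _ _)).trans
      ((Equiv.refl _).sumCongr ((Equiv.sumComm _ _).trans ((Equiv.refl _).sumCongr e)))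
  refine ⟨⟨Fintype.card (V ⊕ T.wires), relabel ((Equiv.refl _).sumCongr e)
    (tensOp (pureOp fun _ => false) (tensOp σ T.state)),
    ((isState_pureOp _).tensOp (hσ.tensOp T.isState)).relabel _,
    (T.circ.map (QGate.map .inl) ++ (copyGates p₁ Finset.univ.toList ++
      copyGates p₂ Finset.univ.toList).map QGate.classical).map (QGate.map Ψ.toEmbedding)⟩, ?_,
    fun pk sk x c => ?_⟩
  · have h₁ := length_copyGates_le p₁ Finset.univ.toList
    have h₂ := length_copyGates_le p₂ Finset.univ.toList
    simp only [HardcoreAdv.size, List.length_append, List.length_map, Test.size,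
      Finset.length_toList, Finset.card_univ, Fintype.card_sum, Fintype.card_fin] at h₁ h₂ ⊢
    omega
  · have hinit : tensOp (pureOp x) (relabel ((Equiv.refl _).sumCongr e)
        (tensOp (pureOp fun _ => false) (tensOp σ T.state))) =
        relabel Ψ (tensOp (tensOp (tensOp (pureOp x) σ) T.state) (pureOp fun _ => false)) := by
      ext u v
      simp only [tensOp_apply, relabel_apply]
      rw [mul_comm (pureOp (fun _ => false) _ _), ← mul_assoc, ← mul_assoc]
      rfl
    have hy : ∀ k, Ψ.symm (.inr (.inl (.inl k))) = .inr (.inl k) := fun _ => rfl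
    have hd : ∀ k, Ψ.symm (.inr (.inl (.inr (.inl k)))) = .inr (.inr (.inl k)) := fun _ => rfl
    have hz : ∀ k, Ψ.symm (.inr (.inl (.inr (.inr k)))) = .inr (.inr (.inr k)) := fun _ => rfl
    have hbij : ∀ p : Fin F.yLen ⊕ (Fin (F.ℓ + 1) ⊕ Fin (F.ℓ + 1)) → Option ((α ⊕ V) ⊕ T.wires),
        Function.Bijective (xorMap (copied p)) := fun p => (xorMap_involutive _).bijective
    rw [HardcoreAdv.winProb, withInput_eq, hinit, circMat_map_equiv, evolve_relabel, prob_relabel,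
      circMat_append, circMat_classical, circMat_map_inl, evolve_mul, evolve_tensOp, evolve_one,
      funext (runGates_append _ _), runGates_copyGates_univ, runGates_copyGates_univ]
    change prob (evolve (permOp (xorMap (copied p₂) ∘ xorMap (copied p₁))) _) _ = _
    rw [← permOp_mul, evolve_mul, prob_evolve_permOp (hbij p₂), prob_evolve_permOp (hbij p₁),
      Test.expect, Test.runExpect, prob, sum_bits_sum]
    refine Finset.sum_congr rfl fun u _ => ?_
    rw [Finset.sum_eq_single fun _ => false]
    · simp only [tensOp_apply, Sum.elim_comp_inl, Sum.elim_comp_inr, pureOp_apply, and_self,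
        if_true, mul_one]
      simp only [xorMap_elim, Function.comp_apply, hy, hd, hz, Sum.elim_inr]
      have hc₁ : ∀ k, copied p₁ u (.inl k) = u (.inl (.inr (fy k))) := fun _ => rfl
      have hc₂ : ∀ k, copied p₁ u (.inr (.inl k)) = u (.inl (.inr (fd k))) := fun _ => rfl
      have hc₃ : ∀ k, copied p₁ u (.inr (.inr k)) = u (.inl (.inr (fz k))) := fun _ => rfl
      have hc₄ : ∀ k, copied p₂ u (.inl k) = false := fun _ => rfl
      have hc₅ : ∀ k, copied p₂ u (.inr (.inl k)) = (decide (k = 0) && u T.out) := by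
        intro k
        by_cases hk : k = 0
        · subst hk; simp [copied, p₂]
        · simp [copied, p₂, hk]
      have hc₆ : ∀ k, copied p₂ u (.inr (.inr k)) = false := by
        intro k; simp [copied, p₂]
      simp only [hc₁, hc₂, hc₃, hc₄, hc₅, hc₆, Bool.false_xor, Bool.xor_false]
      rw [mul_ite, mul_one, mul_zero]
      rfl
    · intro b _ hb
      simp [tensOp_apply, pureOp_apply, hb]
    · simp

end Reductions

/-! ### The measurement round with controlled phases -/

/-- Pauli `Z` gates on the wires `f i` with `σ i = true`. -/
def phaseCirc {N : ℕ} {α : Type} (f : Fin N → α) (σ : Fin N → Bool) (l : List (Fin N)) :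
    List (QGate α) :=
  l.flatMap fun i => if σ i then List.replicate 4 (.phaseT (f i)) else []

theorem length_phaseCirc_le {N : ℕ} {α : Type} (f : Fin N → α) (σ : Fin N → Bool)
    (l : List (Fin N)) : (phaseCirc f σ l).length ≤ 4 * l.length := by
  induction l with
  | nil => simp [phaseCirc]
  | cons i l ih =>
    have : (phaseCirc f σ (i :: l)).length =
        (if σ i then List.replicate 4 (QGate.phaseT (f i)) else []).length +
          (phaseCirc f σ l).length := by simp [phaseCirc]
    rw [this, List.length_cons]
    split_ifs <;> simp <;> omega

theorem circMat_phaseCirc {N : ℕ} {α : Type} [Fintype α] [DecidableEq α] (f : Fin N → α)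
    (σ : Fin N → Bool) (l : List (Fin N)) : circMat (phaseCirc f σ l) =
      Matrix.diagonal fun s => (l.map fun i => if σ i && s (f i) then (-1 : ℂ) else 1).prod := by
  induction l with
  | nil => simp [phaseCirc, circMat]
  | cons i l ih =>
    have h : phaseCirc f σ (i :: l) = (if σ i then List.replicate 4 (QGate.phaseT (f i)) else []) ++
        phaseCirc f σ l := by simp [phaseCirc]
    have hT : circMat (if σ i then List.replicate 4 (QGate.phaseT (f i)) else []) =
        Matrix.diagonal fun s => if σ i && s (f i) then (-1 : ℂ) else 1 := by
      -- Four `T` gates make a Pauli `Z`, as `exp(iπ/4)^4 = -1`.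
      have h4 : Complex.exp (Complex.I * (Real.pi / 4 : ℝ)) ^ 4 = -1 := by
        rw [← Complex.exp_nat_mul, ← Complex.exp_pi_mul_I]
        congr 1
        push_cast
        ring
      cases σ i
      · simp [circMat]
      · simp only [if_true, Bool.true_and, List.replicate, circMat, one_mul, QGate.mat,
          Matrix.diagonal_mul_diagonal]
        congr 1
        funext s
        split_ifs with hs
        · rw [← h4]; ring
        · simp
    rw [h, circMat_append, ih, hT, Matrix.diagonal_mul_diagonal]
    congr 1
    funext s
    rw [List.map_cons, List.prod_cons, mul_comm]

section Score

variable {F : TCF} {B : BatchKeyGen F}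

/-- The bits that are copied for a measurement in the standard basis, where `h` is the basis. -/
def copyMask {ι : Type} (h : Fin B.N → Bool) (w : ZWire B ⊕ ι → Bool) (i : Fin B.N) : Bool :=
  !h i && w (.inl (i, 0))

/-- The output string: decoded bits at positions in `T`, copied bits elsewhere, and a mask. -/
def outStr (B : BatchKeyGen F) (T : Fin B.N → Bool) (sk : Fin B.N → Fin F.skLen → Bool)
    (y : YWire B → Bool) (u m₀ : Fin B.N → Bool) (z : ZWire B → Bool) (a : Fin B.N → Bool)
    (i : Fin B.N) : Bool :=
  (if T i then decodeBits B sk y z u i else a i) ^^ m₀ i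

namespace Prover

variable (P : Prover B)

/-- The wires of the public key and of the prover. -/
abbrev Wires := Fin B.PKLen ⊕ (YWire B ⊕ (ZWire B ⊕ Fin P.aux))

/-- The circuit of the attack after Pauli `Z` operators on the first bits of the blocks `i` with
`σ i = true`, with Hadamard gates on the opening register. -/
def attackCirc (σ : Fin B.N → Bool) : List (QGate P.Wires) :=
  phaseCirc (fun i => .inr (.inr (.inl (i, 0)))) σ Finset.univ.toList ++ (P.attack ++
    ((Finset.univ : Finset (ZWire B)).toList.map fun p => .inr (.inr (.inl p))).map QGate.had)

/-- The operator of `attackCirc` for fixed public key and commitment. -/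
def attackOp (PK : Fin B.PKLen → Bool) (y : YWire B → Bool) (σ : Fin B.N → Bool) :
    Op (ZWire B ⊕ Fin P.aux) :=
  hadOpen B (Fin P.aux) * P.U PK y * Matrix.diagonal fun w => phase σ (firstBits B w)

/-- The expectation of `φ` for the outcome of the attack and of the copied bits. -/
def score (PK : Fin B.PKLen → Bool) (y : YWire B → Bool) (σ h : Fin B.N → Bool)
    (ρ : Op (ZWire B ⊕ Fin P.aux)) (φ : (ZWire B → Bool) → (Fin B.N → Bool) → ℝ) : ℝ :=
  ∑ a, ∑ w, (evolve (P.attackOp PK y σ) (restrict (fun w => decide (copyMask h w = a)) ρ) w w).re *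
    φ (w ∘ Sum.inl) a

/-- Operators that are controlled on the public key and the commitment. -/
def IsControlled (M : Op P.Wires) : Prop :=
  ∀ s t, (s ∘ Sum.inl ≠ t ∘ Sum.inl ∨ s ∘ Sum.inr ∘ Sum.inl ≠ t ∘ Sum.inr ∘ Sum.inl) → M s t = 0

variable {P}

/-- In the matrix product only intermediate states with the same public key and commitment
contribute. It is enough that the left factor is controlled. -/
theorem block_mul {M : Op P.Wires} (hM : P.IsControlled M) (M' : Op P.Wires) (PK y) :
    P.block (M * M') PK y = P.block M PK y * P.block M' PK y := by
  ext s t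
  rw [block, Matrix.submatrix_apply, Matrix.mul_apply, sum_bits_sum,
    Finset.sum_eq_single PK, sum_bits_sum, Finset.sum_eq_single y]
  · rfl
  · intro y' _ hy
    refine Finset.sum_eq_zero fun w _ => ?_
    rw [hM (Sum.elim PK (Sum.elim y s)) (Sum.elim PK (Sum.elim y' w)) (.inr fun h => hy h.symm),
      zero_mul]
  · simp
  · intro PK' _ h'
    refine Finset.sum_eq_zero fun w _ => ?_
    rw [hM (Sum.elim PK (Sum.elim y s)) (Sum.elim PK' w) (.inl fun h => h' h.symm), zero_mul]
  · simp

theorem IsControlled.mul {M M' : Op P.Wires} (hM : P.IsControlled M) (hM' : P.IsControlled M') :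
    P.IsControlled (M * M') := by
  intro s t hst
  rw [Matrix.mul_apply]
  refine Finset.sum_eq_zero fun u _ => ?_
  by_cases h : s ∘ Sum.inl ≠ u ∘ Sum.inl ∨ s ∘ Sum.inr ∘ Sum.inl ≠ u ∘ Sum.inr ∘ Sum.inl
  · rw [hM s u h, zero_mul]
  · push Not at h
    rw [hM' u t (by rwa [h.1, h.2] at hst), mul_zero]

theorem block_evolve {M : Op P.Wires} (hM : P.IsControlled M) (Γ : Op P.Wires) (PK y) :
    P.block (evolve M Γ) PK y = evolve (P.block M PK y) (P.block Γ PK y) := by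
  have h : P.block (M * (Γ * Mᴴ)) PK y = P.block M PK y * P.block (Γ * Mᴴ) PK y := block_mul hM _ _ _
  have h' : (P.block (Γ * Mᴴ) PK y)ᴴ = P.block (M * Γᴴ) PK y := by
    rw [block, Matrix.conjTranspose_submatrix, Matrix.conjTranspose_mul,
      Matrix.conjTranspose_conjTranspose]
    rfl
  have h'' := congrArg Matrix.conjTranspose (h'.trans (block_mul hM _ _ _))
  rw [Matrix.conjTranspose_conjTranspose, Matrix.conjTranspose_mul] at h''
  rw [evolve, Matrix.mul_assoc, h, h'', evolve, Matrix.mul_assoc]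
  congr 2
  rw [block, Matrix.conjTranspose_submatrix, Matrix.conjTranspose_conjTranspose]
  rfl

theorem isControlled_diagonal (d : (P.Wires → Bool) → ℂ) : P.IsControlled (Matrix.diagonal d) := by
  intro s t h
  refine Matrix.diagonal_apply_ne _ ?_
  rintro rfl
  simp at h

variable (P) in
/-- The mask of the opening register. -/
def openMask : P.Wires → Bool :=
  Sum.elim (fun _ => false) (Sum.elim (fun _ => false) (Sum.elim (fun _ => true) fun _ => false))

theorem isControlled_hadOn : P.IsControlled (hadOn P.openMask) := by
  rintro s t (h | h)
  · obtain ⟨a, ha⟩ := Function.ne_iff.mp h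
    exact hadOn_apply_eq_zero (a := .inl a) rfl ha
  · obtain ⟨a, ha⟩ := Function.ne_iff.mp h
    exact hadOn_apply_eq_zero (a := .inr (.inl a)) rfl ha

theorem block_attackCirc (σ : Fin B.N → Bool) (PK y) :
    P.IsControlled (circMat (P.attackCirc σ)) ∧
      P.block (circMat (P.attackCirc σ)) PK y = P.attackOp PK y σ := by
  have hhad : circMat (((Finset.univ : Finset (ZWire B)).toList.map fun p =>
      (.inr (.inr (.inl p)) : P.Wires)).map QGate.had) = hadOn P.openMask := by
    refine circMat_map_had ⟨fun p => (.inr (.inr (.inl p)) : P.Wires), fun p q h => by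
      simpa using h⟩ _ ?_
    rintro (a | a | a | a)
    · exact iff_of_false Bool.false_ne_true fun ⟨_, h⟩ => nomatch h
    · exact iff_of_false Bool.false_ne_true fun ⟨_, h⟩ => nomatch h
    · exact iff_of_true rfl ⟨a, rfl⟩
    · exact iff_of_false Bool.false_ne_true fun ⟨_, h⟩ => nomatch h
  have hatt : P.IsControlled (circMat P.attack) := P.attack_controlled
  rw [attackCirc, circMat_append, circMat_append, hhad, circMat_phaseCirc]
  refine ⟨(isControlled_hadOn.mul hatt).mul (isControlled_diagonal _), ?_⟩
  rw [block_mul (isControlled_hadOn.mul hatt), block_mul isControlled_hadOn]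
  have h₁ : P.block (hadOn P.openMask) PK y = hadOpen B (Fin P.aux) := by
    ext s t
    rw [block, Matrix.submatrix_apply, openMask, hadOn_sumElim, hadOn_sumElim, hadOn_false,
      hadOn_false]
    simp only [tensOp_apply, Sum.elim_comp_inl, Sum.elim_comp_inr]
    refine (congrArg₂ (· * ·) (Matrix.one_apply_eq PK)
      (congrArg (· * _) (Matrix.one_apply_eq y))).trans ?_
    simp only [one_mul]
    rfl
  have h₂ : P.block (Matrix.diagonal fun s => ((Finset.univ : Finset (Fin B.N)).toList.map fun i =>
      if σ i && s (.inr (.inr (.inl (i, 0)))) then (-1 : ℂ) else 1).prod) PK y =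
      Matrix.diagonal fun w => phase σ (firstBits B w) := by
    ext s t
    rw [block, Matrix.submatrix_apply]
    by_cases hst : s = t
    · subst hst
      rw [Matrix.diagonal_apply_eq, Matrix.diagonal_apply_eq, Finset.prod_map_toList]
      rfl
    · rw [Matrix.diagonal_apply_ne _ hst, Matrix.diagonal_apply_ne]
      intro h
      exact hst (congrArg (fun f => f ∘ Sum.inr ∘ Sum.inr) h)
  rw [h₁, h₂]
  rfl

theorem length_attackCirc_le (σ : Fin B.N → Bool) :
    (P.attackCirc σ).length ≤ 4 * B.N + P.size + B.N * (F.ℓ + 1) := by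
  have := length_phaseCirc_le (fun i => (.inr (.inr (.inl (i, 0))) : P.Wires)) σ Finset.univ.toList
  simp only [attackCirc, List.length_append, List.length_map, Finset.length_toList,
    Finset.card_univ, Fintype.card_prod, Fintype.card_fin, size] at this ⊢
  omega

/-- The state after the commitment phase. -/
def commitState (P : Prover B) (PK : Fin B.PKLen → Bool) : Op P.Wires :=
  evolve (circMat P.commit) (tensOp (pureOp PK) P.init)

theorem block_commitState (PK PK' : Fin B.PKLen → Bool) (y) :
    P.block (P.commitState PK) PK' y = if PK' = PK then P.state PK y else 0 := by
  split_ifs with h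
  · subst h
    rw [state, withInput_eq]
    rfl
  · ext s t
    rw [block, Matrix.submatrix_apply, commitState, evolve_apply]
    refine Finset.sum_eq_zero fun u _ => Finset.sum_eq_zero fun v _ => ?_
    by_cases hu : PK' = u ∘ Sum.inl
    · rw [tensOp_apply, pureOp_apply, ← hu, if_neg fun hh => h hh.1]
      simp
    · rw [P.commit_controlled (Sum.elim PK' (Sum.elim y s)) u hu]
      simp

/-- The wires that are copied for the positions in the standard basis. -/
def copyWires (P : Prover B) (h : Fin B.N → Bool) (i : Fin B.N) : Option P.Wires :=
  if h i then none else some (.inr (.inr (.inl (i, 0))))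

theorem copied_copyWires (h : Fin B.N → Bool) (PK y) (w : ZWire B ⊕ Fin P.aux → Bool) :
    copied (P.copyWires h) (Sum.elim PK (Sum.elim y w)) = copyMask h w := by
  funext i
  rw [copied, copyWires, copyMask]
  cases h i <;> simp

/-- The public key is classical and the attack circuit preserves the commitment, so only the
diagonal blocks `Λ s y` of the state enter: the commitment may be regarded as measured although the
circuit never measures it. -/
theorem expect_attack {M S : Type} [Fintype M] [DecidableEq M] [Fintype S] [DecidableEq S]
    (T : Test M) (h σ : Fin B.N → Bool) (G : ClassicalAlg ((P.Wires ⊕ S) ⊕ Fin B.N) M)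
    (Γ : Op (P.Wires ⊕ S)) (PK : Fin B.PKLen → Bool)
    (Λ : (S → Bool) → (YWire B → Bool) → Op (ZWire B ⊕ Fin P.aux))
    (hΓ : ∀ s PK' y, P.block (sideBlock Γ s) PK' y = if PK' = PK then Λ s y else 0) (g) :
    (T.attack (P.copyWires h) (P.attackCirc σ) G).expect Γ g = ∑ s, ∑ y, ∑ a, ∑ w,
      (evolve (P.attackOp PK y σ) (restrict (fun w => decide (copyMask h w = a)) (Λ s y)) w w).re *
        T.expect (pureOp (G.fn (Sum.elim (Sum.elim (Sum.elim PK (Sum.elim y w)) s) a)))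
          fun _ o => g (Sum.elim (Sum.elim PK (Sum.elim y w)) s) o := by
  rw [Test.expect_attack]
  refine Finset.sum_congr rfl fun s _ => ?_
  rw [Finset.sum_comm (s := Finset.univ (α := YWire B → Bool))]
  refine Finset.sum_congr rfl fun a _ => ?_
  have hev : ∀ PK' y w, evolve (circMat (P.attackCirc σ))
      (restrict (fun u => decide (copied (P.copyWires h) u = a)) (sideBlock Γ s))
      (Sum.elim PK' (Sum.elim y w)) (Sum.elim PK' (Sum.elim y w)) =
      evolve (P.attackOp PK' y σ) (restrict (fun w => decide (copyMask h w = a))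
        (if PK' = PK then Λ s y else 0)) w w := by
    intro PK' y w
    have hb := congrFun (congrFun (block_evolve (block_attackCirc σ PK' y).1
      (restrict (fun u => decide (copied (P.copyWires h) u = a)) (sideBlock Γ s)) PK' y) w) w
    refine hb.trans ?_
    rw [(block_attackCirc σ PK' y).2, ← hΓ]
    congr 2
    ext u v
    simp only [block, Matrix.submatrix_apply, restrict, Matrix.of_apply, copied_copyWires]
  rw [sum_bits_sum, Finset.sum_eq_single PK, sum_bits_sum]
  · refine Finset.sum_congr rfl fun y _ => Finset.sum_congr rfl fun w _ => ?_
    rw [hev, if_pos rfl]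
  · intro PK' _ hne
    rw [sum_bits_sum]
    refine Finset.sum_eq_zero fun y _ => Finset.sum_eq_zero fun w _ => ?_
    have h0 : restrict (fun w => decide (copyMask h w = a))
        (0 : Op (ZWire B ⊕ Fin P.aux)) = 0 := by
      ext u v; simp [restrict]
    rw [hev, if_neg hne, h0]
    simp [evolve]
  · simp

end Prover

end Score

/-- A bound for the size of the algorithm that decodes one bit. -/
def TCF.decodeSize (F : TCF) : ℕ := 2 * F.invertTwoAlg.size + 4 * F.goodAlg.size + 10 * F.ℓ + 21

/-- The sign of the hardcore bit, and `0` where it is not defined. -/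
def hardcoreSign (F : TCF) (sk : Fin F.skLen → Bool) (y : Fin F.yLen → Bool)
    (d : Fin (F.ℓ + 1) → Bool) : ℝ :=
  ((F.invertTwo sk y).filter fun p => F.good p.1 p.2 d).elim 0
    fun p => if dotClaw p.1 p.2 d then -1 else 1

/-- The first coordinate of `(1, x₀ ⊕ x₁)` is `1`. -/
theorem dotClaw_flip {ℓ : ℕ} (x₀ x₁ : Fin ℓ → Bool) (d : Fin (ℓ + 1) → Bool) (o : Bool) :
    dotClaw x₀ x₁ (fun k => d k ^^ (decide (k = 0) && o)) = (dotClaw x₀ x₁ d ^^ o) := by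
  have hs : ∀ k : Fin ℓ, (d k.succ ^^ (decide (k.succ = 0) && o)) = d k.succ := by
    intro k; simp
  rw [dotClaw, dotClaw]
  simp only [hs]
  generalize ∑ k : Fin ℓ, (d k.succ && (x₀ k ^^ x₁ k)).toNat = n
  rcases Nat.mod_two_eq_zero_or_one n with h | h <;> cases d 0 <;> cases o <;>
    simp [Nat.add_mod, h]

/-- `Good` ignores the first bit of `d`, so the correction by `o` keeps `d` in the set and adds `o`
to the inner product. The difference of the two winning events is then the sign of the hardcore bit
times the sign of `o`. -/
theorem hardcoreWin_sub (F : TCF) (pk : Fin F.pkLen → Bool) (sk : Fin F.skLen → Bool)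
    (y : Fin F.yLen → Bool) (d z : Fin (F.ℓ + 1) → Bool) (o : Bool) :
    ((if hardcoreWin F pk sk y (fun k => d k ^^ (decide (k = 0) && o)) z false then 1 else 0 : ℝ) -
      if hardcoreWin F pk sk y (fun k => d k ^^ (decide (k = 0) && o)) z true then 1 else 0) =
    if F.check pk z y then hardcoreSign F sk y d * (if o then -1 else 1) else 0 := by
  have hgood : ∀ x₀ x₁ : Fin F.ℓ → Bool,
      F.good x₀ x₁ (fun k => d k ^^ (decide (k = 0) && o)) = F.good x₀ x₁ d := by
    intro x₀ x₁
    rw [TCF.good, TCF.good]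
    congr 2
    have : Fin.tail (fun k => d k ^^ (decide (k = 0) && o)) = Fin.tail d := by
      funext k; simp [Fin.tail]
    rw [this]
  rw [hardcoreWin, hardcoreWin, hardcoreSign]
  cases F.check pk z y
  · simp
  · rcases F.invertTwo sk y with _ | p
    · simp
    · simp only [Option.elim_some, hgood, dotClaw_flip, Bool.true_and, if_true, Option.filter]
      by_cases hg : F.good p.1 p.2 d = true
      · by_cases ht : dotClaw p.1 p.2 d = true <;> cases o <;> simp [hg, ht]
      · simp [hg]

/-! ### The attack of the prover as an adversary in the security games -/

namespace Prover

variable {F : TCF} {B : BatchKeyGen F} (P : Prover B)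

theorem computedWithin_outStr {S : Type} [Fintype S] [DecidableEq S]
    (f : Fin B.N × Fin F.skLen ↪ S) (T u m₀ : Fin B.N → Bool) :
    ComputedWithin (α := (P.Wires ⊕ S) ⊕ Fin B.N) (fun s => outStr B T
      (fun i k => s (.inl (.inr (f (i, k))))) (fun p => s (.inl (.inl (.inr (.inl p))))) u m₀
      (fun p => s (.inl (.inl (.inr (.inr (.inl p)))))) fun i => s (.inr i))
      (B.N * (F.decodeSize + 4)) := by
  refine (computedWithin_pi (k := fun _ => F.decodeSize + 4) fun i => ?_).mono (by simp)
  by_cases hT : T i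
  · have h := (computedWithin_const_bit (α := (P.Wires ⊕ S) ⊕ Fin B.N) (u i)).bind
      (F.decodeBit_computedWithin.comp_injective
        (α' := ((P.Wires ⊕ S) ⊕ Fin B.N) ⊕ Unit)
        (i := Sum.elim (fun k => .inl (.inl (.inr (f (i, k)))))
          (Sum.elim (fun k => .inl (.inl (.inl (.inr (.inl (i, k))))))
          (Sum.elim (fun k => .inl (.inl (.inl (.inr (.inr (.inl (i, k)))))))
            fun _ => .inr ()))) (by
        rintro (a | a | a | a) (b | b | b | b) h <;> simp at h ⊢ <;> exact h))
    refine (h.xor (computedWithin_const_bit (m₀ i))).congr (fun s _ => ?_)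
      (by rw [Fintype.card_unit, TCF.decodeSize]; omega)
    simp only [outStr, hT, if_true]
    rfl
  · refine ((computedWithin_wire (.inr i)).xor (computedWithin_const_bit (m₀ i))).congr
      (fun s _ => ?_) (by omega)
    simp [outStr, hT]

/-- A bound for the overhead of the reductions. -/
def reductionSize : ℕ :=
  3 * P.size + B.N * (F.decodeSize + F.yLen + 2 * F.ℓ + 20) + 8 * (F.ℓ + 1) + 2 * F.yLen

theorem size_attack_le (D : Distinguisher (Fin B.N)) {S : Type} [Fintype S] [DecidableEq S]
    (h σ : Fin B.N → Bool) (G : ClassicalAlg ((P.Wires ⊕ S) ⊕ Fin B.N) (Fin B.N))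
    (hG : G.size ≤ B.N * (F.decodeSize + 4)) :
    (D.toTest.attack (P.copyWires h) (P.attackCirc σ) G).size + P.commit.length +
      Fintype.card (YWire B ⊕ (ZWire B ⊕ Fin P.aux)) + 6 * (F.ℓ + 1) + 2 * F.yLen ≤
        P.reductionSize + D.size := by
  have h₁ := D.toTest.size_attack_le (P.copyWires h) (P.attackCirc σ) G
  have h₂ := length_attackCirc_le (P := P) σ
  have h₃ : P.aux + P.commit.length ≤ P.size := by rw [size]; omega
  rw [D.size_toTest] at h₁
  simp only [Fintype.card_sum, Fintype.card_prod, Fintype.card_fin, reductionSize, mul_add,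
    mul_comm B.N 2] at h₁ h₂ hG ⊢
  have h₄ : B.N * (2 * F.ℓ) = 2 * (B.N * F.ℓ) := by ring
  omega

theorem score_add (PK y σ h) (ρ ρ' : Op (ZWire B ⊕ Fin P.aux)) (φ) :
    P.score PK y σ h (ρ + ρ') φ = P.score PK y σ h ρ φ + P.score PK y σ h ρ' φ := by
  rw [score, score, score, ← Finset.sum_add_distrib]
  refine Finset.sum_congr rfl fun a _ => ?_
  rw [← Finset.sum_add_distrib]
  refine Finset.sum_congr rfl fun w _ => ?_
  have : restrict (fun w => decide (copyMask h w = a)) (ρ + ρ') =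
      restrict (fun w => decide (copyMask h w = a)) ρ +
        restrict (fun w => decide (copyMask h w = a)) ρ' := by
    ext s t
    simp only [restrict, Matrix.of_apply, Matrix.add_apply]
    split_ifs <;> simp
  rw [this, evolve, Matrix.mul_add, Matrix.add_mul, Matrix.add_apply, Complex.add_re, add_mul]
  rfl

theorem score_smul (PK y σ h) (c : ℝ) (ρ : Op (ZWire B ⊕ Fin P.aux)) (φ) :
    P.score PK y σ h ((c : ℂ) • ρ) φ = c * P.score PK y σ h ρ φ := by
  rw [score, score, Finset.mul_sum]
  refine Finset.sum_congr rfl fun a _ => ?_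
  rw [Finset.mul_sum]
  refine Finset.sum_congr rfl fun w _ => ?_
  have : restrict (fun w => decide (copyMask h w = a)) ((c : ℂ) • ρ) =
      (c : ℂ) • restrict (fun w => decide (copyMask h w = a)) ρ := by
    ext s t
    simp [restrict]
  rw [this, evolve, Matrix.mul_smul, Matrix.smul_mul, Matrix.smul_apply, smul_eq_mul,
    Complex.re_ofReal_mul, mul_assoc]
  rfl

theorem score_zero (PK y σ h) (φ) :
    P.score PK y σ h (0 : Op (ZWire B ⊕ Fin P.aux)) φ = 0 := by
  have := P.score_smul PK y σ h 0 0 φ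
  simpa using this

theorem score_sum {κ : Type} (PK y σ h) (s : Finset κ) (ρ : κ → Op (ZWire B ⊕ Fin P.aux)) (φ) :
    P.score PK y σ h (∑ i ∈ s, ρ i) φ = ∑ i ∈ s, P.score PK y σ h (ρ i) φ := by
  classical
  induction s using Finset.induction_on with
  | empty => simp [score_zero]
  | insert i s hi ih => rw [Finset.sum_insert hi, Finset.sum_insert hi, score_add, ih]

/-- The check of the opening of position `j`. -/
def checkAt (PK : Fin B.PKLen → Bool) (y : YWire B → Bool) (j : Fin B.N)
    (w : ZWire B ⊕ Fin P.aux → Bool) : Bool :=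
  F.check (B.extPk PK j) (fun k => w (.inl (j, k))) fun k => y (j, k)

theorem accept_attack (D : Distinguisher (Fin B.N))
    (h σ T u m₀ : Fin B.N → Bool) (G : ClassicalAlg ((P.Wires ⊕ (Fin B.N × Fin F.skLen)) ⊕ Fin B.N)
      (Fin B.N)) (hG : G.fn = fun s => outStr B T (fun i k => s (.inl (.inr (i, k))))
      (fun p => s (.inl (.inl (.inr (.inl p))))) u m₀
      (fun p => s (.inl (.inl (.inr (.inr (.inl p)))))) fun i => s (.inr i))
    (ρ : Op P.Wires) (PK : Fin B.PKLen → Bool) (Λ : (YWire B → Bool) → Op (ZWire B ⊕ Fin P.aux))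
    (hρ : ∀ PK' y, P.block ρ PK' y = if PK' = PK then Λ y else 0)
    (sk : Fin B.N → Fin F.skLen → Bool) :
    (D.toTest.attack (P.copyWires h) (P.attackCirc σ) G).accept
        (tensOp ρ (pureOp fun p => sk p.1 p.2)) =
      ∑ y, P.score PK y σ h (Λ y) fun z a => D.accept (outStr B T sk y u m₀ z a) := by
  rw [Test.accept, expect_attack D.toTest h σ G _ PK
    (fun s y => if s = (fun p => sk p.1 p.2) then Λ y else 0)]
  · rw [Finset.sum_eq_single fun p => sk p.1 p.2]
    · refine Finset.sum_congr rfl fun y _ => Finset.sum_congr rfl fun a _ =>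
        Finset.sum_congr rfl fun w _ => ?_
      rw [if_pos rfl]
      exact congrArg _ ((D.accept_toTest _).trans (by rw [hG]; rfl))
    · intro s _ hs
      refine Finset.sum_eq_zero fun y _ => Finset.sum_eq_zero fun a _ =>
        Finset.sum_eq_zero fun w _ => ?_
      have h0 : restrict (fun w => decide (copyMask h w = a))
          (0 : Op (ZWire B ⊕ Fin P.aux)) = 0 := by
        ext u v; simp [restrict]
      rw [if_neg hs, h0]
      simp [evolve]
    · simp
  · intro s PK' y
    by_cases hs : s = fun p => sk p.1 p.2
    · rw [if_pos hs, ← hρ]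
      ext w w'
      simp [block, sideBlock, tensOp_apply, pureOp_apply, hs]
    · rw [if_neg hs, ite_self]
      ext w w'
      simp [block, sideBlock, tensOp_apply, pureOp_apply, hs]

/-- The scores can be evaluated from the public key and the secret keys on the input. The random
bits `u` and the masks are hardwired, as non-uniform algorithms permit. -/
theorem exists_distinguisher_score (D : Distinguisher (Fin B.N)) (h σ T u m₀ : Fin B.N → Bool) :
    ∃ D' : Distinguisher (Fin B.PKLen ⊕ (Fin B.N × Fin F.skLen)),
      D'.size ≤ P.reductionSize + D.size ∧ ∀ PK (sk : Fin B.N → Fin F.skLen → Bool),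
        D'.accept (Sum.elim PK fun p => sk p.1 p.2) = ∑ y, P.score PK y σ h (P.state PK y)
          fun z a => D.accept (outStr B T sk y u m₀ z a) := by
  obtain ⟨G, hG, hGs⟩ := P.computedWithin_outStr (Function.Embedding.refl _) T u m₀
  obtain ⟨D', hD', hD⟩ := exists_distinguisher_of_test
    (D.toTest.attack (P.copyWires h) (P.attackCirc σ) G) P.commit P.isState
  refine ⟨D', ?_, fun PK sk => ?_⟩
  · have := P.size_attack_le D h σ G hGs
    omega
  · rw [hD]
    exact P.accept_attack D h σ T u m₀ G hG _ PK _ (block_commitState PK) sk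

/-- The wires of position `j` in the registers of the prover. -/
def blockEmb (j : Fin B.N) :
    Fin F.yLen ⊕ Fin (F.ℓ + 1) ↪ YWire B ⊕ (ZWire B ⊕ Fin P.aux) :=
  ⟨Sum.elim (fun k => .inl (j, k)) fun k => .inr (.inl (j, k)), by
    rintro (a | a) (b | b) h <;> simp at h ⊢ <;> exact h⟩

theorem blockEmb_inl (j : Fin B.N) (k) : P.blockEmb j (.inl k) = .inl (j, k) := rfl

theorem blockEmb_inr (j : Fin B.N) (k) : P.blockEmb j (.inr k) = .inr (.inl (j, k)) := rfl

/-- Inside one block the commitment has a fixed value, so the measurement of `y_j` by the challenger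
is invisible there. -/
theorem block_checked (j : Fin B.N) (PK y) (pk : Fin F.pkLen → Bool) (Γ : Op P.Wires) :
    P.block (restrict (fun u => F.check pk (fun k => u (.inr (.inr (.inl (j, k)))))
      fun k => u (.inr (.inl (j, k)))) (dephase (fun u k => u (.inr (.inl (j, k)))) Γ)) PK y =
      restrict (fun w => F.check pk (fun k => w (.inl (j, k))) fun k => y (j, k))
        (P.block Γ PK y) := by
  ext u v
  simp [block, restrict, dephase]

theorem block_dephase (j : Fin B.N) (PK y) (Γ : Op P.Wires) :
    P.block (dephase (fun u => u (.inr (.inr (.inl (j, 0))))) Γ) PK y =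
      dephase (fun w => firstBits B w j) (P.block Γ PK y) := rfl

/-- The commitment is the preparation and the masked attack with `D` is the guess, so the check and
the measurement of the challenger act on the state between them. -/
theorem exists_collapseAdv_score (D : Distinguisher (Fin B.N)) (h σ T u m₀ : Fin B.N → Bool)
    (j : Fin B.N) :
    ∃ D' : CollapseAdv (Fin B.PKLen ⊕ (Fin B.N × Fin F.skLen)) F,
      D'.size ≤ P.reductionSize + D.size ∧ ∀ PK (sk : Fin B.N → Fin F.skLen → Bool) b,
        D'.outProb (B.extPk PK j) (Sum.elim PK fun p => sk p.1 p.2) b =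
          ∑ y, P.score PK y σ h (if b then dephase (fun w => firstBits B w j)
            (restrict (P.checkAt PK y j) (P.state PK y)) else
              restrict (P.checkAt PK y j) (P.state PK y))
            fun z a => D.accept (outStr B T sk y u m₀ z a) := by
  obtain ⟨G, hG, hGs⟩ := P.computedWithin_outStr (Function.Embedding.refl _) T u m₀
  obtain ⟨D', hD', hD⟩ := exists_collapseAdv F
    (D.toTest.attack (P.copyWires h) (P.attackCirc σ) G) P.commit P.isState (P.blockEmb j)
  refine ⟨D', ?_, fun PK sk b => ?_⟩
  · have := P.size_attack_le D h σ G hGs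
    omega
  · rw [hD]
    simp only [blockEmb_inl, blockEmb_inr]
    refine P.accept_attack D h σ T u m₀ G hG _ PK _ (fun PK' y => ?_) sk
    have hc : P.block (evolve (circMat P.commit) (tensOp (pureOp PK) P.init)) PK' y =
      if PK' = PK then P.state PK y else 0 := block_commitState PK PK' y
    cases b
    · simp only [Bool.false_eq_true, if_false]
      rw [block_checked, hc]
      by_cases hPK : PK' = PK
      · subst hPK; rw [if_pos rfl, if_pos rfl]; rfl
      · rw [if_neg hPK, if_neg hPK]; ext u v; simp [restrict]
    · simp only [if_true]
      rw [block_dephase, block_checked, hc]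
      by_cases hPK : PK' = PK
      · subst hPK; rw [if_pos rfl, if_pos rfl]; rfl
      · rw [if_neg hPK, if_neg hPK]; ext u v; simp [restrict, dephase]

/-- The contents of the `j`th block of the opening register. -/
def openAt {B : BatchKeyGen F} {ι : Type} (j : Fin B.N) (w : ZWire B ⊕ ι → Bool)
    (k : Fin (F.ℓ + 1)) : Bool := w (.inl (j, k))

/-- The adversary commits, measures block `j` to obtain its preimage `z`, runs the masked attack to
obtain `d`, and flips the first bit of `d` if `D` accepts. By `hardcoreWin_sub` the advantage is an
expectation of the hardcore sign times `1 - 2 * accept`. -/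
theorem exists_hardcoreAdv_score (D : Distinguisher (Fin B.N)) (h σ T u m₀ : Fin B.N → Bool)
    (j : Fin B.N) :
    ∃ D' : HardcoreAdv (Fin B.PKLen ⊕ (Fin B.N × Fin F.skLen)) F,
      D'.size ≤ P.reductionSize + D.size ∧
      ∀ PK (sk : Fin B.N → Fin F.skLen → Bool) (skj : Fin F.skLen → Bool),
        D'.winProb (B.extPk PK j) skj (Sum.elim PK fun p => sk p.1 p.2) false -
          D'.winProb (B.extPk PK j) skj (Sum.elim PK fun p => sk p.1 p.2) true =
          ∑ y, P.score PK y σ h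
            (dephase (openAt j) (restrict (P.checkAt PK y j) (P.state PK y)))
            fun z a => hardcoreSign F skj (fun k => y (j, k)) (fun k => z (j, k)) *
              (1 - 2 * D.accept (outStr B T sk y u m₀ z a)) := by
  obtain ⟨G, hG, hGs⟩ := P.computedWithin_outStr
    (.inl : _ ↪ (Fin B.N × Fin F.skLen) ⊕ Fin (F.ℓ + 1)) T u m₀
  -- The preimage must be copied before the attack acts on the opening register, because the attack
  -- ends with the measurement of `d` in the same wires.
  let p : Fin (F.ℓ + 1) → Option (P.Wires ⊕ (Fin B.N × Fin F.skLen)) := fun k =>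
    some (.inl (.inr (.inr (.inl (j, k)))))
  let T₀ := D.toTest.attack (P.copyWires h) (P.attackCirc σ) G
  let e : (P.Wires ⊕ (Fin B.N × Fin F.skLen)) ⊕ Fin (F.ℓ + 1) ≃
      (Fin B.PKLen ⊕ (Fin B.N × Fin F.skLen)) ⊕
        ((YWire B ⊕ (ZWire B ⊕ Fin P.aux)) ⊕ Fin (F.ℓ + 1)) :=
    ((inputWires _ _ _).sumCongr (Equiv.refl _)).trans (Equiv.sumAssoc _ _ _)
  let T₁ := ((T₀.relabel (Equiv.sumAssoc _ _ _).symm).precomp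
    ((P.commit.map (QGate.map .inl)).map (QGate.map .inl) ++
      (copyGates p Finset.univ.toList).map QGate.classical)).relabel e
  obtain ⟨D', hD', hD⟩ := exists_hardcoreAdv F T₁
    (P.isState.tensOp (isState_pureOp fun _ : Fin (F.ℓ + 1) => false))
    (fun k => .inl (.inl (j, k))) (fun k => .inl (.inr (.inl (j, k)))) fun k => .inr k
  refine ⟨D', ?_, fun PK sk skj => ?_⟩
  · have h₁ : T₀.size + _ + _ + _ + _ ≤ _ := P.size_attack_le D h σ G hGs
    have h₂ := length_copyGates_le p Finset.univ.toList
    have h₃ : T₁.size = T₀.size + (P.commit.length +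
        (copyGates p Finset.univ.toList).length) := by
      simp only [T₁, Test.size_relabel, Test.size_precomp, List.length_append, List.length_map]
    rw [Finset.length_toList, Finset.card_univ, Fintype.card_fin] at h₂
    rw [Fintype.card_sum, Fintype.card_fin, h₃] at hD'
    omega
  · let s₀ : Fin B.N × Fin F.skLen → Bool := fun p => sk p.1 p.2
    have hinit : relabel e.symm (tensOp (pureOp (Sum.elim PK s₀))
        (tensOp P.init (pureOp fun _ => false))) =
        tensOp (tensOp (tensOp (pureOp PK) P.init) (pureOp s₀)) (pureOp fun _ => false) := by
      have h₁ : tensOp (pureOp (Sum.elim PK s₀))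
          (tensOp P.init (pureOp fun _ : Fin (F.ℓ + 1) => false)) = relabel (Equiv.sumAssoc _ _ _)
          (tensOp (tensOp (pureOp (Sum.elim PK s₀)) P.init)
            (pureOp fun _ => false)) := by
        ext u v
        simp only [tensOp_apply, relabel_apply, mul_assoc]
        rfl
      rw [h₁, tensOp_inputWires]
      have h₂ : ∀ A, relabel e.symm (relabel e A) = A := by
        intro A
        ext u v
        simp only [relabel_apply, Function.comp_assoc, Equiv.symm_comp_self, Function.comp_id]
      exact h₂ (tensOp (tensOp (tensOp (pureOp PK) P.init) (pureOp s₀)) (pureOp fun _ => false))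
    -- Here `zc` is the measured preimage. The distinguisher runs on a classical string, so its
    -- answer is `1` with probability `accept`, which gives one term for each value of the flip.
    have hval : ∀ c, D'.winProb (B.extPk PK j) skj (Sum.elim PK s₀) c =
        ∑ y, ∑ zc, P.score PK y σ h (restrict (fun w => decide (openAt j w = zc)) (P.state PK y))
          fun z a => D.accept (outStr B T sk y u m₀ z a) *
            (if hardcoreWin F (B.extPk PK j) skj (fun k => y (j, k))
              (fun k => z (j, k) ^^ (decide (k = 0) && true)) zc c then 1 else 0) +
            (1 - D.accept (outStr B T sk y u m₀ z a)) *
            (if hardcoreWin F (B.extPk PK j) skj (fun k => y (j, k))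
              (fun k => z (j, k) ^^ (decide (k = 0) && false)) zc c then 1 else 0) := by
      intro c
      rw [hD, Test.expect_relabel, hinit, Test.expect_precomp, circMat_append, circMat_map_inl,
        circMat_map_inl, circMat_classical, runGates_copyGates_univ, evolve_mul, evolve_tensOp,
        evolve_tensOp, evolve_one, evolve_one, Test.expect_relabel,
        expect_attack D.toTest h σ G _ PK (fun s y => if s ∘ Sum.inl = s₀ then
          restrict (fun w => decide (openAt j w = s ∘ Sum.inr)) (P.state PK y) else 0)]
      · rw [sum_bits_sum, Finset.sum_eq_single s₀, Finset.sum_comm]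
        · refine Finset.sum_congr rfl fun y _ => Finset.sum_congr rfl fun zc _ =>
            Finset.sum_congr rfl fun a _ => Finset.sum_congr rfl fun w _ => ?_
          simp only [Sum.elim_comp_inl, Sum.elim_comp_inr, if_true]
          refine congrArg _ ((Test.expect_pureOp _ _ _).trans ?_)
          rw [D.accept_toTest, hG]
          rfl
        · intro s _ hs
          refine Finset.sum_eq_zero fun zc _ => Finset.sum_eq_zero fun y _ => ?_
          rw [Sum.elim_comp_inl, if_neg hs]
          have h0 : ∀ a, restrict (fun w => decide (copyMask h w = a))
              (0 : Op (ZWire B ⊕ Fin P.aux)) = 0 := by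
            intro a; ext u v; simp [restrict]
          simp [h0, evolve]
        · simp
      · intro s PK' y
        have hinv := xorMap_involutive (copied p)
        have hz : ∀ w : ZWire B ⊕ Fin P.aux → Bool,
            (fun k => s (.inr k) ^^ copied p (Sum.elim (Sum.elim PK' (Sum.elim y w))
              (s ∘ Sum.inl)) k) = (fun _ => false) ↔ openAt j w = s ∘ Sum.inr := by
          intro w
          constructor
          · intro hh; funext k; have := congrFun hh k; simp [copied, p] at this; exact this.symm
          · intro hh; funext k
            have := congrFun hh k
            simp only [openAt, Function.comp_apply] at this
            simp [copied, p, this]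
        have hassoc : ∀ q : P.Wires → Bool,
            Sum.elim q s ∘ (Equiv.sumAssoc P.Wires (Fin B.N × Fin F.skLen) (Fin (F.ℓ + 1))) =
              Sum.elim (Sum.elim q (s ∘ Sum.inl)) fun k => s (.inr k) := by
          intro q; funext b; rcases b with (b | b) | b <;> rfl
        have hc := block_commitState (P := P) PK PK' y
        ext w w'
        have hc' := congrFun (congrFun hc w) w'
        rw [block, Matrix.submatrix_apply] at hc' ⊢
        simp only [sideBlock, Matrix.of_apply, relabel_apply, Equiv.symm_symm, hassoc]
        rw [evolve_permOp_of_involutive hinv, xorMap_elim, xorMap_elim, tensOp_apply, tensOp_apply,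
          pureOp_apply, pureOp_apply]
        simp only [Sum.elim_comp_inl, Sum.elim_comp_inr, hz, and_self]
        rw [commitState] at hc'
        rw [hc']
        by_cases hPK : PK' = PK <;> by_cases hs : s ∘ Sum.inl = s₀ <;>
          simp [hPK, hs, restrict]
    refine (congrArg₂ (· - ·) (hval false) (hval true)).trans ?_
    rw [← Finset.sum_sub_distrib]
    refine Finset.sum_congr rfl fun y _ => ?_
    rw [← Finset.sum_sub_distrib]
    have hsub : ∀ (ρ : Op (ZWire B ⊕ Fin P.aux)) (φ φ' : (ZWire B → Bool) → (Fin B.N → Bool) → ℝ),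
        P.score PK y σ h ρ φ - P.score PK y σ h ρ φ' =
          P.score PK y σ h ρ fun z a => φ z a - φ' z a := by
      intro ρ φ φ'
      rw [score, score, score, ← Finset.sum_sub_distrib]
      refine Finset.sum_congr rfl fun a _ => ?_
      rw [← Finset.sum_sub_distrib]
      exact Finset.sum_congr rfl fun w _ => (mul_sub _ _ _).symm
    -- The check is a function of the measured preimage, so the checked and measured state is the
    -- sum over `zc` of the projected states, with weight `1` or `0` according to the check.
    have hρ : dephase (openAt j) (restrict (P.checkAt PK y j) (P.state PK y)) =
        ∑ zc, ((if F.check (B.extPk PK j) zc (fun k => y (j, k)) then 1 else 0 : ℝ) : ℂ) •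
          restrict (fun w => decide (openAt j w = zc)) (P.state PK y) := by
      ext w w'
      rw [Matrix.sum_apply, Finset.sum_eq_single (openAt j w)]
      · simp only [dephase, restrict, Matrix.of_apply, Matrix.smul_apply, decide_eq_true_eq,
          true_and, smul_eq_mul]
        have hck : ∀ w : ZWire B ⊕ Fin P.aux → Bool, P.checkAt PK y j w =
          F.check (B.extPk PK j) (openAt j w) (fun k => y (j, k)) := fun _ => rfl
        simp only [hck, eq_comm (a := openAt j w)]
        by_cases hw : openAt j w' = openAt j w
        · rw [hw]
          split_ifs <;> simp_all
        · simp [hw]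
      · intro zc _ hzc
        simp [restrict, Ne.symm hzc]
      · simp
    rw [hρ, score_sum]
    refine Finset.sum_congr rfl fun zc _ => ?_
    rw [hsub, score_smul, score, score, Finset.mul_sum]
    refine Finset.sum_congr rfl fun a _ => ?_
    rw [Finset.mul_sum]
    refine Finset.sum_congr rfl fun w _ => ?_
    rw [mul_left_comm]
    congr 1
    have e₁ := hardcoreWin_sub F (B.extPk PK j) skj (fun k => y (j, k))
      (fun k => w (.inl (j, k))) zc true
    have e₂ := hardcoreWin_sub F (B.extPk PK j) skj (fun k => y (j, k))
      (fun k => w (.inl (j, k))) zc false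
    simp only [Function.comp_apply] at e₁ e₂ ⊢
    rw [add_sub_add_comm, ← mul_sub, ← mul_sub, e₁, e₂]
    cases F.check (B.extPk PK j) zc (fun k => y (j, k))
    · simp
    · simp only [if_true, Bool.false_eq_true, if_false]
      ring

end Prover

/-! ### Averages -/

section Avg

variable {α β : Type} [Fintype α] [DecidableEq α] [Fintype β] [DecidableEq β]

theorem avg_add (f g : (α → Bool) → ℝ) : (avg fun c => f c + g c) = avg f + avg g := by
  rw [avg, avg, avg, Finset.sum_add_distrib, add_div]

theorem avg_sub (f g : (α → Bool) → ℝ) : (avg fun c => f c - g c) = avg f - avg g := by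
  rw [avg, avg, avg, Finset.sum_sub_distrib, sub_div]

theorem avg_mul_left (x : ℝ) (f : (α → Bool) → ℝ) : (avg fun c => x * f c) = x * avg f := by
  rw [avg, avg, ← Finset.mul_sum, mul_div_assoc]

theorem avg_mul_right (x : ℝ) (f : (α → Bool) → ℝ) : (avg fun c => f c * x) = avg f * x := by
  rw [avg, avg, ← Finset.sum_mul, div_mul_eq_mul_div]

theorem avg_div (x : ℝ) (f : (α → Bool) → ℝ) : (avg fun c => f c / x) = avg f / x := by
  simp only [div_eq_mul_inv, avg_mul_right]

theorem avg_neg (f : (α → Bool) → ℝ) : (avg fun c => -f c) = -avg f := by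
  rw [avg, avg, Finset.sum_neg_distrib, neg_div]

theorem avg_sum {κ : Type} (s : Finset κ) (f : κ → (α → Bool) → ℝ) :
    (avg fun c => ∑ i ∈ s, f i c) = ∑ i ∈ s, avg (f i) := by
  simp only [avg, Finset.sum_div]
  exact Finset.sum_comm

theorem avg_const (x : ℝ) : (avg fun _ : α → Bool => x) = x := by
  rw [avg, Finset.sum_const, Finset.card_univ, Fintype.card_fun, Fintype.card_bool, nsmul_eq_mul]
  push_cast
  field_simp

theorem avg_mono {f g : (α → Bool) → ℝ} (h : ∀ c, f c ≤ g c) : avg f ≤ avg g :=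
  div_le_div_of_nonneg_right (Finset.sum_le_sum fun c _ => h c) (by positivity)

theorem avg_le {f : (α → Bool) → ℝ} {x : ℝ} (h : ∀ c, f c ≤ x) : avg f ≤ x :=
  (avg_mono h).trans_eq (avg_const x)

theorem avg_nonneg {f : (α → Bool) → ℝ} (h : ∀ c, 0 ≤ f c) : 0 ≤ avg f :=
  (avg_const (α := α) 0).symm.trans_le (avg_mono h)

theorem abs_avg_le (f : (α → Bool) → ℝ) : |avg f| ≤ avg fun c => |f c| := by
  rw [abs_le, ← avg_neg]
  exact ⟨avg_mono fun c => neg_abs_le _, avg_mono fun c => le_abs_self _⟩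

theorem avg_comm (f : (α → Bool) → (β → Bool) → ℝ) :
    (avg fun c => avg fun d => f c d) = avg fun d => avg fun c => f c d := by
  simp only [avg, ← Finset.sum_div]
  rw [Finset.sum_comm, div_right_comm]

theorem sum_law_mul (f : (α → Bool) → (β → Bool)) (g : (β → Bool) → ℝ) :
    ∑ x, law f x * g x = avg fun c => g (f c) := by
  have : ∀ x, law f x * g x = avg fun c => if f c = x then g x else 0 := by
    intro x
    rw [law, ← avg_mul_right]
    simp only [ite_mul, one_mul, zero_mul]
  simp only [this]
  rw [← avg_sum]
  simp

theorem avg_comp_equiv (e : (α → Bool) ≃ (α → Bool)) (f : (α → Bool) → ℝ) :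
    (avg fun c => f (e c)) = avg f := by
  rw [avg, avg, e.sum_comp]

/-- Bit `k` of a uniformly random string may be sampled afterwards. -/
theorem avg_resample (k : α) (f : (α → Bool) → Bool → ℝ)
    (hf : ∀ c b b', f (Function.update c k b) b' = f c b') :
    (avg fun c => f c (c k)) = avg fun c => (f c false + f c true) / 2 := by
  -- Flipping bit `k` permutes the strings, so the averages with `c k` and with its negation
  -- coincide.
  have hinv : Function.Involutive fun c : α → Bool => Function.update c k (!c k) := by
    intro c; simp
  have h₁ := avg_comp_equiv hinv.toPerm fun c => f c (c k)
  simp only [Function.Involutive.coe_toPerm, Function.update_self, hf] at h₁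
  have h₂ : (avg fun c => f c (c k)) + (avg fun c => f c (!c k)) =
      avg fun c => f c false + f c true := by
    rw [← avg_add]
    congr 1
    funext c
    cases c k <;> simp [add_comm]
  rw [h₁] at h₂
  have h₃ : (avg fun c => (f c false + f c true) / 2) = (avg fun c => f c false + f c true) / 2 := by
    simp only [div_eq_mul_inv]
    exact avg_mul_right _ _
  rw [h₃, ← h₂]
  ring

end Avg

/-! ### Gentle measurement -/

section Gentle

variable {α : Type} [Fintype α] [DecidableEq α]

theorem restrict_eq_evolve (p : (α → Bool) → Bool) (ρ : Op α) :
    restrict p ρ = evolve (Matrix.diagonal fun s => if p s then 1 else 0) ρ := by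
  ext s t
  rw [evolve_diagonal_apply]
  simp only [restrict, Matrix.of_apply]
  by_cases hs : p s = true <;> by_cases ht : p t = true <;> simp [hs, ht]

theorem posSemidef_restrict {ρ : Op α} (hρ : ρ.PosSemidef) (p : (α → Bool) → Bool) :
    (restrict p ρ).PosSemidef := by
  rw [restrict_eq_evolve]
  exact Matrix.PosSemidef.evolve hρ _

theorem trace_restrict (p : (α → Bool) → Bool) (ρ : Op α) :
    (restrict p ρ).trace.re = prob ρ p := by
  rw [Matrix.trace, Complex.re_sum, prob]
  refine Finset.sum_congr rfl fun s _ => ?_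
  simp only [Matrix.diag_apply, restrict, Matrix.of_apply, and_self]
  split_ifs <;> simp

theorem prob_not (ρ : Op α) (p : (α → Bool) → Bool) :
    prob ρ (fun s => !p s) = ρ.trace.re - prob ρ p := by
  rw [Matrix.trace, Complex.re_sum, prob, prob, ← Finset.sum_sub_distrib]
  exact Finset.sum_congr rfl fun s _ => by cases p s <;> simp

theorem prob_mono {ρ : Op α} (hρ : ρ.PosSemidef) {p q : (α → Bool) → Bool}
    (h : ∀ s, p s → q s) : prob ρ p ≤ prob ρ q :=
  Finset.sum_le_sum fun s _ => by
    by_cases hp : p s = true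
    · rw [if_pos hp, if_pos (h s hp)]
    · rw [if_neg hp]
      split_ifs
      exacts [diag_re_nonneg hρ s, le_rfl]

theorem prob_le_trace {ρ : Op α} (hρ : ρ.PosSemidef) (p : (α → Bool) → Bool) :
    prob ρ p ≤ ρ.trace.re := by
  have := prob_nonneg hρ fun s => !p s
  rw [prob_not] at this
  linarith

/-- The gentle measurement bound for a positive functional `q` that is bounded by the trace. -/
theorem abs_sub_restrict_le {q : Op α → ℝ} (hadd : ∀ ρ ρ', q (ρ + ρ') = q ρ + q ρ')
    (hsmul : ∀ (c : ℝ) ρ, q ((c : ℂ) • ρ) = c * q ρ) (hpos : ∀ ρ : Op α, ρ.PosSemidef → 0 ≤ q ρ)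
    (hle : ∀ ρ : Op α, ρ.PosSemidef → q ρ ≤ ρ.trace.re) {ρ : Op α} (hρ : ρ.PosSemidef)
    (p : (α → Bool) → Bool) {t : ℝ} (ht : 0 < t) :
    |q ρ - q (restrict p ρ)| ≤ t * ρ.trace.re + (1 + t⁻¹) * (ρ.trace.re - prob ρ p) := by
  let cross : Op α := Matrix.of fun s u => if p s = p u then 0 else ρ s u
  have hsplit : ρ = restrict p ρ + (cross + restrict (fun s => !p s) ρ) := by
    ext s u
    simp only [restrict, cross, Matrix.add_apply, Matrix.of_apply]
    by_cases hs : p s = true <;> by_cases hu : p u = true <;> simp [hs, hu]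
  -- Positivity of `q` on `K ρ K†` with `K = a P + b (1 - P)`. Taking `a = t` and `b = ±1` bounds
  -- the off-diagonal part by a weighted sum of the two diagonal parts, a Cauchy–Schwarz inequality
  -- without square roots.
  have hev : ∀ a b : ℝ, 0 ≤ a * a * q (restrict p ρ) + (a * b * q cross +
      b * b * q (restrict (fun s => !p s) ρ)) := by
    intro a b
    have h := hpos _ (Matrix.PosSemidef.evolve hρ
      (Matrix.diagonal fun s => if p s then (a : ℂ) else (b : ℂ)))
    have : evolve (Matrix.diagonal fun s => if p s then (a : ℂ) else (b : ℂ)) ρ =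
        ((a * a : ℝ) : ℂ) • restrict p ρ + (((a * b : ℝ) : ℂ) • cross +
          ((b * b : ℝ) : ℂ) • restrict (fun s => !p s) ρ) := by
      ext s u
      rw [evolve_diagonal_apply]
      simp only [restrict, cross, Matrix.add_apply, Matrix.of_apply, Matrix.smul_apply]
      by_cases hs : p s = true <;> by_cases hu : p u = true <;> simp [hs, hu] <;> ring
    rwa [this, hadd, hadd, hsmul, hsmul, hsmul] at h
  have h₁ := hev t 1
  have h₂ := hev t (-1)
  have hA : q (restrict p ρ) ≤ ρ.trace.re :=
    (hle _ (posSemidef_restrict hρ p)).trans ((trace_restrict p ρ).trans_le (prob_le_trace hρ p))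
  have hB : q (restrict (fun s => !p s) ρ) ≤ ρ.trace.re - prob ρ p :=
    (hle _ (posSemidef_restrict hρ _)).trans_eq ((trace_restrict _ ρ).trans (prob_not ρ p))
  have hB0 := hpos _ (posSemidef_restrict hρ fun s => !p s)
  have hq : q ρ - q (restrict p ρ) = q cross + q (restrict (fun s => !p s) ρ) := by
    conv_lhs => rw [hsplit]
    rw [hadd, hadd, ← hsplit]
    ring
  have hc : |q cross| ≤ t * q (restrict p ρ) + t⁻¹ * q (restrict (fun s => !p s) ρ) := by
    have hti : t * t⁻¹ = 1 := mul_inv_cancel₀ ht.ne'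
    have : t * |q cross| ≤ t * (t * q (restrict p ρ) +
        t⁻¹ * q (restrict (fun s => !p s) ρ)) := by
      rw [mul_add, ← mul_assoc, ← mul_assoc, hti]
      rcases abs_cases (q cross) with ⟨h, _⟩ | ⟨h, _⟩ <;> rw [h] <;> nlinarith
    exact le_of_mul_le_mul_left this ht
  rw [hq]
  calc |q cross + q (restrict (fun s => !p s) ρ)|
      ≤ |q cross| + |q (restrict (fun s => !p s) ρ)| := abs_add_le _ _
    _ ≤ (t * q (restrict p ρ) + t⁻¹ * q (restrict (fun s => !p s) ρ)) +
        q (restrict (fun s => !p s) ρ) := by rw [abs_of_nonneg hB0]; gcongr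
    _ = t * q (restrict p ρ) + (1 + t⁻¹) * q (restrict (fun s => !p s) ρ) := by ring
    _ ≤ _ := by gcongr

end Gentle

namespace Prover

variable {F : TCF} {B : BatchKeyGen F} (P : Prover B)

/-! ### Properties of the score -/

theorem U_mem_unitaryGroup (PK y) : P.U PK y ∈ Matrix.unitaryGroup _ ℂ := by
  have hatt : P.IsControlled (circMat P.attack) := P.attack_controlled
  have h := block_mul hatt (circMat P.attack)ᴴ PK y
  have h₁ : circMat P.attack * (circMat P.attack)ᴴ = 1 :=
    Matrix.mem_unitaryGroup_iff.mp (circMat_mem_unitaryGroup P.attack)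
  have h₂ : P.block (1 : Op P.Wires) PK y = 1 := by
    ext s t
    rw [block, Matrix.submatrix_apply]
    by_cases hst : s = t
    · subst hst; simp
    · rw [Matrix.one_apply_ne hst, Matrix.one_apply_ne]
      intro h
      exact hst (congrArg (fun f => f ∘ Sum.inr ∘ Sum.inr) h)
  rw [h₁, h₂] at h
  rw [Matrix.mem_unitaryGroup_iff]
  exact h.symm

theorem diagonal_phase_mem_unitaryGroup {N : ℕ} {α : Type} [Fintype α] [DecidableEq α]
    (σ : Fin N → Bool) (c : (α → Bool) → Fin N → Bool) :
    Matrix.diagonal (fun w => phase σ (c w)) ∈ Matrix.unitaryGroup (α → Bool) ℂ := by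
  rw [Matrix.mem_unitaryGroup_iff, Matrix.star_eq_conjTranspose, Matrix.diagonal_conjTranspose,
    Matrix.diagonal_mul_diagonal, ← Matrix.diagonal_one]
  congr 1
  funext w
  have : phase (fun _ => false) (c w) = 1 := by simp [phase]
  rw [Pi.star_apply, star_phase, phase_mul]
  simpa using this

theorem attackOp_mem_unitaryGroup (PK y σ) : P.attackOp PK y σ ∈ Matrix.unitaryGroup _ ℂ :=
  mul_mem (mul_mem (hadOn_mem_unitaryGroup _) (P.U_mem_unitaryGroup PK y))
    (diagonal_phase_mem_unitaryGroup σ _)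

theorem score_sub_fun (PK y σ h) (ρ : Op (ZWire B ⊕ Fin P.aux)) (φ φ') :
    P.score PK y σ h ρ (fun z a => φ z a - φ' z a) =
      P.score PK y σ h ρ φ - P.score PK y σ h ρ φ' := by
  rw [score, score, score, ← Finset.sum_sub_distrib]
  refine Finset.sum_congr rfl fun a _ => ?_
  rw [← Finset.sum_sub_distrib]
  exact Finset.sum_congr rfl fun w _ => mul_sub _ _ _

theorem score_add_fun (PK y σ h) (ρ : Op (ZWire B ⊕ Fin P.aux)) (φ φ') :
    P.score PK y σ h ρ (fun z a => φ z a + φ' z a) =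
      P.score PK y σ h ρ φ + P.score PK y σ h ρ φ' := by
  rw [score, score, score, ← Finset.sum_add_distrib]
  refine Finset.sum_congr rfl fun a _ => ?_
  rw [← Finset.sum_add_distrib]
  exact Finset.sum_congr rfl fun w _ => mul_add _ _ _

theorem score_smul_fun (PK y σ h) (ρ : Op (ZWire B ⊕ Fin P.aux)) (c : ℝ) (φ) :
    P.score PK y σ h ρ (fun z a => c * φ z a) = c * P.score PK y σ h ρ φ := by
  rw [score, score, Finset.mul_sum]
  refine Finset.sum_congr rfl fun a _ => ?_
  rw [Finset.mul_sum]
  exact Finset.sum_congr rfl fun w _ => mul_left_comm _ _ _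

theorem score_sum_fun {κ : Type} (PK y σ h) (ρ : Op (ZWire B ⊕ Fin P.aux)) (s : Finset κ)
    (φ : κ → (ZWire B → Bool) → (Fin B.N → Bool) → ℝ) :
    P.score PK y σ h ρ (fun z a => ∑ i ∈ s, φ i z a) = ∑ i ∈ s, P.score PK y σ h ρ (φ i) := by
  simp only [score, Finset.mul_sum]
  rw [Finset.sum_comm (s := s)]
  refine Finset.sum_congr rfl fun a _ => ?_
  exact Finset.sum_comm

theorem score_avg_fun {β : Type} [Fintype β] [DecidableEq β] (PK y σ h)
    (ρ : Op (ZWire B ⊕ Fin P.aux)) (φ : (β → Bool) → (ZWire B → Bool) → (Fin B.N → Bool) → ℝ) :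
    P.score PK y σ h ρ (fun z a => avg fun u => φ u z a) = avg fun u => P.score PK y σ h ρ (φ u) := by
  simp only [avg, div_eq_inv_mul]
  rw [score_smul_fun, score_sum_fun]

/-- Only the outcomes of the copied bits that can occur matter. -/
theorem score_congr (PK y σ) {h : Fin B.N → Bool} (ρ : Op (ZWire B ⊕ Fin P.aux)) {φ φ'}
    (hφ : ∀ z a, (∀ i, h i = true → a i = false) → φ z a = φ' z a) :
    P.score PK y σ h ρ φ = P.score PK y σ h ρ φ' := by
  refine Finset.sum_congr rfl fun a _ => Finset.sum_congr rfl fun w _ => ?_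
  by_cases ha : ∀ i, h i = true → a i = false
  · rw [hφ _ _ ha]
  · have h0 : restrict (fun w => decide (copyMask h w = a)) ρ = 0 := by
      ext u v
      simp only [restrict, Matrix.of_apply, decide_eq_true_eq]
      rw [if_neg, Matrix.zero_apply]
      rintro ⟨hu, -⟩
      refine ha fun i hi => ?_
      rw [← hu, copyMask, hi]
      simp
    rw [h0]
    simp [evolve]

theorem score_nonneg (PK y σ h) {ρ : Op (ZWire B ⊕ Fin P.aux)} (hρ : ρ.PosSemidef) {φ}
    (hφ : ∀ z a, 0 ≤ φ z a) : 0 ≤ P.score PK y σ h ρ φ :=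
  Finset.sum_nonneg fun _ _ => Finset.sum_nonneg fun _ _ => mul_nonneg
    (diag_re_nonneg (Matrix.PosSemidef.evolve (posSemidef_restrict hρ _) _) _) (hφ _ _)

theorem score_one (PK y σ h) (ρ : Op (ZWire B ⊕ Fin P.aux)) :
    P.score PK y σ h ρ (fun _ _ => 1) = ρ.trace.re := by
  have h₁ : ∀ a, ∑ w, (evolve (P.attackOp PK y σ)
      (restrict (fun w => decide (copyMask h w = a)) ρ) w w).re * 1 =
      ∑ w, if copyMask h w = a then (ρ w w).re else 0 := by
    intro a
    have := congrArg Complex.re (trace_evolve (P.attackOp_mem_unitaryGroup PK y σ)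
      (restrict (fun w => decide (copyMask h w = a)) ρ))
    rw [trace_restrict, Matrix.trace, Complex.re_sum] at this
    simp only [mul_one]
    refine this.trans ?_
    simp [prob]
  rw [score]
  simp only [h₁]
  rw [Finset.sum_comm]
  simp [Matrix.trace]

theorem score_le_trace (PK y σ h) {ρ : Op (ZWire B ⊕ Fin P.aux)} (hρ : ρ.PosSemidef) {φ}
    (hφ : ∀ z a, φ z a ≤ 1) : P.score PK y σ h ρ φ ≤ ρ.trace.re := by
  have := P.score_nonneg PK y σ h hρ (φ := fun z a => 1 - φ z a) fun z a => by linarith [hφ z a]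
  rw [score_sub_fun, score_one] at this
  linarith

/-- The gentle measurement bound needs functions with values in `[0, 1]`. Writing `φ = 2 * ((1 + φ)
/ 2) - 1` uses it twice for `(1 + φ) / 2` and once for `1`, hence the factor 3. -/
theorem abs_score_sub_restrict_le (PK y σ h) {ρ : Op (ZWire B ⊕ Fin P.aux)} (hρ : ρ.PosSemidef)
    {φ} (hφ : ∀ z a, |φ z a| ≤ 1) (p) {t : ℝ} (ht : 0 < t) :
    |P.score PK y σ h ρ φ - P.score PK y σ h (restrict p ρ) φ| ≤
      3 * (t * ρ.trace.re + (1 + t⁻¹) * (ρ.trace.re - prob ρ p)) := by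
  have key : ∀ ψ : (ZWire B → Bool) → (Fin B.N → Bool) → ℝ, (∀ z a, 0 ≤ ψ z a) →
      (∀ z a, ψ z a ≤ 1) → |P.score PK y σ h ρ ψ - P.score PK y σ h (restrict p ρ) ψ| ≤
        t * ρ.trace.re + (1 + t⁻¹) * (ρ.trace.re - prob ρ p) := fun ψ h0 h1 =>
    abs_sub_restrict_le (q := fun ρ => P.score PK y σ h ρ ψ) (fun _ _ => P.score_add _ _ _ _ _ _ _)
      (fun _ _ => P.score_smul _ _ _ _ _ _ _) (fun _ hρ => P.score_nonneg _ _ _ _ hρ h0)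
      (fun _ hρ => P.score_le_trace _ _ _ _ hρ h1) hρ p ht
  have h₁ := key (fun z a => (1 + φ z a) / 2) (fun z a => by linarith [(abs_le.mp (hφ z a)).1])
    fun z a => by linarith [(abs_le.mp (hφ z a)).2]
  have h₂ := key (fun _ _ => 1) (fun _ _ => zero_le_one) fun _ _ => le_rfl
  have hs : ∀ ρ : Op (ZWire B ⊕ Fin P.aux), P.score PK y σ h ρ φ =
      2 * P.score PK y σ h ρ (fun z a => (1 + φ z a) / 2) - P.score PK y σ h ρ fun _ _ => 1 := by
    intro ρ
    rw [← score_smul_fun, ← score_sub_fun]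
    congr 1
    funext z a
    ring
  rw [hs, hs (restrict p ρ)]
  rw [abs_le] at h₁ h₂ ⊢
  constructor <;> linarith [h₁.1, h₁.2, h₂.1, h₂.2]

end Prover

/-! ### The real experiment -/

section Real

variable {F : TCF} {B : BatchKeyGen F}

theorem law_pi {N : ℕ} (o : Fin N → Bool → Bool) (x : Fin N → Bool) :
    law (fun u i => o i (u i)) x = ∏ i, ((if o i false = x i then 1 else 0) +
      if o i true = x i then 1 else 0) / 2 := by
  have h : ∀ u : Fin N → Bool, (if (fun i => o i (u i)) = x then (1 : ℝ) else 0) =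
      ∏ i, if o i (u i) = x i then 1 else 0 := by
    intro u
    rw [Fintype.prod_ite_zero]
    simp [funext_iff]
  rw [law, avg, Finset.prod_div_distrib, Finset.prod_const, Finset.card_univ]
  congr 1
  simp only [h]
  have hs : ∀ i, ((if o i false = x i then (1 : ℝ) else 0) + if o i true = x i then 1 else 0) =
      ∑ b : Bool, if o i b = x i then 1 else 0 := by
    intro i; rw [Fintype.sum_bool, add_comm]
  simp only [hs]
  rw [Finset.prod_univ_sum, Fintype.piFinset_univ]

/-- The first bit of the preimage in injective mode. -/
def invertBit (B : BatchKeyGen F) (sk : Fin B.N → Fin F.skLen → Bool) (y : YWire B → Bool)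
    (i : Fin B.N) : Bool :=
  (F.invertInj (sk i) fun k => y (i, k)).elim false fun v => v 0

/-- The output of the verifier with random bits `u`. -/
def verifierOut (B : BatchKeyGen F) (h : Fin B.N → Bool) (sk : Fin B.N → Fin F.skLen → Bool)
    (y : YWire B → Bool) (u : Fin B.N → Bool) (z : ZWire B → Bool) (i : Fin B.N) : Bool :=
  if h i then decodeBits B sk y z u i else invertBit B sk y i

/-- The factor `1 / 2` where no good claw exists is the average over the random bit of that
position. -/
theorem outDist_eq_law (h SK y z) (m : Fin B.N → Bool) :
    outDist B h SK y z m = law (fun u => verifierOut B h (B.extSk SK) y u z) m := by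
  refine Eq.trans ?_ (law_pi (fun i b => if h i then F.decodeBit (B.extSk SK i)
    (fun k => y (i, k)) (fun k => z (i, k)) b else invertBit B (B.extSk SK) y i) m).symm
  rw [outDist]
  refine Finset.prod_congr rfl fun i _ => ?_
  by_cases hi : h i = true
  · have key : ∀ (o : Option ((Fin F.ℓ → Bool) × (Fin F.ℓ → Bool))) (f : _ → Bool) (b : Bool),
        (o.elim (1 / 2 : ℝ) fun p => if b = f p then 1 else 0) =
          ((if o.elim false f = b then 1 else 0) + if o.elim true f = b then 1 else 0) / 2 := by
      intro o f b
      rcases o with _ | p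
      · cases b <;> simp
      · by_cases hp : f p = b
        · simp [hp]
        · simp [hp, Ne.symm hp]
    simp only [hi, if_true]
    exact key _ _ _
  · simp only [hi, if_false, Bool.false_eq_true, invertBit, eq_comm (a := m i)]
    split_ifs <;> norm_num

/-- The masks of the `k`th hybrid. -/
def maskBelow {N : ℕ} (h : Fin N → Bool) (k : ℕ) (s : Fin N → Bool) (i : Fin N) : Bool :=
  s i && (decide ((i : ℕ) < k) && h i)

namespace Prover

variable (P : Prover B)

/-- If all surviving basis states have the same copied bits, the copy does not disturb the state. -/
theorem score_restrict_of_copyMask (PK y σ) {h : Fin B.N → Bool} (ρ : Op (ZWire B ⊕ Fin P.aux))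
    {p} {a : Fin B.N → Bool} (hp : ∀ w, p w = true → copyMask h w = a) (φ) :
    P.score PK y σ h (restrict p ρ) φ =
      ∑ w, (evolve (P.attackOp PK y σ) (restrict p ρ) w w).re * φ (w ∘ Sum.inl) a := by
  rw [score, Finset.sum_eq_single a]
  · have : restrict (fun w => decide (copyMask h w = a)) (restrict p ρ) = restrict p ρ := by
      ext u v
      simp only [restrict, Matrix.of_apply, decide_eq_true_eq]
      by_cases hu : p u = true <;> by_cases hv : p v = true <;> simp [hu, hv]
      intro h'
      exact absurd (hp v hv) (h' (hp u hu))
    rw [this]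
  · intro b _ hb
    have : restrict (fun w => decide (copyMask h w = b)) (restrict p ρ) = 0 := by
      ext u v
      simp only [restrict, Matrix.of_apply, decide_eq_true_eq, Matrix.zero_apply]
      by_cases hu : p u = true
      · rw [if_neg fun h' => hb (h'.1.symm.trans (hp u hu))]
      · simp [hu]
    refine Finset.sum_eq_zero fun w _ => ?_
    rw [this]
    simp [evolve]
  · simp

theorem attackOp_false (PK y) : P.attackOp PK y (fun _ => false) = hadOpen B (Fin P.aux) * P.U PK y := by
  have : (Matrix.diagonal fun w : ZWire B ⊕ Fin P.aux → Bool =>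
      phase (fun _ => false) (firstBits B w)) = 1 := by
    rw [← Matrix.diagonal_one]
    congr 1
    funext w
    simp [phase]
  rw [attackOp, this, mul_one]

theorem restrict_true {α : Type} [Fintype α] [DecidableEq α] (ρ : Op α) :
    restrict (fun _ => true) ρ = ρ := by
  ext s t; simp [restrict]

theorem sum_realDist_mul (C : Fin B.descLen → Bool) (g : (Fin B.N → Bool) → ℝ) :
    ∑ m, P.realDist C m * g m = avg fun r => ∑ y,
      P.score (B.genPK C r) y (fun _ => false) (fun _ => true) (P.state (B.genPK C r) y)
        fun z _ => avg fun u =>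
          g (verifierOut B (B.basis C) (B.extSk (B.genSK C r)) y u z) := by
  simp only [realDist, ← avg_mul_right]
  rw [← avg_sum]
  congr 1
  funext r
  simp only [Finset.sum_mul]
  rw [Finset.sum_comm]
  refine Finset.sum_congr rfl fun y _ => ?_
  -- With the mask `fun _ => true` no position is in the standard basis, so nothing is copied and
  -- the score is the undisturbed measurement round.
  have h := P.score_restrict_of_copyMask (B.genPK C r) y (fun _ => false) (h := fun _ => true)
    (P.state (B.genPK C r) y) (p := fun _ => true) (a := fun _ => false)
    (fun w _ => by funext i; simp [copyMask])
  rw [restrict_true] at h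
  rw [h, Finset.sum_comm]
  refine Finset.sum_congr rfl fun w _ => ?_
  simp only [mul_assoc, ← Finset.mul_sum, outDist_eq_law]
  rw [sum_law_mul, measure, ← evolve_mul, attackOp_false]
  rfl

/-! ### The states of the prover -/

theorem posSemidef_state (PK y) : (P.state PK y).PosSemidef := by
  refine Matrix.PosSemidef.submatrix (Matrix.PosSemidef.evolve ?_ _) _
  rw [withInput_eq]
  exact ((isState_pureOp PK).tensOp P.isState).1

theorem sum_trace_state (PK) : ∑ y, (P.state PK y).trace.re = 1 := by
  have h : IsState (P.commitState PK) := IsState.evolve ((isState_pureOp PK).tensOp P.isState)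
    (circMat_mem_unitaryGroup _)
  have h₁ : (P.commitState PK).trace = ∑ PK', ∑ y, (P.block (P.commitState PK) PK' y).trace := by
    rw [Matrix.trace, sum_bits_sum]
    refine Finset.sum_congr rfl fun PK' _ => ?_
    rw [sum_bits_sum]
    rfl
  simp only [block_commitState] at h₁
  rw [h.2, Finset.sum_eq_single PK] at h₁
  · simp only [if_true] at h₁
    rw [← Complex.re_sum, ← h₁, Complex.one_re]
  · intro PK' _ hne
    simp [hne]
  · simp

theorem one_sub_passProb (C : Fin B.descLen → Bool) : 1 - P.passProb C = avg fun r => ∑ y,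
    ((P.state (B.genPK C r) y).trace.re - prob (P.state (B.genPK C r) y)
      fun w => testAccepts B (B.genPK C r) y (w ∘ Sum.inl)) := by
  simp only [Finset.sum_sub_distrib, sum_trace_state]
  rw [avg_sub, avg_const]
  rfl

theorem one_sub_passProb_nonneg (C : Fin B.descLen → Bool) : 0 ≤ 1 - P.passProb C := by
  rw [one_sub_passProb]
  exact avg_nonneg fun r => Finset.sum_nonneg fun y _ =>
    sub_nonneg.mpr (prob_le_trace (P.posSemidef_state _ _) _)

theorem one_sub_passProb_le_one (C : Fin B.descLen → Bool) : 1 - P.passProb C ≤ 1 := by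
  have : 0 ≤ P.passProb C := avg_nonneg fun r => Finset.sum_nonneg fun y _ =>
    prob_nonneg (P.posSemidef_state _ _) _
  linarith

/-- For `ε > 0` choose `t = √ε`: the bound becomes `3 (2 √ε + ε)`, and `ε ≤ √ε`. For `ε = 0` let `t`
tend to `0`. -/
theorem le_of_forall_tradeoff {x ε : ℝ} (h0 : 0 ≤ ε) (h1 : ε ≤ 1)
    (h : ∀ t : ℝ, 0 < t → x ≤ 3 * (t + (1 + t⁻¹) * ε)) : x ≤ 9 * Real.sqrt ε := by
  rcases h0.eq_or_lt with rfl | hpos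
  · rw [Real.sqrt_zero, mul_zero]
    refine le_of_forall_pos_le_add fun t ht => ?_
    have := h (t / 3) (by positivity)
    linarith
  · have hs := Real.sqrt_pos.mpr hpos
    have h₁ := h _ hs
    have h₂ : Real.sqrt ε * Real.sqrt ε = ε := Real.mul_self_sqrt h0
    have h₃ : (Real.sqrt ε)⁻¹ * ε = Real.sqrt ε := by
      nth_rewrite 2 [← h₂]
      rw [← mul_assoc, inv_mul_cancel₀ hs.ne', one_mul]
    have h₄ : Real.sqrt ε ≤ 1 := Real.sqrt_le_one.mpr h1
    nlinarith

/-- The effect of a projection that is implied by the test, averaged over the keys. -/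
theorem abs_avg_score_sub_restrict_le (C : Fin B.descLen → Bool) (σ h : Fin B.N → Bool)
    (p : (Fin B.coinLen → Bool) → (YWire B → Bool) → (ZWire B ⊕ Fin P.aux → Bool) → Bool)
    (hp : ∀ r y w, testAccepts B (B.genPK C r) y (w ∘ Sum.inl) = true → p r y w = true)
    (Γ : (Fin B.coinLen → Bool) → (YWire B → Bool) → Op (ZWire B ⊕ Fin P.aux))
    (hΓ : ∀ r y, (Γ r y).PosSemidef)
    (hdiag : ∀ r y w, Γ r y w w = P.state (B.genPK C r) y w w)
    (φ : (Fin B.coinLen → Bool) → (YWire B → Bool) →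
      (ZWire B → Bool) → (Fin B.N → Bool) → ℝ) (hφ : ∀ r y z a, |φ r y z a| ≤ 1) :
    |avg fun r => ∑ y, (P.score (B.genPK C r) y σ h (Γ r y) (φ r y) -
      P.score (B.genPK C r) y σ h (restrict (p r y) (Γ r y)) (φ r y))| ≤
        9 * Real.sqrt (1 - P.passProb C) := by
  refine le_of_forall_tradeoff (P.one_sub_passProb_nonneg C) (P.one_sub_passProb_le_one C)
    fun t ht => ?_
  have htr : ∀ r y, (Γ r y).trace = (P.state (B.genPK C r) y).trace := fun r y =>
    Finset.sum_congr rfl fun w _ => hdiag r y w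
  have hprob : ∀ r y, prob (P.state (B.genPK C r) y)
      (fun w => testAccepts B (B.genPK C r) y (w ∘ Sum.inl)) ≤ prob (Γ r y) (p r y) := by
    intro r y
    have : prob (Γ r y) (p r y) = prob (P.state (B.genPK C r) y) (p r y) := by
      simp only [prob, hdiag]
    rw [this]
    exact prob_mono (P.posSemidef_state _ _) fun w hw => hp r y w hw
  calc _ ≤ avg fun r => ∑ y, 3 * (t * (P.state (B.genPK C r) y).trace.re + (1 + t⁻¹) *
        ((P.state (B.genPK C r) y).trace.re - prob (P.state (B.genPK C r) y)
          fun w => testAccepts B (B.genPK C r) y (w ∘ Sum.inl))) := by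
        refine (abs_avg_le _).trans (avg_mono fun r => (Finset.abs_sum_le_sum_abs _ _).trans
          (Finset.sum_le_sum fun y _ => ?_))
        refine (P.abs_score_sub_restrict_le _ _ _ _ (hΓ r y) (hφ r y) _ ht).trans ?_
        rw [htr]
        have := hprob r y
        gcongr
    _ = 3 * (t + (1 + t⁻¹) * (1 - P.passProb C)) := by
        simp only [← Finset.mul_sum, Finset.sum_add_distrib, sum_trace_state, mul_one]
        rw [avg_mul_left, avg_add, avg_const, avg_mul_left, one_sub_passProb]

/-! ### The hybrids -/

/-- The `k`th hybrid: the positions below `k` with `h i = true` are measured as in the simulated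
experiment. The keys are sampled for `C`. -/
def hybrid (D : Distinguisher (Fin B.N)) (C : Fin B.descLen → Bool) (h : Fin B.N → Bool)
    (k : ℕ) : ℝ :=
  avg fun r => avg fun s => avg fun u => ∑ y,
    P.score (B.genPK C r) y (maskBelow h k s) h (P.state (B.genPK C r) y) fun z a =>
      D.accept (outStr B h (B.extSk (B.genSK C r)) y u (maskBelow h k s) z a)

theorem invertBit_eq (hF : F.Correct) (hB : B.Correct) (C r) {i : Fin B.N}
    (hi : B.basis C i = false) {y : YWire B → Bool} {z : Fin (F.ℓ + 1) → Bool}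
    (hz : F.check (B.extPk (B.genPK C r) i) z (fun k => y (i, k)) = true) :
    invertBit B (B.extSk (B.genSK C r)) y i = z 0 := by
  obtain ⟨r', h₁, h₂⟩ := hB C r i
  rw [hi] at h₁ h₂
  rw [← h₁] at hz
  obtain ⟨hdom, e, he⟩ := (hF.check_iff _ _ _ _).mp hz
  have := hF.injective r' z e hdom
  rw [he, h₂] at this
  rw [invertBit, this, Option.elim_some]

/-- On openings that pass the test, the first bit at a standard position is the inverted bit, which
depends only on `y`. Copying it therefore disturbs nothing there, and both experiments agree on the
projected state. Removing the projection from each of them costs `9 √ε`. -/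
theorem abs_real_sub_hybrid_zero_le (hF : F.Correct) (hB : B.Correct)
    (D : Distinguisher (Fin B.N)) (C : Fin B.descLen → Bool) :
    |∑ m, P.realDist C m * D.accept m - P.hybrid D C (B.basis C) 0| ≤
      18 * Real.sqrt (1 - P.passProb C) := by
  let test : (Fin B.coinLen → Bool) → (YWire B → Bool) → (ZWire B ⊕ Fin P.aux → Bool) → Bool :=
    fun r y w => testAccepts B (B.genPK C r) y (w ∘ Sum.inl)
  let φ₁ : (Fin B.coinLen → Bool) → (YWire B → Bool) → (ZWire B → Bool) → (Fin B.N → Bool) → ℝ :=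
    fun r y z _ => avg fun u => D.accept (verifierOut B (B.basis C) (B.extSk (B.genSK C r)) y u z)
  let φ₂ : (Fin B.coinLen → Bool) → (YWire B → Bool) → (ZWire B → Bool) → (Fin B.N → Bool) → ℝ :=
    fun r y z a => avg fun u => D.accept
      (outStr B (B.basis C) (B.extSk (B.genSK C r)) y u (fun _ => false) z a)
  have hacc : ∀ f : (Fin B.N → Bool) → Fin B.N → Bool, |avg fun u => D.accept (f u)| ≤ 1 :=
    fun f => abs_le.mpr ⟨by
      linarith [avg_nonneg (f := fun u => D.accept (f u)) fun u => D.accept_nonneg _],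
      avg_le fun u => D.accept_le_one _⟩
  have hmask : ∀ s, maskBelow (B.basis C) 0 s = fun _ => false := by
    intro s; funext i; simp [maskBelow]
  have hG : P.hybrid D C (B.basis C) 0 = avg fun r => ∑ y, P.score (B.genPK C r) y
      (fun _ => false) (B.basis C) (P.state (B.genPK C r) y) (φ₂ r y) := by
    simp only [hybrid, hmask, avg_const, φ₂, score_avg_fun]
    congr 1
    funext r
    rw [avg_sum]
  have heq : ∀ r y, P.score (B.genPK C r) y (fun _ => false) (fun _ => true)
      (restrict (test r y) (P.state (B.genPK C r) y)) (φ₁ r y) =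
      P.score (B.genPK C r) y (fun _ => false) (B.basis C)
        (restrict (test r y) (P.state (B.genPK C r) y)) (φ₂ r y) := by
    intro r y
    rw [P.score_restrict_of_copyMask (a := fun _ => false),
      P.score_restrict_of_copyMask (h := B.basis C)
        (a := fun i => !B.basis C i && invertBit B (B.extSk (B.genSK C r)) y i)]
    · refine Finset.sum_congr rfl fun w _ => congrArg _ (congrArg avg (funext fun u =>
        congrArg D.accept (funext fun i => ?_)))
      rw [verifierOut, outStr]
      cases B.basis C i <;> simp
    · intro w hw
      funext i
      rw [copyMask]
      cases hi : B.basis C i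
      · rw [invertBit_eq hF hB C r hi (of_decide_eq_true hw i)]
        rfl
      · rfl
    · intro w _
      funext i
      simp [copyMask]
  have h₁ := P.abs_avg_score_sub_restrict_le C (fun _ => false) (fun _ => true) test
    (fun _ _ _ h => h) (fun r y => P.state (B.genPK C r) y) (fun r y => P.posSemidef_state _ _)
    (fun _ _ _ => rfl) φ₁ (fun r y z a => hacc _)
  have h₂ := P.abs_avg_score_sub_restrict_le C (fun _ => false) (B.basis C) test
    (fun _ _ _ h => h) (fun r y => P.state (B.genPK C r) y) (fun r y => P.posSemidef_state _ _)
    (fun _ _ _ => rfl) φ₂ (fun r y z a => hacc _)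
  simp only [heq, Finset.sum_sub_distrib, avg_sub] at h₁ h₂
  rw [sum_realDist_mul, hG]
  rw [abs_le] at h₁ h₂ ⊢
  constructor <;> linarith [h₁.1, h₁.2, h₂.1, h₂.2]

end Prover

end Real

/-! ### The simulated experiment -/

section Simulated

variable {F : TCF} {B : BatchKeyGen F}

/-- One position of the kernel of the simulated measurement: `h` is the basis, `m` the outcome,
`a` and `b` are the copied bits, `v` is the decoded bit, `s` the random mask. -/
def simEntry (h m a b v s : Bool) : ℂ :=
  (if (!h && a) = (!h && b) then 1 else 0) * ((if (s && h) && (a ^^ b) then -1 else 1) *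
    if ((if h then v else (!h && a)) ^^ (s && h)) = m then 1 else 0)

/-- For `h = 1` the left side is `(-1)^((a ⊕ b)(m ⊕ v)) / 2`, and on the right only the mask `s = m
⊕ v` yields the outcome `m`, with exactly this sign. For `h = 0` both masks give the indicator of `a
= b = m`. -/
theorem hadEntry_mul_hadEntry (h m a b v : Bool) :
    hadEntry h m a * hadEntry h m b * (if (a ^^ b) && v then -1 else 1) =
      2⁻¹ * (simEntry h m a b v true + simEntry h m a b v false) := by
  have h2 : (Real.sqrt 2 : ℂ) * Real.sqrt 2 = 2 := by
    rw [← Complex.ofReal_mul, Real.mul_self_sqrt (by norm_num)]; norm_num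
  have h0 : (Real.sqrt 2 : ℂ) ≠ 0 := by
    intro h; rw [h] at h2; norm_num at h2
  have h3 : (Real.sqrt 2 : ℂ)⁻¹ * (Real.sqrt 2 : ℂ)⁻¹ = 2⁻¹ := by rw [← mul_inv, h2]
  cases h
  · cases m <;> cases a <;> cases b <;> cases v <;> simp [hadEntry, simEntry] <;> norm_num
  · cases m <;> cases a <;> cases b <;> cases v <;>
      simp [hadEntry, simEntry, neg_div, h3, div_eq_mul_inv]

theorem maskBelow_card {N : ℕ} (h s : Fin N → Bool) (i : Fin N) :
    maskBelow h N s i = (s i && h i) := by simp [maskBelow]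

theorem hadOn_mul_hadOn_mul_phase {N : ℕ} (h m a b v : Fin N → Bool) :
    hadOn h m a * hadOn h m b * phase (fun i => a i ^^ b i) v =
      ((2 : ℂ) ^ N)⁻¹ * ∑ s, ∑ a' : Fin N → Bool,
        (if (fun i => !h i && a i) = a' ∧ (fun i => !h i && b i) = a' then
          phase (maskBelow h N s) (fun i => a i ^^ b i) else 0) *
        if (fun i => (if h i then v i else a' i) ^^ maskBelow h N s i) = m then 1 else 0 := by
  have h₁ : ∀ s : Fin N → Bool, ∑ a' : Fin N → Bool,
        (if (fun i => !h i && a i) = a' ∧ (fun i => !h i && b i) = a' then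
          phase (maskBelow h N s) (fun i => a i ^^ b i) else 0) *
        (if (fun i => (if h i then v i else a' i) ^^ maskBelow h N s i) = m then (1 : ℂ) else 0) =
      ∏ i, simEntry (h i) (m i) (a i) (b i) (v i) (s i) := by
    intro s
    have h₄ : ∀ f g : Fin N → Bool, ∏ i, (if f i = g i then (1 : ℂ) else 0) =
        if f = g then 1 else 0 := by
      intro f g
      rw [Fintype.prod_ite_zero]
      simp [funext_iff]
    -- The copied string `a'` is determined by `a`, so the sum over it reduces to one product over
    -- the positions.
    rw [Finset.sum_eq_single fun i => !h i && a i]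
    · simp only [simEntry, Finset.prod_mul_distrib, h₄]
      simp only [phase, maskBelow_card, true_and, ite_mul, one_mul, zero_mul,
        eq_comm (a := fun i => !h i && b i)]
    · intro a' _ ha'
      rw [if_neg fun hh => ha' hh.1.symm, zero_mul]
    · simp
  simp only [h₁]
  have h₂ : ∑ s : Fin N → Bool, ∏ i, simEntry (h i) (m i) (a i) (b i) (v i) (s i) =
      ∏ i, ∑ t : Bool, simEntry (h i) (m i) (a i) (b i) (v i) t := by
    rw [Finset.prod_univ_sum, Fintype.piFinset_univ]
  have h₃ : ((2 : ℂ) ^ N)⁻¹ = ∏ _i : Fin N, (2 : ℂ)⁻¹ := by simp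
  rw [h₂, h₃, ← Finset.prod_mul_distrib, hadOn_apply, hadOn_apply, phase,
    ← Finset.prod_mul_distrib, ← Finset.prod_mul_distrib]
  refine Finset.prod_congr rfl fun i _ => ?_
  rw [Fintype.sum_bool]
  exact hadEntry_mul_hadEntry _ _ _ _ _

namespace Prover

variable (P : Prover B)

/-- The state is split into the blocks `P_a ρ P_b`. Copying the standard positions keeps the blocks
on which `a` and `b` both agree with `a'` there, and conjugation by `Z(σ)` multiplies a block by the
character of `a ⊕ b`. -/
theorem evolve_attackOp_restrict (PK y σ) (h a' : Fin B.N → Bool) (ρ : Op (ZWire B ⊕ Fin P.aux))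
    (w) : evolve (P.attackOp PK y σ) (restrict (fun w => decide (copyMask h w = a')) ρ) w w =
      ∑ a, ∑ b, (if (fun i => !h i && a i) = a' ∧ (fun i => !h i && b i) = a' then
        phase σ (fun i => a i ^^ b i) else 0) *
          evolve (hadOpen B (Fin P.aux) * P.U PK y) (select (firstBits B) a b ρ) w w := by
  have h₁ : evolve (Matrix.diagonal fun w => phase σ (firstBits B w))
      (restrict (fun w => decide (copyMask h w = a')) ρ) = ∑ a, ∑ b,
        (if (fun i => !h i && a i) = a' ∧ (fun i => !h i && b i) = a' then
          phase σ (fun i => a i ^^ b i) else 0) • select (firstBits B) a b ρ := by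
    ext s t
    simp only [evolve_diagonal_apply, Matrix.sum_apply, Matrix.smul_apply, smul_eq_mul, select,
      Matrix.of_apply, star_phase]
    rw [Finset.sum_eq_single (firstBits B s), Finset.sum_eq_single (firstBits B t)]
    · have hc : ∀ w : ZWire B ⊕ Fin P.aux → Bool,
          (fun i => !h i && firstBits B w i) = copyMask h w := fun _ => rfl
      simp only [hc, restrict, Matrix.of_apply, decide_eq_true_eq, and_self, if_true,
        ← phase_mul_right]
      split_ifs <;> ring
    · intro b _ hb
      exact mul_eq_zero_of_right _ (if_neg fun hh => hb hh.2.symm)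
    · simp
    · intro a _ ha
      refine Finset.sum_eq_zero fun b _ => ?_
      exact mul_eq_zero_of_right _ (if_neg fun hh => ha hh.1.symm)
    · simp
  rw [attackOp, evolve_mul, h₁]
  generalize hadOpen B (Fin P.aux) * P.U PK y = V
  simp only [evolve, Matrix.mul_sum, Matrix.sum_mul, Matrix.sum_apply, Matrix.mul_smul,
    Matrix.smul_mul, Matrix.smul_apply, smul_eq_mul]

/-- The bridge from extraction to an experiment with the prover: the closed form of the extracted
state is paired with the Hadamard entries of the measurement, and `hadOn_mul_hadOn_mul_phase`
rewrites their product as an average over masks. At standard positions no secret key is needed any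
more. -/
theorem measure_extractedState (PK SK y) (ρ : Op (ZWire B ⊕ Fin P.aux)) (h m : Fin B.N → Bool) :
    measure h (extractedState B (P.U PK y) ρ SK y) m = avg fun s => avg fun u =>
      P.score PK y (maskBelow h B.N s) h ρ fun z a =>
        if outStr B h (B.extSk SK) y u (maskBelow h B.N s) z a = m then 1 else 0 := by
  let E : (Fin B.N → Bool) → (Fin B.N → Bool) → (ZWire B ⊕ Fin P.aux → Bool) → ℂ := fun a b w =>
    evolve (hadOpen B (Fin P.aux) * P.U PK y) (select (firstBits B) a b ρ) w w
  let c : ℝ := ((2 : ℝ) ^ B.N)⁻¹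
  have hc : (c : ℂ) = ((2 : ℂ) ^ B.N)⁻¹ := by simp [c]
  let X : (Fin B.N → Bool) → (Fin B.N → Bool) → (Fin B.N → Bool) →
      (ZWire B ⊕ Fin P.aux → Bool) → ℂ := fun s u a' w =>
    evolve (P.attackOp PK y (maskBelow h B.N s)) (restrict (fun w => decide (copyMask h w = a')) ρ)
      w w * if outStr B h (B.extSk SK) y u (maskBelow h B.N s) (w ∘ Sum.inl) a' = m then 1 else 0
  have hR : (avg fun s => avg fun u => P.score PK y (maskBelow h B.N s) h ρ fun z a =>
      if outStr B h (B.extSk SK) y u (maskBelow h B.N s) z a = m then 1 else 0) =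
      ((c : ℂ) * ∑ s, (c : ℂ) * ∑ u, ∑ a', ∑ w, X s u a' w).re := by
    simp only [avg, Fintype.card_fin, div_eq_inv_mul, Complex.re_ofReal_mul, Complex.re_sum, score]
    refine congrArg _ (Finset.sum_congr rfl fun s _ => congrArg _ (Finset.sum_congr rfl fun u _ =>
      Finset.sum_congr rfl fun a _ => Finset.sum_congr rfl fun w _ => ?_))
    simp only [X]
    split_ifs <;> simp
  have hL : evolve (hadOn h) (extractedState B (P.U PK y) ρ SK y) m m = ∑ w, ∑ u, (c : ℂ) *
      ∑ a, ∑ b, hadOn h m a * hadOn h m b *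
        phase (fun i => a i ^^ b i) (decodeBits B (B.extSk SK) y (w ∘ Sum.inl) u) * E a b w := by
    rw [evolve_apply]
    simp only [extractedState_apply B (P.U_mem_unitaryGroup PK y), hadOn_star,
      Finset.mul_sum, Finset.sum_mul, hc]
    have hsw : ∀ f : (Fin B.N → Bool) → (Fin B.N → Bool) → (ZWire B ⊕ Fin P.aux → Bool) →
        (Fin B.N → Bool) → ℂ, ∑ a, ∑ b, ∑ w, ∑ u, f a b w u = ∑ w, ∑ u, ∑ a, ∑ b, f a b w u := by
      intro f
      calc _ = ∑ a, ∑ w, ∑ b, ∑ u, f a b w u :=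
            Finset.sum_congr rfl fun a _ => Finset.sum_comm
        _ = ∑ w, ∑ a, ∑ b, ∑ u, f a b w u := Finset.sum_comm
        _ = ∑ w, ∑ a, ∑ u, ∑ b, f a b w u :=
            Finset.sum_congr rfl fun w _ => Finset.sum_congr rfl fun a _ => Finset.sum_comm
        _ = _ := Finset.sum_congr rfl fun w _ => Finset.sum_comm
    rw [← hsw]
    refine Finset.sum_congr rfl fun a _ => Finset.sum_congr rfl fun b _ =>
      Finset.sum_congr rfl fun w _ => Finset.sum_congr rfl fun u _ => ?_
    simp only [E]
    ring
  have hk : ∀ w u, ∑ a, ∑ b, hadOn h m a * hadOn h m b *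
      phase (fun i => a i ^^ b i) (decodeBits B (B.extSk SK) y (w ∘ Sum.inl) u) * E a b w =
      (c : ℂ) * ∑ s, ∑ a', X s u a' w := by
    intro w u
    simp only [hadOn_mul_hadOn_mul_phase, X, evolve_attackOp_restrict, ← hc, Finset.mul_sum,
      Finset.sum_mul]
    have hsw : ∀ f : (Fin B.N → Bool) → (Fin B.N → Bool) → (Fin B.N → Bool) →
        (Fin B.N → Bool) → ℂ, ∑ a, ∑ b, ∑ s, ∑ a', f a b s a' =
          ∑ s, ∑ a', ∑ a, ∑ b, f a b s a' := by
      intro f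
      calc _ = ∑ a, ∑ s, ∑ b, ∑ a', f a b s a' :=
            Finset.sum_congr rfl fun a _ => Finset.sum_comm
        _ = ∑ s, ∑ a, ∑ b, ∑ a', f a b s a' := Finset.sum_comm
        _ = ∑ s, ∑ a, ∑ a', ∑ b, f a b s a' :=
            Finset.sum_congr rfl fun w _ => Finset.sum_congr rfl fun a _ => Finset.sum_comm
        _ = _ := Finset.sum_congr rfl fun w _ => Finset.sum_comm
    rw [hsw]
    refine Finset.sum_congr rfl fun s _ => Finset.sum_congr rfl fun a' _ =>
      Finset.sum_congr rfl fun a _ => Finset.sum_congr rfl fun b _ => ?_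
    have ho : outStr B h (B.extSk SK) y u (maskBelow h B.N s) (w ∘ Sum.inl) a' = fun i =>
        (if h i then decodeBits B (B.extSk SK) y (w ∘ Sum.inl) u i else a' i) ^^
          maskBelow h B.N s i := rfl
    rw [ho]
    simp only [E]
    ring
  rw [hR, measure, hL]
  congr 1
  simp only [hk, Finset.mul_sum]
  calc _ = ∑ w, ∑ s, ∑ u, ∑ a', (c : ℂ) * (c * X s u a' w) :=
        Finset.sum_congr rfl fun w _ => Finset.sum_comm
    _ = ∑ s, ∑ w, ∑ u, ∑ a', (c : ℂ) * (c * X s u a' w) := Finset.sum_comm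
    _ = ∑ s, ∑ u, ∑ w, ∑ a', (c : ℂ) * (c * X s u a' w) :=
        Finset.sum_congr rfl fun s _ => Finset.sum_comm
    _ = _ := Finset.sum_congr rfl fun s _ => Finset.sum_congr rfl fun u _ => Finset.sum_comm

/-- With all masks on, the hybrid is the simulated experiment, whose keys are those of `B.one` while
the basis is that of `C`. -/
theorem sum_simDist_mul {sim : ClassicalAlg (Fin B.coinLen) (Fin B.PKLen ⊕ Fin B.SKLen)}
    {ext : Extractor B} (hsim : ∀ r, sim.fn r = B.genAlg.fn (Sum.elim B.one r))
    (hext : ∀ PK SK y, ext.run (P.U PK y) (P.state PK y) (Sum.elim PK (Sum.elim SK y)) =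
      extractedState B (P.U PK y) (P.state PK y) SK y)
    (D : Distinguisher (Fin B.N)) (C : Fin B.descLen → Bool) :
    ∑ m, simDist P sim ext C m * D.accept m = P.hybrid D B.one (B.basis C) B.N := by
  have hPK : ∀ r, sim.fn r ∘ Sum.inl = B.genPK B.one r := fun r => by rw [hsim, BatchKeyGen.genPK]
  have hSK : ∀ r, sim.fn r ∘ Sum.inr = B.genSK B.one r := fun r => by rw [hsim, BatchKeyGen.genSK]
  simp only [simDist, ← avg_mul_right]
  rw [← avg_sum, hybrid]
  refine congrArg avg (funext fun r => ?_)
  simp only [hPK, hSK, hext, measure_extractedState, Finset.sum_mul]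
  rw [Finset.sum_comm]
  simp only [← avg_mul_right, ← avg_sum]
  refine congrArg avg (funext fun s => congrArg avg (funext fun u =>
    Finset.sum_congr rfl fun y _ => ?_))
  simp only [mul_comm _ (D.accept _), ← score_smul_fun]
  rw [← score_sum_fun]
  refine congrArg _ (funext fun z => funext fun a => ?_)
  simp

end Prover

end Simulated

/-! ### One hybrid step -/

section Step

variable {F : TCF} {B : BatchKeyGen F}

/-- The states of the openings that pass the check at `k` are determined by the first bit. -/
theorem dephase_openAt_restrict (hF : F.Correct) (hB : B.Correct) (P : Prover B) {C r}
    {k : Fin B.N} (hk : B.basis C k = true) (y : YWire B → Bool) (ρ : Op (ZWire B ⊕ Fin P.aux)) :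
    dephase (Prover.openAt k) (restrict (P.checkAt (B.genPK C r) y k) ρ) =
      dephase (fun w => firstBits B w k) (restrict (P.checkAt (B.genPK C r) y k) ρ) := by
  obtain ⟨r', h₁, h₂⟩ := hB C r k
  rw [hk] at h₁ h₂
  have key : ∀ w, P.checkAt (B.genPK C r) y k w = true → ∃ x₀ x₁,
      F.invertTwo (F.genSk true r') (fun i => y (k, i)) = some (x₀, x₁) ∧
        (if w (.inl (k, 0)) then x₁ else x₀) = Fin.tail (Prover.openAt k w) := by
    intro w hw
    rw [Prover.checkAt, ← h₁] at hw
    obtain ⟨hdom, e, he⟩ := (hF.check_iff _ _ _ _).mp hw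
    obtain ⟨x₀, x₁, hi, ht, -⟩ := hF.twoToOne r' _ e hdom
    rw [he] at hi
    exact ⟨x₀, x₁, hi, ht⟩
  ext w w'
  simp only [dephase, restrict, Matrix.of_apply]
  by_cases hc : P.checkAt (B.genPK C r) y k w = true ∧ P.checkAt (B.genPK C r) y k w' = true
  · obtain ⟨x₀, x₁, hi, ht⟩ := key w hc.1
    obtain ⟨x₀', x₁', hi', ht'⟩ := key w' hc.2
    -- Both openings are checked against the same `y`, so they belong to the same pair of preimages
    -- and differ only if their first bits do.
    have hx := Option.some.inj (hi.symm.trans hi')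
    refine if_congr ⟨fun h => congrFun h 0, fun h => ?_⟩ rfl rfl
    have h0 : w (.inl (k, 0)) = w' (.inl (k, 0)) := h
    have htail : Fin.tail (Prover.openAt k w) = Fin.tail (Prover.openAt k w') := by
      rw [← ht, ← ht', h0, (Prod.mk.inj hx).1, (Prod.mk.inj hx).2]
    funext i
    refine Fin.cases h0 (fun j => ?_) i
    exact congrFun htail j
  · rw [if_neg hc, ite_self, ite_self]

theorem posSemidef_dephase_bit {α : Type} [Fintype α] [DecidableEq α] {ρ : Op α}
    (hρ : ρ.PosSemidef) (f : (α → Bool) → Bool) : (dephase f ρ).PosSemidef := by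
  have : dephase f ρ = restrict f ρ + restrict (fun s => !f s) ρ := by
    ext s t
    simp only [dephase, restrict, Matrix.add_apply, Matrix.of_apply]
    by_cases hs : f s = true <;> by_cases ht : f t = true <;> simp [hs, ht]
  rw [this]
  exact (posSemidef_restrict hρ _).add (posSemidef_restrict hρ _)

theorem dephase_restrict {α γ : Type} [Fintype α] [DecidableEq α] [DecidableEq γ] (ρ : Op α)
    (f : (α → Bool) → γ) (p : (α → Bool) → Bool) :
    dephase f (restrict p ρ) = restrict p (dephase f ρ) := by
  ext s t
  simp only [dephase, restrict, Matrix.of_apply]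
  split_ifs <;> rfl

theorem phase_update {N : ℕ} {σ : Fin N → Bool} {k : Fin N} (hσ : σ k = false)
    (v : Fin N → Bool) : phase (Function.update σ k true) v =
      phase σ v * if v k then -1 else 1 := by
  have h₁ : phase (fun i => decide (i = k)) v = if v k then -1 else 1 := by
    rw [phase, Fintype.prod_eq_single k]
    · simp
    · intro i hi
      simp [hi]
  rw [← h₁, phase_mul]
  congr 1
  funext i
  by_cases hi : i = k
  · subst hi; simp [hσ]
  · simp [hi]

namespace Prover

variable (P : Prover B)

/-- For a Pauli `Z` operator on one bit, `Z ρ Z` is twice the state with that bit measured, minus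
`ρ`. In this way masks are turned into measurements of the first bit. -/
theorem score_update (PK y h) {σ : Fin B.N → Bool} {k : Fin B.N} (hσ : σ k = false)
    (ρ : Op (ZWire B ⊕ Fin P.aux)) (φ) : P.score PK y (Function.update σ k true) h ρ φ =
      2 * P.score PK y σ h (dephase (fun w => firstBits B w k) ρ) φ - P.score PK y σ h ρ φ := by
  let Z : Op (ZWire B ⊕ Fin P.aux) := Matrix.diagonal fun w => if firstBits B w k then -1 else 1
  have hA : P.attackOp PK y (Function.update σ k true) = P.attackOp PK y σ * Z := by
    rw [attackOp, attackOp, Matrix.mul_assoc (_ * _), Matrix.diagonal_mul_diagonal]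
    congr 2
    funext w
    exact phase_update hσ _
  have hZ : ∀ p, evolve Z (restrict p ρ) = restrict p (evolve Z ρ) := by
    intro p
    ext s t
    simp only [Z, evolve_diagonal_apply, restrict, Matrix.of_apply]
    split_ifs <;> simp
  have hρ : evolve Z ρ =
      ((2 : ℝ) : ℂ) • dephase (fun w => firstBits B w k) ρ + ((-1 : ℝ) : ℂ) • ρ := by
    ext s t
    simp only [Z, evolve_diagonal_apply, dephase, Matrix.add_apply, Matrix.smul_apply,
      Matrix.of_apply, smul_eq_mul]
    by_cases hs : firstBits B s k = true <;> by_cases ht : firstBits B t k = true <;>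
      simp [hs, ht] <;> ring
  have : P.score PK y (Function.update σ k true) h ρ φ = P.score PK y σ h (evolve Z ρ) φ := by
    rw [score, score]
    simp only [hA, evolve_mul, hZ]
  rw [this, hρ, score_add, score_smul, score_smul]
  ring

/-- The decoded bit at `k` is moved into the mask, so that the rest of the string can be computed
without the secret key of position `k`. As `k` is a Hadamard position, no copied bit stands in its
place. -/
theorem outStr_update (T : Fin B.N → Bool) {k : Fin B.N} (hk : T k = true)
    (sk : Fin B.N → Fin F.skLen → Bool) (y u σ z) {a : Fin B.N → Bool} (ha : a k = false)
    (c : Bool) : outStr B T sk y u (Function.update σ k c) z a =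
      outStr B (Function.update T k false) sk y u
        (Function.update σ k (c ^^ decodeBits B sk y z u k)) z a := by
  funext i
  rw [outStr, outStr]
  by_cases hi : i = k
  · subst hi
    simp [hk, ha, Bool.xor_comm]
  · simp [hi]

/-- The change of the score when position `k` is measured as in the simulated experiment. -/
theorem score_step (PK y) {h σ : Fin B.N → Bool} {k : Fin B.N} (hk : h k = true)
    (hσ : σ k = false) (sk : Fin B.N → Fin F.skLen → Bool) (u : Fin B.N → Bool)
    (g : (Fin B.N → Bool) → ℝ) (ρ : Op (ZWire B ⊕ Fin P.aux))
    {φ ψ : Bool → (ZWire B → Bool) → (Fin B.N → Bool) → ℝ}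
    (hφ : φ = fun c z a => g (outStr B h sk y u (Function.update σ k c) z a))
    (hψ : ψ = fun c z a =>
      g (outStr B (Function.update h k false) sk y u (Function.update σ k c) z a)) :
    (P.score PK y σ h ρ (φ false) + P.score PK y (Function.update σ k true) h ρ (φ true)) / 2 -
      P.score PK y σ h ρ (φ false) =
    ((P.score PK y σ h (dephase (fun w => firstBits B w k) ρ) (ψ false) -
        P.score PK y σ h ρ (ψ false)) +
      (P.score PK y σ h (dephase (fun w => firstBits B w k) ρ) (ψ true) -
        P.score PK y σ h ρ (ψ true))) / 2 -
      P.score PK y σ h (dephase (fun w => firstBits B w k) ρ) fun z a =>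
        (if decodeBits B sk y z u k then -1 else 1) * ((ψ false z a - ψ true z a) / 2) := by
  have hφψ : ∀ c z a, (∀ i, h i = true → a i = false) →
      φ c z a = ψ (c ^^ decodeBits B sk y z u k) z a := by
    intro c z a ha
    rw [hφ, hψ]
    dsimp only
    rw [outStr_update h hk sk y u σ z (ha k hk)]
  -- In the sum over both masks the decoded bit only permutes the two terms, so it disappears.
  have h₁ : ∀ ρ', P.score PK y σ h ρ' (φ false) + P.score PK y σ h ρ' (φ true) =
      P.score PK y σ h ρ' (ψ false) + P.score PK y σ h ρ' (ψ true) := by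
    intro ρ'
    rw [← score_add_fun, ← score_add_fun]
    refine P.score_congr _ _ _ _ fun z a ha => ?_
    rw [hφψ _ _ _ ha, hφψ _ _ _ ha]
    cases decodeBits B sk y z u k <;> simp [add_comm]
  -- In the difference of the masks the same permutation becomes the sign of the decoded bit.
  have h₂ : ∀ ρ', (P.score PK y σ h ρ' fun z a =>
      (if decodeBits B sk y z u k then -1 else 1) * ((ψ false z a - ψ true z a) / 2)) =
      2⁻¹ * (P.score PK y σ h ρ' (φ false) - P.score PK y σ h ρ' (φ true)) := by
    intro ρ'
    rw [← score_sub_fun, ← score_smul_fun]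
    refine P.score_congr _ _ _ _ fun z a ha => ?_
    rw [hφψ _ _ _ ha, hφψ _ _ _ ha]
    cases decodeBits B sk y z u k <;> simp <;> ring
  rw [h₂, score_update P PK y h hσ]
  have e₁ := h₁ ρ
  have e₂ := h₁ (dephase (fun w => firstBits B w k) ρ)
  linarith

/-- Where no good claw exists, the decoded bit is the uniform bit `u k`, so its sign averages to
`0`; elsewhere it does not depend on `u k`. The result is the signed function of the hardcore bit
game. -/
theorem avg_sign_decodeBits (sk : Fin B.N → Fin F.skLen → Bool) (y z) (k : Fin B.N)
    (f : (Fin B.N → Bool) → ℝ) (hf : ∀ u b, f (Function.update u k b) = f u) :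
    (avg fun u => (if decodeBits B sk y z u k then -1 else 1) * f u) =
      avg fun u => hardcoreSign F (sk k) (fun i => y (k, i)) (fun i => z (k, i)) * f u := by
  have h := avg_resample k (fun u b => (if F.decodeBit (sk k) (fun i => y (k, i))
    (fun i => z (k, i)) b then (-1 : ℝ) else 1) * f u) fun c b b' => by rw [hf]
  refine h.trans (congrArg avg (funext fun u => ?_))
  have key : ∀ (o : Option ((Fin F.ℓ → Bool) × (Fin F.ℓ → Bool))) (e : _ → Bool) (x : ℝ),
      ((if o.elim false e then -1 else 1) * x + (if o.elim true e then -1 else 1) * x) / 2 =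
        (o.elim 0 fun p => if e p then -1 else 1) * x := by
    intro o e x
    rcases o with _ | p
    · simp
    · by_cases he : e p = true <;> simp [he, add_self_div_two]
  exact key _ _ _

theorem outStr_update_random (T : Fin B.N → Bool) {k : Fin B.N} (hk : T k = false)
    (sk : Fin B.N → Fin F.skLen → Bool) (y u m₀ z) (a : Fin B.N → Bool) (b : Bool) :
    outStr B T sk y (Function.update u k b) m₀ z a = outStr B T sk y u m₀ z a := by
  funext i
  rw [outStr, outStr]
  by_cases hi : i = k
  · subst hi; simp [hk]
  · simp [decodeBits, hi]

theorem outStr_congr_keys (T : Fin B.N → Bool) {sk sk' : Fin B.N → Fin F.skLen → Bool}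
    (hsk : ∀ i, T i = true → sk i = sk' i) (y u m₀ z) (a : Fin B.N → Bool) :
    outStr B T sk y u m₀ z a = outStr B T sk' y u m₀ z a := by
  funext i
  rw [outStr, outStr]
  by_cases hi : T i = true
  · simp [hi, decodeBits, hsk i hi]
  · simp [hi]

theorem maskBelow_succ {N : ℕ} {h : Fin N → Bool} {k : Fin N} (hk : h k = true)
    (s : Fin N → Bool) : maskBelow h (k + 1) s = Function.update (maskBelow h k s) k (s k) := by
  funext i
  by_cases hi : i = k
  · subst hi; simp [maskBelow, hk]
  · have : ((i : ℕ) < k + 1) ↔ (i : ℕ) < k := by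
      have := Fin.val_ne_of_ne hi
      omega
    simp [maskBelow, hi, this]

theorem maskBelow_succ_of_false {N : ℕ} {h : Fin N → Bool} {k : Fin N} (hk : h k = false)
    (s : Fin N → Bool) : maskBelow h (k + 1) s = maskBelow h k s := by
  funext i
  by_cases hi : i = k
  · subst hi; simp [maskBelow, hk]
  · have : ((i : ℕ) < k + 1) ↔ (i : ℕ) < k := by
      have := Fin.val_ne_of_ne hi
      omega
    simp [maskBelow, this]

theorem maskBelow_update {N : ℕ} (h : Fin N → Bool) (k : Fin N) (s : Fin N → Bool) (b : Bool) :
    maskBelow h k (Function.update s k b) = maskBelow h k s := by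
  funext i
  by_cases hi : i = k
  · subst hi; simp [maskBelow]
  · simp [maskBelow, hi]

theorem hybrid_succ_of_false (D : Distinguisher (Fin B.N)) (C) {h : Fin B.N → Bool} {k : Fin B.N}
    (hk : h k = false) : P.hybrid D C h (k + 1) = P.hybrid D C h k := by
  simp only [hybrid, maskBelow_succ_of_false hk]

/-- The test function of the reductions at position `k`. -/
def stepTest (D : Distinguisher (Fin B.N)) (C : Fin B.descLen → Bool) (k : Fin B.N)
    (u m₀ : Fin B.N → Bool) (r : Fin B.coinLen → Bool) (y : YWire B → Bool)
    (z : ZWire B → Bool) (a : Fin B.N → Bool) : ℝ :=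
  D.accept (outStr B (Function.update (B.basis C) k false) (B.extSk (B.genSK C r)) y u m₀ z a)

/-- One step of the hybrid is the average over mask bit `k` of `score_step`: a collapsing difference
for each of the two output masks, minus the hardcore term. None of the test functions decodes
position `k`; its secret key enters only through `hardcoreSign`. -/
theorem hybrid_succ_sub (D : Distinguisher (Fin B.N)) (C) {k : Fin B.N}
    (hk : B.basis C k = true) :
    P.hybrid D C (B.basis C) (k + 1) - P.hybrid D C (B.basis C) k =
      avg fun s => avg fun u => avg fun r => ∑ y,
        (((P.score (B.genPK C r) y (maskBelow (B.basis C) k s) (B.basis C)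
            (dephase (fun w => firstBits B w k) (P.state (B.genPK C r) y))
            (stepTest D C k u (Function.update (maskBelow (B.basis C) k s) k false) r y) -
          P.score (B.genPK C r) y (maskBelow (B.basis C) k s) (B.basis C) (P.state (B.genPK C r) y)
            (stepTest D C k u (Function.update (maskBelow (B.basis C) k s) k false) r y)) +
          (P.score (B.genPK C r) y (maskBelow (B.basis C) k s) (B.basis C)
            (dephase (fun w => firstBits B w k) (P.state (B.genPK C r) y))
            (stepTest D C k u (Function.update (maskBelow (B.basis C) k s) k true) r y) -
          P.score (B.genPK C r) y (maskBelow (B.basis C) k s) (B.basis C) (P.state (B.genPK C r) y)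
            (stepTest D C k u (Function.update (maskBelow (B.basis C) k s) k true) r y))) / 2 -
        P.score (B.genPK C r) y (maskBelow (B.basis C) k s) (B.basis C)
          (dephase (fun w => firstBits B w k) (P.state (B.genPK C r) y)) fun z a =>
            hardcoreSign F (B.extSk (B.genSK C r) k) (fun i => y (k, i)) (fun i => z (k, i)) *
            ((stepTest D C k u (Function.update (maskBelow (B.basis C) k s) k false) r y z a -
              stepTest D C k u (Function.update (maskBelow (B.basis C) k s) k true) r y z a) / 2)) := by
  have hrot : ∀ f : (Fin B.N → Bool) → (Fin B.N → Bool) → (Fin B.coinLen → Bool) → ℝ,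
      (avg fun s => avg fun u => avg fun r => f s u r) =
        avg fun r => avg fun s => avg fun u => f s u r := by
    intro f
    have h₁ : ∀ s, (avg fun u => avg fun r => f s u r) = avg fun r => avg fun u => f s u r :=
      fun s => avg_comm _
    simp only [h₁]
    exact avg_comm _
  rw [hrot, hybrid, hybrid, ← avg_sub]
  refine congrArg avg (funext fun r => ?_)
  have hmask : ∀ s, maskBelow (B.basis C) k s k = false := by intro s; simp [maskBelow]
  have hsame : ∀ s, Function.update (maskBelow (B.basis C) k s) k false =
      maskBelow (B.basis C) k s := by
    intro s; rw [← hmask s]; exact Function.update_eq_self _ _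
  -- The mask below `k` does not involve bit `k` of `s`, so that bit can be drawn last and the
  -- average over its two values taken explicitly.
  have h₁ := avg_resample k (fun s b => avg fun u => ∑ y, P.score (B.genPK C r) y
    (Function.update (maskBelow (B.basis C) k s) k b) (B.basis C) (P.state (B.genPK C r) y)
      fun z a => D.accept (outStr B (B.basis C) (B.extSk (B.genSK C r)) y u
        (Function.update (maskBelow (B.basis C) k s) k b) z a))
    fun s b b' => by rw [maskBelow_update]
  simp only [maskBelow_succ hk]
  rw [h₁, ← avg_sub]
  refine congrArg avg (funext fun s => ?_)
  rw [hsame, ← avg_add, div_eq_inv_mul, ← avg_mul_left, ← avg_sub, ← hsame s]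
  have hdist : ∀ a b : (YWire B → Bool) → ℝ, 2⁻¹ * (∑ y, a y + ∑ y, b y) - ∑ y, a y =
      ∑ y, ((a y + b y) / 2 - a y) := by
    intro a b
    rw [Finset.sum_sub_distrib, ← Finset.sum_div, Finset.sum_add_distrib]
    ring
  simp only [hdist, avg_sum]
  refine Finset.sum_congr rfl fun y _ => ?_
  have hstep := fun u => P.score_step (B.genPK C r) y hk (hmask s) (B.extSk (B.genSK C r)) u
    D.accept (P.state (B.genPK C r) y) rfl rfl
  simp only [hsame] at hstep ⊢
  simp only [hstep]
  rw [avg_sub, avg_sub, ← score_avg_fun, ← score_avg_fun]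
  refine congrArg₂ _ rfl (congrArg _ (funext fun z => funext fun a => ?_))
  refine avg_sign_decodeBits _ y z k _ fun u b => ?_
  rw [outStr_update_random _ (by simp), outStr_update_random _ (by simp)]

end Prover

end Step

/-! ### The distance of the two experiments -/

namespace Prover

variable {F : TCF} {B : BatchKeyGen F} (P : Prover B)

theorem abs_stepTest_le (D : Distinguisher (Fin B.N)) (C k u m₀ r y z a) :
    |stepTest D C k u m₀ r y z a| ≤ 1 :=
  abs_le.mpr ⟨by linarith [D.accept_nonneg (outStr B (Function.update (B.basis C) k false)
    (B.extSk (B.genSK C r)) y u m₀ z a), stepTest.eq_1 D C k u m₀ r y z a],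
    D.accept_le_one _⟩

theorem abs_hardcoreSign_le (F : TCF) (sk y d) : |hardcoreSign F sk y d| ≤ 1 := by
  have key : ∀ (o : Option ((Fin F.ℓ → Bool) × (Fin F.ℓ → Bool))) (e : _ → Bool),
      |(o.elim 0 fun p => if e p then -1 else 1 : ℝ)| ≤ 1 := by
    intro o e
    rcases o with _ | p
    · simp
    · by_cases he : e p = true <;> simp [he]
  exact key _ _

theorem testAccepts_imp_checkAt (C : Fin B.descLen → Bool) (k : Fin B.N) (r y)
    (w : ZWire B ⊕ Fin P.aux → Bool)
    (hw : testAccepts B (B.genPK C r) y (w ∘ Sum.inl) = true) :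
    P.checkAt (B.genPK C r) y k w = true := of_decide_eq_true hw k

/-- Each of the terms in `hybrid_succ_sub` is first moved to the state projected by the check at
`k`. The undisturbed and the dephased scores occur twice each with weight `1 / 2`, and the hardcore
term occurs once, so the gentle measurement errors add up to `27 √ε`. -/
theorem abs_hybrid_succ_sub_le (hF : F.Correct) (hB : B.Correct) (D : Distinguisher (Fin B.N))
    (C : Fin B.descLen → Bool) {k : Fin B.N} (hk : B.basis C k = true) {ν₁ ν₂ : ℝ}
    (hν₁ : ∀ σ u m₀, |avg fun r =>
      ∑ y, P.score (B.genPK C r) y σ (B.basis C) (dephase (fun w => firstBits B w k)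
        (restrict (P.checkAt (B.genPK C r) y k) (P.state (B.genPK C r) y)))
        (stepTest D C k u m₀ r y) -
      ∑ y, P.score (B.genPK C r) y σ (B.basis C)
        (restrict (P.checkAt (B.genPK C r) y k) (P.state (B.genPK C r) y))
        (stepTest D C k u m₀ r y)| ≤ ν₁)
    (hν₂ : ∀ σ u m₀, |avg fun r =>
      ∑ y, P.score (B.genPK C r) y σ (B.basis C) (dephase (openAt k)
        (restrict (P.checkAt (B.genPK C r) y k) (P.state (B.genPK C r) y))) fun z a =>
          hardcoreSign F (B.extSk (B.genSK C r) k) (fun i => y (k, i)) (fun i => z (k, i)) *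
            (1 - 2 * stepTest D C k u m₀ r y z a)| ≤ ν₂) :
    |P.hybrid D C (B.basis C) (k + 1) - P.hybrid D C (B.basis C) k| ≤
      ν₁ + ν₂ / 2 + 27 * Real.sqrt (1 - P.passProb C) := by
  rw [hybrid_succ_sub P D C hk]
  refine (abs_avg_le _).trans (avg_le fun s => (abs_avg_le _).trans (avg_le fun u => ?_))
  generalize maskBelow (B.basis C) k s = σ
  have hcheck := P.testAccepts_imp_checkAt C k
  have g₁ : ∀ c, _ := fun c => P.abs_avg_score_sub_restrict_le C σ (B.basis C)
    (fun r y => P.checkAt (B.genPK C r) y k) (fun r y w => hcheck r y w)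
    (fun r y => P.state (B.genPK C r) y) (fun r y => P.posSemidef_state _ _) (fun _ _ _ => rfl)
    (fun r y => stepTest D C k u (Function.update σ k c) r y)
    fun r y z a => abs_stepTest_le D C k u _ r y z a
  have hdiag : ∀ r y w, dephase (fun w => firstBits B w k) (P.state (B.genPK C r) y) w w =
      P.state (B.genPK C r) y w w := fun _ _ _ => if_pos rfl
  have g₂ : ∀ c, _ := fun c => P.abs_avg_score_sub_restrict_le C σ (B.basis C)
    (fun r y => P.checkAt (B.genPK C r) y k) (fun r y w => hcheck r y w)
    (fun r y => dephase (fun w => firstBits B w k) (P.state (B.genPK C r) y))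
    (fun r y => posSemidef_dephase_bit (P.posSemidef_state _ _) _) hdiag
    (fun r y => stepTest D C k u (Function.update σ k c) r y)
    fun r y z a => abs_stepTest_le D C k u _ r y z a
  have g₃ := P.abs_avg_score_sub_restrict_le C σ (B.basis C)
    (fun r y => P.checkAt (B.genPK C r) y k) (fun r y w => hcheck r y w)
    (fun r y => dephase (fun w => firstBits B w k) (P.state (B.genPK C r) y))
    (fun r y => posSemidef_dephase_bit (P.posSemidef_state _ _) _) hdiag
    (fun r y z a =>
      hardcoreSign F (B.extSk (B.genSK C r) k) (fun i => y (k, i)) (fun i => z (k, i)) *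
        ((stepTest D C k u (Function.update σ k false) r y z a -
          stepTest D C k u (Function.update σ k true) r y z a) / 2))
    fun r y z a => by
      rw [abs_mul]
      have h₁ := abs_hardcoreSign_le F (B.extSk (B.genSK C r) k) (fun i => y (k, i))
        fun i => z (k, i)
      have h₂ : |(stepTest D C k u (Function.update σ k false) r y z a -
          stepTest D C k u (Function.update σ k true) r y z a) / 2| ≤ 1 := by
        have e₁ := abs_le.mp (abs_stepTest_le D C k u (Function.update σ k false) r y z a)
        have e₂ := abs_le.mp (abs_stepTest_le D C k u (Function.update σ k true) r y z a)
        exact abs_le.mpr ⟨by linarith [e₁.1, e₂.2], by linarith [e₁.2, e₂.1]⟩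
      exact mul_le_one₀ h₁ (abs_nonneg _) h₂
  -- The difference of two acceptance probabilities is half a difference of two biases `1 - 2 *
  -- accept`, and together with the factor `1 / 2` of the hardcore term this gives `4⁻¹`. The two
  -- biases then contribute `ν₂ / 2` in all.
  have hsplit : ∀ r y, P.score (B.genPK C r) y σ (B.basis C) (restrict
      (P.checkAt (B.genPK C r) y k) (dephase (fun w => firstBits B w k)
        (P.state (B.genPK C r) y))) (fun z a =>
      hardcoreSign F (B.extSk (B.genSK C r) k) (fun i => y (k, i)) (fun i => z (k, i)) *
        ((stepTest D C k u (Function.update σ k false) r y z a -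
          stepTest D C k u (Function.update σ k true) r y z a) / 2)) =
      4⁻¹ * (P.score (B.genPK C r) y σ (B.basis C) (dephase (openAt k) (restrict
          (P.checkAt (B.genPK C r) y k) (P.state (B.genPK C r) y))) (fun z a =>
        hardcoreSign F (B.extSk (B.genSK C r) k) (fun i => y (k, i)) (fun i => z (k, i)) *
          (1 - 2 * stepTest D C k u (Function.update σ k true) r y z a)) -
        P.score (B.genPK C r) y σ (B.basis C) (dephase (openAt k) (restrict
          (P.checkAt (B.genPK C r) y k) (P.state (B.genPK C r) y))) fun z a =>
        hardcoreSign F (B.extSk (B.genSK C r) k) (fun i => y (k, i)) (fun i => z (k, i)) *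
          (1 - 2 * stepTest D C k u (Function.update σ k false) r y z a)) := by
    intro r y
    rw [dephase_openAt_restrict hF hB P hk, dephase_restrict, ← score_sub_fun, ← score_smul_fun]
    refine congrArg _ (funext fun z => funext fun a => ?_)
    ring
  have c₁ := hν₁ σ u (Function.update σ k false)
  have c₂ := hν₁ σ u (Function.update σ k true)
  have d₁ := hν₂ σ u (Function.update σ k false)
  have d₂ := hν₂ σ u (Function.update σ k true)
  have g₁₁ := g₁ false
  have g₁₂ := g₁ true
  have g₂₁ := g₂ false
  have g₂₂ := g₂ true
  clear g₁ g₂ hν₁ hν₂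
  simp only [hsplit] at g₃
  simp only [dephase_restrict, Finset.sum_sub_distrib, Finset.sum_add_distrib, ← Finset.sum_div,
    ← Finset.mul_sum, avg_sub, avg_add, avg_mul_left, avg_div] at c₁ c₂ d₁ d₂ g₁₁ g₁₂ g₂₁ g₂₂ g₃ ⊢
  rw [abs_le] at c₁ c₂ d₁ d₂ g₁₁ g₁₂ g₂₁ g₂₂ g₃ ⊢
  constructor <;> linarith [c₁.1, c₁.2, c₂.1, c₂.2, d₁.1, d₁.2, d₂.1, d₂.2, g₁₁.1, g₁₁.2, g₁₂.1,
    g₁₂.2, g₂₁.1, g₂₁.2, g₂₂.1, g₂₂.2, g₃.1, g₃.2]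

/-- The score of the simulated experiment with fixed random bits. -/
def maskedScore (D : Distinguisher (Fin B.N)) (h σ u : Fin B.N → Bool)
    (PK : Fin B.PKLen → Bool) (sk : Fin B.N → Fin F.skLen → Bool) : ℝ :=
  ∑ y, P.score PK y σ h (P.state PK y) fun z a => D.accept (outStr B h sk y u σ z a)

theorem abs_hybrid_sub_hybrid_le (D : Distinguisher (Fin B.N)) (C C' : Fin B.descLen → Bool)
    (h : Fin B.N → Bool) (k : ℕ) {ν : ℝ}
    (hν : ∀ σ u, |(avg fun r => P.maskedScore D h σ u (B.genPK C r) (B.extSk (B.genSK C r))) -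
      avg fun r => P.maskedScore D h σ u (B.genPK C' r) (B.extSk (B.genSK C' r))| ≤ ν) :
    |P.hybrid D C h k - P.hybrid D C' h k| ≤ ν := by
  have hrot : ∀ C, P.hybrid D C h k = avg fun s => avg fun u => avg fun r =>
      P.maskedScore D h (maskBelow h k s) u (B.genPK C r) (B.extSk (B.genSK C r)) := by
    intro C
    rw [hybrid, avg_comm]
    exact congrArg avg (funext fun s => avg_comm _)
  rw [hrot, hrot, ← avg_sub]
  refine (abs_avg_le _).trans (avg_le fun s => ?_)
  rw [← avg_sub]
  exact (abs_avg_le _).trans (avg_le fun u => hν _ _)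

/-- A chain of three comparisons: real to hybrid `0`, hybrid `0` to hybrid `N` under the keys for
`C`, and the exchange of those keys for the keys of `B.one`. The masks are switched on before the
keys are exchanged, since the hardcore property is applied to the keys for `C`. -/
theorem abs_real_sub_sim_le (hF : F.Correct) (hB : B.Correct)
    {sim : ClassicalAlg (Fin B.coinLen) (Fin B.PKLen ⊕ Fin B.SKLen)}
    {ext : Extractor B} (hsim : ∀ r, sim.fn r = B.genAlg.fn (Sum.elim B.one r))
    (hext : ∀ PK SK y, ext.run (P.U PK y) (P.state PK y) (Sum.elim PK (Sum.elim SK y)) =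
      extractedState B (P.U PK y) (P.state PK y) SK y)
    (D : Distinguisher (Fin B.N)) (C : Fin B.descLen → Bool) {ν₁ ν₂ ν₃ : ℝ} (h0 : 0 ≤ ν₁ + ν₂ / 2)
    (hν₁ : ∀ k σ u m₀, B.basis C k = true → |avg fun r =>
      ∑ y, P.score (B.genPK C r) y σ (B.basis C) (dephase (fun w => firstBits B w k)
        (restrict (P.checkAt (B.genPK C r) y k) (P.state (B.genPK C r) y)))
        (stepTest D C k u m₀ r y) -
      ∑ y, P.score (B.genPK C r) y σ (B.basis C)
        (restrict (P.checkAt (B.genPK C r) y k) (P.state (B.genPK C r) y))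
        (stepTest D C k u m₀ r y)| ≤ ν₁)
    (hν₂ : ∀ k σ u m₀, B.basis C k = true → |avg fun r =>
      ∑ y, P.score (B.genPK C r) y σ (B.basis C) (dephase (openAt k)
        (restrict (P.checkAt (B.genPK C r) y k) (P.state (B.genPK C r) y))) fun z a =>
          hardcoreSign F (B.extSk (B.genSK C r) k) (fun i => y (k, i)) (fun i => z (k, i)) *
            (1 - 2 * stepTest D C k u m₀ r y z a)| ≤ ν₂)
    (hν₃ : ∀ σ u, |(avg fun r => P.maskedScore D (B.basis C) σ u (B.genPK C r)
        (B.extSk (B.genSK C r))) - avg fun r => P.maskedScore D (B.basis C) σ u (B.genPK B.one r)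
          (B.extSk (B.genSK B.one r))| ≤ ν₃) :
    |∑ m, P.realDist C m * D.accept m - ∑ m, simDist P sim ext C m * D.accept m| ≤
      18 * Real.sqrt (1 - P.passProb C) +
        B.N * (ν₁ + ν₂ / 2 + 27 * Real.sqrt (1 - P.passProb C)) + ν₃ := by
  rw [sum_simDist_mul P hsim hext]
  have hstep : ∀ k < B.N, |P.hybrid D C (B.basis C) (k + 1) - P.hybrid D C (B.basis C) k| ≤
      ν₁ + ν₂ / 2 + 27 * Real.sqrt (1 - P.passProb C) := by
    intro k hk
    have hsqrt := Real.sqrt_nonneg (1 - P.passProb C)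
    cases hb : B.basis C ⟨k, hk⟩
    · rw [P.hybrid_succ_of_false D C (k := ⟨k, hk⟩) hb, sub_self, abs_zero]
      positivity
    · exact P.abs_hybrid_succ_sub_le hF hB D C hb (fun σ u m₀ => hν₁ _ σ u m₀ hb)
        fun σ u m₀ => hν₂ _ σ u m₀ hb
  have hsum : ∀ k ≤ B.N, |P.hybrid D C (B.basis C) 0 - P.hybrid D C (B.basis C) k| ≤
      k * (ν₁ + ν₂ / 2 + 27 * Real.sqrt (1 - P.passProb C)) := by
    intro k
    induction k with
    | zero => simp
    | succ k ih =>
      intro hk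
      have h₁ := ih (by omega)
      have h₂ := hstep k (by omega)
      rw [abs_sub_comm] at h₂
      push_cast
      rw [add_mul, one_mul]
      exact (abs_sub_le _ _ _).trans (add_le_add h₁ h₂)
  have h₁ := P.abs_real_sub_hybrid_zero_le hF hB D C
  have h₂ := hsum B.N le_rfl
  have h₃ := P.abs_hybrid_sub_hybrid_le D C B.one (B.basis C) B.N hν₃
  exact (abs_sub_le _ _ _).trans (add_le_add ((abs_sub_le _ _ _).trans (add_le_add h₁ h₂)) h₃)

end Prover

/-! ### Asymptotics -/

section Asymptotic

theorem PolyBounded.mono {f g : ℕ → ℕ} (hg : PolyBounded g) (h : ∀ n, f n ≤ g n) :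
    PolyBounded f := by
  obtain ⟨p, hp⟩ := hg
  exact ⟨p, fun n => (h n).trans (hp n)⟩

theorem PolyBounded.add {f g : ℕ → ℕ} (hf : PolyBounded f) (hg : PolyBounded g) :
    PolyBounded fun n => f n + g n := by
  obtain ⟨p, hp⟩ := hf
  obtain ⟨q, hq⟩ := hg
  exact ⟨p + q, fun n => by rw [Polynomial.eval_add]; exact add_le_add (hp n) (hq n)⟩

theorem PolyBounded.mul {f g : ℕ → ℕ} (hf : PolyBounded f) (hg : PolyBounded g) :
    PolyBounded fun n => f n * g n := by
  obtain ⟨p, hp⟩ := hf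
  obtain ⟨q, hq⟩ := hg
  exact ⟨p * q, fun n => by rw [Polynomial.eval_mul]; exact Nat.mul_le_mul (hp n) (hq n)⟩

theorem PolyBounded.const (c : ℕ) : PolyBounded fun _ => c :=
  ⟨Polynomial.C c, fun n => by simp⟩

theorem Negl.mono {f g : ℕ → ℝ} (hg : Negl g) (h : ∀ n, |f n| ≤ g n) : Negl f :=
  Asymptotics.SuperpolynomialDecay.trans_abs_le hg fun n => (h n).trans (le_abs_self _)

theorem Negl.add {f g : ℕ → ℝ} (hf : Negl f) (hg : Negl g) : Negl fun n => f n + g n :=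
  Asymptotics.SuperpolynomialDecay.add hf hg

theorem Negl.const_mul {f : ℕ → ℝ} (hf : Negl f) (c : ℝ) : Negl fun n => c * f n :=
  Asymptotics.SuperpolynomialDecay.const_mul hf c

theorem Negl.polyBounded_mul {f : ℕ → ℝ} {N : ℕ → ℕ} (hf : Negl f) (hN : PolyBounded N) :
    Negl fun n => N n * f n := by
  obtain ⟨p, hp⟩ := hN
  have h := Asymptotics.SuperpolynomialDecay.polynomial_mul hf (p.map (Nat.castRingHom ℝ))
  refine Asymptotics.SuperpolynomialDecay.trans_abs_le h fun n => ?_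
  have he : (p.map (Nat.castRingHom ℝ)).eval (n : ℝ) = (p.eval n : ℕ) := by
    rw [Polynomial.eval_natCast_map]
    simp
  rw [he, abs_mul, abs_mul, Nat.abs_cast, Nat.abs_cast]
  exact mul_le_mul_of_nonneg_right (Nat.cast_le.mpr (hp n)) (abs_nonneg _)

/-- `n ^ m * √f` is the square root of `n ^ (2 m) * f`, which tends to `0`. -/
theorem Negl.sqrt {f : ℕ → ℝ} (hf : Negl f) : Negl fun n => Real.sqrt (f n) := by
  intro m
  have h := (Real.continuous_sqrt.tendsto 0).comp (hf (m + m))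
  rw [Real.sqrt_zero] at h
  refine h.congr fun n => ?_
  rw [Function.comp_apply, pow_add, Real.sqrt_mul (by positivity),
    Real.sqrt_mul_self (by positivity)]

/-- If a family is negligible for every selection of indices, then it is uniformly negligible. -/
theorem exists_negl_bound {ι : ℕ → Type} [∀ n, Finite (ι n)] [∀ n, Nonempty (ι n)]
    (f : ∀ n, ι n → ℝ) (h : ∀ sel : ∀ n, ι n, Negl fun n => f n (sel n)) :
    ∃ e : ℕ → ℝ, Negl e ∧ ∀ n i, f n i ≤ e n := by
  choose sel hsel using fun n => Finite.exists_max (f n)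
  exact ⟨_, h sel, hsel⟩

end Asymptotic

/-! ### Soundness -/

namespace Prover

variable {F : TCF} {B : BatchKeyGen F} (P : Prover B)

theorem reductionSize_le : P.reductionSize ≤
    3 * P.size + B.size * (40 * F.size + 41) + (10 * F.size + 8) := by
  have hN : B.N ≤ B.size := by unfold BatchKeyGen.size; omega
  have h₁ : F.decodeSize + F.yLen + 2 * F.ℓ + 20 ≤ 40 * F.size + 41 := by
    unfold TCF.decodeSize TCF.size
    omega
  have h₂ : 8 * (F.ℓ + 1) + 2 * F.yLen ≤ 10 * F.size + 8 := by
    unfold TCF.size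
    omega
  have h₃ := Nat.mul_le_mul hN h₁
  unfold reductionSize
  omega

end Prover

section Soundness

variable {F : ℕ → TCF} {B : ∀ n, BatchKeyGen (F n)} {P : ∀ n, Prover (B n)}
  {D : ∀ n, Distinguisher (Fin (B n).N)}

theorem polyBounded_reduction (hF : PolyBounded fun n => (F n).size)
    (hB : PolyBounded fun n => (B n).size) (hP : PolyBounded fun n => (P n).size)
    (hD : PolyBounded fun n => (D n).size) :
    PolyBounded fun n => (P n).reductionSize + (D n).size := by
  refine PolyBounded.mono (((((PolyBounded.const 3).mul hP).add (hB.mul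
    (((PolyBounded.const 40).mul hF).add (PolyBounded.const 41)))).add
      (((PolyBounded.const 10).mul hF).add (PolyBounded.const 8))).add hD) fun n => ?_
  exact Nat.add_le_add_right (P n).reductionSize_le _

/-- A selection of a position and of random bits. -/
abbrev StepIndex (N : ℕ) := Fin N × (Fin N → Bool) × (Fin N → Bool) × (Fin N → Bool)

/-- For each security parameter the position, the masks and the random bits are hardwired into the
collapsing adversary; `exists_negl_bound` then makes the bound uniform in them. -/
theorem exists_collapsing_bound (hsize : PolyBounded fun n => (P n).reductionSize + (D n).size)
    (hcol : BatchKeyGen.CollapsingAtIndex B) (C : ∀ n, Fin (B n).descLen → Bool) :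
    ∃ ν : ℕ → ℝ, Negl ν ∧ ∀ n (i : StepIndex (B n).N), |avg fun r =>
      ∑ y, (P n).score ((B n).genPK (C n) r) y i.2.1 ((B n).basis (C n))
        (dephase (fun w => firstBits (B n) w i.1) (restrict
          ((P n).checkAt ((B n).genPK (C n) r) y i.1) ((P n).state ((B n).genPK (C n) r) y)))
        (Prover.stepTest (D n) (C n) i.1 i.2.2.1 i.2.2.2 r y) -
      ∑ y, (P n).score ((B n).genPK (C n) r) y i.2.1 ((B n).basis (C n)) (restrict
          ((P n).checkAt ((B n).genPK (C n) r) y i.1) ((P n).state ((B n).genPK (C n) r) y))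
        (Prover.stepTest (D n) (C n) i.1 i.2.2.1 i.2.2.2 r y)| ≤ ν n := by
  have : ∀ n, Nonempty (StepIndex (B n).N) := fun n =>
    ⟨(⟨0, (B n).N_pos⟩, fun _ => false, fun _ => false, fun _ => false)⟩
  refine exists_negl_bound _ fun sel => ?_
  choose A hA hout using fun n => (P n).exists_collapseAdv_score (D n) ((B n).basis (C n))
    (sel n).2.1 (Function.update ((B n).basis (C n)) (sel n).1 false) (sel n).2.2.1 (sel n).2.2.2
    (sel n).1
  refine (hcol C (fun n => (sel n).1) A (hsize.mono hA)).mono fun n => ?_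
  rw [abs_abs]
  refine le_of_eq (congrArg abs (congrArg avg (funext fun r => ?_)))
  -- The view replaces the key of the selected position by zeros. This has no effect, because the
  -- test does not decode that position.
  have h := hout n ((B n).genPK (C n) r) fun i k =>
    decide (i ≠ (sel n).1) && (B n).extSk ((B n).genSK (C n) r) i k
  have hkeys : ∀ y z a, (D n).accept (outStr (B n)
      (Function.update ((B n).basis (C n)) (sel n).1 false) (fun i k =>
        decide (i ≠ (sel n).1) && (B n).extSk ((B n).genSK (C n) r) i k) y (sel n).2.2.1
          (sel n).2.2.2 z a) =
      Prover.stepTest (D n) (C n) (sel n).1 (sel n).2.2.1 (sel n).2.2.2 r y z a := by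
    intro y z a
    rw [Prover.stepTest, Prover.outStr_congr_keys]
    intro i hi
    have : i ≠ (sel n).1 := by rintro rfl; simp at hi
    simp [this]
  simp only [hkeys] at h
  exact (congrArg₂ (· - ·) (h true) (h false)).symm

theorem exists_hardcore_bound (hsize : PolyBounded fun n => (P n).reductionSize + (D n).size)
    (hhc : BatchKeyGen.HardcoreAtIndex B) (C : ∀ n, Fin (B n).descLen → Bool) :
    ∃ ν : ℕ → ℝ, Negl ν ∧ ∀ n (i : StepIndex (B n).N), (if (B n).basis (C n) i.1 then |avg fun r =>
      ∑ y, (P n).score ((B n).genPK (C n) r) y i.2.1 ((B n).basis (C n))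
        (dephase (Prover.openAt i.1) (restrict
          ((P n).checkAt ((B n).genPK (C n) r) y i.1) ((P n).state ((B n).genPK (C n) r) y)))
        fun z a => hardcoreSign (F n) ((B n).extSk ((B n).genSK (C n) r) i.1)
          (fun k => y (i.1, k)) (fun k => z (i.1, k)) *
            (1 - 2 * Prover.stepTest (D n) (C n) i.1 i.2.2.1 i.2.2.2 r y z a)| else 0) ≤ ν n := by
  have : ∀ n, Nonempty (StepIndex (B n).N) := fun n =>
    ⟨(⟨0, (B n).N_pos⟩, fun _ => false, fun _ => false, fun _ => false)⟩
  refine exists_negl_bound _ fun sel => ?_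
  choose A hA hout using fun n => (P n).exists_hardcoreAdv_score (D n) ((B n).basis (C n))
    (sel n).2.1 (Function.update ((B n).basis (C n)) (sel n).1 false) (sel n).2.2.1 (sel n).2.2.2
    (sel n).1
  -- The hardcore property is stated for descriptions that are two-to-one at the selected position
  -- for every security parameter. Where `C n` is not, `one` takes its place, and the quantity to be
  -- bounded is `0` there.
  let C' : ∀ n, Fin (B n).descLen → Bool := fun n =>
    if (B n).basis (C n) (sel n).1 then C n else (B n).one
  have hC' : ∀ n, (B n).basis (C' n) (sel n).1 = true := by
    intro n
    by_cases h : (B n).basis (C n) (sel n).1 = true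
    · simp only [C', if_pos h, h]
    · simp only [C', if_neg h, (B n).basis_one]
  refine (hhc C' (fun n => (sel n).1) A hC' (hsize.mono hA)).mono fun n => ?_
  by_cases hb : (B n).basis (C n) (sel n).1 = true
  swap
  · rw [if_neg hb, abs_zero]
    exact abs_nonneg _
  have hCn : C' n = C n := if_pos hb
  rw [if_pos hb, abs_abs, hCn]
  refine le_of_eq (congrArg abs (congrArg avg (funext fun r => ?_)))
  have h := hout n ((B n).genPK (C n) r) (fun i k =>
    decide (i ≠ (sel n).1) && (B n).extSk ((B n).genSK (C n) r) i k)
    ((B n).extSk ((B n).genSK (C n) r) (sel n).1)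
  have hkeys : ∀ y z a, (D n).accept (outStr (B n)
      (Function.update ((B n).basis (C n)) (sel n).1 false) (fun i k =>
        decide (i ≠ (sel n).1) && (B n).extSk ((B n).genSK (C n) r) i k) y (sel n).2.2.1
          (sel n).2.2.2 z a) =
      Prover.stepTest (D n) (C n) (sel n).1 (sel n).2.2.1 (sel n).2.2.2 r y z a := by
    intro y z a
    rw [Prover.stepTest, Prover.outStr_congr_keys]
    intro i hi
    have : i ≠ (sel n).1 := by rintro rfl; simp at hi
    simp [this]
  simp only [hkeys] at h
  exact h.symm

/-- The simulated experiment decodes only positions with `h_i = 1`, and there the modes for `C` and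
for `one` coincide, so these secret keys may be revealed. -/
theorem exists_keyIndist_bound (hsize : PolyBounded fun n => (P n).reductionSize + (D n).size)
    (hkey : BatchKeyGen.KeyIndist B) (C : ∀ n, Fin (B n).descLen → Bool) :
    ∃ ν : ℕ → ℝ, Negl ν ∧ ∀ n (i : (Fin (B n).N → Bool) × (Fin (B n).N → Bool)),
      |(avg fun r => (P n).maskedScore (D n) ((B n).basis (C n)) i.1 i.2 ((B n).genPK (C n) r)
        ((B n).extSk ((B n).genSK (C n) r))) -
      avg fun r => (P n).maskedScore (D n) ((B n).basis (C n)) i.1 i.2 ((B n).genPK (B n).one r)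
        ((B n).extSk ((B n).genSK (B n).one r))| ≤ ν n := by
  refine exists_negl_bound _ fun sel => ?_
  choose A hA hout using fun n => (P n).exists_distinguisher_score (D n) ((B n).basis (C n))
    (sel n).1 ((B n).basis (C n)) (sel n).2 (sel n).1
  have hkeyA := hkey C (fun n => (B n).one) (fun n => (B n).basis (C n))
    (fun n i hi => by rw [hi, (B n).basis_one]) A (hsize.mono hA)
  have hview : ∀ n C', (avg fun r => (A n).accept ((B n).view ((B n).basis (C n)) C' r)) =
      avg fun r => (P n).maskedScore (D n) ((B n).basis (C n)) (sel n).1 (sel n).2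
        ((B n).genPK C' r) ((B n).extSk ((B n).genSK C' r)) := by
    intro n C'
    refine congrArg avg (funext fun r => ?_)
    have h := hout n ((B n).genPK C' r) fun i k =>
      (B n).basis (C n) i && (B n).extSk ((B n).genSK C' r) i k
    refine h.trans (Finset.sum_congr rfl fun y _ => congrArg _ (funext fun z => funext fun a =>
      congrArg _ (Prover.outStr_congr_keys _ (fun i hi => ?_) _ _ _ _ _)))
    simp [hi]
  simp only [sum_law_mul, hview] at hkeyA
  exact hkeyA

theorem soundWith (hF : PolyBounded fun n => (F n).size) (hB : PolyBounded fun n => (B n).size)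
    (hFc : ∀ n, (F n).Correct) (hBc : ∀ n, (B n).Correct) (hkey : BatchKeyGen.KeyIndist B)
    (hcol : BatchKeyGen.CollapsingAtIndex B) (hhc : BatchKeyGen.HardcoreAtIndex B) :
    SoundWith B (fun n => simGen (B n)) fun n => extractor (B n) where
  coins_poly := hB.mono fun n => by unfold BatchKeyGen.size; omega
  sim_efficient := ((PolyBounded.const 4).mul hB).mono fun n => by
    have := size_simGen_le (B n)
    unfold BatchKeyGen.size
    omega
  ext_efficient := by
    refine (((PolyBounded.const 7).mul hB).add ((hB.mul (((PolyBounded.const 40).mul hF).add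
      (PolyBounded.const 41))).add (PolyBounded.const 1))).mono fun n => ?_
    refine (size_extractor_le (B n)).trans ?_
    have hN : (B n).N ≤ (B n).size := by unfold BatchKeyGen.size; omega
    have hsk : ∑ i, ((B n).extSkAlg i).size ≤ (B n).size := by
      have : ∑ i, ((B n).extSkAlg i).size ≤
          ∑ i, (((B n).extPkAlg i).size + ((B n).extSkAlg i).size) :=
        Finset.sum_le_sum fun i _ => Nat.le_add_left _ _
      unfold BatchKeyGen.size
      omega
    have h₁ : ((F n).ℓ + 1) + ((F n).skLen + (2 * (F n).invertTwoAlg.size +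
        4 * (F n).goodAlg.size + 10 * (F n).ℓ + 21)) ≤ 40 * (F n).size + 41 := by
      unfold TCF.size
      omega
    have h₂ := Nat.mul_le_mul hN h₁
    rw [mul_add] at h₂
    omega
  sound := by
    intro P hP hpass C D hD
    have hsize := polyBounded_reduction hF hB hP hD
    obtain ⟨ν₁, hν₁, hb₁⟩ := exists_collapsing_bound hsize hcol C
    obtain ⟨ν₂, hν₂, hb₂⟩ := exists_hardcore_bound hsize hhc C
    obtain ⟨ν₃, hν₃, hb₃⟩ := exists_keyIndist_bound hsize hkey C
    have hN : PolyBounded fun n => (B n).N := hB.mono fun n => by unfold BatchKeyGen.size; omega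
    have hs := (hpass C).sqrt
    refine (((hs.const_mul 18).add (((hν₁.add (hν₂.const_mul 2⁻¹)).add
      (hs.const_mul 27)).polyBounded_mul hN)).add hν₃).mono fun n => ?_
    rw [abs_abs]
    have h0 : (0 : ℝ) ≤ ν₁ n + ν₂ n / 2 := by
      let i : StepIndex (B n).N :=
        (⟨0, (B n).N_pos⟩, fun _ => false, fun _ => false, fun _ => false)
      have e₁ := (abs_nonneg _).trans (hb₁ n i)
      have e₂ : 0 ≤ ν₂ n := by
        refine le_trans ?_ (hb₂ n i)
        split_ifs
        exacts [abs_nonneg _, le_rfl]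
      positivity
    have h := (P n).abs_real_sub_sim_le (hFc n) (hBc n) (sim := simGen (B n))
      (ext := extractor (B n)) (simGen_fn (B n))
      (fun PK SK y => run_extractor (B n) ((P n).U_mem_unitaryGroup PK y) _ PK SK y) (D n) (C n) h0
      (fun k σ u m₀ _ => hb₁ n (k, σ, u, m₀))
      (fun k σ u m₀ hk => by
        have := hb₂ n (k, σ, u, m₀)
        rwa [if_pos hk] at this)
      fun σ u => hb₃ n (σ, u)
    refine h.trans (le_of_eq ?_)
    ring

end Soundness

/-! ### Independently sampled keys -/

section Resampling

variable {α β γ : Type} [Fintype α] [DecidableEq α] [Fintype β] [DecidableEq β]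

theorem extend_comp_equiv {n : ℕ} {f : β ↪ α} {e : β ⊕ Fin n ≃ α} (he : ∀ b, e (.inl b) = f b)
    (s : β → Bool) (r : α → Bool) :
    Function.extend f s r ∘ e = Sum.elim s fun k => r (e (.inr k)) := by
  funext w
  rcases w with b | k
  · rw [Function.comp_apply, he, f.injective.extend_apply]
    rfl
  · have : ¬ ∃ b, f b = e (.inr k) := by
      rintro ⟨b, hb⟩
      rw [← he] at hb
      exact absurd (e.injective hb) Sum.inl_ne_inr
    rw [Function.comp_apply, Function.extend_apply' _ _ _ this]
    rfl

/-- Redrawing a block of uniform coins does not change their distribution. -/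
theorem avg_extend (f : β ↪ α) (g : (α → Bool) → ℝ) :
    avg g = avg fun r => avg fun s => g (Function.extend f s r) := by
  obtain ⟨n, -, e, he⟩ := exists_equiv_extending f
  have hcard : Fintype.card α = Fintype.card β + n := by
    rw [← Fintype.card_congr e, Fintype.card_sum, Fintype.card_fin]
  have hext : ∀ s (a : β → Bool) (b : Fin n → Bool),
      Function.extend f s (Sum.elim a b ∘ e.symm) = Sum.elim s b ∘ e.symm := by
    intro s a b
    have := extend_comp_equiv he s (Sum.elim a b ∘ e.symm)
    simp only [Function.comp_apply, Equiv.symm_apply_apply, Sum.elim_inr] at this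
    rw [← this, Function.comp_assoc, Equiv.self_comp_symm, Function.comp_id]
  simp only [avg, hcard]
  rw [sum_bits_equiv e.symm, sum_bits_equiv e.symm, sum_bits_sum, sum_bits_sum]
  simp only [hext]
  rw [Finset.sum_const, Finset.card_univ, Fintype.card_fun, Fintype.card_bool, nsmul_eq_mul,
    ← Finset.sum_div, Finset.sum_comm]
  push_cast
  field_simp

/-- The contents `c` of the wires outside the range of `f` are supplied as advice. -/
theorem exists_distinguisher_extend (D : Distinguisher α) (f : β ↪ α) (c : α → Bool) :
    ∃ D' : Distinguisher β, D'.size ≤ D.size + Fintype.card α ∧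
      ∀ x, D'.accept x = D.accept (Function.extend f x c) := by
  obtain ⟨n, hn, e, he⟩ := exists_equiv_extending f
  obtain ⟨D', hsize, h⟩ := ((D.toTest.relabel e.symm).addState
    (pureOp fun k => c (e (.inr k))) (isState_pureOp _)).exists_distinguisher
  refine ⟨D', ?_, fun x => ?_⟩
  · rw [hsize, Test.size_addState, Test.size_relabel, D.size_toTest, Fintype.card_fin]
    omega
  · rw [h, Test.accept, Test.expect_addState, Test.expect_relabel, ← pureOp_sumElim,
      ← extend_comp_equiv he, ← D.accept_toTest]
    refine congrArg (fun Γ => D.toTest.accept Γ) ?_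
    ext s t
    simp only [relabel_apply, pureOp_apply]
    have hcomp : ∀ s : α → Bool, s ∘ e = Function.extend f x c ∘ e ↔ s = Function.extend f x c :=
      fun s => ⟨fun h => e.surjective.injective_comp_right h, fun h => h ▸ rfl⟩
    exact if_congr (and_congr (hcomp s) (hcomp t)) rfl rfl

theorem exists_hardcoreAdv_extend {F : TCF} (A : HardcoreAdv α F) (f : β ↪ α) (c : α → Bool) :
    ∃ A' : HardcoreAdv β F,
      A'.size ≤ A.size + Fintype.card α + 3 * (F.yLen + 2 * (F.ℓ + 1)) + 1 ∧
      ∀ pk sk x v, A'.winProb pk sk x v = A.winProb pk sk (Function.extend f x c) v := by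
  obtain ⟨n, hn, e, he⟩ := exists_equiv_extending f
  let Φ : α ⊕ ((Fin F.yLen ⊕ (Fin (F.ℓ + 1) ⊕ Fin (F.ℓ + 1))) ⊕ Fin A.work) ≃
      β ⊕ (Fin n ⊕ ((Fin F.yLen ⊕ (Fin (F.ℓ + 1) ⊕ Fin (F.ℓ + 1))) ⊕ Fin A.work)) :=
    (e.symm.sumCongr (Equiv.refl _)).trans (Equiv.sumAssoc _ _ _)
  -- The construction `exists_hardcoreAdv` adds the output of the test to `d`. Here the output is a
  -- spare wire that stays `0`, so the adversary is left unchanged.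
  let T : Test (β ⊕ (Fin n ⊕ ((Fin F.yLen ⊕ (Fin (F.ℓ + 1) ⊕ Fin (F.ℓ + 1))) ⊕ Fin A.work))) :=
    { wires := Unit
      state := pureOp fun _ => false
      isState := isState_pureOp _
      circ := (A.circ.map (QGate.map Φ.toEmbedding)).map (QGate.map .inl)
      out := .inr () }
  obtain ⟨A', hsize, h⟩ := exists_hardcoreAdv F T
    ((isState_pureOp fun k => c (e (.inr k))).tensOp A.isState)
    (fun k => .inr (.inl (.inl k))) (fun k => .inr (.inl (.inr (.inl k))))
    (fun k => .inr (.inl (.inr (.inr k))))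
  refine ⟨A', hsize.trans ?_, fun pk sk x v => ?_⟩
  · have : T.size = 1 + A.circ.length := by
      change Fintype.card Unit + List.length (List.map _ (List.map _ A.circ)) = _
      simp
    rw [this]
    simp only [HardcoreAdv.size, Fintype.card_sum, Fintype.card_fin]
    omega
  · have hinit : tensOp (pureOp x) (tensOp (pureOp fun k => c (e (.inr k))) A.advice) =
        relabel Φ (tensOp (pureOp (Function.extend f x c)) A.advice) := by
      have h₁ : tensOp (pureOp x) (tensOp (pureOp fun k => c (e (.inr k))) A.advice) =
          relabel (Equiv.sumAssoc _ _ _)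
            (tensOp (pureOp (Function.extend f x c ∘ e)) A.advice) := by
        rw [extend_comp_equiv he, pureOp_sumElim]
        ext u v
        simp only [tensOp_apply, relabel_apply, mul_assoc]
        rfl
      have h₂ : pureOp (Function.extend f x c ∘ e) =
          relabel e.symm (pureOp (Function.extend f x c)) := by
        ext s t
        simp only [relabel_apply, pureOp_apply]
        have hcomp : ∀ s : β ⊕ Fin n → Bool, s = Function.extend f x c ∘ e ↔
            s ∘ e.symm = Function.extend f x c := fun s =>
          ⟨fun h => by rw [h, Function.comp_assoc, Equiv.self_comp_symm, Function.comp_id],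
            fun h => by rw [← h, Function.comp_assoc, Equiv.symm_comp_self, Function.comp_id]⟩
        exact if_congr (and_congr (hcomp s) (hcomp t)) rfl rfl
      rw [h₁, h₂]
      rfl
    rw [h, Test.expect, HardcoreAdv.winProb, withInput_eq]
    change Test.runExpect (V := Unit) (pureOp fun _ => false)
      ((A.circ.map (QGate.map Φ.toEmbedding)).map (QGate.map .inl)) (.inr ()) _ _ = _
    rw [Test.runExpect, circMat_map_inl, circMat_map_equiv, hinit, evolve_tensOp, evolve_one,
      evolve_relabel, sum_bits_sum, prob, sum_bits_equiv Φ]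
    refine Finset.sum_congr rfl fun s _ => ?_
    rw [Finset.sum_eq_single fun _ => false]
    · simp only [tensOp_apply, Sum.elim_comp_inl, Sum.elim_comp_inr, pureOp_apply, and_self,
        if_true, mul_one, Sum.elim_inr, Bool.and_false, Bool.xor_false, relabel_apply, mul_ite,
        mul_zero]
      have hs : ∀ k, s (.inr (.inr k)) = (s ∘ Φ) (.inr k) := fun _ => rfl
      simp only [hs, Function.comp_assoc, Equiv.self_comp_symm, Function.comp_id]
      rfl
    · intro b _ hb
      simp [tensOp_apply, pureOp_apply, hb]
    · simp

end Resampling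

/-! ### Views of independently sampled keys -/

section Blocks

variable {F : TCF} {B : BatchKeyGen F}

theorem BatchKeyGen.IsIndependent.correct (hB : B.IsIndependent) : B.Correct := by
  obtain ⟨e, he⟩ := hB.coins_block
  exact fun C r i => ⟨_, (he C r i).1.symm, (he C r i).2.symm⟩

/-- The coins of the `i`th key pair, if the coins are arranged by `e`. -/
def blockCoins {N k l : ℕ} (e : Fin N × Fin k ≃ Fin l) (i : Fin N) : Fin k ↪ Fin l :=
  ⟨fun a => e (i, a), fun _ _ h => (Prod.mk.inj (e.injective h)).2⟩

/-- The wires of the `i`th public key in the view of an adversary. -/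
def blockPk (F : TCF) {N l : ℕ} (e : Fin N × Fin F.pkLen ≃ Fin l) (i : Fin N) :
    Fin F.pkLen ↪ Fin l ⊕ (Fin N × Fin F.skLen) :=
  (blockCoins e i).trans .inl

/-- All public keys, and the secret keys in `T`, if the `i`th key pair is sampled in mode `b i`. -/
def keyView (F : TCF) {N k l : ℕ} (ep : Fin N × Fin F.pkLen ≃ Fin l)
    (ec : Fin N × Fin F.coinLen ≃ Fin k) (T b : Fin N → Bool) (r : Fin k → Bool) :
    Fin l ⊕ (Fin N × Fin F.skLen) → Bool :=
  Sum.elim (fun p => F.genPk (b (ep.symm p).1) (r ∘ blockCoins ec (ep.symm p).1) (ep.symm p).2)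
    fun p => T p.1 && F.genSk (b p.1) (r ∘ blockCoins ec p.1) p.2

variable {N k l : ℕ} {ep : Fin N × Fin F.pkLen ≃ Fin l} {ec : Fin N × Fin F.coinLen ≃ Fin k}

theorem extend_blockCoins_self (j : Fin N) (s : Fin F.coinLen → Bool) (r : Fin k → Bool) :
    Function.extend (blockCoins ec j) s r ∘ blockCoins ec j = s :=
  funext fun a => (blockCoins ec j).injective.extend_apply _ _ a

theorem extend_blockCoins_of_ne {i j : Fin N} (hij : i ≠ j) (s : Fin F.coinLen → Bool)
    (r : Fin k → Bool) :
    Function.extend (blockCoins ec j) s r ∘ blockCoins ec i = r ∘ blockCoins ec i := by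
  funext a
  refine Function.extend_apply' _ _ _ ?_
  rintro ⟨b, hb⟩
  exact hij (Prod.mk.inj (ec.injective hb)).1.symm

/-- The coins of pair `j` influence only public key `j`, because the secret key of `j` is withheld.
Redrawing them, even in the other mode, thus replaces one block of the view. -/
theorem keyView_extend {T b b' : Fin N → Bool} {j : Fin N} (hT : T j = false)
    (hb : ∀ i, i ≠ j → b' i = b i) (s r) :
    keyView F ep ec T b' (Function.extend (blockCoins ec j) s r) =
      Function.extend (blockPk F ep j) (F.genPk (b' j) s) (keyView F ep ec T b r) := by
  funext w
  rcases w with p | p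
  · obtain ⟨⟨i, a⟩, rfl⟩ := ep.surjective p
    by_cases hij : i = j
    · subst hij
      have : (Sum.inl (ep (i, a)) : Fin l ⊕ (Fin N × Fin F.skLen)) = blockPk F ep i a := rfl
      conv_rhs => rw [this, (blockPk F ep i).injective.extend_apply]
      simp only [keyView, Sum.elim_inl, Equiv.symm_apply_apply]
      rw [extend_blockCoins_self]
    · rw [Function.extend_apply']
      · simp only [keyView, Sum.elim_inl, Equiv.symm_apply_apply]
        rw [extend_blockCoins_of_ne hij, hb i hij]
      · rintro ⟨c, hc⟩
        exact hij (Prod.mk.inj (ep.injective (Sum.inl.inj hc))).1.symm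
  · rw [Function.extend_apply' _ _ _ (by rintro ⟨c, hc⟩; exact absurd hc Sum.inl_ne_inr)]
    simp only [keyView, Sum.elim_inr]
    by_cases hij : p.1 = j
    · rw [hij, hT, Bool.false_and, Bool.false_and]
    · rw [extend_blockCoins_of_ne hij, hb _ hij]

/-- The wires of independently sampled keys. -/
theorem BatchKeyGen.IsIndependent.exists_blocks (hB : B.IsIndependent) :
    ∃ (ep : Fin B.N × Fin F.pkLen ≃ Fin B.PKLen) (ec : Fin B.N × Fin F.coinLen ≃ Fin B.coinLen),
      (∀ T C r, B.view T C r = keyView F ep ec T (B.basis C) r) ∧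
      ∀ C r i, B.extPk (B.genPK C r) i = F.genPk (B.basis C i) (r ∘ blockCoins ec i) ∧
        B.extSk (B.genSK C r) i = F.genSk (B.basis C i) (r ∘ blockCoins ec i) := by
  obtain ⟨ep, hp⟩ := hB.pk_block
  obtain ⟨ec, hc⟩ := hB.coins_block
  refine ⟨ep, ec, fun T C r => ?_, hc⟩
  funext w
  rcases w with p | p
  · have h := hp (B.genPK C r) (ep.symm p).1 (ep.symm p).2
    rw [Prod.mk.eta, Equiv.apply_symm_apply, (hc C r _).1] at h
    exact h.symm
  · exact congrArg (T p.1 && ·) (congrFun (hc C r p.1).2 p.2)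

end Blocks

/-! ### Key indistinguishability and the hardcore bit for independent keys -/

section IndependentKeys

variable {F : ℕ → TCF} {B : ∀ n, BatchKeyGen (F n)}

/-- The bound is uniform in the position and in the remaining contents `c`, so it can be applied
inside an average over all other coins. -/
theorem exists_keyIndist_extend_bound (hF : TCF.KeyIndist F) {α ι : ℕ → Type}
    [∀ n, Fintype (α n)] [∀ n, DecidableEq (α n)] [∀ n, Finite (ι n)] [∀ n, Nonempty (ι n)]
    (D : ∀ n, Distinguisher (α n)) (hD : PolyBounded fun n => (D n).size + Fintype.card (α n))
    (f : ∀ n, ι n → (Fin (F n).pkLen ↪ α n)) :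
    ∃ ν : ℕ → ℝ, Negl ν ∧ ∀ n i c,
      |(avg fun s => (D n).accept (Function.extend (f n i) ((F n).genPk true s) c)) -
        avg fun s => (D n).accept (Function.extend (f n i) ((F n).genPk false s) c)| ≤ ν n := by
  obtain ⟨ν, hν, h⟩ := exists_negl_bound (ι := fun n => ι n × (α n → Bool))
    (fun n i => |(avg fun s => (D n).accept (Function.extend (f n i.1) ((F n).genPk true s) i.2)) -
      avg fun s => (D n).accept (Function.extend (f n i.1) ((F n).genPk false s) i.2)|)
    fun sel => by
      choose D' hsize hacc using fun n =>
        exists_distinguisher_extend (D n) (f n (sel n).1) (sel n).2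
      have := hF D' (hD.mono hsize)
      simpa only [sum_law_mul, hacc] using this
  exact ⟨ν, hν, fun n i c => h n (i, c)⟩

theorem BatchKeyGen.card_view_le (n : ℕ) :
    Fintype.card (Fin (B n).PKLen ⊕ (Fin (B n).N × Fin (F n).skLen)) ≤
      (B n).size + (B n).size * (F n).size := by
  have h₁ : (B n).PKLen ≤ (B n).size := by unfold BatchKeyGen.size; omega
  have h₂ : (B n).N ≤ (B n).size := by unfold BatchKeyGen.size; omega
  have h₃ : (F n).skLen ≤ (F n).size := by unfold TCF.size; omega
  simp only [Fintype.card_sum, Fintype.card_prod, Fintype.card_fin]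
  exact Nat.add_le_add h₁ (Nat.mul_le_mul h₂ h₃)

theorem BatchKeyGen.polyBounded_view (hF : PolyBounded fun n => (F n).size)
    (hB : PolyBounded fun n => (B n).size) :
    PolyBounded fun n => Fintype.card (Fin (B n).PKLen ⊕ (Fin (B n).N × Fin (F n).skLen)) :=
  (hB.add (hB.mul hF)).mono BatchKeyGen.card_view_le

theorem abs_sub_le_mul_of_steps {N : ℕ} (a : ℕ → ℝ) (ν : ℝ)
    (h : ∀ i : Fin N, |a (i + 1) - a i| ≤ ν) : |a N - a 0| ≤ N * ν := by
  rw [← Finset.sum_range_sub, Finset.sum_range]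
  refine (Finset.abs_sum_le_sum_abs _ _).trans ((Finset.sum_le_sum fun i _ => h i).trans ?_)
  simp

/-- The modes are changed from `C₀` to `C₁` one position at a time. Positions in `T` keep their
mode; at any other position the secret key is withheld, so a change of mode is the two-mode game
with the other keys hardwired. -/
theorem BatchKeyGen.keyIndist_of_isIndependent (hF : TCF.IsMahadevRTCF F)
    (hB : PolyBounded fun n => (B n).size) (hind : ∀ n, (B n).IsIndependent) :
    BatchKeyGen.KeyIndist B := by
  intro C₀ C₁ T hT D hD
  choose ep ec hview hkeys using fun n => (hind n).exists_blocks
  have : ∀ n, Nonempty (Fin (B n).N) := fun n => ⟨⟨0, (B n).N_pos⟩⟩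
  obtain ⟨ν, hν, hstep⟩ := exists_keyIndist_extend_bound hF.keyIndist D
    (hD.add (BatchKeyGen.polyBounded_view hF.efficient hB)) fun n i => blockPk (F n) (ep n) i
  have hN : PolyBounded fun n => (B n).N := hB.mono fun n => by unfold BatchKeyGen.size; omega
  refine (hν.polyBounded_mul hN).mono fun n => ?_
  let b : ℕ → Fin (B n).N → Bool := fun m i =>
    if (i : ℕ) < m then (B n).basis (C₁ n) i else (B n).basis (C₀ n) i
  let a : ℕ → ℝ := fun m => avg fun r => (D n).accept (keyView (F n) (ep n) (ec n) (T n) (b m) r)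
  have h₀ : b 0 = (B n).basis (C₀ n) := by funext i; simp [b]
  have h₁ : b (B n).N = (B n).basis (C₁ n) := by funext i; simp [b]
  have ha : |a (B n).N - a 0| ≤ (B n).N * ν n := by
    refine abs_sub_le_mul_of_steps a (ν n) fun i => ?_
    have hne : ∀ k, k ≠ i → b (i + 1) k = b i k := by
      intro k hk
      have : (k : ℕ) ≠ i := fun h => hk (Fin.ext h)
      simp only [b]
      exact if_congr (by omega) rfl rfl
    have hb₀ : b i i = (B n).basis (C₀ n) i := by simp [b]
    have hb₁ : b (i + 1) i = (B n).basis (C₁ n) i := by simp [b]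
    have hν₀ : 0 ≤ ν n := (abs_nonneg _).trans (hstep n i fun _ => false)
    by_cases heq : (B n).basis (C₀ n) i = (B n).basis (C₁ n) i
    · have : b (i + 1) = b i := by
        funext k
        by_cases hk : k = i
        · rw [hk, hb₀, hb₁, heq]
        · exact hne k hk
      simp only [a, this, sub_self, abs_zero, hν₀]
    · have hTi : T n i = false := by
        by_contra h
        exact heq (hT n i (by simpa using h))
      have hav : ∀ b' : Fin (B n).N → Bool, (∀ k, k ≠ i → b' k = b i k) →
          (avg fun r => (D n).accept (keyView (F n) (ep n) (ec n) (T n) b' r)) =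
          avg fun r => avg fun s => (D n).accept (Function.extend (blockPk (F n) (ep n) i)
            ((F n).genPk (b' i) s) (keyView (F n) (ep n) (ec n) (T n) (b i) r)) := by
        intro b' hb'
        rw [avg_extend (blockCoins (ec n) i)]
        simp only [keyView_extend hTi hb']
      simp only [a]
      rw [hav _ hne, hav _ fun _ _ => rfl, ← avg_sub]
      refine (abs_avg_le _).trans (avg_le fun r => ?_)
      have hs := hstep n i (keyView (F n) (ep n) (ec n) (T n) (b i) r)
      rw [hb₀, hb₁]
      cases h₀ : (B n).basis (C₀ n) i <;> cases h₁ : (B n).basis (C₁ n) i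
      · exact absurd (h₀.trans h₁.symm) heq
      · exact hs
      · rwa [abs_sub_comm]
      · exact absurd (h₀.trans h₁.symm) heq
  rw [sum_law_mul, sum_law_mul, abs_abs, abs_sub_comm]
  simp only [a, h₀, h₁] at ha
  simpa only [hview] using ha

/-- All other key pairs are independent of pair `j` and can be hardwired, which leaves the game for
a single two-to-one key. -/
theorem BatchKeyGen.hardcoreAtIndex_of_isIndependent (hF : TCF.IsMahadevRTCF F)
    (hB : PolyBounded fun n => (B n).size) (hind : ∀ n, (B n).IsIndependent) :
    BatchKeyGen.HardcoreAtIndex B := by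
  intro C j A hj hA
  choose ep ec hview hkeys using fun n => (hind n).exists_blocks
  obtain ⟨ν, hν, h⟩ := exists_negl_bound
    (ι := fun n => Fin (B n).PKLen ⊕ (Fin (B n).N × Fin (F n).skLen) → Bool)
    (fun n c => |avg fun s => (A n).winProb ((F n).genPk true s) ((F n).genSk true s)
        (Function.extend (blockPk (F n) (ep n) (j n)) ((F n).genPk true s) c) false -
      (A n).winProb ((F n).genPk true s) ((F n).genSk true s)
        (Function.extend (blockPk (F n) (ep n) (j n)) ((F n).genPk true s) c) true|)
    fun sel => by
      choose A' hsize hwin using fun n =>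
        exists_hardcoreAdv_extend (A n) (blockPk (F n) (ep n) (j n)) (sel n)
      have hpoly : PolyBounded fun n => (A' n).size := by
        refine (((hA.add (BatchKeyGen.polyBounded_view hF.efficient hB)).add
          ((PolyBounded.const 9).mul hF.efficient)).add (PolyBounded.const 7)).mono fun n =>
            (hsize n).trans ?_
        have : (F n).yLen + (F n).ℓ ≤ (F n).size := by unfold TCF.size; omega
        omega
      simpa only [hwin] using hF.hardcore A' hpoly
  refine hν.mono fun n => ?_
  have hT : (fun i => decide (i ≠ j n)) (j n) = false := by simp
  rw [abs_abs, avg_extend (blockCoins (ec n) (j n))]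
  refine (abs_avg_le _).trans (avg_le fun r => ?_)
  refine le_trans (le_of_eq ?_) (h n (keyView (F n) (ep n) (ec n)
    (fun i => decide (i ≠ j n)) ((B n).basis (C n)) r))
  simp only [hview, (hkeys n _ _ _).1, (hkeys n _ _ _).2, extend_blockCoins_self, hj n]
  refine congrArg abs (congrArg avg (funext fun s => ?_))
  rw [keyView_extend hT fun _ _ => rfl, hj n]

end IndependentKeys

/-! ### Simulation of the collapsing game -/

section CollapsingGame

variable {α Q M : Type} [Fintype α] [DecidableEq α] [Fintype Q] [DecidableEq Q]
  [Fintype M] [DecidableEq M]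

/-- The test that computes `A` coherently into fresh wires and then runs `T`. -/
def Test.oracle (T : Test (Q ⊕ M)) (A : ClassicalAlg Q M) : Test Q :=
  ((((T.spect (Fin A.anc)).relabel (Equiv.sumComm _ _)).precomp
    ((A.gates.map QGate.classical).map (QGate.map (Equiv.sumAssoc _ _ _).symm.toEmbedding))).addState
    (pureOp fun _ => false) (isState_pureOp _)).addState (pureOp fun _ => false) (isState_pureOp _)

theorem Test.accept_oracle (T : Test (Q ⊕ M)) (A : ClassicalAlg Q M) (Γ : Op Q) :
    (T.oracle A).accept Γ =
      T.accept (evolve (permOp (xorMap A.fn)) (tensOp Γ (pureOp fun _ => false))) := by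
  rw [Test.oracle, Test.accept, Test.expect_addState, Test.expect_addState, Test.expect_precomp,
    circMat_map_equiv, circMat_classical, evolve_classicalAlg, Test.expect_relabel]
  refine (Test.expect_spect T _ fun _ o => if o then 1 else 0).trans ?_
  have hb : ∀ k : Fin A.anc → Bool, diagBlock (CommitMeasure.relabel
      (Equiv.sumComm (Fin A.anc) (Q ⊕ M)).symm
      (tensOp (evolve (permOp (xorMap A.fn)) (tensOp Γ (pureOp fun _ => false)))
        (pureOp fun _ => false))) k = if k = fun _ => false then
          evolve (permOp (xorMap A.fn)) (tensOp Γ (pureOp fun _ => false)) else 0 := by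
    intro k
    ext s t
    have hs : ∀ s : Q ⊕ M → Bool, Sum.elim k s ∘ (Equiv.sumComm (Fin A.anc) (Q ⊕ M)).symm =
        Sum.elim s k := by
      intro s; funext b; rcases b with b | b <;> rfl
    simp only [diagBlock, Matrix.of_apply, relabel_apply, hs, tensOp_apply, Sum.elim_comp_inl,
      Sum.elim_comp_inr, pureOp_apply, and_self]
    split_ifs <;> simp
  simp only [hb]
  rw [Finset.sum_eq_single fun _ => false]
  · rw [if_pos rfl]; rfl
  · intro k _ hk
    rw [if_neg hk, Test.expect_zero]
  · simp

theorem Test.size_oracle (T : Test (Q ⊕ M)) (A : ClassicalAlg Q M) :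
    (T.oracle A).size = T.size + A.size + Fintype.card M := by
  simp [Test.oracle, Test.size_addState, Test.size_precomp, Test.size_relabel, Test.size_spect,
    ClassicalAlg.size]
  omega

/-- The test that reads one wire. -/
def Test.wire : Test Unit where
  wires := Fin 0
  state := pureOp fun _ => false
  isState := isState_pureOp _
  circ := []
  out := .inl ()

theorem Test.accept_wire (x : Unit → Bool) :
    Test.wire.accept (pureOp x) = if x () then 1 else 0 := by
  rw [Test.accept]
  change Test.runExpect (V := Fin 0) (pureOp fun _ => false) [] (.inl ()) (pureOp x) _ = _
  rw [Test.runExpect, sum_bits_sum, Finset.sum_eq_single x]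
  · rw [Finset.sum_eq_single fun _ => false]
    · rw [circMat, evolve_one, tensOp_apply, pureOp_apply, pureOp_apply]
      simp only [Sum.elim_comp_inl, Sum.elim_comp_inr, and_self, if_true, mul_one, Complex.one_re,
        one_mul, Sum.elim_inl]
      by_cases hx : x () = true
      · exact (if_pos hx).trans (if_pos hx).symm
      · exact (if_neg hx).trans (if_neg hx).symm
    · intro b _ hb
      exact absurd (Subsingleton.elim _ _) hb
    · exact fun h => absurd (Finset.mem_univ _) h
  · intro s _ hs
    simp [circMat, evolve_one, tensOp_apply, pureOp_apply, hs]
  · simp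

theorem sum_restrict_eq_dephase (f : (Q → Bool) → M → Bool) (ρ : Op Q) :
    ∑ a, restrict (fun u => decide (f u = a)) ρ = dephase f ρ := by
  ext s t
  simp only [Matrix.sum_apply, restrict, dephase, Matrix.of_apply, decide_eq_true_eq]
  rw [Finset.sum_eq_single (f s)]
  · simp [eq_comm]
  · intro a _ ha
    rw [if_neg fun h => ha h.1.symm]
  · simp

theorem evolve_sum {κ : Type} (s : Finset κ) (U : Op Q) (ρ : κ → Op Q) :
    evolve U (∑ i ∈ s, ρ i) = ∑ i ∈ s, evolve U (ρ i) := by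
  simp only [evolve, Finset.mul_sum, Finset.sum_mul]

variable {F : TCF}

/-- The wires that the challenger measures in the collapsing game. -/
def challengeWires (F : TCF) (α : Type) (w : ℕ) (c : Bool) : Fin F.yLen ⊕ Unit →
    Option (α ⊕ (Fin F.yLen ⊕ (Fin (F.ℓ + 1) ⊕ Fin w))) :=
  Sum.elim (fun k => some (.inr (.inl k))) fun _ => if c then some (.inr (.inr (.inl 0))) else none

theorem dephase_challengeWires {w : ℕ} (c : Bool)
    (p : (α ⊕ (Fin F.yLen ⊕ (Fin (F.ℓ + 1) ⊕ Fin w)) → Bool) → Bool) (ρ) :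
    dephase (copied (challengeWires F α w c)) (restrict p ρ) =
      let ρ' := restrict p (dephase (fun s (k : Fin F.yLen) => s (.inr (.inl k))) ρ)
      if c then dephase (fun s => s (.inr (.inr (.inl 0)))) ρ' else ρ' := by
  have hiff : ∀ s t, copied (challengeWires F α w c) s = copied (challengeWires F α w c) t ↔
      (fun k : Fin F.yLen => s (.inr (.inl k))) = (fun k => t (.inr (.inl k))) ∧
      (c = true → s (.inr (.inr (.inl 0))) = t (.inr (.inr (.inl 0)))) := by
    intro s t
    constructor
    · intro h
      refine ⟨funext fun k => congrFun h (.inl k), fun hc => ?_⟩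
      have := congrFun h (.inr ())
      simpa [copied, challengeWires, hc] using this
    · rintro ⟨h₁, h₂⟩
      funext a
      rcases a with k | k
      · exact congrFun h₁ k
      · cases c
        · rfl
        · exact h₂ rfl
  ext s t
  cases c
  · simp only [dephase, restrict, Matrix.of_apply, hiff, Bool.false_eq_true, false_imp_iff,
      and_true, if_false]
    split_ifs <;> rfl
  · simp only [dephase, restrict, Matrix.of_apply, hiff, true_imp_iff, if_true]
    split_ifs <;> first | rfl | tauto

/-- The challenger uses no secret: the check is computed coherently from the public key into a flag
wire, the measurements of `y` and of the challenged bit are copies, and the answer counts only if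
the flag is set. -/
theorem CollapseAdv.exists_distinguisher_pair (A : CollapseAdv α F) (c : Bool) :
    ∃ D : Distinguisher (α ⊕ Fin F.pkLen),
      D.size ≤ A.size + F.checkAlg.size + 3 * F.yLen + F.ℓ + 20 ∧
      ∀ x pk, D.accept (Sum.elim x pk) = A.outProb pk x c := by
  obtain ⟨G, hG, hGsize⟩ : ComputedWithin
      (fun (u : ((α ⊕ (Fin F.yLen ⊕ (Fin (F.ℓ + 1) ⊕ Fin A.work))) ⊕ (Fin F.pkLen ⊕ Unit)) ⊕
        (Fin F.yLen ⊕ Unit) → Bool) (_ : Unit) =>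
        u (.inl (.inl A.out)) && u (.inl (.inr (.inr ())))) 1 :=
    computedWithin_and (by simp)
  let T₁ := Test.wire.attack (challengeWires F α A.work c) A.guess G
  let i : Fin F.pkLen ⊕ (Fin (F.ℓ + 1) ⊕ Fin F.yLen) ↪
      (α ⊕ (Fin F.yLen ⊕ (Fin (F.ℓ + 1) ⊕ Fin A.work))) ⊕ Fin F.pkLen :=
    ⟨Sum.elim Sum.inr (Sum.elim (fun k => .inl (.inr (.inr (.inl k))))
      fun k => .inl (.inr (.inl k))), by
      rintro (a | a | a) (b | b | b) h <;> simp_all⟩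
  let K := F.checkAlg.mapInput i
  let T := (T₁.relabel (Equiv.sumAssoc _ _ _).symm).oracle K
  obtain ⟨D, hD, hacc⟩ := exists_distinguisher_of_test T A.prep A.isState
  have hK : K.size = F.checkAlg.size := by
    simp only [K, ClassicalAlg.size, ClassicalAlg.mapInput, List.length_map]
  refine ⟨D, ?_, fun x pk => ?_⟩
  · have h₁ := Test.size_attack_le Test.wire (challengeWires F α A.work c) A.guess G
    have h₂ : Test.wire.size = 0 := rfl
    change T₁.size ≤ _ at h₁
    rw [hD, Test.size_oracle, Test.size_relabel, hK]
    simp only [CollapseAdv.size, Fintype.card_sum, Fintype.card_fin, Fintype.card_unit] at h₁ ⊢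
    omega
  · rw [hacc, Test.accept_oracle, Test.accept, Test.expect_relabel]
    set ρ := evolve (circMat A.prep) (tensOp (pureOp x) A.advice) with hρ
    let chk : (α ⊕ (Fin F.yLen ⊕ (Fin (F.ℓ + 1) ⊕ Fin A.work)) → Bool) → Bool := fun s =>
      F.check pk (fun k => s (.inr (.inr (.inl k)))) fun k => s (.inr (.inl k))
    have hKfn : ∀ s, K.fn (Sum.elim s pk) () = chk s := by
      intro s
      have : Sum.elim s pk ∘ i = Sum.elim pk (Sum.elim (fun k => s (.inr (.inr (.inl k))))
          fun k => s (.inr (.inl k))) := by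
        funext b; rcases b with b | b | b <;> rfl
      change F.checkAlg.fn (Sum.elim s pk ∘ i) () = _
      rw [this]
      rfl
    -- Since the flag starts at `0`, the block in which it is read as `1` is the state projected
    -- onto the openings that pass the check.
    have hblock : ∀ (s : Fin F.pkLen → Bool) (b : Unit → Bool), b () = true →
        sideBlock (relabel (Equiv.sumAssoc _ _ _).symm.symm (evolve (permOp (xorMap K.fn))
          (tensOp (tensOp ρ (pureOp pk)) (pureOp fun _ => false)))) (Sum.elim s b) =
        if s = pk then restrict chk ρ else 0 := by
      intro s b hb
      ext u v
      have hu : ∀ u : α ⊕ (Fin F.yLen ⊕ (Fin (F.ℓ + 1) ⊕ Fin A.work)) → Bool,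
          Sum.elim u (Sum.elim s b) ∘ (Equiv.sumAssoc _ (Fin F.pkLen) Unit).symm.symm =
            Sum.elim (Sum.elim u s) b := by
        intro u; funext a; rcases a with (a | a) | a <;> rfl
      have hv : ∀ z : Unit → Bool, (fun a => b a ^^ z a) = (fun _ => false) ↔ z () = true := by
        intro z
        constructor
        · intro h; have := congrFun h (); simpa [hb] using this
        · intro h; funext a; simp [hb, h]
      simp only [sideBlock, Matrix.of_apply, relabel_apply, hu]
      rw [evolve_permOp_of_involutive (xorMap_involutive _), xorMap_elim, xorMap_elim]
      simp only [tensOp_apply, Sum.elim_comp_inl, Sum.elim_comp_inr, pureOp_apply, hv]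
      by_cases hs : s = pk
      · subst hs
        simp only [hKfn, and_self, if_true, mul_one, restrict, Matrix.of_apply, mul_ite, mul_zero]
      · simp [hs]
    have hT₁ := Test.expect_attack Test.wire (challengeWires F α A.work c) A.guess G
      (relabel (Equiv.sumAssoc _ _ _).symm.symm (evolve (permOp (xorMap K.fn))
          (tensOp (tensOp ρ (pureOp pk)) (pureOp fun _ => false)))) fun _ o => if o then 1 else 0
    refine hT₁.trans ?_
    have hwire : ∀ q (s : Fin F.pkLen ⊕ Unit → Bool) (a : Fin F.yLen ⊕ Unit → Bool),
        (Test.wire.expect (pureOp (G.fn (Sum.elim (Sum.elim q s) a))) fun _ o =>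
          if o then (1 : ℝ) else 0) = if q A.out && s (.inr ()) then 1 else 0 := by
      intro q s a
      refine (Test.accept_wire _).trans ?_
      rw [hG]
      rfl
    simp only [hwire]
    rw [sum_bits_sum, Finset.sum_eq_single pk, Finset.sum_eq_single fun _ => true]
    · simp only [hblock pk (fun _ => true) rfl, if_true, Sum.elim_inr, Bool.and_true]
      rw [Finset.sum_comm]
      simp only [← Finset.sum_mul, ← Complex.re_sum, ← Matrix.sum_apply, ← evolve_sum]
      have hd := sum_restrict_eq_dephase (copied (challengeWires F α A.work c)) (restrict chk ρ)
      rw [hd, dephase_challengeWires, CollapseAdv.outProb, prob, withInput_eq]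
      refine Finset.sum_congr rfl fun q _ => ?_
      rw [mul_ite, mul_one, mul_zero]
    · intro b _ hb
      have : b () = false := by
        by_contra h
        exact hb (funext fun _ => by simpa using h)
      simp [this]
    · simp
    · intro s _ hs
      refine Finset.sum_eq_zero fun b _ => Finset.sum_eq_zero fun a _ =>
        Finset.sum_eq_zero fun q _ => ?_
      by_cases hb : b () = true
      · rw [hblock s b hb, if_neg hs]
        have : restrict (fun u => decide (copied (challengeWires F α A.work c) u = a))
            (0 : Op (α ⊕ (Fin F.yLen ⊕ (Fin (F.ℓ + 1) ⊕ Fin A.work)))) = 0 := by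
          ext u v; simp [restrict]
        rw [this]
        simp [evolve]
      · simp [hb]
    · simp

/-- The challenge public key is already part of the input, so its wires are duplicated before the
previous construction is used. -/
theorem CollapseAdv.exists_distinguisher (A : CollapseAdv α F) (f : Fin F.pkLen → α) (c : Bool) :
    ∃ D : Distinguisher α,
      D.size ≤ A.size + F.checkAlg.size + 3 * F.yLen + F.ℓ + 2 * (Fintype.card α + F.pkLen) + 20 ∧
      ∀ x, D.accept x = A.outProb (x ∘ f) x c := by
  obtain ⟨D, hD, hacc⟩ := A.exists_distinguisher_pair c
  obtain ⟨G, hG, hGsize⟩ : ComputedWithin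
      (fun (x : α → Bool) (w : α ⊕ Fin F.pkLen) => x (Sum.elim id f w))
        (∑ _w : α ⊕ Fin F.pkLen, 1) :=
    computedWithin_pi fun w => computedWithin_wire _
  obtain ⟨D', hD', hacc'⟩ := (D.toTest.comp G).exists_distinguisher
  refine ⟨D', ?_, fun x => ?_⟩
  · rw [hD', Test.size_comp, D.size_toTest]
    simp only [Finset.sum_const, Finset.card_univ, smul_eq_mul, mul_one, Fintype.card_sum,
      Fintype.card_fin] at hGsize ⊢
    omega
  · have hx : G.fn x = Sum.elim x (x ∘ f) := by
      rw [hG]; funext w; rcases w with w | w <;> rfl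
    rw [hacc', Test.accept, Test.expect_comp, Finset.sum_eq_single x]
    · rw [pureOp_apply, if_pos ⟨rfl, rfl⟩, Complex.one_re, one_mul, hx, ← hacc, ← D.accept_toTest]
      rfl
    · intro y _ hy
      simp [pureOp_apply, hy]
    · simp

/-- In injective mode `y` has at most one opening that passes the check, so once `y` is measured and
the check has passed, the challenged bit is constant and measuring it changes nothing. -/
theorem CollapseAdv.outProb_eq_of_injective (hF : F.Correct) (A : CollapseAdv α F)
    (r : Fin F.coinLen → Bool) (x) :
    A.outProb (F.genPk false r) x true = A.outProb (F.genPk false r) x false := by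
  have key : ∀ z z' y, F.check (F.genPk false r) z y = true →
      F.check (F.genPk false r) z' y = true → z = z' := by
    intro z z' y h h'
    obtain ⟨hd, e, he⟩ := (hF.check_iff false r z y).mp h
    obtain ⟨hd', e', he'⟩ := (hF.check_iff false r z' y).mp h'
    have h₁ := hF.injective r z e hd
    have h₂ := hF.injective r z' e' hd'
    rw [he] at h₁
    rw [he'] at h₂
    exact Option.some.inj (h₁.symm.trans h₂)
  simp only [CollapseAdv.outProb, if_true, Bool.false_eq_true, if_false]
  congr 2
  ext s t
  simp only [dephase, restrict, Matrix.of_apply]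
  by_cases h₁ : s (.inr (.inr (.inl 0))) = t (.inr (.inr (.inl 0)))
  · rw [if_pos h₁]
  · rw [if_neg h₁]
    split_ifs with h₂ h₃ <;> try rfl
    refine absurd (congrFun (key _ (fun k => t (.inr (.inr (.inl k)))) _ h₂.1 ?_) 0) h₁
    rw [h₃]
    exact h₂.2

end CollapsingGame

/-! ### Collapsing and soundness for independent keys -/

section IndependentCollapsing

variable {F : ℕ → TCF} {B : ∀ n, BatchKeyGen (F n)}

/-- For each value of the challenge bit the game is a distinguisher for public key `j`, so a
two-to-one key can be exchanged for an injective one at negligible cost. There the two values of the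
bit give equal probabilities. If key `j` is injective already, the advantage vanishes. -/
theorem BatchKeyGen.collapsingAtIndex_of_isIndependent (hF : TCF.IsMahadevRTCF F)
    (hB : PolyBounded fun n => (B n).size) (hind : ∀ n, (B n).IsIndependent) :
    BatchKeyGen.CollapsingAtIndex B := by
  intro C j A hA
  choose ep ec hview hkeys using fun n => (hind n).exists_blocks
  choose D hD hacc using fun n c => (A n).exists_distinguisher (blockPk (F n) (ep n) (j n)) c
  have hview_poly := BatchKeyGen.polyBounded_view hF.efficient hB
  have hpoly : ∀ c, PolyBounded fun n => (D n c).size +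
      Fintype.card (Fin (B n).PKLen ⊕ (Fin (B n).N × Fin (F n).skLen)) := by
    intro c
    refine (((hA.add ((PolyBounded.const 3).mul hF.efficient)).add
      ((PolyBounded.const 3).mul hview_poly)).add (PolyBounded.const 20)).mono fun n => ?_
    have h₁ := hD n c
    have h₂ : (F n).checkAlg.size + (F n).yLen + (F n).ℓ + (F n).pkLen ≤ (F n).size := by
      unfold TCF.size; omega
    omega
  have hbound := fun c => exists_keyIndist_extend_bound hF.keyIndist (ι := fun _ => Unit)
    (fun n => D n c) (hpoly c) fun n _ => blockPk (F n) (ep n) (j n)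
  obtain ⟨ν₀, hν₀, h₀⟩ := hbound false
  obtain ⟨ν₁, hν₁, h₁⟩ := hbound true
  refine (hν₀.add hν₁).mono fun n => ?_
  have hpos₀ : 0 ≤ ν₀ n := (abs_nonneg _).trans (h₀ n () fun _ => false)
  have hpos₁ : 0 ≤ ν₁ n := (abs_nonneg _).trans (h₁ n () fun _ => false)
  have hT : (fun i => decide (i ≠ j n)) (j n) = false := by simp
  rw [abs_abs, avg_extend (blockCoins (ec n) (j n))]
  refine (abs_avg_le _).trans (avg_le fun r => ?_)
  simp only [hview, (hkeys n _ _ _).1, extend_blockCoins_self]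
  simp only [keyView_extend (T := fun i => decide (i ≠ j n)) (j := j n) hT fun _ _ => rfl]
  set v := keyView (F n) (ep n) (ec n) (fun i => decide (i ≠ j n)) ((B n).basis (C n)) r
  let g : Bool → Bool → (Fin (F n).coinLen → Bool) → ℝ := fun b c s =>
    (A n).outProb ((F n).genPk b s)
      (Function.extend (blockPk (F n) (ep n) (j n)) ((F n).genPk b s) v) c
  have hg : ∀ b c s, (D n c).accept (Function.extend (blockPk (F n) (ep n) (j n))
      ((F n).genPk b s) v) = g b c s := by
    intro b c s
    rw [hacc]
    have : Function.extend (blockPk (F n) (ep n) (j n)) ((F n).genPk b s) v ∘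
        blockPk (F n) (ep n) (j n) = (F n).genPk b s :=
      funext fun a => (blockPk (F n) (ep n) (j n)).injective.extend_apply _ _ a
    rw [this]
  have hinj : ∀ s, g false true s = g false false s := fun s =>
    (A n).outProb_eq_of_injective (hF.correct n) s _
  have e₀ := h₀ n () v
  have e₁ := h₁ n () v
  simp only [hg] at e₀ e₁
  change |avg fun s => g ((B n).basis (C n) (j n)) true s -
    g ((B n).basis (C n) (j n)) false s| ≤ _
  cases (B n).basis (C n) (j n)
  · simp only [hinj, sub_self, avg_const, abs_zero]
    exact add_nonneg hpos₀ hpos₁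
  · rw [avg_sub]
    simp only [hinj] at e₁
    rw [abs_le] at e₀ e₁ ⊢
    constructor <;> linarith [e₀.1, e₀.2, e₁.1, e₁.2]

theorem soundWith_of_isIndependent (hF : TCF.IsMahadevRTCF F)
    (hB : PolyBounded fun n => (B n).size) (hind : ∀ n, (B n).IsIndependent) :
    SoundWith B (fun n => simGen (B n)) fun n => extractor (B n) :=
  soundWith hF.efficient hB hF.correct (fun n => (hind n).correct)
    (BatchKeyGen.keyIndist_of_isIndependent hF hB hind)
    (BatchKeyGen.collapsingAtIndex_of_isIndependent hF hB hind)
    (BatchKeyGen.hardcoreAtIndex_of_isIndependent hF hB hind)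

end IndependentCollapsing

end CommitMeasure

end

theorem mainTheorem3 :
    ∃ (sim : ∀ (F : TCF) (B : BatchKeyGen F),
        ClassicalAlg (Fin B.coinLen) (Fin B.PKLen ⊕ Fin B.SKLen))
      (ext : ∀ (F : TCF) (B : BatchKeyGen F), Extractor B),
      -- the simulated keys are the keys for the all-Hadamard basis
      (∀ (F : TCF) (B : BatchKeyGen F) (r : Fin B.coinLen → Bool),
        (sim F B).fn r = B.genAlg.fn (Sum.elim B.one r)) ∧
      -- the extractor is the teleportation-based one
      (∀ (F : TCF) (B : BatchKeyGen F) (a : ℕ) (U ρ : Op (ZWire B ⊕ Fin a))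
          (PK : Fin B.PKLen → Bool) (SK : Fin B.SKLen → Bool) (y : YWire B → Bool),
        U ∈ Matrix.unitaryGroup (ZWire B ⊕ Fin a → Bool) ℂ →
        (ext F B).run U ρ (Sum.elim PK (Sum.elim SK y)) = extractedState B U ρ SK y) ∧
      -- soundness of the template
      (∀ (F : ℕ → TCF) (B : ∀ n, BatchKeyGen (F n)),
        PolyBounded (fun n => (F n).size) → PolyBounded (fun n => (B n).size) →
        (∀ n, (F n).Correct) → TCF.GoodDense F → (∀ n, (B n).Correct) →
        BatchKeyGen.KeyIndist B → BatchKeyGen.CollapsingAtIndex B →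
        BatchKeyGen.HardcoreAtIndex B →
        SoundWith B (fun n => sim (F n) (B n)) (fun n => ext (F n) (B n))) ∧
      -- soundness of the protocol with independent keys
      (∀ (F : ℕ → TCF) (B : ∀ n, BatchKeyGen (F n)),
        TCF.IsMahadevRTCF F → PolyBounded (fun n => (B n).size) →
        (∀ n, (B n).IsIndependent) →
        SoundWith B (fun n => sim (F n) (B n)) (fun n => ext (F n) (B n))) := by
  refine ⟨fun F B => simGen B, fun F B => extractor B, fun F B r => simGen_fn B r,
    fun F B a U ρ PK SK y hU => run_extractor B hU ρ PK SK y,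
    fun F B hF hB hFc _ hBc hkey hcol hhc => soundWith hF hB hFc hBc hkey hcol hhc,
    fun F B hF hB hind => ?_⟩
  exact soundWith_of_isIndependent hF hB hind
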